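/- Let $K$ be a field of characteristic $0$. Algebras are associative and unital, and "generic" means: non-zero and not a root of unity. A $K$-algebra $A$ is *cancellative* if $A[t]\cong B[t]$ for a $K$-algebra $B$ implies $A\cong B$; it is *universally cancellative* if, for every finitely generated commutative $K$-algebra $R$ that is a domain and has an ideal $I$ with $R/I=K$, and for every $K$-algebra $B$, $A\otimes_K R\cong B\otimes_K R$ implies $A\cong B$ (all isomorphisms are of $K$-algebras). A matrix $(q_{ij})$ over $K$ is *multiplicatively antisymmetric* if $q_{ii}=1=q_{ij}q_{ji}$ for all $i,j$. Each of the following $K$-algebras is universally cancellative, and hence cancellative ($n\ge 0$ arbitrary unless stated otherwise; algebras given by generators and relations are the $K$-algebras with that presentation; in 7–12 the generators $t_i$ (or $x_i$) commute with each other, the other generators commute with each other, and generators of the two kinds with different indices commute). 1. The Weyl algebra $A_n(K)=K[t_1,\dots,t_n][x_1;\partial/\partial t_1]\cdots[x_n;\partial/\partial t_n]$. 2. The extended Weyl algebra $B_n(K)=K(t_1,\dots,t_n)[x_1;\partial/\partial t_1]\cdots[x_n;\partial/\partial t_n]$. 3. The algebra of $q$-differential operators $D_{q,h}[x,y]$: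 $xy=qyx+h$, with $q$ generic, or $q=1$ and $h\ne0$. 4. The algebra of shift operators $S_h=K[t][x_h;\sigma_h]$, $\sigma_h(p(t))=p(t-h)$, with $h\neq 0$. 5. The mixed algebra $D_h=K[t][x;d/dt][x_h;\sigma_h]$, $\sigma_h(p(t))=p(t-h)$, $\sigma_h(x)=x$, with $h\ne 0$. 6. The algebra of discrete linear systems $K[t_1,\dots,t_n][x_1;\sigma_1]\cdots[x_n;\sigma_n]$, where $\sigma_i$ replaces $t_i$ by $t_i+1$ and fixes the other $t_j$ and the $x_j$. 7. Linear partial shift operators $K[t_1,\dots,t_n][E_1,\dots,E_n]$: $E_it_i=t_iE_i+E_i$. 8. Linear partial differential operators $K[t_1,\dots,t_n][\partial_1,\dots,\partial_n]$: $\partial_it_i=t_i\partial_i+1$. 9. Linear partial difference operators $K[t_1,\dots,t_n][\Delta_1,\dots,\Delta_n]$: $\Delta_it_i=t_i\Delta_i+\Delta_i+1$. 10. Linear partial $q$-dilation operators $K[t_1,\dots,t_n][H_1^{(q)},\dots,H_n^{(q)}]$: $H_i^{(q)}t_i=qt_iH_i^{(q)}$, with $q$ generic. 11. Linear partial $q$-differential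 operators $K[t_1,\dots,t_n][D_1^{(q)},\dots,D_n^{(q)}]$: $D_i^{(q)}t_i=qt_iD_i^{(q)}+1$, with $q$ generic or $q=1$. 12. The additive analogue of the Weyl algebra $A_n(q_1,\dots,q_n)$, generated by $x_i,y_i$: $y_ix_i=q_ix_iy_i+1$, with each $q_i$ generic or equal to $1$. 13. The multiplicative analogue of the Weyl algebra $\mathcal O_n(\lambda_{ji})$, generated by $x_1,\dots,x_n$: $x_jx_i=\lambda_{ji}x_ix_j$ for $i<j$, where $n\ge2$ and the $\lambda_{ji}\in K\setminus\{0\}$ ($i<j$) are multiplicatively independent (a product of integer powers of them is $1$ only if all the exponents are $0$). 14. The $n$-multiparametric quantum space, generated by $x_1,\dots,x_n$: $x_jx_i=q_{ij}x_ix_j$ for $i<j$, where $n\ge 2$ and the $q_{ij}\in K\setminus\{0\}$ ($i<j$) are multiplicatively independent. 15. The Woronowicz algebra: $xz-q^4zx=(1+q^2)x$, $xy-q^2yx=qz$, $zy-q^4yz=(1+q^2)y$, with $q$ generic. 16. The algebra $U$, generated by $x_i,y_i,z_i$ ($1\le i\le n$): the $x_i$ commute with each other, and so do the $y_i$ and the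 $z_i$; $y_jx_i=q^{\delta_{ij}}x_iy_j$, $z_jx_i=q^{-\delta_{ij}}x_iz_j$, $z_jy_i=y_iz_j$ for $i\ne j$, $z_iy_i=q^2y_iz_i-q^2x_i^2$, with $q$ generic. 17. The algebra of differential operators $D_{\mathbf q}(S_{\mathbf q})$ on a quantum space, generated by $x_i,\partial_i$ ($1\le i\le n$): $x_jx_i=q_{ij}x_ix_j$, $\partial_j\partial_i=q_{ij}\partial_i\partial_j$, $\partial_ix_j=q_{ij}x_j\partial_i+\delta_{ij}$, with $\mathbf q=(q_{ij})$ multiplicatively antisymmetric. 18. The conformal algebra (a particular Witten deformation of $\mathcal U(\mathfrak{sl}(2,K))$): $yx=cxy+bz^2+z$, $zx=a^{-1}xz-a^{-1}x$, $zy=ayz+y$, with $b\ne0$ and $a,c$ generic. 19. The quantum Weyl algebra of Maltsiniotis $A_n^{\mathbf q,\lambda}$, generated by $x_i,y_i$ ($1\le i\le n$): for $i<j$, $x_ix_j=\lambda_iq_{ij}x_jx_i$, $y_iy_j=q_{ij}y_jy_i$, $x_iy_j=q_{ji}y_jx_i$, $y_ix_j=\lambda_i^{-1}q_{ji}x_jy_i$;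 for all $i$, $x_iy_i-\lambda_iy_ix_i=1+\sum_{j<i}(\lambda_j-1)y_jx_j$; with $\mathbf q$ multiplicatively antisymmetric and each $\lambda_i$ generic. 20. The multiparameter Weyl algebra $A_n^{Q,\Gamma}(K)$, generated by $x_i,y_i$ ($1\le i\le n$): $y_iy_j=\gamma_{ij}y_jy_i$ for all $i,j$; $x_ix_j=q_i\gamma_{ij}x_jx_i$ and $x_iy_j=\gamma_{ji}y_jx_i$ for $i<j$; $x_iy_j=q_j\gamma_{ji}y_jx_i$ for $j<i$; $x_jy_j=q_jy_jx_j+1+\sum_{l<j}(q_l-1)y_lx_l$; and also its symmetric type: $y_iy_j=\gamma_{ij}y_jy_i$ and $x_ix_j=\gamma_{ij}x_jx_i$ for $i<j$, $x_iy_j=\gamma_{ji}y_jx_i$ for $i\ne j$, $x_jy_j=q_jy_jx_j+1$; in both cases with $\Gamma=(\gamma_{ij})$ multiplicatively antisymmetric and each $q_i$ generic. 21. The quantum symplectic space $\mathcal O_q(\mathfrak{sp}(K^{2n}))$, generated by $x_1,\dots,x_{2n}$: with $i'=2n-i+1$, $x_jx_i=qx_ix_j$ for $i<j$, $j\neq i'$,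 and $x_{i'}x_i=q^2x_ix_{i'}+(q^2-1)\sum_{1\le k<i}q^{i-k}x_kx_{k'}$ for $i<i'$; with $q$ generic. 22. The Jordan plane $K\langle x,y\rangle/(yx-xy-x^2)$. 23. The quantum plane $yx=qxy$, with $q$ generic. 24. The quadratic algebra $\mathcal A_2$ in three variables: $yx=xy+axz+bz^2$, $zx=xz$, $zy=yz+cz^2$, with $a,b,c\in K\setminus\{0\}$ such that $a/c$ is not a positive rational number (for instance, $K$ an ordered field and $ac<0$). -/

import Mathlib

open scoped TensorProduct

universe u v w₁ w₂

namespace ZariskiPBW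

section Cancellation

variable (K : Type u) [Field K] (A : Type v) [Ring A] [Algebra K A]

/-- `A` is cancellative: `A[t] ≅ B[t]` implies `A ≅ B`, for every (associative, unital, not
necessarily commutative) `K`-algebra `B`. -/
def IsCancellative : Prop :=
  ∀ (B : Type w₂) [Ring B] [Algebra K B],
    Nonempty (Polynomial A ≃ₐ[K] Polynomial B) → Nonempty (A ≃ₐ[K] B)

/-- `A` is universally cancellative: for every finitely generated commutative `K`-algebra `R` that
is a domain and has an ideal `I` with `R / I = K`, and for every `K`-algebra `B`,
`A ⊗ R ≅ B ⊗ R` implies `A ≅ B`. -/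
def IsUniversallyCancellative : Prop :=
  ∀ (R : Type w₁) [CommRing R] [IsDomain R] [Algebra K R] [Algebra.FiniteType K R]
    (I : Ideal R), Nonempty ((R ⧸ I) ≃ₐ[K] K) →
    ∀ (B : Type w₂) [Ring B] [Algebra K B],
      Nonempty (A ⊗[K] R ≃ₐ[K] B ⊗[K] R) → Nonempty (A ≃ₐ[K] B)

/-- Universally cancellative and cancellative. -/
def IsUnivCancellativeAndCancellative : Prop :=
  IsUniversallyCancellative.{u, v, w₁, w₂} K A ∧ IsCancellative.{u, v, w₂} K A

end Cancellation

/-- `q` is nonzero and not a root of unity. -/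
def NonRootOfUnity {K : Type u} [Field K] (q : K) : Prop :=
  q ≠ 0 ∧ ¬ IsOfFinOrder q

/-- The elements `q i j`, `i < j`, are nonzero and multiplicatively independent: a product of
integer powers of them is `1` only if all the exponents vanish. -/
def MultIndependent {K : Type u} [Field K] {n : ℕ} (q : Fin n → Fin n → K) : Prop :=
  (∀ i j, i < j → q i j ≠ 0) ∧
  ∀ e : Fin n → Fin n → ℤ, (∏ i, ∏ j ∈ Finset.Ioi i, q i j ^ e i j) = 1 →
    ∀ i j, i < j → e i j = 0

/-- A multiplicatively antisymmetric matrix. -/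
def MultAntisymm {K : Type u} [Field K] {n : ℕ} (q : Fin n → Fin n → K) : Prop :=
  (∀ i, q i i = 1) ∧ ∀ i j, q i j * q j i = 1

/-- Names of the variables of algebras in two and three variables, and in two and three families of
`n` variables. -/
inductive XY : Type
  | x | y

/-- See `XY`. -/
inductive XYZ : Type
  | x | y | z

/-- See `XY`. -/
inductive XYs (n : ℕ) : Type
  | x (i : Fin n) | y (i : Fin n)

/-- See `XY`. -/
inductive XYZs (n : ℕ) : Type
  | x (i : Fin n) | y (i : Fin n) | z (i : Fin n)

section Algebras

variable (K : Type u) [Field K]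

/-- A generator of the free algebra. -/
abbrev gen {X : Type v} (a : X) : FreeAlgebra K X := FreeAlgebra.ι K a

/-! ### Iterated Ore extensions in commuting variables -/

/-- Relations of the algebra generated by the (commutative) `K`-algebra `R` and by variables `x_i`:
`R` is mapped in by a homomorphism of `K`-algebras, `x_i r = σ_i(r) x_i + δ_i(r)` for `r` in `R`,
and `x_j x_i = x_i x_j`. -/
inductive OreRel {R : Type u} [CommRing R] [Algebra K R] {V : Type} (σ δ : V → R → R) :
    FreeAlgebra K (R ⊕ V) → FreeAlgebra K (R ⊕ V) → Prop
  | scalar (k : K) :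
      OreRel σ δ (gen K (Sum.inl (algebraMap K R k))) (algebraMap K (FreeAlgebra K (R ⊕ V)) k)
  | add (r s : R) :
      OreRel σ δ (gen K (Sum.inl (r + s))) (gen K (Sum.inl r) + gen K (Sum.inl s))
  | mul (r s : R) :
      OreRel σ δ (gen K (Sum.inl (r * s))) (gen K (Sum.inl r) * gen K (Sum.inl s))
  | coeff (i : V) (r : R) :
      OreRel σ δ (gen K (Sum.inr i) * gen K (Sum.inl r))
        (gen K (Sum.inl (σ i r)) * gen K (Sum.inr i) + gen K (Sum.inl (δ i r)))
  | var (i j : V) :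
      OreRel σ δ (gen K (Sum.inr j) * gen K (Sum.inr i)) (gen K (Sum.inr i) * gen K (Sum.inr j))

/-- The iterated Ore extension `R[x_1; σ_1, δ_1] ⋯ [x_n; σ_n, δ_n]` in which the endomorphisms and
derivations map `R` to itself and satisfy `σ_j(x_i) = x_i`, `δ_j(x_i) = 0`. -/
abbrev OreAlgebra {R : Type u} [CommRing R] [Algebra K R] {V : Type} (σ δ : V → R → R) : Type u :=
  RingQuot (OreRel K σ δ)

/-- The Weyl algebra `A_n(K) = K[t_1, …, t_n][x_1; ∂/∂t_1] ⋯ [x_n; ∂/∂t_n]`. -/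
abbrev WeylAlgebra (n : ℕ) : Type u :=
  OreAlgebra K (R := MvPolynomial (Fin n) K) (V := Fin n)
    (fun _ p => p) (fun i p => MvPolynomial.pderiv i p)

/-- The field of rational functions `K(t_1, …, t_n)`. -/
abbrev RationalFunctions (n : ℕ) : Type u := FractionRing (MvPolynomial (Fin n) K)

/-- The partial derivative `∂/∂t_i` on `K(t_1, …, t_n)`, computed by the quotient rule from the
reduced form of a fraction; see `ratDeriv_div` for an arbitrary form. -/
noncomputable def ratDeriv {n : ℕ} (i : Fin n) (f : RationalFunctions K n) : RationalFunctions K n :=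
  let p : MvPolynomial (Fin n) K := IsFractionRing.num (MvPolynomial (Fin n) K) f
  let s : MvPolynomial (Fin n) K := (IsFractionRing.den (MvPolynomial (Fin n) K) f).val
  algebraMap _ (RationalFunctions K n) (MvPolynomial.pderiv i p * s - p * MvPolynomial.pderiv i s) /
    algebraMap _ (RationalFunctions K n) s ^ 2

/-- The extended Weyl algebra
`B_n(K) = K(t_1, …, t_n)[x_1; ∂/∂t_1] ⋯ [x_n; ∂/∂t_n]`. -/
abbrev ExtendedWeylAlgebra (n : ℕ) : Type u :=
  OreAlgebra K (R := RationalFunctions K n) (V := Fin n) (fun _ f => f) (fun i f => ratDeriv K i f)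

/-- The algebra of shift operators `S_h = K[t][x_h; σ_h]`, `σ_h(p(t)) = p(t - h)`. -/
abbrev ShiftAlgebra (h : K) : Type u :=
  OreAlgebra K (R := Polynomial K) (V := Unit)
    (fun _ p => p.comp (Polynomial.X - Polynomial.C h)) (fun _ _ => 0)

/-- The mixed algebra `D_h = K[t][x; d/dt][x_h; σ_h]`, `σ_h(p(t)) = p(t - h)`, `σ_h(x) = x`; the
variable `x` is `XY.x` and the variable `x_h` is `XY.y`. -/
abbrev MixedAlgebra (h : K) : Type u :=
  OreAlgebra K (R := Polynomial K) (V := XY)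
    (fun v p => match v with
      | XY.x => p
      | XY.y => p.comp (Polynomial.X - Polynomial.C h))
    (fun v p => match v with
      | XY.x => Polynomial.derivative p
      | XY.y => 0)

/-- The algebra `K[t_1, …, t_n][x_1; σ_1] ⋯ [x_n; σ_n]` of multidimensional discrete linear systems,
`σ_i(p(t_1, …, t_n)) = p(t_1, …, t_i + 1, …, t_n)`. -/
abbrev DiscreteLinearSystems (n : ℕ) : Type u :=
  OreAlgebra K (R := MvPolynomial (Fin n) K) (V := Fin n)
    (fun i p => MvPolynomial.aeval
      (fun j => MvPolynomial.X j + if j = i then (1 : MvPolynomial (Fin n) K) else 0) p)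
    (fun _ _ => 0)

/-! ### Operator algebras and the additive analogue of the Weyl algebra -/

/-- `xy = q yx + h`. -/
inductive QDiffRel (q h : K) : FreeAlgebra K XY → FreeAlgebra K XY → Prop
  | xy : QDiffRel q h (gen K XY.x * gen K XY.y)
      (q • (gen K XY.y * gen K XY.x) + algebraMap K (FreeAlgebra K XY) h)

/-- The algebra `D_{q,h}[x, y]` of `q`-differential operators. -/
abbrev QDiffAlgebra (q h : K) : Type u := RingQuot (QDiffRel K q h)

/-- The `x_i` commute, the `y_i` commute, `y_j x_i = x_i y_j` for `i ≠ j`, and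
`y_i x_i = q_i x_i y_i + d_i y_i + a_i`. -/
inductive OperatorRel {n : ℕ} (q d a : Fin n → K) :
    FreeAlgebra K (XYs n) → FreeAlgebra K (XYs n) → Prop
  | xx (i j : Fin n) : OperatorRel q d a
      (gen K (XYs.x j) * gen K (XYs.x i)) (gen K (XYs.x i) * gen K (XYs.x j))
  | yy (i j : Fin n) : OperatorRel q d a
      (gen K (XYs.y j) * gen K (XYs.y i)) (gen K (XYs.y i) * gen K (XYs.y j))
  | yx_ne (i j : Fin n) (h : i ≠ j) : OperatorRel q d a
      (gen K (XYs.y j) * gen K (XYs.x i)) (gen K (XYs.x i) * gen K (XYs.y j))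
  | yx (i : Fin n) : OperatorRel q d a
      (gen K (XYs.y i) * gen K (XYs.x i))
      (q i • (gen K (XYs.x i) * gen K (XYs.y i)) + d i • gen K (XYs.y i)
        + algebraMap K (FreeAlgebra K (XYs n)) (a i))

/-- The algebra with the relations `OperatorRel`. -/
abbrev OperatorAlgebra {n : ℕ} (q d a : Fin n → K) : Type u := RingQuot (OperatorRel K q d a)

/-- Linear partial shift operators: `E_i t_i = t_i E_i + E_i`. -/
abbrev PartialShift (n : ℕ) : Type u :=
  OperatorAlgebra K (n := n) (fun _ => 1) (fun _ => 1) (fun _ => 0)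

/-- Linear partial differential operators: `∂_i t_i = t_i ∂_i + 1`. -/
abbrev PartialDifferential (n : ℕ) : Type u :=
  OperatorAlgebra K (n := n) (fun _ => 1) (fun _ => 0) (fun _ => 1)

/-- Linear partial difference operators: `Δ_i t_i = t_i Δ_i + Δ_i + 1`. -/
abbrev PartialDifference (n : ℕ) : Type u :=
  OperatorAlgebra K (n := n) (fun _ => 1) (fun _ => 1) (fun _ => 1)

/-- Linear partial `q`-dilation operators: `H_i t_i = q t_i H_i`. -/
abbrev PartialQDilation (n : ℕ) (q : K) : Type u :=
  OperatorAlgebra K (n := n) (fun _ => q) (fun _ => 0) (fun _ => 0)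

/-- Linear partial `q`-differential operators: `D_i t_i = q t_i D_i + 1`. -/
abbrev PartialQDifferential (n : ℕ) (q : K) : Type u :=
  OperatorAlgebra K (n := n) (fun _ => q) (fun _ => 0) (fun _ => 1)

/-- The additive analogue `A_n(q_1, …, q_n)` of the Weyl algebra: `y_i x_i = q_i x_i y_i + 1`. -/
abbrev AdditiveWeyl {n : ℕ} (q : Fin n → K) : Type u :=
  OperatorAlgebra K q (fun _ => 0) (fun _ => 1)

/-! ### Quantum spaces -/

/-- `x_j x_i = λ_{ji} x_i x_j` for `i < j`. -/
inductive MultWeylRel {n : ℕ} (lam : Fin n → Fin n → K) :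
    FreeAlgebra K (Fin n) → FreeAlgebra K (Fin n) → Prop
  | xx (i j : Fin n) (h : i < j) :
      MultWeylRel lam (gen K j * gen K i) (lam j i • (gen K i * gen K j))

/-- The multiplicative analogue `O_n(λ_{ji})` of the Weyl algebra. -/
abbrev MultiplicativeWeyl {n : ℕ} (lam : Fin n → Fin n → K) : Type u :=
  RingQuot (MultWeylRel K lam)

/-- `x_j x_i = q_{ij} x_i x_j` for `i < j`. -/
inductive QuantumSpaceRel {n : ℕ} (q : Fin n → Fin n → K) :
    FreeAlgebra K (Fin n) → FreeAlgebra K (Fin n) → Prop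
  | xx (i j : Fin n) (h : i < j) :
      QuantumSpaceRel q (gen K j * gen K i) (q i j • (gen K i * gen K j))

/-- The `n`-multiparametric quantum space `K_q[x_1, …, x_n]`. -/
abbrev QuantumSpace {n : ℕ} (q : Fin n → Fin n → K) : Type u :=
  RingQuot (QuantumSpaceRel K q)

/-- `yx = q xy`. -/
inductive QuantumPlaneRel (q : K) : FreeAlgebra K XY → FreeAlgebra K XY → Prop
  | yx : QuantumPlaneRel q (gen K XY.y * gen K XY.x) (q • (gen K XY.x * gen K XY.y))

/-- The quantum plane. -/
abbrev QuantumPlane (q : K) : Type u := RingQuot (QuantumPlaneRel K q)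

/-- The variables `x_i` and `∂_i` (here `y i`) with `x_j x_i = q_{ij} x_i x_j`,
`∂_j ∂_i = q_{ij} ∂_i ∂_j` and `∂_i x_j = q_{ij} x_j ∂_i + δ_{ij}` for all `i`, `j`. -/
inductive QSpaceDiffRel {n : ℕ} (q : Fin n → Fin n → K) :
    FreeAlgebra K (XYs n) → FreeAlgebra K (XYs n) → Prop
  | xx (i j : Fin n) : QSpaceDiffRel q
      (gen K (XYs.x j) * gen K (XYs.x i)) (q i j • (gen K (XYs.x i) * gen K (XYs.x j)))
  | yy (i j : Fin n) : QSpaceDiffRel q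
      (gen K (XYs.y j) * gen K (XYs.y i)) (q i j • (gen K (XYs.y i) * gen K (XYs.y j)))
  | yx (i j : Fin n) : QSpaceDiffRel q
      (gen K (XYs.y i) * gen K (XYs.x j))
      (q i j • (gen K (XYs.x j) * gen K (XYs.y i)) + if i = j then 1 else 0)

/-- The algebra `D_q(S_q)` of `q`-differential operators on the quantum space `S_q`. -/
abbrev QSpaceDiff {n : ℕ} (q : Fin n → Fin n → K) : Type u := RingQuot (QSpaceDiffRel K q)

/-! ### Algebras in two or three variables -/

/-- `xz - q⁴ zx = (1 + q²) x`, `xy - q² yx = q z`, `zy - q⁴ yz = (1 + q²) y`. -/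
inductive WoronowiczRel (q : K) : FreeAlgebra K XYZ → FreeAlgebra K XYZ → Prop
  | xz : WoronowiczRel q
      (gen K XYZ.x * gen K XYZ.z - q ^ 4 • (gen K XYZ.z * gen K XYZ.x))
      ((1 + q ^ 2) • gen K XYZ.x)
  | xy : WoronowiczRel q
      (gen K XYZ.x * gen K XYZ.y - q ^ 2 • (gen K XYZ.y * gen K XYZ.x))
      (q • gen K XYZ.z)
  | zy : WoronowiczRel q
      (gen K XYZ.z * gen K XYZ.y - q ^ 4 • (gen K XYZ.y * gen K XYZ.z))
      ((1 + q ^ 2) • gen K XYZ.y)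

/-- The Woronowicz algebra `W_q(sl(2, K))`. -/
abbrev Woronowicz (q : K) : Type u := RingQuot (WoronowiczRel K q)

/-- `yx = c xy + b z² + z`, `zx = a⁻¹ xz - a⁻¹ x`, `zy = a yz + y`. -/
inductive ConformalRel (a b c : K) : FreeAlgebra K XYZ → FreeAlgebra K XYZ → Prop
  | yx : ConformalRel a b c (gen K XYZ.y * gen K XYZ.x)
      (c • (gen K XYZ.x * gen K XYZ.y) + b • gen K XYZ.z ^ 2 + gen K XYZ.z)
  | zx : ConformalRel a b c (gen K XYZ.z * gen K XYZ.x)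
      (a⁻¹ • (gen K XYZ.x * gen K XYZ.z) - a⁻¹ • gen K XYZ.x)
  | zy : ConformalRel a b c (gen K XYZ.z * gen K XYZ.y)
      (a • (gen K XYZ.y * gen K XYZ.z) + gen K XYZ.y)

/-- The conformal algebra, a particular case of Witten's deformation of `U(sl(2, K))`. -/
abbrev ConformalAlgebra (a b c : K) : Type u := RingQuot (ConformalRel K a b c)

/-- `yx - xy - x² = 0`. -/
inductive JordanRel : FreeAlgebra K XY → FreeAlgebra K XY → Prop
  | yx : JordanRel
      (gen K XY.y * gen K XY.x - gen K XY.x * gen K XY.y - gen K XY.x ^ 2) 0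

/-- The Jordan plane. -/
abbrev JordanPlane : Type u := RingQuot (JordanRel K)

/-- `yx = xy + a xz + b z²`, `zx = xz`, `zy = yz + c z²`. -/
inductive QuadraticRel (a b c : K) : FreeAlgebra K XYZ → FreeAlgebra K XYZ → Prop
  | yx : QuadraticRel a b c (gen K XYZ.y * gen K XYZ.x)
      (gen K XYZ.x * gen K XYZ.y + a • (gen K XYZ.x * gen K XYZ.z) + b • gen K XYZ.z ^ 2)
  | zx : QuadraticRel a b c (gen K XYZ.z * gen K XYZ.x) (gen K XYZ.x * gen K XYZ.z)
  | zy : QuadraticRel a b c (gen K XYZ.z * gen K XYZ.y)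
      (gen K XYZ.y * gen K XYZ.z + c • gen K XYZ.z ^ 2)

/-- The quadratic algebra `𝒜₂` in three variables. -/
abbrev QuadraticA2 (a b c : K) : Type u := RingQuot (QuadraticRel K a b c)

/-! ### Algebras in families of variables -/

/-- The `x_i` commute, the `y_i` commute, the `z_i` commute, `y_j x_i = q^{δ_{ij}} x_i y_j`,
`z_j x_i = q^{-δ_{ij}} x_i z_j`, `z_j y_i = y_i z_j` for `i ≠ j`, and
`z_i y_i = q² y_i z_i - q² x_i²`. -/
inductive URel (n : ℕ) (q : K) : FreeAlgebra K (XYZs n) → FreeAlgebra K (XYZs n) → Prop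
  | xx (i j : Fin n) : URel n q
      (gen K (XYZs.x j) * gen K (XYZs.x i)) (gen K (XYZs.x i) * gen K (XYZs.x j))
  | yy (i j : Fin n) : URel n q
      (gen K (XYZs.y j) * gen K (XYZs.y i)) (gen K (XYZs.y i) * gen K (XYZs.y j))
  | zz (i j : Fin n) : URel n q
      (gen K (XYZs.z j) * gen K (XYZs.z i)) (gen K (XYZs.z i) * gen K (XYZs.z j))
  | yx (i j : Fin n) : URel n q
      (gen K (XYZs.y j) * gen K (XYZs.x i))
      ((if i = j then q else 1) • (gen K (XYZs.x i) * gen K (XYZs.y j)))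
  | zx (i j : Fin n) : URel n q
      (gen K (XYZs.z j) * gen K (XYZs.x i))
      ((if i = j then q⁻¹ else 1) • (gen K (XYZs.x i) * gen K (XYZs.z j)))
  | zy_ne (i j : Fin n) (h : i ≠ j) : URel n q
      (gen K (XYZs.z j) * gen K (XYZs.y i)) (gen K (XYZs.y i) * gen K (XYZs.z j))
  | zy (i : Fin n) : URel n q
      (gen K (XYZs.z i) * gen K (XYZs.y i))
      (q ^ 2 • (gen K (XYZs.y i) * gen K (XYZs.z i)) - q ^ 2 • gen K (XYZs.x i) ^ 2)

/-- The algebra `U`. -/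
abbrev UAlgebra (n : ℕ) (q : K) : Type u := RingQuot (URel K n q)

/-- For `i < j`: `x_i x_j = λ_i q_{ij} x_j x_i`, `y_i y_j = q_{ij} y_j y_i`,
`x_i y_j = q_{ji} y_j x_i`, `y_i x_j = λ_i⁻¹ q_{ji} x_j y_i`; and for all `i`:
`x_i y_i - λ_i y_i x_i = 1 + ∑_{j < i} (λ_j - 1) y_j x_j`. -/
inductive MaltsiniotisRel {n : ℕ} (q : Fin n → Fin n → K) (lam : Fin n → K) :
    FreeAlgebra K (XYs n) → FreeAlgebra K (XYs n) → Prop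
  | xx (i j : Fin n) (h : i < j) : MaltsiniotisRel q lam
      (gen K (XYs.x i) * gen K (XYs.x j))
      ((lam i * q i j) • (gen K (XYs.x j) * gen K (XYs.x i)))
  | yy (i j : Fin n) (h : i < j) : MaltsiniotisRel q lam
      (gen K (XYs.y i) * gen K (XYs.y j)) (q i j • (gen K (XYs.y j) * gen K (XYs.y i)))
  | xy_lt (i j : Fin n) (h : i < j) : MaltsiniotisRel q lam
      (gen K (XYs.x i) * gen K (XYs.y j)) (q j i • (gen K (XYs.y j) * gen K (XYs.x i)))
  | yx_lt (i j : Fin n) (h : i < j) : MaltsiniotisRel q lam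
      (gen K (XYs.y i) * gen K (XYs.x j))
      (((lam i)⁻¹ * q j i) • (gen K (XYs.x j) * gen K (XYs.y i)))
  | xy (i : Fin n) : MaltsiniotisRel q lam
      (gen K (XYs.x i) * gen K (XYs.y i) - lam i • (gen K (XYs.y i) * gen K (XYs.x i)))
      (1 + ∑ j ∈ Finset.Iio i, (lam j - 1) • (gen K (XYs.y j) * gen K (XYs.x j)))

/-- The quantum Weyl algebra of Maltsiniotis `A_n^{q,λ}`. -/
abbrev Maltsiniotis {n : ℕ} (q : Fin n → Fin n → K) (lam : Fin n → K) : Type u :=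
  RingQuot (MaltsiniotisRel K q lam)

/-- `y_i y_j = γ_{ij} y_j y_i` for all `i`, `j`; `x_i x_j = q_i γ_{ij} x_j x_i` and
`x_i y_j = γ_{ji} y_j x_i` for `i < j`; `x_i y_j = q_j γ_{ji} y_j x_i` for `j < i`;
`x_j y_j = q_j y_j x_j + 1 + ∑_{l < j} (q_l - 1) y_l x_l`. -/
inductive MultiparamWeylRel {n : ℕ} (q : Fin n → K) (γ : Fin n → Fin n → K) :
    FreeAlgebra K (XYs n) → FreeAlgebra K (XYs n) → Prop
  | yy (i j : Fin n) : MultiparamWeylRel q γ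
      (gen K (XYs.y i) * gen K (XYs.y j)) (γ i j • (gen K (XYs.y j) * gen K (XYs.y i)))
  | xx (i j : Fin n) (h : i < j) : MultiparamWeylRel q γ
      (gen K (XYs.x i) * gen K (XYs.x j))
      ((q i * γ i j) • (gen K (XYs.x j) * gen K (XYs.x i)))
  | xy_lt (i j : Fin n) (h : i < j) : MultiparamWeylRel q γ
      (gen K (XYs.x i) * gen K (XYs.y j)) (γ j i • (gen K (XYs.y j) * gen K (XYs.x i)))
  | xy_gt (i j : Fin n) (h : j < i) : MultiparamWeylRel q γ
      (gen K (XYs.x i) * gen K (XYs.y j))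
      ((q j * γ j i) • (gen K (XYs.y j) * gen K (XYs.x i)))
  | xy (j : Fin n) : MultiparamWeylRel q γ
      (gen K (XYs.x j) * gen K (XYs.y j))
      (q j • (gen K (XYs.y j) * gen K (XYs.x j)) + 1
        + ∑ l ∈ Finset.Iio j, (q l - 1) • (gen K (XYs.y l) * gen K (XYs.x l)))

/-- The multiparameter (quantized) Weyl algebra `A_n^{Q,Γ}(K)`. -/
abbrev MultiparamWeyl {n : ℕ} (q : Fin n → K) (γ : Fin n → Fin n → K) : Type u :=
  RingQuot (MultiparamWeylRel K q γ)

/-- `y_i y_j = γ_{ij} y_j y_i` and `x_i x_j = γ_{ij} x_j x_i` for `i < j`,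
`x_i y_j = γ_{ji} y_j x_i` for `i ≠ j`, `x_j y_j = q_j y_j x_j + 1`. -/
inductive SymmMultiparamWeylRel {n : ℕ} (q : Fin n → K) (γ : Fin n → Fin n → K) :
    FreeAlgebra K (XYs n) → FreeAlgebra K (XYs n) → Prop
  | yy (i j : Fin n) (h : i < j) : SymmMultiparamWeylRel q γ
      (gen K (XYs.y i) * gen K (XYs.y j)) (γ i j • (gen K (XYs.y j) * gen K (XYs.y i)))
  | xx (i j : Fin n) (h : i < j) : SymmMultiparamWeylRel q γ
      (gen K (XYs.x i) * gen K (XYs.x j)) (γ i j • (gen K (XYs.x j) * gen K (XYs.x i)))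
  | xy_ne (i j : Fin n) (h : i ≠ j) : SymmMultiparamWeylRel q γ
      (gen K (XYs.x i) * gen K (XYs.y j)) (γ j i • (gen K (XYs.y j) * gen K (XYs.x i)))
  | xy (j : Fin n) : SymmMultiparamWeylRel q γ
      (gen K (XYs.x j) * gen K (XYs.y j)) (q j • (gen K (XYs.y j) * gen K (XYs.x j)) + 1)

/-- The multiparameter (quantized) Weyl algebra of symmetric type. -/
abbrev SymmMultiparamWeyl {n : ℕ} (q : Fin n → K) (γ : Fin n → Fin n → K) : Type u :=
  RingQuot (SymmMultiparamWeylRel K q γ)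

/-- With `i' = 2n - i + 1`, that is `i' = i.rev`: `x_j x_i = q x_i x_j` for `i < j`, `i' ≠ j`, and
`x_{i'} x_i = q² x_i x_{i'} + (q² - 1) ∑_{k < i} q^{i-k} x_k x_{k'}` for `i < i'`. -/
inductive SymplecticRel (n : ℕ) (q : K) :
    FreeAlgebra K (Fin (2 * n)) → FreeAlgebra K (Fin (2 * n)) → Prop
  | comm (i j : Fin (2 * n)) (h : i < j) (h' : i.rev ≠ j) : SymplecticRel n q
      (gen K j * gen K i) (q • (gen K i * gen K j))
  | rev (i : Fin (2 * n)) (h : i < i.rev) : SymplecticRel n q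
      (gen K i.rev * gen K i)
      (q ^ 2 • (gen K i * gen K i.rev)
        + (q ^ 2 - 1) • ∑ k ∈ Finset.Iio i,
            q ^ (i.val - k.val) • (gen K k * gen K k.rev))

/-- The quantum symplectic space `O_q(sp(K^{2n}))`. -/
abbrev QuantumSymplectic (n : ℕ) (q : K) : Type u := RingQuot (SymplecticRel K n q)

end Algebras

/-- The quotient rule, for an arbitrary presentation of a rational function. -/
theorem ratDeriv_div (K : Type u) [Field K] {n : ℕ} (i : Fin n)
    (p s : MvPolynomial (Fin n) K) (hs : s ≠ 0) :
    ratDeriv K i (algebraMap _ (RationalFunctions K n) p / algebraMap _ (RationalFunctions K n) s) =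
      algebraMap _ (RationalFunctions K n)
        (MvPolynomial.pderiv i p * s - p * MvPolynomial.pderiv i s) /
      algebraMap _ (RationalFunctions K n) s ^ 2 := by
  set f : RationalFunctions K n := algebraMap _ (RationalFunctions K n) p / algebraMap _ (RationalFunctions K n) s with hf
  set P : MvPolynomial (Fin n) K := IsFractionRing.num (MvPolynomial (Fin n) K) f with hP
  set S : MvPolynomial (Fin n) K := (IsFractionRing.den (MvPolynomial (Fin n) K) f).val with hS
  have hS0 : S ≠ 0 := nonZeroDivisors.ne_zero (IsFractionRing.den (MvPolynomial (Fin n) K) f).2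
  have inj := IsFractionRing.injective (MvPolynomial (Fin n) K) (RationalFunctions K n)
  have hs' : algebraMap _ (RationalFunctions K n) s ≠ 0 := by
    simpa using (map_ne_zero_iff _ inj).2 hs
  have hS' : algebraMap _ (RationalFunctions K n) S ≠ 0 := (map_ne_zero_iff _ inj).2 hS0
  have hPS : algebraMap _ (RationalFunctions K n) P / algebraMap _ (RationalFunctions K n) S = f := by
    have := IsFractionRing.mk'_num_den (MvPolynomial (Fin n) K) f
    rwa [IsFractionRing.mk'_eq_div] at this
  have hcross : P * s = p * S := by
    apply inj
    rw [map_mul, map_mul]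
    rw [hf, div_eq_div_iff hS' hs'] at hPS
    exact hPS
  have hd := congrArg (MvPolynomial.pderiv i) hcross
  simp only [Derivation.leibniz, smul_eq_mul] at hd
  have key : (MvPolynomial.pderiv i P * S - P * MvPolynomial.pderiv i S) * s ^ 2 =
      (MvPolynomial.pderiv i p * s - p * MvPolynomial.pderiv i s) * S ^ 2 := by
    linear_combination (S * s) * hd - (S * MvPolynomial.pderiv i s + s * MvPolynomial.pderiv i S) * hcross
  change algebraMap _ (RationalFunctions K n) (MvPolynomial.pderiv i P * S - P * MvPolynomial.pderiv i S) /
    algebraMap _ (RationalFunctions K n) S ^ 2 = _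
  rw [div_eq_div_iff (pow_ne_zero _ hS') (pow_ne_zero _ hs'), ← map_pow, ← map_pow, ← map_mul,
    ← map_mul, key]

end ZariskiPBW

open ZariskiPBW

/-! Let `φ : A ⊗ R ≅ B ⊗ R` and let `ε : R → K` be the augmentation. As `R` is commutative, the
center of `A ⊗ R` is `Z(A) ⊗ R`, so `φ` restricts to `Z(A) ⊗ R ≅ Z(B) ⊗ R`, and applying `ε` on the
side of `A` gives a map `Z(B) → Z(A)`. The criterion `nonempty_algEquiv_of_surjective` says that `A
≅ B` as soon as this map is onto and `Z(A)` is finitely generated: it then induces a surjective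
endomorphism of the Noetherian ring `Z(B) ⊗ R`, hence is bijective. The quotient of `B ⊗ R` that
corresponds to `(A ⊗ R) / (A ⊗ I) = A` is obtained by sending each `r` in `R` to a central element
of `B`, so it is `B` itself.

If `Z(A) = K`, surjectivity is automatic. Most of the theorem is therefore the computation of
centers, by three methods. In `exists_of_mem_center` the algebra acts by weighted shifts on the
functions on a lattice, with polynomial coefficients; a commutative subalgebra acts diagonally and
separates the lattice points, so a central element is a polynomial, and it is invariant under the
shifts. In `mem_of_commute` the algebra is an extension by a variable `y` and iterated commutators
with a coefficient kill the powers of `y`; characteristic zero makes the factorials invertible. For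
quantum spaces (`isCentral_of_qcomm_fin`) the monomials are compared one at a time.

Two families can have a larger center: the algebra `U`, and the conformal algebra when `a` and `c`
satisfy a relation `c ^ l = a ^ k` with positive exponents. There the center is a polynomial ring
and `isUniversallyCancellative_of_discriminant` applies. A property of representations that is
insensitive to `φ` singles out the central characters on which the product of the variables
vanishes. The retraction of `Z(A) ⊗ R = R[X_1, …, X_n]` onto the copy of `Z(B)` then preserves this
locus, so it sends each variable to a unit times a monomial. Idempotence leaves only `X_i ↦ u_i
X_i`, and surjectivity of `Z(B) → Z(A)` follows. The property is "commutative image with a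
transcendental element" for the conformal algebra, and "image with a non-scalar central element" for
`U`. -/

namespace ZariskiPBW

/-! ### Centers of tensor products and the cancellation criterion -/

section Framework

/-- A surjective endomorphism of a Noetherian ring is injective. -/
theorem ringHom_injective_of_surjective {S : Type*} [CommRing S] [IsNoetherianRing S]
    (f : S →+* S) (hf : Function.Surjective f) : Function.Injective f := by
  -- The kernels of the iterates stabilize at some `n`. An element of the kernel of `f` has the form
  -- `(f ^ n) y`, and then `y` lies in the kernel of `f ^ (n + 1)`, hence in that of `f ^ n`.
  have hmono : Monotone fun n : ℕ => RingHom.ker (f ^ n) := by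
    refine monotone_nat_of_le_succ fun n x hx => ?_
    rw [RingHom.mem_ker] at hx ⊢
    rw [pow_succ', RingHom.mul_def, RingHom.comp_apply, hx, map_zero]
  obtain ⟨n, hn⟩ := monotone_stabilizes_iff_noetherian.2 (inferInstance : IsNoetherian S S)
    ⟨fun n : ℕ => RingHom.ker (f ^ n), hmono⟩
  have hs : Function.Surjective (f ^ n) := by
    rw [RingHom.coe_pow]
    exact hf.iterate n
  rw [injective_iff_map_eq_zero]
  intro x hx
  obtain ⟨y, rfl⟩ := hs x
  have h1 : y ∈ RingHom.ker (f ^ (n + 1)) := by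
    rw [RingHom.mem_ker, pow_succ', RingHom.mul_def, RingHom.comp_apply, hx]
  have h2 : RingHom.ker (f ^ n) = RingHom.ker (f ^ (n + 1)) := hn (n + 1) n.le_succ
  rw [← h2] at h1
  exact h1

variable {K : Type u} [Field K]

/-- The inclusion of `Z(A) ⊗ R` into `A ⊗ R`. -/
noncomputable def centerTensor (A : Type v) [Ring A] [Algebra K A] (R : Type w₁) [CommRing R]
    [Algebra K R] : Subalgebra.center K A ⊗[K] R →ₐ[K] A ⊗[K] R :=
  Algebra.TensorProduct.map (Subalgebra.center K A).val (AlgHom.id K R)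

section

variable (A : Type v) [Ring A] [Algebra K A] (R : Type w₁) [CommRing R] [Algebra K R]

@[simp] theorem centerTensor_tmul (z : Subalgebra.center K A) (r : R) :
    centerTensor A R (z ⊗ₜ[K] r) = (z : A) ⊗ₜ[K] r := by
  simp [centerTensor]

theorem centerTensor_injective : Function.Injective (centerTensor (K := K) A R) := by
  have h := Module.Flat.rTensor_preserves_injective_linearMap (M := R)
    (Subalgebra.center K A).val.toLinearMap Subtype.val_injective
  exact h

theorem centerTensor_range :
    (centerTensor (K := K) A R).range = Subalgebra.center K (A ⊗[K] R) := by
  apply le_antisymm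
  · rintro _ ⟨x, rfl⟩
    rw [Subalgebra.mem_center_iff]
    intro b
    induction x using TensorProduct.induction_on with
    | zero => simp
    | add x y hx hy => rw [map_add, mul_add, add_mul, hx, hy]
    | tmul z r =>
      induction b using TensorProduct.induction_on with
      | zero => simp
      | add x y hx hy => simp only [mul_add, add_mul, hx, hy]
      | tmul a s =>
        have := Subalgebra.mem_center_iff.1 z.2 a
        simp [this, mul_comm]
  · intro x hx
    have h := Subalgebra.centralizer_coe_range_includeLeft_eq_center_tensorProduct K A R
    change x ∈ (Algebra.TensorProduct.map (Subalgebra.center K A).val (AlgHom.id K R)).range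
    rw [← h, Subalgebra.mem_centralizer_iff]
    intro g _
    exact Subalgebra.mem_center_iff.1 hx g

end

variable {A : Type v} [Ring A] [Algebra K A] {B : Type w₂} [Ring B] [Algebra K B]
  {R : Type w₁} [CommRing R] [Algebra K R]

/-- An isomorphism `A ⊗ R ≅ B ⊗ R` restricts to the centers. -/
theorem exists_centerTensor_equiv (φ : A ⊗[K] R ≃ₐ[K] B ⊗[K] R) :
    ∃ φc : Subalgebra.center K A ⊗[K] R ≃ₐ[K] Subalgebra.center K B ⊗[K] R,
      ∀ x, centerTensor B R (φc x) = φ (centerTensor A R x) := by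
  let eA := AlgEquiv.ofInjective (centerTensor (K := K) A R) (centerTensor_injective A R)
  let eB := AlgEquiv.ofInjective (centerTensor (K := K) B R) (centerTensor_injective B R)
  have hmap : (centerTensor (K := K) A R).range.map φ.toAlgHom = (centerTensor (K := K) B R).range := by
    rw [centerTensor_range, centerTensor_range]
    ext x
    simp only [Subalgebra.mem_map, Subalgebra.mem_center_iff]
    constructor
    · rintro ⟨y, hy, rfl⟩ b
      have := congrArg φ (hy (φ.symm b))
      simpa using this
    · intro hx
      refine ⟨φ.symm x, fun b => ?_, by simp⟩
      have := congrArg φ.symm (hx (φ b))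
      simpa using this
  let e := (φ.subalgebraMap (centerTensor (K := K) A R).range).trans (Subalgebra.equivOfEq _ _ hmap)
  refine ⟨eA.trans (e.trans eB.symm), fun x => ?_⟩
  have h1 : ∀ y, centerTensor B R (eB.symm y) = y := fun y => by
    have := congrArg Subtype.val (eB.apply_symm_apply y)
    exact this
  simp only [AlgEquiv.trans_apply]
  rw [h1]
  rfl

/-- `id ⊗ ε`. -/
noncomputable def specialize (A : Type v) [Ring A] [Algebra K A] (ε : R →ₐ[K] K) :
    A ⊗[K] R →ₐ[K] A :=
  (Algebra.TensorProduct.rid K K A).toAlgHom.comp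
    (Algebra.TensorProduct.map (AlgHom.id K A) ε)

@[simp] theorem specialize_tmul (ε : R →ₐ[K] K) (a : A) (r : R) :
    specialize A ε (a ⊗ₜ[K] r) = ε r • a := by
  simp [specialize]

theorem specialize_centerTensor (ε : R →ₐ[K] K) (x : Subalgebra.center K A ⊗[K] R) :
    specialize A ε (centerTensor A R x) = (specialize (Subalgebra.center K A) ε x : A) := by
  induction x using TensorProduct.induction_on with
  | zero => simp
  | add x y hx hy => simp [hx, hy]
  | tmul z r => simp

/-- If the map `Z(B) → Z(A)` induced by `φ` and an augmentation `ε` of `R` is surjective and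
`Z(A)` is finitely generated, then `A ≅ B`. -/
theorem nonempty_algEquiv_of_surjective [Algebra.FiniteType K R]
    [Algebra.FiniteType K (Subalgebra.center K A)] (ε : R →ₐ[K] K)
    (φ : A ⊗[K] R ≃ₐ[K] B ⊗[K] R)
    (φc : Subalgebra.center K A ⊗[K] R ≃ₐ[K] Subalgebra.center K B ⊗[K] R)
    (hφ : ∀ x, centerTensor B R (φc x) = φ (centerTensor A R x))
    (hsurj : Function.Surjective fun z : Subalgebra.center K B =>
      specialize (Subalgebra.center K A) ε (φc.symm (z ⊗ₜ 1))) :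
    Nonempty (A ≃ₐ[K] B) := by
  let βc : Subalgebra.center K B →ₐ[K] Subalgebra.center K A :=
    (specialize (Subalgebra.center K A) ε).comp
      (φc.symm.toAlgHom.comp Algebra.TensorProduct.includeLeft)
  have hβ : ∀ z, βc z = specialize (Subalgebra.center K A) ε (φc.symm (z ⊗ₜ 1)) := fun z => rfl
  have hβs : Function.Surjective βc := hsurj
  have hft : Algebra.FiniteType K (Subalgebra.center K A ⊗[K] R) :=
    Algebra.FiniteType.trans (S := Subalgebra.center K A) inferInstance inferInstance
  have hft' : Algebra.FiniteType K (Subalgebra.center K B ⊗[K] R) := hft.equiv φc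
  have hN : IsNoetherianRing (Subalgebra.center K B ⊗[K] R) :=
    Algebra.FiniteType.isNoetherianRing K _
  -- A surjective endomorphism of a Noetherian ring, hence injective. It kills `z ⊗ 1` whenever `βc
  -- z = 0`, so `βc` is injective too.
  let f : Subalgebra.center K B ⊗[K] R →ₐ[K] Subalgebra.center K B ⊗[K] R :=
    φc.toAlgHom.comp (Algebra.TensorProduct.map βc (AlgHom.id K R))
  have hfs : Function.Surjective f := by
    apply φc.surjective.comp
    exact TensorProduct.map_surjective hβs Function.surjective_id
  have hfi : Function.Injective f :=
    ringHom_injective_of_surjective f.toRingHom hfs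
  have hβi : Function.Injective βc := by
    rw [injective_iff_map_eq_zero]
    intro z hz
    have : f (z ⊗ₜ 1) = f 0 := by
      simp [f, hz]
    have h2 := congrArg (specialize (Subalgebra.center K B) ε) (hfi this)
    simpa using h2
  let βe : Subalgebra.center K B ≃ₐ[K] Subalgebra.center K A := AlgEquiv.ofBijective βc ⟨hβi, hβs⟩
  -- A retraction onto `Z(B)`. Its values on `R` are central in `B`, so together with the identity
  -- of `B` they define the retraction `Γ` of `B ⊗ R` onto `B`.
  let γ : Subalgebra.center K B ⊗[K] R →ₐ[K] Subalgebra.center K B :=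
    βe.symm.toAlgHom.comp ((specialize (Subalgebra.center K A) ε).comp φc.symm.toAlgHom)
  have hγ1 : ∀ z, γ (z ⊗ₜ 1) = z := fun z => βe.symm_apply_apply z
  have hγφ : ∀ x, γ (φc x) = βe.symm (specialize _ ε x) := fun x => by
    simp [γ]
  let γR : R →ₐ[K] Subalgebra.center K B := γ.comp Algebra.TensorProduct.includeRight
  let Γ : B ⊗[K] R →ₐ[K] B := Algebra.TensorProduct.lift (AlgHom.id K B)
    ((Subalgebra.center K B).val.comp γR)
    (fun b r => (Subalgebra.mem_center_iff.1 (γR r).2 b))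
  have hΓ : ∀ b r, Γ (b ⊗ₜ r) = b * (γR r : B) := fun b r =>
    Algebra.TensorProduct.lift_tmul ..
  have hΓc : ∀ x, Γ (centerTensor B R x) = (γ x : B) := fun x => by
    induction x using TensorProduct.induction_on with
    | zero => simp
    | add x y hx hy => simp [hx, hy]
    | tmul z r =>
      rw [centerTensor_tmul, hΓ]
      have : γ (z ⊗ₜ r) = z * γR r := by
        conv_rhs => rw [← hγ1 z]
        change _ = γ (z ⊗ₜ 1) * γ (1 ⊗ₜ r)
        rw [← map_mul]
        simp
      rw [this]; rfl
  let α : A →ₐ[K] B := Γ.comp (φ.toAlgHom.comp Algebra.TensorProduct.includeLeft)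
  let β : B →ₐ[K] A := (specialize A ε).comp
    (φ.symm.toAlgHom.comp Algebra.TensorProduct.includeLeft)
  -- On `1 ⊗ r` the map `Γ ∘ φ` takes the scalar value `ε r`, by the choice of `γ`; so it factors
  -- through the specialization at `ε`.
  have hαs : ∀ x, Γ (φ x) = α (specialize A ε x) := fun x => by
    induction x using TensorProduct.induction_on with
    | zero => simp
    | add x y hx hy => simp [hx, hy]
    | tmul a r =>
      have e1 : (a ⊗ₜ[K] r) = (a ⊗ₜ[K] (1 : R)) * centerTensor A R (1 ⊗ₜ r) := by simp
      rw [e1, map_mul, map_mul, ← hφ, hΓc, hγφ, map_mul, map_mul, specialize_centerTensor]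
      have e2 : ∀ k : K, ((βe.symm (k • 1) : Subalgebra.center K B) : B) = algebraMap K B k :=
        fun k => by simp [Algebra.algebraMap_eq_smul_one]
      simp only [specialize_tmul, e2, map_one, one_smul]
      have e3 : α (((ε r • (1 : Subalgebra.center K A) : Subalgebra.center K A)) : A)
          = algebraMap K B (ε r) := by
        simp [Algebra.algebraMap_eq_smul_one]
      rw [e3]
      rfl
  -- On the center `β` restricts to `βc`, which undoes the inverse built into `γ`; so both sides
  -- agree on `1 ⊗ r` as well as on `B`.
  have hβs : ∀ x, β (Γ x) = specialize A ε (φ.symm x) := fun x => by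
    induction x using TensorProduct.induction_on with
    | zero => simp
    | add x y hx hy => simp [hx, hy]
    | tmul b r =>
      have e1 : (b ⊗ₜ[K] r) = (b ⊗ₜ[K] (1 : R)) * centerTensor B R (1 ⊗ₜ r) := by simp
      have e4 : φ.symm (centerTensor B R (1 ⊗ₜ r)) = centerTensor A R (φc.symm (1 ⊗ₜ r)) := by
        rw [AlgEquiv.symm_apply_eq, ← hφ, AlgEquiv.apply_symm_apply]
      have e5 : ∀ z : Subalgebra.center K B, β z = (βc z : A) := fun z => by
        change specialize A ε (φ.symm ((z : B) ⊗ₜ 1)) = _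
        have : φ.symm ((z : B) ⊗ₜ 1) = centerTensor A R (φc.symm (z ⊗ₜ 1)) := by
          rw [AlgEquiv.symm_apply_eq, ← hφ, AlgEquiv.apply_symm_apply, centerTensor_tmul]
        rw [this, specialize_centerTensor, hβ]
      rw [e1, map_mul, map_mul, map_mul, map_mul, hΓc, e4, specialize_centerTensor, e5]
      have e6 : βc (γ (1 ⊗ₜ r)) = specialize _ ε (φc.symm (1 ⊗ₜ r)) :=
        βe.apply_symm_apply _
      rw [e6, hΓ]
      simp [β]
  refine ⟨AlgEquiv.ofAlgHom α β ?_ ?_⟩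
  · ext b
    change α (specialize A ε (φ.symm (b ⊗ₜ 1))) = b
    rw [← hαs, AlgEquiv.apply_symm_apply, hΓ]
    simp
  · ext a
    change β (Γ (φ (a ⊗ₜ 1))) = a
    rw [hβs, AlgEquiv.symm_apply_apply]
    simp

/-- The augmentation given by an ideal `I` with `R / I = K`. -/
noncomputable def augmentation (I : Ideal R) (e : (R ⧸ I) ≃ₐ[K] K) : R →ₐ[K] K :=
  e.toAlgHom.comp (Ideal.Quotient.mkₐ K I)

/-- The case `R = K[t]`, `I = (t)`, where `A ⊗ K[t]` is `A[t]`. -/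
theorem isCancellative_of_isUniversallyCancellative
    (h : IsUniversallyCancellative.{u, v, u, w₂} K A) : IsCancellative.{u, v, w₂} K A := by
  intro B _ _ ⟨e⟩
  have hs : Function.Surjective (Polynomial.aeval (R := K) (0 : K)) := fun k =>
    ⟨Polynomial.C k, by simp⟩
  refine h (Polynomial K) (RingHom.ker (Polynomial.aeval (R := K) (0 : K)))
    ⟨Ideal.quotientKerAlgEquivOfSurjective hs⟩ B ?_
  exact ⟨(polyEquivTensor K A).symm.trans (e.trans (polyEquivTensor K B))⟩

/-- A homomorphism of `K`-algebras to `Z(A) = K` is onto, so the criterion applies without any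
information on `B`. -/
theorem isUniversallyCancellative_of_isCentral [Algebra.IsCentral K A] :
    IsUniversallyCancellative.{u, v, w₁, w₂} K A := by
  intro R _ _ _ _ I ⟨e⟩ B _ _ ⟨φ⟩
  obtain ⟨φc, hφ⟩ := exists_centerTensor_equiv φ
  have hsc : Function.Surjective (algebraMap K (Subalgebra.center K A)) := by
    rintro ⟨z, hz⟩
    obtain ⟨k, hk⟩ := Algebra.IsCentral.out hz
    exact ⟨k, Subtype.ext hk⟩
  have : Algebra.FiniteType K (Subalgebra.center K A) :=
    Algebra.FiniteType.of_surjective (Algebra.ofId K _) hsc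
  refine nonempty_algEquiv_of_surjective (augmentation I e) φ φc hφ fun z => ?_
  obtain ⟨k, rfl⟩ := hsc z
  refine ⟨algebraMap K _ k, ?_⟩
  exact ((specialize _ (augmentation I e)).comp (φc.symm.toAlgHom.comp
    Algebra.TensorProduct.includeLeft)).commutes k

theorem isUnivCancellativeAndCancellative_of_isCentral (h : Algebra.IsCentral K A) :
    IsUnivCancellativeAndCancellative.{u, v, w₁, w₂} K A :=
  ⟨isUniversallyCancellative_of_isCentral,
    isCancellative_of_isUniversallyCancellative isUniversallyCancellative_of_isCentral⟩

end Framework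

/-! ### Spanning by left multiplication, and commuting families -/

section Tools

/-- A submodule that contains `1` and is stable under left multiplication by generators of the
algebra is everything. -/
theorem submodule_eq_top_of_mul_mem {K : Type*} [CommRing K] {A : Type*} [Ring A] [Algebra K A]
    {s : Set A} (hs : Algebra.adjoin K s = ⊤) (T : Submodule K A) (h1 : (1 : A) ∈ T)
    (hT : ∀ g ∈ s, ∀ t ∈ T, g * t ∈ T) : T = ⊤ := by
  have key : ∀ a : A, ∀ t ∈ T, a * t ∈ T := by
    intro a
    have ha : a ∈ Algebra.adjoin K s := hs ▸ Algebra.mem_top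
    induction ha using Algebra.adjoin_induction with
    | mem x hx => exact hT x hx
    | algebraMap r => 
      intro t ht
      rw [← Algebra.smul_def]
      exact T.smul_mem r ht
    | add x y _ _ hx hy =>
      intro t ht
      rw [add_mul]
      exact T.add_mem (hx t ht) (hy t ht)
    | mul x y _ _ hx hy =>
      intro t ht
      rw [mul_assoc]
      exact hx _ (hy t ht)
  rw [eq_top_iff]
  intro a _
  simpa using key a 1 h1

/-- A commuting family defines a homomorphism from the polynomial ring. -/
theorem exists_mvPolynomial_algHom (K : Type*) [CommRing K] {A : Type*} [Ring A] [Algebra K A]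
    {τ : Type*} (f : τ → A) (hf : ∀ i j, f i * f j = f j * f i) :
    ∃ ι : MvPolynomial τ K →ₐ[K] A, ∀ t, ι (MvPolynomial.X t) = f t := by
  let S := Algebra.adjoin K (Set.range f)
  have hS : IsMulCommutative S := Algebra.isMulCommutative_adjoin K (by
    rintro _ ⟨i, rfl⟩ _ ⟨j, rfl⟩
    exact hf i j)
  let _ : CommRing S := { (inferInstance : Ring S) with mul_comm := hS.is_comm.comm }
  let g : MvPolynomial τ K →ₐ[K] S :=
    MvPolynomial.aeval fun t => ⟨f t, Algebra.subset_adjoin ⟨t, rfl⟩⟩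
  refine ⟨S.val.comp g, fun t => ?_⟩
  change S.val (g _) = _
  simp [g]

theorem mul_pow_of_qcomm {K : Type*} [CommRing K] {A : Type*} [Ring A] [Algebra K A] {a b : A}
    {c : K} (h : a * b = c • (b * a)) (k : ℕ) : a * b ^ k = c ^ k • (b ^ k * a) := by
  induction k with
  | zero => simp
  | succ k ih =>
    rw [pow_succ, ← mul_assoc, ih, smul_mul_assoc, mul_assoc, h, mul_smul_comm, smul_smul,
      pow_succ, mul_assoc]

end Tools

/-! ### Weighted shift operators -/

section Shift

variable {G : Type*} [AddCommMonoid G] {k : Type*} [CommRing k]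

/-- The weighted shift `e_a ↦ c(a) e_{a + m}`. -/
noncomputable def wshift (m : G) (c : G → k) : Module.End k (G →₀ k) :=
  Finsupp.lsum k fun a => c a • Finsupp.lsingle (a + m)

@[simp] theorem wshift_single (m : G) (c : G → k) (a : G) (g : k) :
    wshift m c (Finsupp.single a g) = Finsupp.single (a + m) (c a * g) := by
  simp [wshift]

theorem wshift_mul (m m' : G) (c c' : G → k) :
    wshift m c * wshift m' c' = wshift (m' + m) fun a => c (a + m') * c' a := by
  apply Finsupp.lhom_ext
  intro a g
  rw [Module.End.mul_apply, wshift_single, wshift_single, wshift_single, mul_assoc, add_assoc]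

theorem wshift_add (m : G) (c c' : G → k) :
    wshift m c + wshift m c' = wshift m fun a => c a + c' a := by
  apply Finsupp.lhom_ext
  intro a g
  simp [add_mul]

theorem wshift_sub (m : G) (c c' : G → k) :
    wshift m c - wshift m c' = wshift m fun a => c a - c' a := by
  apply Finsupp.lhom_ext
  intro a g
  simp [sub_mul]

theorem wshift_zero (m : G) : wshift m (fun _ => (0 : k)) = 0 := by
  apply Finsupp.lhom_ext
  intro a g
  simp

theorem wshift_one : wshift (0 : G) (fun _ => (1 : k)) = 1 := by
  apply Finsupp.lhom_ext
  intro a g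
  simp

theorem smul_wshift {K : Type*} [CommRing K] [Algebra K k] (r : K) (m : G) (c : G → k) :
    r • wshift m c = wshift m fun a => r • c a := by
  apply Finsupp.lhom_ext
  intro a g
  simp [-Finsupp.single_mul]

theorem wshift_algebraMap {K : Type*} [CommRing K] [Algebra K k] (r : K) :
    algebraMap K (Module.End k (G →₀ k)) r = wshift 0 fun _ => algebraMap K k r := by
  apply Finsupp.lhom_ext
  intro a g
  simp [Algebra.smul_def]

theorem wshift_congr {m m' : G} {c c' : G → k} (hm : m = m') (hc : ∀ a, c a = c' a) :
    wshift m c = wshift m' c' := by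
  rw [hm, funext hc]

end Shift

/-! ### Algebras of generalized Weyl type and their centers -/

section TwistedGWA

variable {K : Type*} [Field K] {A : Type*} [Ring A] [Algebra K A]

/-- `x ^ m` for `m ≥ 0` and `y ^ (-m)` for `m < 0`. -/
def signedPow (x y : A) (m : ℤ) : A := if 0 ≤ m then x ^ m.toNat else y ^ (-m).toNat

theorem signedPow_neg (x y : A) (m : ℤ) : signedPow y x (-m) = signedPow x y m := by
  unfold signedPow
  rcases lt_trichotomy m 0 with h | h | h
  · rw [if_pos (by omega), if_neg (by omega)]
  · subst h; simp
  · rw [if_neg (by omega), if_pos (by omega), neg_neg]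

/-- The product of the signed powers `x_i ^ m_i`, in the order of the indices. -/
def signedMonomial {n : ℕ} (x y : Fin n → A) (m : Fin n → ℤ) : A :=
  (List.ofFn fun i => signedPow (x i) (y i) (m i)).prod

theorem signedMonomial_neg {n : ℕ} (x y : Fin n → A) (m : Fin n → ℤ) :
    signedMonomial y x (-m) = signedMonomial x y m := by
  simp [signedMonomial, signedPow_neg]

theorem signedMonomial_succ {n : ℕ} (x y : Fin (n + 1) → A) (m : Fin (n + 1) → ℤ) :
    signedMonomial x y m = signedPow (x 0) (y 0) (m 0) *
      signedMonomial (fun i => x i.succ) (fun i => y i.succ) (fun i => m i.succ) := by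
  simp [signedMonomial, List.ofFn_succ]

theorem signedMonomial_zero {n : ℕ} (x y : Fin n → A) : signedMonomial x y 0 = 1 := by
  apply List.prod_eq_one
  intro a ha
  obtain ⟨i, rfl⟩ := (List.mem_ofFn' _ _).1 ha
  simp [signedPow]

theorem qcomm_signedPow {a x y : A} (hx : ∃ c : K, a * x = c • (x * a))
    (hy : ∃ c : K, a * y = c • (y * a)) (m : ℤ) :
    ∃ c : K, a * signedPow x y m = c • (signedPow x y m * a) := by
  obtain ⟨c, hc⟩ := hx
  obtain ⟨d, hd⟩ := hy
  unfold signedPow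
  split_ifs
  · exact ⟨_, mul_pow_of_qcomm hc _⟩
  · exact ⟨_, mul_pow_of_qcomm hd _⟩

/-- `S a ⊆ a S`. -/
def Normalizes (S : Subalgebra K A) (a : A) : Prop := ∀ s ∈ S, ∃ s' ∈ S, s * a = a * s'

theorem Normalizes.mul {S : Subalgebra K A} {a b : A} (ha : Normalizes S a)
    (hb : Normalizes S b) : Normalizes S (a * b) := by
  intro s hs
  obtain ⟨s', hs', e⟩ := ha s hs
  obtain ⟨s'', hs'', e'⟩ := hb s' hs'
  exact ⟨s'', hs'', by rw [← mul_assoc, e, mul_assoc, e', mul_assoc]⟩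

theorem Normalizes.one (S : Subalgebra K A) : Normalizes S (1 : A) :=
  fun s hs => ⟨s, hs, by simp⟩

theorem Normalizes.pow {S : Subalgebra K A} {a : A} (ha : Normalizes S a) (k : ℕ) :
    Normalizes S (a ^ k) := by
  induction k with
  | zero => simpa using Normalizes.one S
  | succ k ih => rw [pow_succ]; exact ih.mul ha

theorem Normalizes.signedPow {S : Subalgebra K A} {x y : A} (hx : Normalizes S x)
    (hy : Normalizes S y) (m : ℤ) : Normalizes S (signedPow x y m) := by
  unfold ZariskiPBW.signedPow
  split_ifs
  · exact hx.pow _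
  · exact hy.pow _

theorem Normalizes.signedMonomial {S : Subalgebra K A} : ∀ {n : ℕ} {x y : Fin n → A}
    (_ : ∀ i, Normalizes S (x i)) (_ : ∀ i, Normalizes S (y i)) (m : Fin n → ℤ),
    Normalizes S (signedMonomial x y m) := by
  intro n
  induction n with
  | zero => 
    intro x y _ _ m
    simpa [ZariskiPBW.signedMonomial] using Normalizes.one S
  | succ n ih =>
    intro x y hx hy m
    rw [signedMonomial_succ]
    exact ((hx 0).signedPow (hy 0) _).mul (ih (fun i => hx i.succ) (fun i => hy i.succ) _)

theorem Normalizes.of_generators {τ : Type*} {ι : MvPolynomial τ K →ₐ[K] A} {a : A}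
    (h : ∀ t, ∃ P, ι (MvPolynomial.X t) * a = a * ι P) : Normalizes ι.range a := by
  rintro _ ⟨P, rfl⟩
  change ∃ s' ∈ ι.range, ι P * a = a * s'
  induction P using MvPolynomial.induction_on with
  | C c => 
    refine ⟨ι (MvPolynomial.C c), ⟨_, rfl⟩, ?_⟩
    have : ι (MvPolynomial.C c) = algebraMap K A c := ι.commutes c
    rw [this]
    exact Algebra.commutes c a
  | add P Q hP hQ =>
    obtain ⟨s, hs, e⟩ := hP
    obtain ⟨s', hs', e'⟩ := hQ
    exact ⟨s + s', add_mem hs hs', by rw [map_add, add_mul, mul_add, e, e']⟩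
  | mul_X P t hP =>
    obtain ⟨s, hs, e⟩ := hP
    obtain ⟨Q, e'⟩ := h t
    exact ⟨s * ι Q, mul_mem hs ⟨_, rfl⟩, by rw [map_mul, mul_assoc, e', ← mul_assoc, e, mul_assoc]⟩

/-- For `m < 0` one factor `y` is absorbed into `x * y`, which lies in `S` and is moved to the right
of the remaining power of `y` by normality. At `m = -1` no power of `y` remains and the exponent `m
+ 1` already belongs to the other branch of the definition. -/
theorem mul_signedPow {S : Subalgebra K A} {x y : A} (hy : Normalizes S y)
    (hxy : x * y ∈ S) (m : ℤ) :
    ∃ s ∈ S, x * signedPow x y m = signedPow x y (m + 1) * s := by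
  unfold signedPow
  split_ifs with h h' h'
  · exact ⟨1, one_mem S, by rw [show (m + 1).toNat = m.toNat + 1 by omega, pow_succ', mul_one]⟩
  · omega
  · have : m = -1 := by omega
    subst this
    exact ⟨x * y, hxy, by simp⟩
  · obtain ⟨s, hs, e⟩ := hy.pow (-(m + 1)).toNat _ hxy
    refine ⟨s, hs, ?_⟩
    rw [show (-m).toNat = (-(m + 1)).toNat + 1 by omega, pow_succ', ← mul_assoc, e]

/-- The factor `x i` passes the blocks of smaller index up to scalars and enters its own block; the
element of `S` that this produces is moved past the later blocks by normality. -/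
theorem mul_signedMonomial {S : Subalgebra K A} : ∀ {n : ℕ} {x y : Fin n → A}
    (_ : ∀ i, Normalizes S (x i)) (_ : ∀ i, Normalizes S (y i)) (_ : ∀ i, x i * y i ∈ S)
    (_ : ∀ i j, i ≠ j → ∃ c : K, x i * x j = c • (x j * x i))
    (_ : ∀ i j, i ≠ j → ∃ c : K, x i * y j = c • (y j * x i)) (m : Fin n → ℤ) (i : Fin n),
    ∃ s ∈ S, x i * signedMonomial x y m = signedMonomial x y (m + Pi.single i 1) * s := by
  intro n
  induction n with
  | zero => intro x y _ _ _ _ _ m i; exact i.elim0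
  | succ n ih =>
    intro x y hx hy hxy hxx hxy' m i
    simp only [signedMonomial_succ]
    refine Fin.cases ?_ (fun j => ?_) i
    · obtain ⟨s, hs, e⟩ := mul_signedPow (hy 0) (hxy 0) (m 0)
      obtain ⟨s', hs', e'⟩ := Normalizes.signedMonomial (fun i : Fin n => hx i.succ)
        (fun i => hy i.succ) (fun i => m i.succ) s hs
      refine ⟨s', hs', ?_⟩
      rw [← mul_assoc, e, mul_assoc, e', ← mul_assoc]
      simp
    · obtain ⟨c, hc⟩ := qcomm_signedPow (hxx j.succ 0 (Fin.succ_ne_zero j))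
        (hxy' j.succ 0 (Fin.succ_ne_zero j)) (m 0)
      obtain ⟨s, hs, e⟩ := ih (fun i => hx i.succ) (fun i => hy i.succ) (fun i => hxy i.succ)
        (fun i j h => hxx i.succ j.succ (by simpa using h))
        (fun i j h => hxy' i.succ j.succ (by simpa using h)) (fun i => m i.succ) j
      refine ⟨c • s, S.smul_mem hs c, ?_⟩
      have h0 : (Pi.single j.succ 1 : Fin (n + 1) → ℤ) 0 = 0 := by simp
      have h1 : (fun i : Fin n => (m + Pi.single j.succ 1 : Fin (n + 1) → ℤ) i.succ)
          = (fun i => m i.succ) + Pi.single j 1 := by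
        ext l
        by_cases h : l = j
        · subst h; simp
        · simp [h]
      rw [h1, ← mul_assoc, hc, smul_mul_assoc, mul_assoc, e, Pi.add_apply, h0, add_zero,
        mul_smul_comm, mul_assoc]

/-- `A` is generated by the image of a polynomial ring and by `x_i`, `y_i`, with the commutation
relations of a (twisted) generalized Weyl algebra. -/
structure IsTwistedGWA {τ : Type*} {n : ℕ} (ι : MvPolynomial τ K →ₐ[K] A) (x y : Fin n → A) :
    Prop where
  x_norm : ∀ i t, ∃ P, ι (MvPolynomial.X t) * x i = x i * ι P
  y_norm : ∀ i t, ∃ P, ι (MvPolynomial.X t) * y i = y i * ι P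
  xy : ∀ i, ∃ P, x i * y i = ι P
  yx : ∀ i, ∃ P, y i * x i = ι P
  xx_ne : ∀ i j, i ≠ j → ∃ c : K, x i * x j = c • (x j * x i)
  xy_ne : ∀ i j, i ≠ j → ∃ c : K, x i * y j = c • (y j * x i)
  yx_ne : ∀ i j, i ≠ j → ∃ c : K, y i * x j = c • (x j * y i)
  yy_ne : ∀ i j, i ≠ j → ∃ c : K, y i * y j = c • (y j * y i)
  gen : Algebra.adjoin K (Set.range x ∪ Set.range y ∪ Set.range ι) = ⊤

/-- `∑ b_m ι(f_m)`. -/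
noncomputable def polySum {τ M : Type*} (ι : MvPolynomial τ K →ₐ[K] A) (b : M → A) :
    (M →₀ MvPolynomial τ K) →ₗ[K] A :=
  Finsupp.lsum K fun m => (LinearMap.mulLeft K (b m)).comp ι.toLinearMap

@[simp] theorem polySum_single {τ M : Type*} (ι : MvPolynomial τ K →ₐ[K] A) (b : M → A) (m : M)
    (P : MvPolynomial τ K) : polySum ι b (Finsupp.single m P) = b m * ι P := by
  simp [polySum]

/-- The range contains `1`, and each generator sends a signed monomial to a signed monomial times a
polynomial; so the range is stable under left multiplication. -/
theorem IsTwistedGWA.range_polySum {τ : Type*} {n : ℕ} {ι : MvPolynomial τ K →ₐ[K] A}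
    {x y : Fin n → A} (h : IsTwistedGWA ι x y) : LinearMap.range (polySum ι (signedMonomial x y)) = ⊤ := by
  have hx : ∀ i, Normalizes ι.range (x i) := fun i => .of_generators (h.x_norm i)
  have hy : ∀ i, Normalizes ι.range (y i) := fun i => .of_generators (h.y_norm i)
  have hmem : ∀ m, ∀ s ∈ ι.range, signedMonomial x y m * s ∈ LinearMap.range (polySum ι (signedMonomial x y)) := by
    rintro m _ ⟨P, rfl⟩
    exact ⟨Finsupp.single m P, by simp⟩
  have key : ∀ g : A, (∀ m, ∃ m', ∃ s ∈ ι.range, g * signedMonomial x y m =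
      signedMonomial x y m' * s) → ∀ t ∈ LinearMap.range (polySum ι (signedMonomial x y)),
      g * t ∈ LinearMap.range (polySum ι (signedMonomial x y)) := by
    rintro g hg _ ⟨f, rfl⟩
    induction f using Finsupp.induction_linear with
    | zero => simp
    | add f f' hf hf' => rw [map_add, mul_add]; exact add_mem hf hf'
    | single m P =>
      obtain ⟨m', s, hs, e⟩ := hg m
      rw [polySum_single, ← mul_assoc, e, mul_assoc]
      exact hmem _ _ (mul_mem hs ⟨P, rfl⟩)
  refine submodule_eq_top_of_mul_mem h.gen _ ?_ ?_
  · simpa [signedMonomial_zero] using hmem 0 1 (one_mem _)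
  · rintro g ((⟨i, rfl⟩ | ⟨i, rfl⟩) | ⟨P, rfl⟩)
    · refine key _ fun m => ⟨_, mul_signedMonomial hx hy (fun i => ?_) h.xx_ne h.xy_ne m i⟩
      obtain ⟨P, hP⟩ := h.xy i
      exact ⟨P, hP.symm⟩
    -- Exchanging the roles of `x` and `y` negates degrees, which reduces this case to the previous
    -- one; the witness is `m - e_i`.
    · refine key _ fun m => ⟨-(-m + Pi.single i 1), ?_⟩
      obtain ⟨s, hs, e⟩ := mul_signedMonomial hy hx (fun i => (by
        obtain ⟨P, hP⟩ := h.yx i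
        exact ⟨P, hP.symm⟩ : y i * x i ∈ ι.range)) h.yy_ne h.yx_ne (-m) i
      refine ⟨s, hs, ?_⟩
      rw [← signedMonomial_neg x y m, e, ← signedMonomial_neg x y, neg_neg]
    · exact key _ fun m => ⟨m, Normalizes.signedMonomial hx hy m _ ⟨P, rfl⟩⟩

variable {k : Type*} [CommRing k]

/-- A shift by `m` with nonzero weights. -/
def IsShift {G : Type*} [AddCommMonoid G] (f : Module.End k (G →₀ k)) (m : G) : Prop :=
  ∀ a, ∃ c : k, c ≠ 0 ∧ ∀ g, f (Finsupp.single a g) = Finsupp.single (a + m) (c * g)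

theorem isShift_wshift {G : Type*} [AddCommMonoid G] (m : G) (c : G → k) (hc : ∀ a, c a ≠ 0) :
    IsShift (wshift m c) m := fun a => ⟨c a, hc a, by simp⟩

variable [IsDomain k]

theorem IsShift.one {G : Type*} [AddCommMonoid G] : IsShift (1 : Module.End k (G →₀ k)) 0 :=
  fun a => ⟨1, one_ne_zero, by simp⟩

theorem IsShift.mul {G : Type*} [AddCommMonoid G] {f f' : Module.End k (G →₀ k)} {m m' : G}
    (h : IsShift f m) (h' : IsShift f' m') : IsShift (f * f') (m + m') := by
  intro a
  obtain ⟨c', hc', e'⟩ := h' a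
  obtain ⟨c, hc, e⟩ := h (a + m')
  exact ⟨c * c', mul_ne_zero hc hc', fun g => by
    rw [Module.End.mul_apply, e', e, mul_assoc, add_assoc, add_comm m m']⟩

theorem IsShift.pow {G : Type*} [AddCommMonoid G] {f : Module.End k (G →₀ k)} {m : G}
    (h : IsShift f m) (r : ℕ) : IsShift (f ^ r) (r • m) := by
  induction r with
  | zero => simpa using IsShift.one
  | succ r ih => rw [pow_succ, succ_nsmul]; exact ih.mul h

theorem IsShift.list_prod {G ι : Type*} [AddCommMonoid G] {F : ι → Module.End k (G →₀ k)} {s : ι → G}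
    (l : List ι) (h : ∀ i, IsShift (F i) (s i)) : IsShift (l.map F).prod (l.map s).sum := by
  induction l with
  | nil => simpa using IsShift.one
  | cons a l ih => simpa using (h a).mul ih

theorem IsShift.signedMonomial {n : ℕ} {x y : Fin n → Module.End k ((Fin n → ℤ) →₀ k)}
    (hx : ∀ i, IsShift (x i) (Pi.single i 1)) (hy : ∀ i, IsShift (y i) (Pi.single i (-1)))
    (m : Fin n → ℤ) : IsShift (signedMonomial x y m) m := by
  have h : ∀ i, IsShift (signedPow (x i) (y i) (m i)) (Pi.single i (m i)) := by
    intro i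
    unfold signedPow
    split_ifs with h
    · convert (hx i).pow (m i).toNat using 1
      rw [← Pi.single_smul]
      simp [h]
    · convert (hy i).pow (-(m i)).toNat using 1
      rw [← Pi.single_smul]
      congr 1
      simp
      omega
  have := IsShift.list_prod (List.finRange n) h
  have e1 : ((List.finRange n).map fun i => (Pi.single i (m i) : Fin n → ℤ)).sum = m := by
    rw [← List.ofFn_eq_map, List.sum_ofFn, Finset.univ_sum_single]
  rw [e1] at this
  rwa [ZariskiPBW.signedMonomial, List.ofFn_eq_map]

theorem map_signedMonomial {B : Type*} [Ring B] [Algebra K B] {n : ℕ} (f : A →ₐ[K] B)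
    (x y : Fin n → A) (m : Fin n → ℤ) : f (signedMonomial x y m) =
      signedMonomial (fun i => f (x i)) (fun i => f (y i)) m := by
  rw [signedMonomial, signedMonomial, map_list_prod, List.map_ofFn]
  congr 2
  ext i
  simp only [Function.comp, signedPow]
  split_ifs <;> simp

/-- The center of an algebra `A` of sums `∑ b_m ι(f_m)`, in presence of a representation by weighted
shifts in which the polynomials act diagonally with separate eigenvalues. -/
theorem exists_of_mem_center {τ M : Type*} {n : ℕ} {ι : MvPolynomial τ K →ₐ[K] A} {b : M → A}
    {deg : M → Fin n → ℤ} (hdeg : Function.Injective deg) {m₀ : M} (hm₀ : b m₀ = 1)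
    (hd₀ : deg m₀ = 0) (hspan : LinearMap.range (polySum ι b) = ⊤)
    (ρ : A →ₐ[K] Module.End (MvPolynomial τ K) ((Fin n → ℤ) →₀ MvPolynomial τ K))
    (η : τ → (Fin n → ℤ) → MvPolynomial τ K) (hη : ∀ t, η t 0 = MvPolynomial.X t)
    (hsep : ∀ a, a ≠ 0 → ∃ t, η t a ≠ MvPolynomial.X t)
    (hι : ∀ t, ρ (ι (MvPolynomial.X t)) = wshift 0 (η t))
    (hb : ∀ m, IsShift (ρ (b m)) (deg m)) :
    Function.Injective ρ ∧ ∀ z ∈ Subalgebra.center K A, ∃ P, z = ι P ∧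
      ∀ x a, IsShift (ρ x) a → MvPolynomial.aeval (fun t => η t a) P = P := by
  have hP : ∀ P a g, ρ (ι P) (Finsupp.single a g) =
      Finsupp.single a (MvPolynomial.aeval (fun t => η t a) P * g) := by
    intro P a
    induction P using MvPolynomial.induction_on with
    | C c =>
      intro g
      have : ρ (ι (MvPolynomial.C c)) = algebraMap K _ c := (ρ.comp ι).commutes c
      rw [this]
      simp [Algebra.smul_def]
    | add P Q hP hQ => intro g; simp [hP, hQ, add_mul]
    | mul_X P t hP => intro g; simp [-Finsupp.single_mul, hP, hι, mul_assoc]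
  have hs : ∀ m, ∃ c : MvPolynomial τ K, c ≠ 0 ∧ ∀ g,
      ρ (b m) (Finsupp.single 0 g) = Finsupp.single (deg m) (c * g) := by
    intro m
    simpa using hb m 0
  choose c hc0 hc using hs
  -- At the lattice point `0` the eigenvalues are the variables themselves, so a polynomial acts by
  -- multiplication by itself. As the degrees of the `b m` are distinct, every coefficient can be
  -- read off from the action on `e_0`.
  have hΨ : ∀ f g, ρ (polySum ι b f) (Finsupp.single 0 g) =
      f.sum fun m P => Finsupp.single (deg m) (c m * P * g) := by
    intro f g
    induction f using Finsupp.induction_linear with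
    | zero => simp
    | add f f' hf hf' =>
      rw [map_add, map_add, LinearMap.add_apply, hf, hf', Finsupp.sum_add_index']
      · simp
      · intro m P Q; rw [← Finsupp.single_add]; ring_nf
    | single m P =>
      rw [polySum_single, map_mul, Module.End.mul_apply, hP]
      simp [-Finsupp.single_mul, hη, hc, mul_assoc]
  have hcoef : ∀ f g m, ρ (polySum ι b f) (Finsupp.single 0 g) (deg m) = c m * f m * g := by
    intro f g m
    rw [hΨ, Finsupp.sum, Finsupp.finsetSum_apply]
    rw [Finset.sum_eq_single m]
    · simp
    · intro l _ hl
      exact Finsupp.single_eq_of_ne fun h => hl (hdeg h).symm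
    · intro hm; simp [Finsupp.notMem_support_iff.1 hm]
  constructor
  · rw [injective_iff_map_eq_zero]
    intro z hz
    have hz' : z ∈ LinearMap.range (polySum ι b) := hspan ▸ Submodule.mem_top
    obtain ⟨f, rfl⟩ := hz'
    have : f = 0 := by
      ext1 m
      have := hcoef f 1 m
      rw [hz] at this
      simpa [hc0] using this.symm
    rw [this, map_zero]
  intro z hz
  have hz' : z ∈ LinearMap.range (polySum ι b) := hspan ▸ Submodule.mem_top
  obtain ⟨f, rfl⟩ := hz'
  rw [Subalgebra.mem_center_iff] at hz
  -- Commute `z` with the variable `X t` that separates `deg m` from `0`, and compare the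
  -- coefficients of `e_{deg m}` in the image of `e_0`: the difference of the eigenvalues multiplies
  -- `c m * f m` to zero.
  have hf : ∀ m, m ≠ m₀ → f m = 0 := by
    intro m hm
    obtain ⟨t, ht⟩ := hsep (deg m) fun h => hm (hdeg (h.trans hd₀.symm))
    have e := congrArg (fun b => ρ b (Finsupp.single 0 1) (deg m)) (hz (ι (MvPolynomial.X t)))
    simp only [map_mul, Module.End.mul_apply, hι] at e
    rw [wshift_single, hη, add_zero, mul_one, hcoef] at e
    have e2 : ∀ v : (Fin n → ℤ) →₀ MvPolynomial τ K,
        (wshift 0 (η t) v) (deg m) = η t (deg m) * v (deg m) := by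
      intro v
      induction v using Finsupp.induction_linear with
      | zero => simp
      | add f f' hf hf' => simp [hf, hf', mul_add]
      | single b g =>
        rw [wshift_single, add_zero]
        by_cases hb : b = deg m
        · subst hb; simp
        · simp [hb]
    rw [e2, hcoef] at e
    have e3 : (η t (deg m) - MvPolynomial.X t) * (c m * f m) = 0 := by linear_combination e
    rcases mul_eq_zero.1 e3 with h | h
    · exact absurd (sub_eq_zero.1 h) ht
    · exact (mul_eq_zero.1 h).resolve_left (hc0 m)
  have hf' : f = Finsupp.single m₀ (f m₀) := by
    ext1 m
    by_cases hm : m = m₀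
    · subst hm; simp
    · rw [hf m hm, Finsupp.single_eq_of_ne hm]
  rw [hf', polySum_single, hm₀, one_mul] at hz ⊢
  -- The scalars by which `z` acts at `e_0` and at `e_a` agree, because the shift `x` intertwines
  -- them with a nonzero weight.
  refine ⟨f m₀, rfl, fun x a hx => ?_⟩
  have e := congrArg (fun b => ρ b (Finsupp.single 0 1) a) (hz x)
  obtain ⟨d, hd0, hd⟩ := hx 0
  simp only [map_mul, Module.End.mul_apply, hP, hd, hη] at e
  simp only [zero_add, Finsupp.single_eq_same, mul_one] at e
  have e2 : MvPolynomial.aeval (fun t => (MvPolynomial.X t : MvPolynomial τ K)) (f m₀) = f m₀ := by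
    simp
  rw [e2, mul_comm] at e
  exact (mul_right_cancel₀ hd0 e).symm

/-- The center of an algebra `A` generated like a (twisted) generalized Weyl algebra, in presence
of a representation by weighted shifts in which the polynomials act diagonally with separate
eigenvalues. -/
theorem IsTwistedGWA.center {τ : Type*} {n : ℕ} {ι : MvPolynomial τ K →ₐ[K] A}
    {x y : Fin n → A} (h : IsTwistedGWA ι x y)
    (ρ : A →ₐ[K] Module.End (MvPolynomial τ K) ((Fin n → ℤ) →₀ MvPolynomial τ K))
    (η : τ → (Fin n → ℤ) → MvPolynomial τ K) (hη : ∀ t, η t 0 = MvPolynomial.X t)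
    (hsep : ∀ a, a ≠ 0 → ∃ t, η t a ≠ MvPolynomial.X t)
    (hι : ∀ t, ρ (ι (MvPolynomial.X t)) = wshift 0 (η t))
    (hx : ∀ i, IsShift (ρ (x i)) (Pi.single i 1))
    (hy : ∀ i, IsShift (ρ (y i)) (Pi.single i (-1))) :
    Function.Injective ρ ∧ ∀ z ∈ Subalgebra.center K A, ∃ P, z = ι P ∧
      ∀ i, MvPolynomial.aeval (fun t => η t (Pi.single i 1)) P = P := by
  obtain ⟨h1, h2⟩ := exists_of_mem_center (b := signedMonomial x y) (deg := fun m => m)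
    (fun _ _ h => h) (signedMonomial_zero x y) rfl h.range_polySum ρ η hη hsep hι fun m => by
      rw [map_signedMonomial (B := Module.End (MvPolynomial τ K) ((Fin n → ℤ) →₀ MvPolynomial τ K)) ρ]
      exact IsShift.signedMonomial hx hy m
  refine ⟨h1, fun z hz => ?_⟩
  obtain ⟨P, e, hP⟩ := h2 z hz
  exact ⟨P, e, fun i => hP _ _ (hx i)⟩

end TwistedGWA

/-! ### Algebras given by generators and relations -/

section Presentations

variable {K : Type u} [Field K] {X : Type v}

/-- The elements `f x` satisfy the relations `r`. -/
def Satisfies (r : FreeAlgebra K X → FreeAlgebra K X → Prop) {E : Type*} [Ring E] [Algebra K E]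
    (f : X → E) : Prop :=
  ∀ ⦃a b⦄, r a b → FreeAlgebra.lift K f a = FreeAlgebra.lift K f b

/-- `A` is presented by the generators `g x` and the relations `r`. -/
structure IsPresentation (r : FreeAlgebra K X → FreeAlgebra K X → Prop) {A : Type*} [Ring A]
    [Algebra K A] (g : X → A) : Prop where
  rel : Satisfies r g
  gen : Algebra.adjoin K (Set.range g) = ⊤
  lift : ∀ (E : Type (max u v)) [Ring E] [Algebra K E] (f : X → E), Satisfies r f →
    ∃ φ : A →ₐ[K] E, ∀ x, φ (g x) = f x

theorem exists_isPresentation (r : FreeAlgebra K X → FreeAlgebra K X → Prop) :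
    ∃ g : X → RingQuot r, IsPresentation r g := by
  have hπ : FreeAlgebra.lift K (fun x => RingQuot.mkAlgHom K r (gen K x)) =
      RingQuot.mkAlgHom K r := by
    ext x
    exact FreeAlgebra.lift_ι_apply _ x
  refine ⟨fun x => RingQuot.mkAlgHom K r (gen K x), fun a b h => ?_, ?_, fun E _ _ f h => ?_⟩
  · rw [hπ, RingQuot.mkAlgHom_rel K h]
  · rw [Algebra.adjoin_range_eq_range_freeAlgebra_lift, hπ, AlgHom.range_eq_top]
    exact RingQuot.mkAlgHom_surjective K r
  · exact ⟨RingQuot.liftAlgHom K ⟨FreeAlgebra.lift K f, h⟩, fun x =>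
      (RingQuot.liftAlgHom_mkAlgHom_apply ..).trans (FreeAlgebra.lift_ι_apply _ x)⟩

end Presentations

/-! ### Roots of unity, scalar monomials, diagonal substitutions -/

section Scalars

theorem NonRootOfUnity.zpow_ne_one {K : Type u} [Field K] {q : K} (h : NonRootOfUnity q) {m : ℤ}
    (hm : m ≠ 0) : q ^ m ≠ 1 := by
  intro h1
  have h2 : ∀ m : ℕ, m ≠ 0 → q ^ m ≠ 1 := fun m hm h1 =>
    h.2 (isOfFinOrder_iff_pow_eq_one.2 ⟨m, Nat.pos_of_ne_zero hm, h1⟩)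
  rcases Int.eq_nat_or_neg m with ⟨k, rfl | rfl⟩
  · exact h2 k (by simpa using hm) (by simpa using h1)
  · exact h2 k (by simpa using hm) (by simpa using h1)

theorem NonRootOfUnity.pow_ne_one {K : Type u} [Field K] {q : K} (h : NonRootOfUnity q) {m : ℕ}
    (hm : m ≠ 0) : q ^ m ≠ 1 := by
  have := h.zpow_ne_one (m := m) (by exact_mod_cast hm)
  simpa using this

theorem NonRootOfUnity.pow {K : Type u} [Field K] {q : K} (h : NonRootOfUnity q) {m : ℕ}
    (hm : m ≠ 0) : NonRootOfUnity (q ^ m) := by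
  refine ⟨pow_ne_zero _ h.1, fun h' => ?_⟩
  obtain ⟨k, hk, e⟩ := isOfFinOrder_iff_pow_eq_one.1 h'
  rw [← pow_mul] at e
  exact h.pow_ne_one (mul_ne_zero hm hk.ne') e

theorem NonRootOfUnity.ne_one {K : Type u} [Field K] {q : K} (h : NonRootOfUnity q) : q ≠ 1 := by
  simpa using h.pow_ne_one one_ne_zero

/-- `∏ s_j ^ a_j`. -/
def zmonomial {K : Type*} [Field K] {n : ℕ} (s : Fin n → K) (a : Fin n → ℤ) : K := ∏ j, s j ^ a j

theorem zmonomial_add_single {K : Type*} [Field K] {n : ℕ} {s : Fin n → K} (a : Fin n → ℤ)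
    (j : Fin n) (m : ℤ) (hs : s j ≠ 0) :
    zmonomial s (a + Pi.single j m) = zmonomial s a * s j ^ m := by
  unfold zmonomial
  rw [← Finset.mul_prod_erase _ _ (Finset.mem_univ j),
    ← Finset.mul_prod_erase Finset.univ (fun i => s i ^ a i) (Finset.mem_univ j)]
  have : ∀ i ∈ Finset.univ.erase j, s i ^ (a + Pi.single j m : Fin n → ℤ) i = s i ^ a i := by
    intro i hi
    simp [Finset.ne_of_mem_erase hi]
  rw [Finset.prod_congr rfl this]
  simp [zpow_add₀ hs]
  ring

theorem zmonomial_ne_zero {K : Type*} [Field K] {n : ℕ} {s : Fin n → K} (hs : ∀ j, s j ≠ 0)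
    (a : Fin n → ℤ) : zmonomial s a ≠ 0 :=
  Finset.prod_ne_zero_iff.2 fun j _ => zpow_ne_zero _ (hs j)

/-- Monomials are eigenvectors of a diagonal substitution, so its invariants can be determined
coefficient by coefficient. -/
theorem coeff_aeval_scale {K : Type*} [Field K] {τ : Type*} (s : τ → K) (P : MvPolynomial τ K)
    (b : τ →₀ ℕ) : MvPolynomial.coeff b
      (MvPolynomial.aeval (fun t => MvPolynomial.C (s t) * MvPolynomial.X t) P) =
      (b.prod fun t k => s t ^ k) * MvPolynomial.coeff b P := by
  classical
  induction P using MvPolynomial.induction_on' with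
  | add p q hp hq => simp only [map_add, MvPolynomial.coeff_add, hp, hq, mul_add]
  | monomial c a =>
    have : MvPolynomial.aeval (fun t => MvPolynomial.C (s t) * MvPolynomial.X t)
        (MvPolynomial.monomial c a) = MvPolynomial.C (c.prod fun t k => s t ^ k) *
          MvPolynomial.monomial c a := by
      rw [MvPolynomial.aeval_monomial, MvPolynomial.monomial_eq]
      simp only [mul_pow, Finsupp.prod_mul, MvPolynomial.algebraMap_eq]
      rw [show (c.prod fun a b => MvPolynomial.C (σ := τ) (s a) ^ b) =
        MvPolynomial.C (c.prod fun t k => s t ^ k) by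
          simp [Finsupp.prod, map_prod]]
      ring
    rw [this, MvPolynomial.coeff_C_mul, MvPolynomial.coeff_monomial]
    split_ifs with h
    · rw [h]
    · simp

/-- The twist of the shifts in a representation of a quantum space. -/
def twist {K : Type*} [Field K] {n : ℕ} (γ : Fin n → Fin n → K) (i j : Fin n) : K :=
  if j < i then γ i j else 1

variable {K : Type u} [Field K] {n : ℕ} {γ : Fin n → Fin n → K}

theorem MultAntisymm.ne_zero (h : MultAntisymm γ) (i j : Fin n) : γ i j ≠ 0 :=
  left_ne_zero_of_mul (h.2 i j ▸ one_ne_zero)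

theorem MultAntisymm.twist_ne_zero (h : MultAntisymm γ) (i j : Fin n) : twist γ i j ≠ 0 := by
  unfold twist; split_ifs
  · exact h.ne_zero i j
  · exact one_ne_zero

/-- All of `γ` is put below the diagonal, so that the two orders of composition of raising operators
differ exactly by the factor `γ i j`. -/
theorem MultAntisymm.twist_eq (h : MultAntisymm γ) (i j : Fin n) :
    twist γ i j = γ i j * twist γ j i := by
  unfold twist
  rcases lt_trichotomy i j with hij | hij | hij
  · rw [if_neg hij.not_gt, if_pos hij, h.2]
  · subst hij; simp [h.1]
  · rw [if_pos hij, if_neg hij.not_gt, mul_one]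

@[simp] theorem twist_self (i : Fin n) : twist γ i i = 1 := by simp [twist]

end Scalars

/-! ### Quantum Weyl relations of Maltsiniotis and symplectic type -/

section TypeW

/-- `ν + ∑_{l < m} θ_l`. -/
def partialSum {K E : Type*} [Field K] [Ring E] [Algebra K E] {n : ℕ} (ν : K) (θ : Fin n → E) :
    ℕ → E
  | 0 => algebraMap K E ν
  | m + 1 => partialSum ν θ m + if h : m < n then θ ⟨m, h⟩ else 0

theorem partialSum_eq {K E : Type*} [Field K] [Ring E] [Algebra K E] {n : ℕ} (ν : K)
    (θ : Fin n → E) (i : Fin n) :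
    partialSum ν θ i = algebraMap K E ν + ∑ l ∈ Finset.Iio i, θ l := by
  have key : ∀ m : ℕ, m ≤ n → partialSum ν θ m =
      algebraMap K E ν + ∑ l ∈ Finset.univ.filter (fun l : Fin n => l.val < m), θ l := by
    intro m
    induction m with
    | zero => simp [partialSum]
    | succ m ih =>
      intro hm
      have hm' : m < n := hm
      rw [partialSum, ih hm'.le, dif_pos hm', add_assoc]
      congr 1
      have : (Finset.univ.filter fun l : Fin n => l.val < m + 1) =
          insert ⟨m, hm'⟩ (Finset.univ.filter fun l : Fin n => l.val < m) := by
        ext l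
        simp only [Finset.mem_filter, Finset.mem_univ, true_and, Finset.mem_insert, Fin.ext_iff]
        omega
      rw [this, Finset.sum_insert (by simp), add_comm]
  rw [key i i.2.le]
  congr 2
  ext l
  rw [Finset.mem_filter, Finset.mem_Iio]
  exact ⟨fun h => h.2, fun h => ⟨Finset.mem_univ _, h⟩⟩

/-- The relations of the quantum Weyl algebras of Maltsiniotis (`ν = 1`) and of the quantum
symplectic spaces (`ν = 0`), up to rescaling of the generators. -/
structure WRel {K : Type*} [Field K] {E : Type*} [Ring E] [Algebra K E] {n : ℕ} (ν : K)
    (r : Fin n → K) (γ : Fin n → Fin n → K) (x y : Fin n → E) : Prop where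
  yy : ∀ i j, y i * y j = γ i j • (y j * y i)
  xx : ∀ i j, i < j → x i * x j = (r i * γ i j) • (x j * x i)
  xy_lt : ∀ i j, i < j → x i * y j = γ j i • (y j * x i)
  xy_gt : ∀ i j, j < i → x i * y j = (r j * γ j i) • (y j * x i)
  xy : ∀ i, x i * y i = r i • (y i * x i) + (r i - 1) • partialSum ν (fun l => y l * x l) i

variable {K : Type u} [Field K] {n : ℕ} {ν : K} {r : Fin n → K} {γ : Fin n → Fin n → K}

section Relations

variable {E : Type*} [Ring E] [Algebra K E] {x y : Fin n → E}

theorem smul_eq_iff_inv {c : K} (hc : c ≠ 0) {a b : E} : a = c • b ↔ b = c⁻¹ • a := by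
  constructor
  · rintro rfl; rw [inv_smul_smul₀ hc]
  · rintro rfl; rw [smul_inv_smul₀ hc]

/-- The partial sums `w_m` are normal. The terms with `l < j` commute with `y j`, those with `l > j`
contribute the factor `r j`, and the relation between `x j` and `y j` says precisely that the sum up
to and including `l = j` picks up `r j`. -/
theorem WRel.sum_mul_y (h : WRel ν r γ x y) (hγ : MultAntisymm γ) (j : Fin n)
    (m : ℕ) : partialSum ν (fun l => y l * x l) m * y j =
      (if j.val < m then r j else 1) • (y j * partialSum ν (fun l => y l * x l) m) := by
  induction m with
  | zero => simp [partialSum, Algebra.commutes]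
  | succ m ih =>
    rw [partialSum]
    by_cases hm : m < n
    · rw [dif_pos hm, add_mul, mul_add, smul_add, ih]
      rcases lt_trichotomy m j.val with hl | hl | hl
      · rw [if_neg (by omega), if_neg (by omega), mul_assoc, h.xy_lt ⟨m, hm⟩ j hl, mul_smul_comm,
          ← mul_assoc, h.yy ⟨m, hm⟩ j, smul_mul_assoc, smul_smul, hγ.2, mul_assoc]
      · obtain rfl : j = ⟨m, hm⟩ := Fin.ext hl.symm
        rw [if_neg (by omega), if_pos (by omega), mul_assoc (y ⟨m, hm⟩), h.xy ⟨m, hm⟩, mul_add,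
          mul_smul_comm, mul_smul_comm]
        module
      · rw [if_pos (by omega), if_pos (by omega), mul_assoc, h.xy_gt ⟨m, hm⟩ j hl, mul_smul_comm,
          ← mul_assoc, h.yy ⟨m, hm⟩ j, smul_mul_assoc, smul_smul, mul_assoc, hγ.2, mul_one, mul_assoc]
    · rw [dif_neg hm, add_zero, ih]
      have := j.2
      rw [if_pos (by omega), if_pos (by omega)]

/-- The mirror image of the rule for `y j`: the scalar is the same but appears on the opposite side,
so that `y j * x j` commutes with every partial sum. -/
theorem WRel.x_mul_sum (h : WRel ν r γ x y) (hγ : MultAntisymm γ) (hr : ∀ i, r i ≠ 0) (j : Fin n)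
    (m : ℕ) : x j * partialSum ν (fun l => y l * x l) m =
      (if j.val < m then r j else 1) • (partialSum ν (fun l => y l * x l) m * x j) := by
  induction m with
  | zero => simp [partialSum, Algebra.commutes]
  | succ m ih =>
    rw [partialSum]
    by_cases hm : m < n
    · rw [dif_pos hm, add_mul, mul_add, smul_add, ih]
      rcases lt_trichotomy m j.val with hl | hl | hl
      · have hc : r ⟨m, hm⟩ * γ ⟨m, hm⟩ j ≠ 0 := mul_ne_zero (hr _) (hγ.ne_zero _ _)
        have e := (smul_eq_iff_inv hc).1 (h.xx ⟨m, hm⟩ j hl)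
        rw [if_neg (by omega), if_neg (by omega), ← mul_assoc, h.xy_gt j ⟨m, hm⟩ hl,
          smul_mul_assoc, mul_assoc, e, mul_smul_comm, smul_smul, mul_inv_cancel₀ hc, mul_assoc]
      · obtain rfl : j = ⟨m, hm⟩ := Fin.ext hl.symm
        rw [if_neg (by omega), if_pos (by omega), ← mul_assoc (x ⟨m, hm⟩), h.xy ⟨m, hm⟩, add_mul,
          smul_mul_assoc, smul_mul_assoc]
        module
      · rw [if_pos (by omega), if_pos (by omega), ← mul_assoc, h.xy_lt j ⟨m, hm⟩ hl,
          smul_mul_assoc, mul_assoc, h.xx j ⟨m, hm⟩ hl, mul_smul_comm, smul_smul, mul_left_comm,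
          hγ.2, mul_one, mul_assoc]
    · rw [dif_neg hm, add_zero, ih]
      have := j.2
      rw [if_pos (by omega), if_pos (by omega)]

theorem WRel.sum_comm (h : WRel ν r γ x y) (hγ : MultAntisymm γ) (hr : ∀ i, r i ≠ 0) (m m' : ℕ) :
    partialSum ν (fun l => y l * x l) m * partialSum ν (fun l => y l * x l) m' =
      partialSum ν (fun l => y l * x l) m' * partialSum ν (fun l => y l * x l) m := by
  induction m' with
  | zero => simp [partialSum, Algebra.commutes]
  | succ m' ih =>
    rw [partialSum, mul_add, add_mul, ih]
    congr 1
    split_ifs with hm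
    · have hc : (if m' < m then r ⟨m', hm⟩ else 1) ≠ 0 := by
        split_ifs
        exacts [hr _, one_ne_zero]
      have e := h.x_mul_sum hγ hr ⟨m', hm⟩ m
      rw [← mul_assoc, h.sum_mul_y hγ, smul_mul_assoc, mul_assoc, mul_assoc, e, mul_smul_comm]
    · simp

end Relations

section Representation

open MvPolynomial

/-- The eigenvalues of the elements `w_m = ν + ∑_{l < m} y_l x_l`. -/
noncomputable def wEigen (ν : K) (r : Fin n → K) (m : ℕ) (a : Fin n → ℤ) : MvPolynomial (Fin n) K :=
  match m with
  | 0 => C ν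
  -- The element `w_{m+1}` gets a new variable, scaled by `r_j` along each direction `j ≤ m`. The
  -- value `0` for `m ≥ n` is a default.
  | m + 1 => if h : m < n then
      C (zmonomial (fun j : Fin n => if j.val < m + 1 then r j else 1) a) * X ⟨m, h⟩ else 0

theorem wEigen_add_single (hr : ∀ i, r i ≠ 0) (m : ℕ) (a : Fin n → ℤ) (j : Fin n) (s : ℤ) :
    wEigen ν r m (a + Pi.single j s) = C ((if j.val < m then r j else 1) ^ s) * wEigen ν r m a := by
  cases m with
  | zero => simp [wEigen]
  | succ m =>
    simp only [wEigen]
    split_ifs with h h' h'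
    · rw [zmonomial_add_single _ _ _ (by split_ifs; exact hr j), if_pos h', map_mul]
      ring
    · rw [zmonomial_add_single _ _ _ (by rw [if_neg h']; exact one_ne_zero), if_neg h', map_mul]
      ring
    · simp
    · simp

/-- The difference of two consecutive eigenvalues. -/
noncomputable def wDiff (ν : K) (r : Fin n → K) (i : Fin n) (a : Fin n → ℤ) :
    MvPolynomial (Fin n) K := wEigen ν r (i + 1) a - wEigen ν r i a

/-- The variable `X i` occurs in the eigenvalue of `w_{i+1}` with a nonzero scalar and does not
occur in that of `w_i`. -/
theorem wDiff_ne_zero (hr : ∀ i, r i ≠ 0) (i : Fin n) (a : Fin n → ℤ) : wDiff ν r i a ≠ 0 := by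
  intro h
  have h2 := congrArg (coeff (Finsupp.single i 1)) h
  have h3 : coeff (Finsupp.single i 1) (wEigen ν r i a) = 0 := by
    rcases i with ⟨_ | m, hm⟩
    · simp [wEigen, coeff_C, Finsupp.single_eq_zero, eq_comm]
    · simp only [wEigen]
      rw [dif_pos (by omega), coeff_C_mul, coeff_X, if_neg, mul_zero]
      intro e
      have := (Finsupp.single_left_inj (one_ne_zero)).1 e
      simp [Fin.ext_iff] at this
  rw [wDiff, coeff_sub, h3, wEigen, dif_pos i.2, coeff_C_mul, coeff_X, if_pos rfl] at h2
  simp only [mul_one, sub_zero, coeff_zero] at h2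
  refine zmonomial_ne_zero (fun j => ?_) a h2
  split_ifs
  exacts [hr j, one_ne_zero]

/-- The raising operators. -/
noncomputable def raise (γ : Fin n → Fin n → K) (i : Fin n) :
    Module.End (MvPolynomial (Fin n) K) ((Fin n → ℤ) →₀ MvPolynomial (Fin n) K) :=
  wshift (Pi.single i 1) fun a => C (zmonomial (twist γ i) a)

/-- The lowering operators with weights `d`. -/
noncomputable def lower (γ : Fin n → Fin n → K) (i : Fin n)
    (d : (Fin n → ℤ) → MvPolynomial (Fin n) K) :
    Module.End (MvPolynomial (Fin n) K) ((Fin n → ℤ) →₀ MvPolynomial (Fin n) K) :=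
  wshift (Pi.single i (-1)) fun a => C (zmonomial (twist γ i) a)⁻¹ * d a

theorem raise_mul_raise (hγ : MultAntisymm γ) (i j : Fin n) :
    raise γ i * raise γ j = γ i j • (raise γ j * raise γ i) := by
  unfold raise
  rw [wshift_mul, wshift_mul, smul_wshift]
  refine wshift_congr (add_comm _ _) fun a => ?_
  rw [zmonomial_add_single _ _ _ (hγ.twist_ne_zero _ _),
    zmonomial_add_single _ _ _ (hγ.twist_ne_zero _ _), smul_eq_C_mul, zpow_one, zpow_one,
    hγ.twist_eq i j]
  simp only [map_mul]
  ring

theorem lower_mul_raise (hγ : MultAntisymm γ) {i j : Fin n} {s : K}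
    (d : (Fin n → ℤ) → MvPolynomial (Fin n) K) (hd : ∀ a, d (a + Pi.single j 1) = C s * d a) :
    lower γ i d * raise γ j = (s * γ j i) • (raise γ j * lower γ i d) := by
  unfold raise lower
  rw [wshift_mul, wshift_mul, smul_wshift]
  refine wshift_congr (add_comm _ _) fun a => ?_
  have h1 := hγ.twist_ne_zero i j
  have h2 := hγ.twist_ne_zero j i
  have h3 : C (σ := Fin n) (γ j i * (twist γ j i)⁻¹) = C (twist γ i j)⁻¹ := by
    congr 1
    rw [hγ.twist_eq j i, mul_inv, mul_inv_cancel_left₀ (hγ.ne_zero _ _)]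
  rw [zmonomial_add_single _ _ _ h1, zmonomial_add_single _ _ _ h2, smul_eq_C_mul, zpow_one, hd,
    zpow_neg_one, mul_inv, map_mul, ← h3]
  simp only [map_mul]
  ring

theorem lower_mul_lower (hγ : MultAntisymm γ) {i j : Fin n} {s s' : K} (hs' : s' ≠ 0)
    (d d' : (Fin n → ℤ) → MvPolynomial (Fin n) K)
    (hd : ∀ a, d (a + Pi.single j (-1)) = C s * d a)
    (hd' : ∀ a, d' (a + Pi.single i (-1)) = C s' * d' a) :
    lower γ i d * lower γ j d' = (s * s'⁻¹ * γ i j) • (lower γ j d' * lower γ i d) := by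
  unfold lower
  rw [wshift_mul, wshift_mul, smul_wshift]
  refine wshift_congr (add_comm _ _) fun a => ?_
  have h1 := hγ.twist_ne_zero i j
  have h2 := hγ.twist_ne_zero j i
  rw [zmonomial_add_single _ _ _ h1, zmonomial_add_single _ _ _ h2, smul_eq_C_mul, hd, hd',
    zpow_neg_one, zpow_neg_one, mul_inv, mul_inv, inv_inv, inv_inv, hγ.twist_eq i j]
  have h3 : C (σ := Fin n) s'⁻¹ * C s' = 1 := by rw [← map_mul, inv_mul_cancel₀ hs', map_one]
  simp only [map_mul]
  linear_combination (-(C (σ := Fin n) s * C (γ i j) * C (twist γ j i) *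
    C (zmonomial (twist γ i) a)⁻¹ * C (zmonomial (twist γ j) a)⁻¹ * d a * d' a)) * h3

theorem raise_mul_lower (hγ : MultAntisymm γ) (i : Fin n)
    (d : (Fin n → ℤ) → MvPolynomial (Fin n) K) : raise γ i * lower γ i d = wshift 0 d := by
  unfold raise lower
  rw [wshift_mul]
  refine wshift_congr (by rw [← Pi.single_add]; simp) fun a => ?_
  rw [zmonomial_add_single _ _ _ (hγ.twist_ne_zero _ _), twist_self, one_zpow, mul_one, ← mul_assoc,
    ← map_mul, mul_inv_cancel₀ (zmonomial_ne_zero (hγ.twist_ne_zero i) a), map_one, one_mul]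

theorem lower_mul_raise_self (hγ : MultAntisymm γ) (i : Fin n)
    (d : (Fin n → ℤ) → MvPolynomial (Fin n) K) :
    lower γ i d * raise γ i = wshift 0 fun a => d (a + Pi.single i 1) := by
  unfold raise lower
  rw [wshift_mul]
  refine wshift_congr (by rw [← Pi.single_add]; simp) fun a => ?_
  rw [zmonomial_add_single _ _ _ (hγ.twist_ne_zero _ _), twist_self, one_zpow, mul_one,
    mul_right_comm, ← map_mul, inv_mul_cancel₀ (zmonomial_ne_zero (hγ.twist_ne_zero i) a), map_one,
    one_mul]

theorem isShift_raise (hγ : MultAntisymm γ) (i : Fin n) :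
    IsShift (raise γ i) (Pi.single i 1) :=
  isShift_wshift _ _ fun a => by
    simpa using zmonomial_ne_zero (hγ.twist_ne_zero i) a

theorem isShift_lower (hγ : MultAntisymm γ) (i : Fin n)
    {d : (Fin n → ℤ) → MvPolynomial (Fin n) K} (hd : ∀ a, d a ≠ 0) :
    IsShift (lower γ i d) (Pi.single i (-1)) :=
  isShift_wshift _ _ fun a => mul_ne_zero (by
    simpa using zmonomial_ne_zero (hγ.twist_ne_zero i) a) (hd a)

theorem partialSum_wDiff (m : ℕ) (hm : m ≤ n) :
    partialSum ν (fun l => wshift 0 (wDiff ν r l) : Fin n → Module.End (MvPolynomial (Fin n) K)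
      ((Fin n → ℤ) →₀ MvPolynomial (Fin n) K)) m = wshift 0 (wEigen ν r m) := by
  induction m with
  | zero =>
    rw [partialSum, wshift_algebraMap]
    rfl
  | succ m ih =>
    rw [partialSum, dif_pos (show m < n from hm), ih (by omega), wshift_add]
    refine wshift_congr rfl fun a => ?_
    rw [wDiff]
    ring

theorem wDiff_add_single_lt (hr : ∀ i, r i ≠ 0) {i j : Fin n} (h : j < i) (a : Fin n → ℤ) (s : ℤ) :
    wDiff ν r i (a + Pi.single j s) = C (r j ^ s) * wDiff ν r i a := by
  have h' : j.val < i.val := h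
  rw [wDiff, wDiff, wEigen_add_single hr, wEigen_add_single hr, if_pos (by omega), if_pos h']
  ring

theorem wDiff_add_single_gt (hr : ∀ i, r i ≠ 0) {i j : Fin n} (h : i < j) (a : Fin n → ℤ) (s : ℤ) :
    wDiff ν r i (a + Pi.single j s) = C 1 * wDiff ν r i a := by
  have h' : i.val < j.val := h
  rw [wDiff, wDiff, wEigen_add_single hr, wEigen_add_single hr, if_neg (by omega),
    if_neg (by omega), one_zpow]
  ring

/-- The weights of the lowering operators are forced by `y_i x_i = w_{i+1} - w_i`. The relation
between `x_i` and `y_i` then says that a step in direction `i` multiplies the eigenvalue of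
`w_{i+1}` by `r_i` and fixes that of `w_i`. -/
theorem wRel_representation (ν : K) (hγ : MultAntisymm γ) (hr : ∀ i, r i ≠ 0) :
    WRel ν r γ (fun i => lower γ i (wDiff ν r i)) (raise γ) where
  yy := raise_mul_raise hγ
  xx i j h := by
    have := lower_mul_lower hγ (s := 1) (s' := r i ^ (-1 : ℤ)) (zpow_ne_zero _ (hr i))
      (wDiff ν r i) (wDiff ν r j)
      (fun a => wDiff_add_single_gt hr h a (-1)) (fun a => wDiff_add_single_lt hr h a (-1))
    rw [this]
    simp
  xy_lt i j h := by
    have := lower_mul_raise hγ (i := i) (j := j) (s := 1) (wDiff ν r i) (fun a => wDiff_add_single_gt hr h a 1)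
    rw [this, one_mul]
  xy_gt i j h := by
    have := lower_mul_raise hγ (i := i) (j := j) (wDiff ν r i) (fun a => wDiff_add_single_lt hr h a 1)
    rw [this, zpow_one]
  xy i := by
    simp only [raise_mul_lower hγ]
    rw [lower_mul_raise_self hγ, partialSum_wDiff _ i.2.le, smul_wshift, smul_wshift, wshift_add]
    refine wshift_congr rfl fun a => ?_
    rw [wDiff, wDiff, wEigen_add_single hr, wEigen_add_single hr, if_pos (by omega), if_neg (by omega),
      smul_eq_C_mul, smul_eq_C_mul, zpow_one, one_zpow]
    simp only [map_sub, map_one]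
    ring

end Representation

open MvPolynomial in
/-- An algebra presented by the relations `WRel`, with parameters `r_i` that are not roots of unity,
has trivial center. -/
theorem isCentral_of_wRel (ν : K) (hγ : MultAntisymm γ) (hr : ∀ i, NonRootOfUnity (r i))
    {A : Type u} [Ring A] [Algebra K A] {x y : Fin n → A} (h : WRel ν r γ x y)
    (hgen : Algebra.adjoin K (Set.range x ∪ Set.range y) = ⊤)
    (hlift : ∀ (E : Type u) [Ring E] [Algebra K E] (x' y' : Fin n → E), WRel ν r γ x' y' →
      ∃ φ : A →ₐ[K] E, (∀ i, φ (x i) = x' i) ∧ ∀ i, φ (y i) = y' i) :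
    Algebra.IsCentral K A := by
  have hr0 : ∀ i, r i ≠ 0 := fun i => (hr i).1
  set W : ℕ → A := partialSum ν (fun l => y l * x l) with hW
  obtain ⟨ι, hι⟩ := exists_mvPolynomial_algHom K (fun t : Fin n => W (t + 1))
    (fun _ _ => h.sum_comm hγ hr0 _ _)
  have hWι : ∀ m ≤ n, ∃ P, W m = ι P := by
    intro m hm
    cases m with
    | zero => exact ⟨C ν, (ι.commutes ν).symm⟩
    | succ m => exact ⟨X ⟨m, hm⟩, (hι ⟨m, hm⟩).symm⟩
  have hyx : ∀ i : Fin n, ∃ P, y i * x i = ι P := by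
    intro i
    obtain ⟨P, hP⟩ := hWι (i + 1) i.2
    obtain ⟨Q, hQ⟩ := hWι i i.2.le
    refine ⟨P - Q, ?_⟩
    rw [map_sub, ← hP, ← hQ]
    simp [hW, partialSum]
  have hne : ∀ i j, r i * γ i j ≠ 0 := fun i j => mul_ne_zero (hr0 i) (hγ.ne_zero i j)
  have hxyne : ∀ i j, i ≠ j → ∃ c : K, c ≠ 0 ∧ x i * y j = c • (y j * x i) := by
    intro i j hij
    rcases lt_or_gt_of_ne hij with h' | h'
    · exact ⟨_, hγ.ne_zero _ _, h.xy_lt i j h'⟩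
    · exact ⟨_, hne _ _, h.xy_gt i j h'⟩
  -- The `y i` are the raising generators; conjugation by either family rescales the partial sums,
  -- which are the variables of the polynomial subalgebra.
  have hT : IsTwistedGWA ι y x := by
    refine ⟨fun i t => ?_, fun i t => ?_, hyx, fun i => ?_, fun i j _ => ⟨_, h.yy i j⟩,
      fun i j hij => ?_, fun i j hij => ?_, fun i j hij => ?_, ?_⟩
    · refine ⟨C (if i.val < t.val + 1 then r i else 1) * X t, ?_⟩
      rw [← smul_eq_C_mul, map_smul, hι, hW, h.sum_mul_y hγ, mul_smul_comm]
    · have hc : (if i.val < t.val + 1 then r i else 1) ≠ 0 := by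
        split_ifs
        exacts [hr0 _, one_ne_zero]
      refine ⟨C (if i.val < t.val + 1 then r i else 1)⁻¹ * X t, ?_⟩
      have := (smul_eq_iff_inv hc).1 (h.x_mul_sum hγ hr0 i (t + 1))
      rw [← smul_eq_C_mul, map_smul, hι, hW, this, mul_smul_comm]
    · obtain ⟨P, hP⟩ := hyx i
      obtain ⟨Q, hQ⟩ := hWι i i.2.le
      refine ⟨C (r i) * P + C (r i - 1) * Q, ?_⟩
      rw [h.xy, hP, ← hW, hQ, ← smul_eq_C_mul, ← smul_eq_C_mul, map_add, map_smul, map_smul]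
    · obtain ⟨c, hc, e⟩ := hxyne j i hij.symm
      exact ⟨_, (smul_eq_iff_inv hc).1 e⟩
    · obtain ⟨c, hc, e⟩ := hxyne i j hij
      exact ⟨_, e⟩
    · rcases lt_or_gt_of_ne hij with h' | h'
      · exact ⟨_, h.xx i j h'⟩
      · exact ⟨_, (smul_eq_iff_inv (hne _ _)).1 (h.xx j i h')⟩
    · rw [eq_top_iff, ← hgen]
      apply Algebra.adjoin_mono
      rintro a (ha | ha)
      · exact Or.inl (Or.inr ha)
      · exact Or.inl (Or.inl ha)
  obtain ⟨ρ, hρx, hρy⟩ := hlift _ _ _ (wRel_representation ν hγ hr0)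
  have hρW : ∀ m ≤ n, ρ (W m) = wshift 0 (wEigen ν r m) := by
    intro m hm
    rw [← partialSum_wDiff m hm, hW]
    clear hm
    induction m with
    | zero => simp [partialSum]
    | succ m ih =>
      rw [partialSum, partialSum, map_add, ih]
      congr 1
      split_ifs with hm
      · rw [map_mul, hρx, hρy, raise_mul_lower hγ]
      · simp
  have hη0 : ∀ t : Fin n, wEigen ν r (t + 1) 0 = X t := by
    intro t
    simp [wEigen, zmonomial]
  have hηi : ∀ t i : Fin n, wEigen ν r (t + 1) (Pi.single i 1) =
      C (if i.val < t.val + 1 then r i else 1) * X t := by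
    intro t i
    have := wEigen_add_single (ν := ν) hr0 (t + 1) 0 i 1
    rwa [zero_add, hη0, zpow_one] at this
  -- The system of eigenvalues is triangular: once the earlier exponents vanish, the scalar at
  -- `w_{j+1}` is `r_j ^ a_j`, which is `1` only for `a_j = 0`.
  have hsep : ∀ a : Fin n → ℤ, a ≠ 0 → ∃ t : Fin n, wEigen ν r (t + 1) a ≠ X t := by
    intro a ha
    by_contra hcon
    push Not at hcon
    apply ha
    have key : ∀ m : ℕ, ∀ j : Fin n, j.val < m → a j = 0 := by
      intro m
      induction m with
      | zero => intro j hj; omega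
      | succ m ih =>
        intro j hj
        rcases Nat.lt_succ_iff_lt_or_eq.1 hj with hj | rfl
        · exact ih j hj
        · have h1 := hcon j
          simp only [wEigen] at h1
          rw [dif_pos j.2] at h1
          have h2 := congrArg (coeff (Finsupp.single j 1)) h1
          rw [coeff_C_mul, coeff_X, if_pos rfl, mul_one] at h2
          have h3 : zmonomial (fun l : Fin n => if l.val < j.val + 1 then r l else 1) a =
              r j ^ a j := by
            unfold zmonomial
            rw [Finset.prod_eq_single j]
            · simp
            · intro b _ hb
              dsimp only
              split_ifs with hbj
              · rw [ih b (by have : b.val ≠ j.val := fun e => hb (Fin.ext e)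
                             omega), zpow_zero]
              · exact one_zpow _
            · simp
          rw [h3] at h2
          by_contra haj
          exact (hr j).zpow_ne_one haj h2
    exact funext fun j => key n j j.2
  have hz := (hT.center ρ (fun t => wEigen ν r (t + 1)) hη0 hsep (fun t => by rw [hι, hρW _ t.2])
    (fun i => hρy i ▸ isShift_raise hγ i)
    (fun i => hρx i ▸ isShift_lower hγ i (wDiff_ne_zero hr0 i))).2
  constructor
  intro z hzc
  obtain ⟨P, rfl, hP⟩ := hz z hzc
  -- A step in direction `0` multiplies every variable by the same `r_0`, hence a monomial of degree
  -- `d` by `r_0 ^ d`; so an invariant polynomial has only a constant term.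
  have hPc : P = C (coeff 0 P) := by
    ext b
    rw [coeff_C]
    split_ifs with hb
    · rw [← hb]
    · by_contra hb0
      obtain ⟨t, ht⟩ := Finsupp.ne_iff.1 (Ne.symm hb)
      have hn : 0 < n := lt_of_le_of_lt (Nat.zero_le _) t.2
      have h1 := hP ⟨0, hn⟩
      simp only [hηi] at h1
      have h2 := congrArg (coeff b) h1
      rw [coeff_aeval_scale] at h2
      have h3 : (b.prod fun t k => (if (0 : ℕ) < t.val + 1 then r ⟨0, hn⟩ else 1) ^ k) = 1 :=
        mul_right_cancel₀ hb0 (by rw [h2, one_mul])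
      simp only [Nat.succ_pos, if_true] at h3
      rw [Finsupp.prod, Finset.prod_pow_eq_pow_sum] at h3
      refine (hr _).pow_ne_one ?_ h3
      intro h0
      rw [Finset.sum_eq_zero_iff] at h0
      exact ht (by
        by_contra hbt
        exact hbt (h0 t (Finsupp.mem_support_iff.2 hbt)))
  rw [hPc]
  exact ⟨coeff 0 P, (ι.commutes _).symm⟩

end TypeW

/-! ### Multiparameter Weyl algebras and the algebra of Maltsiniotis -/

section QuantumWeyl

variable {K : Type u} [Field K] {n : ℕ}

theorem adjoin_eq_top_of_subset {A : Type*} [Ring A] [Algebra K A] {s t : Set A}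
    (hs : Algebra.adjoin K s = ⊤) (h : s ⊆ Algebra.adjoin K t) : Algebra.adjoin K t = ⊤ := by
  rw [eq_top_iff, ← hs]
  exact Algebra.adjoin_le h

theorem IsPresentation.adjoin_XYs {r : FreeAlgebra K (XYs n) → FreeAlgebra K (XYs n) → Prop}
    {A : Type u} [Ring A] [Algebra K A] {g : XYs n → A} (h : IsPresentation r g) :
    Algebra.adjoin K (Set.range (fun i => g (XYs.x i)) ∪ Set.range fun i => g (XYs.y i)) = ⊤ := by
  refine adjoin_eq_top_of_subset h.gen ?_
  rintro _ ⟨i | i, rfl⟩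
  · exact Algebra.subset_adjoin (Or.inl ⟨i, rfl⟩)
  · exact Algebra.subset_adjoin (Or.inr ⟨i, rfl⟩)

/-- The relations of the multiparameter Weyl algebra in an algebra. -/
structure QuantumWeylRel {E : Type*} [Ring E] [Algebra K E] (q : Fin n → K)
    (γ : Fin n → Fin n → K) (x y : Fin n → E) : Prop where
  yy : ∀ i j, y i * y j = γ i j • (y j * y i)
  xx : ∀ i j, i < j → x i * x j = (q i * γ i j) • (x j * x i)
  xy_lt : ∀ i j, i < j → x i * y j = γ j i • (y j * x i)
  xy_gt : ∀ i j, j < i → x i * y j = (q j * γ j i) • (y j * x i)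
  xy : ∀ j, x j * y j = q j • (y j * x j) + 1
        + ∑ l ∈ Finset.Iio j, (q l - 1) • (y l * x l)

/-- Rescaling `y_i` by `q_i - 1` absorbs the coefficients `q_l - 1` of the sum, which becomes a
partial sum with `ν = 1`; it is reversible because `q_i ≠ 1`. -/
theorem quantumWeylRel_iff {E : Type*} [Ring E] [Algebra K E] {q : Fin n → K}
    {γ : Fin n → Fin n → K} {x y : Fin n → E} (hq : ∀ i, q i ≠ 1) :
    QuantumWeylRel q γ x y ↔ WRel (1 : K) q γ x fun i => (q i - 1) • y i := by
  have hq' : ∀ i, q i - 1 ≠ 0 := fun i => sub_ne_zero.2 (hq i)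
  have hs : ∀ c : K, c ≠ 0 → ∀ a b : E, c • a = c • b ↔ a = b := fun c hc a b =>
    (smul_right_injective E hc).eq_iff
  have e1 : ∀ i j, ((q i - 1) • y i) * ((q j - 1) • y j) = γ i j • ((q j - 1) • y j * (q i - 1) • y i)
      ↔ y i * y j = γ i j • (y j * y i) := by
    intro i j
    rw [← hs _ (mul_ne_zero (hq' i) (hq' j)) (y i * y j)]
    simp only [smul_mul_smul_comm, smul_smul]
    rw [show γ i j * ((q j - 1) * (q i - 1)) = (q i - 1) * (q j - 1) * γ i j by ring]
  have e2 : ∀ i j (c : K), x i * ((q j - 1) • y j) = c • ((q j - 1) • y j * x i) ↔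
      x i * y j = c • (y j * x i) := by
    intro i j c
    rw [← hs _ (hq' j) (x i * y j)]
    simp only [mul_smul_comm, smul_mul_assoc, smul_smul]
    rw [mul_comm (q j - 1) c]
  have e3 : ∀ i, x i * ((q i - 1) • y i) = q i • ((q i - 1) • y i * x i) +
      (q i - 1) • partialSum (1 : K) (fun l => ((q l - 1) • y l) * x l) i ↔
      x i * y i = q i • (y i * x i) + 1 + ∑ l ∈ Finset.Iio i, (q l - 1) • (y l * x l) := by
    intro i
    rw [← hs _ (hq' i) (x i * y i), partialSum_eq]
    simp only [mul_smul_comm, smul_mul_assoc, smul_add, smul_smul, map_one, add_assoc]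
    rw [mul_comm (q i - 1) (q i)]
  constructor
  · intro h
    exact ⟨fun i j => (e1 i j).2 (h.yy i j), h.xx, fun i j hij => (e2 _ _ _).2 (h.xy_lt i j hij),
      fun i j hij => (e2 _ _ _).2 (h.xy_gt i j hij), fun i => (e3 i).2 (h.xy i)⟩
  · intro h
    exact ⟨fun i j => (e1 i j).1 (h.yy i j), h.xx, fun i j hij => (e2 _ _ _).1 (h.xy_lt i j hij),
      fun i j hij => (e2 _ _ _).1 (h.xy_gt i j hij), fun i => (e3 i).1 (h.xy i)⟩

theorem isCentral_of_quantumWeylRel {q : Fin n → K} {γ : Fin n → Fin n → K} (hγ : MultAntisymm γ)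
    (hq : ∀ i, NonRootOfUnity (q i))
    {A : Type u} [Ring A] [Algebra K A] {x y : Fin n → A} (h : QuantumWeylRel q γ x y)
    (hgen : Algebra.adjoin K (Set.range x ∪ Set.range y) = ⊤)
    (hlift : ∀ (E : Type u) [Ring E] [Algebra K E] (x' y' : Fin n → E), QuantumWeylRel q γ x' y' →
      ∃ φ : A →ₐ[K] E, (∀ i, φ (x i) = x' i) ∧ ∀ i, φ (y i) = y' i) :
    Algebra.IsCentral K A := by
  have hq1 : ∀ i, q i ≠ 1 := fun i => (hq i).ne_one
  have hq' : ∀ i, q i - 1 ≠ 0 := fun i => sub_ne_zero.2 (hq1 i)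
  refine isCentral_of_wRel 1 hγ hq ((quantumWeylRel_iff hq1).1 h)
    (adjoin_eq_top_of_subset hgen ?_) fun E _ _ x' y' h' => ?_
  · rintro _ (⟨i, rfl⟩ | ⟨i, rfl⟩)
    · exact Algebra.subset_adjoin (Or.inl ⟨i, rfl⟩)
    · rw [← inv_smul_smul₀ (hq' i) (y i)]
      refine Subalgebra.smul_mem _ (Algebra.subset_adjoin ?_) _
      exact Or.inr ⟨i, rfl⟩
  · obtain ⟨φ, hx, hy⟩ := hlift E x' (fun i => (q i - 1)⁻¹ • y' i)
      ((quantumWeylRel_iff hq1).2 (by simpa only [smul_inv_smul₀ (hq' _)] using h'))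
    exact ⟨φ, hx, fun i => by rw [map_smul, hy, smul_inv_smul₀ (hq' i)]⟩

/-- The center of an algebra presented by relations equivalent to `QuantumWeylRel`. -/
theorem IsPresentation.isCentral_of_quantumWeylRel
    {r : FreeAlgebra K (XYs n) → FreeAlgebra K (XYs n) → Prop}
    {A : Type u} [Ring A] [Algebra K A] {g : XYs n → A} (h : IsPresentation r g) {q : Fin n → K}
    {γ : Fin n → Fin n → K} (hγ : MultAntisymm γ) (hq : ∀ i, NonRootOfUnity (q i))
    (hr : ∀ (E : Type u) [Ring E] [Algebra K E] (f : XYs n → E), Satisfies r f ↔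
      QuantumWeylRel q γ (fun i => f (XYs.x i)) fun i => f (XYs.y i)) : Algebra.IsCentral K A :=
  ZariskiPBW.isCentral_of_quantumWeylRel hγ hq ((hr A g).1 h.rel) h.adjoin_XYs fun E _ _ x' y' h' => by
    obtain ⟨φ, hφ⟩ := h.lift E (fun | XYs.x i => x' i | XYs.y i => y' i) ((hr E _).2 h')
    exact ⟨φ, fun i => hφ _, fun i => hφ _⟩

theorem isCentral_multiparamWeyl {q : Fin n → K} {γ : Fin n → Fin n → K} (hγ : MultAntisymm γ)
    (hq : ∀ i, NonRootOfUnity (q i)) : Algebra.IsCentral K (MultiparamWeyl K q γ) := by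
  obtain ⟨g, hg⟩ := exists_isPresentation (MultiparamWeylRel K q γ)
  refine hg.isCentral_of_quantumWeylRel hγ hq fun E _ _ f => ⟨fun h => ⟨fun i j => ?_,
    fun i j hij => ?_, fun i j hij => ?_, fun i j hij => ?_, fun j => ?_⟩, fun h => ?_⟩
  · simpa using h (.yy i j)
  · simpa using h (.xx i j hij)
  · simpa using h (.xy_lt i j hij)
  · simpa using h (.xy_gt i j hij)
  · simpa using h (.xy j)
  · rintro _ _ (⟨i, j⟩ | ⟨i, j, hij⟩ | ⟨i, j, hij⟩ | ⟨i, j, hij⟩ | ⟨j⟩)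
    · simpa using h.yy i j
    · simpa using h.xx i j hij
    · simpa using h.xy_lt i j hij
    · simpa using h.xy_gt i j hij
    · simpa using h.xy j

/-- These are the multiparameter relations, except that those between the `y_i` are given for `i <
j` only and one mixed relation is solved for the other product; antisymmetry and invertible scalars
recover the rest. -/
theorem isCentral_maltsiniotis {q : Fin n → Fin n → K} {lam : Fin n → K} (hq : MultAntisymm q)
    (hlam : ∀ i, NonRootOfUnity (lam i)) : Algebra.IsCentral K (Maltsiniotis K q lam) := by
  have hinv : ∀ i j, (lam i * q i j)⁻¹ = (lam i)⁻¹ * q j i := fun i j => by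
    rw [mul_inv, inv_eq_of_mul_eq_one_right (hq.2 i j)]
  have hne : ∀ i j, lam i * q i j ≠ 0 := fun i j => mul_ne_zero (hlam i).1 (hq.ne_zero i j)
  obtain ⟨g, hg⟩ := exists_isPresentation (MaltsiniotisRel K q lam)
  refine hg.isCentral_of_quantumWeylRel hq hlam fun E _ _ f => ⟨fun h => ⟨fun i j => ?_,
    fun i j hij => ?_, fun i j hij => ?_, fun i j hij => ?_, fun j => ?_⟩, fun h => ?_⟩
  · have key : ∀ i j : Fin n, i < j → f (XYs.y i) * f (XYs.y j) = q i j • (f (XYs.y j) *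
        f (XYs.y i)) := fun i j hij => by simpa using h (.yy i j hij)
    rcases lt_trichotomy i j with hij | rfl | hij
    · exact key i j hij
    · rw [hq.1, one_smul]
    · rw [smul_eq_iff_inv (hq.ne_zero i j), inv_eq_of_mul_eq_one_right (hq.2 i j)]
      exact key j i hij
  · simpa using h (.xx i j hij)
  · simpa using h (.xy_lt i j hij)
  · rw [smul_eq_iff_inv (hne j i), hinv]
    simpa using h (.yx_lt j i hij)
  · rw [add_assoc, ← sub_eq_iff_eq_add']
    simpa using h (.xy j)
  · rintro _ _ (⟨i, j, hij⟩ | ⟨i, j, hij⟩ | ⟨i, j, hij⟩ | ⟨i, j, hij⟩ | ⟨j⟩)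
    · simpa using h.xx i j hij
    · simpa using h.yy i j
    · simpa using h.xy_lt i j hij
    · have := (smul_eq_iff_inv (hne i j)).1 (h.xy_gt j i hij)
      rw [hinv] at this
      simpa using this
    · have := h.xy j
      rw [add_assoc] at this
      simpa using sub_eq_iff_eq_add'.2 this

end QuantumWeyl

/-! ### Quantum symplectic spaces -/

section Symplectic

variable {K : Type u} [Field K] {n : ℕ}

theorem sum_Iio_castLE {M : Type*} [AddCommMonoid M] {n m : ℕ} (h : n ≤ m) (i : Fin n)
    (F : Fin m → M) :
    ∑ k ∈ Finset.Iio (Fin.castLE h i), F k = ∑ l ∈ Finset.Iio i, F (Fin.castLE h l) := by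
  symm
  refine Finset.sum_bij (fun l _ => Fin.castLE h l) (fun l hl => ?_)
    (fun a _ b _ e => Fin.castLE_injective h e) (fun k hk => ?_) fun _ _ => rfl
  · simpa using hl
  · have hk' : k.val < i.val := by simpa [Fin.lt_def] using hk
    exact ⟨⟨k.val, hk'.trans i.2⟩, by simpa [Fin.lt_def] using hk', rfl⟩

/-- With the first half of the generators as `y_i` and `q ^ (-i)` times their partners as `x_i`, the
powers `q ^ (i - k)` in the sum disappear, and the relations are those of type W with `ν = 0` and
`r_i = q ^ 2`. -/
theorem isCentral_quantumSymplectic {q : K} (hq : NonRootOfUnity q) :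
    Algebra.IsCentral K (QuantumSymplectic K n q) := by
  have hn : n ≤ 2 * n := by omega
  have hq0 := hq.1
  -- Read off from `x_j x_i = q x_i x_j` in the first half. The other relations fit because `q ^ 2 *
  -- q⁻¹ = q`.
  let γ : Fin n → Fin n → K := fun i j => if i < j then q⁻¹ else if j < i then q else 1
  have hγ : MultAntisymm γ := by
    refine ⟨fun i => by simp [γ], fun i j => ?_⟩
    rcases lt_trichotomy i j with h | rfl | h
    · simp [γ, h, h.not_gt, hq0]
    · simp [γ]
    · simp [γ, h, h.not_gt, hq0]
  have hlt : ∀ {i j}, i < j → γ i j = q⁻¹ := fun {i j} h => by simp [γ, h]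
  have hgt : ∀ {i j}, j < i → γ i j = q := fun {i j} h => by simp [γ, h, h.not_gt]
  have hqq : q ^ 2 * q⁻¹ = q := by field_simp
  obtain ⟨X, hg⟩ := exists_isPresentation (SymplecticRel K n q)
  let e : Fin n → Fin (2 * n) := Fin.castLE hn
  have hev : ∀ i, (e i).val = i.val := fun i => rfl
  have hrv : ∀ i, (e i).rev.val = 2 * n - 1 - i.val := fun i => by
    rw [Fin.val_rev, hev]; omega
  have hX : ∀ i j, i < j → i.rev ≠ j → X j * X i = q • (X i * X j) := fun i j h h' => by
    simpa using hg.rel (.comm i j h h')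
  have hXr : ∀ i, i < i.rev → X i.rev * X i = q ^ 2 • (X i * X i.rev)
        + (q ^ 2 - 1) • ∑ k ∈ Finset.Iio i, q ^ (i.val - k.val) • (X k * X k.rev) := fun i h => by
    simpa using hg.rel (.rev i h)
  refine isCentral_of_wRel (ν := 0) (r := fun _ => q ^ 2) hγ (fun _ => hq.pow two_ne_zero)
    (x := fun i => (q ^ i.val)⁻¹ • X (e i).rev) (y := fun i => X (e i))
    ⟨fun i j => ?_, fun i j h => ?_, fun i j h => ?_, fun i j h => ?_, fun i => ?_⟩
    (adjoin_eq_top_of_subset hg.gen ?_) fun E _ _ x' y' h' => ?_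
  · have key : ∀ i j, i < j → X (e j) * X (e i) = q • (X (e i) * X (e j)) := fun i j h =>
      hX _ _ h (by rw [Ne, Fin.ext_iff, hrv, hev]; omega)
    rcases lt_trichotomy i j with h | rfl | h
    · rw [hlt h, key i j h, inv_smul_smul₀ hq0]
    · rw [hγ.1, one_smul]
    · rw [hgt h, key j i h]
  · rw [hlt h, hqq, smul_mul_smul_comm, smul_mul_smul_comm, hX (e j).rev (e i).rev, smul_smul,
      smul_smul, mul_comm q, mul_comm (q ^ i.val)⁻¹]
    · rw [Fin.lt_def, hrv, hrv]
      have : i.val < j.val := h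
      omega
    · rw [Fin.rev_rev, Ne, Fin.ext_iff, hrv, hev]; omega
  · rw [hgt h, smul_mul_assoc, mul_smul_comm, hX (e j) (e i).rev, smul_comm]
    · rw [Fin.lt_def, hrv, hev]; omega
    · rw [Ne, Fin.ext_iff, hrv, hrv]
      have : i.val < j.val := h
      omega
  · rw [hlt h, hqq, smul_mul_assoc, mul_smul_comm, hX (e j) (e i).rev, smul_comm]
    · rw [Fin.lt_def, hrv, hev]; omega
    · rw [Ne, Fin.ext_iff, hrv, hrv]
      have : j.val < i.val := h
      omega
  · rw [partialSum_eq, map_zero, zero_add, smul_mul_assoc, mul_smul_comm, hXr (e i), smul_add,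
      smul_comm, smul_comm (q ^ i.val)⁻¹ (q ^ 2 - 1), sum_Iio_castLE hn, Finset.smul_sum]
    · congr 2
      refine Finset.sum_congr rfl fun l hl => ?_
      have hl' : l.val < i.val := Fin.lt_def.1 (Finset.mem_Iio.1 hl)
      rw [mul_smul_comm, smul_smul]
      congr 1
      rw [hev, Fin.val_castLE, inv_mul_eq_iff_eq_mul₀ (pow_ne_zero _ hq0),
        eq_mul_inv_iff_mul_eq₀ (pow_ne_zero _ hq0), ← pow_add]
      congr 1
      omega
    · rw [Fin.lt_def, hrv, hev]; omega
  · rintro _ ⟨k, rfl⟩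
    by_cases hk : k.val < n
    · exact Algebra.subset_adjoin (Or.inr ⟨⟨k.val, hk⟩, rfl⟩)
    · have hk2 := k.2
      have e1 : k = (e ⟨k.rev.val, by rw [Fin.val_rev]; omega⟩).rev := by
        rw [Fin.ext_iff, hrv, Fin.val_rev]; omega
      rw [e1]
      have := Subalgebra.smul_mem (Algebra.adjoin K
        (Set.range (fun i => (q ^ i.val)⁻¹ • X (e i).rev) ∪ Set.range fun i => X (e i)))
        (Algebra.subset_adjoin (Or.inl ⟨⟨k.rev.val, by rw [Fin.val_rev]; omega⟩, rfl⟩))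
        (q ^ k.rev.val)
      simpa [smul_smul, hq0] using this
  · let f : Fin (2 * n) → E := fun k => if h : k.val < n then y' ⟨k.val, h⟩ else
      q ^ k.rev.val • x' ⟨k.rev.val, by rw [Fin.val_rev]; omega⟩
    have hf1 : ∀ i, f (e i) = y' i := fun i => by simp [f, hev]
    have hf2 : ∀ i, f (e i).rev = q ^ i.val • x' i := fun i => by
      have : ¬ (e i).rev.val < n := by rw [hrv]; omega
      simp only [f, dif_neg this, Fin.rev_rev, hev]
    have hcase : ∀ k, (∃ i, k = e i) ∨ ∃ i, k = (e i).rev := fun k => by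
      by_cases hk : k.val < n
      · exact Or.inl ⟨⟨k.val, hk⟩, rfl⟩
      · right
        refine ⟨⟨k.rev.val, by rw [Fin.val_rev]; omega⟩, ?_⟩
        rw [Fin.ext_iff, hrv, Fin.val_rev]
        have := k.2
        omega
    obtain ⟨φ, hφ⟩ := hg.lift E f (by
        rintro _ _ (⟨i, j, h, h2⟩ | ⟨i, h⟩)
        · simp only [map_mul, map_smul, FreeAlgebra.lift_ι_apply]
          rcases hcase i with ⟨i, rfl⟩ | ⟨i, rfl⟩ <;> rcases hcase j with ⟨j, rfl⟩ | ⟨j, rfl⟩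
          · have hij : i < j := h
            rw [hf1, hf1, h'.yy, hgt hij]
          · rw [hf1, hf2, smul_mul_assoc, mul_smul_comm, smul_comm q]
            congr 1
            have hne : i ≠ j := fun e => h2 (by rw [e])
            rcases lt_or_gt_of_ne hne with h3 | h3
            · rw [h'.xy_gt _ _ h3, hlt h3, hqq]
            · rw [h'.xy_lt _ _ h3, hgt h3]
          · rw [Fin.lt_def, hrv, hev] at h; omega
          · rw [Fin.lt_def, hrv, hrv] at h
            have hij : j < i := by rw [Fin.lt_def]; omega
            rw [hf2, hf2, smul_mul_smul_comm, smul_mul_smul_comm, h'.xx j i hij, hlt hij, hqq,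
              smul_comm q, mul_comm (q ^ i.val)]
        · rcases hcase i with ⟨i, rfl⟩ | ⟨i, rfl⟩
          · simp only [map_mul, map_smul, map_add, map_sum, FreeAlgebra.lift_ι_apply]
            rw [sum_Iio_castLE hn]
            simp only [show ∀ l, Fin.castLE hn l = e l from fun _ => rfl, hf1, hf2]
            rw [smul_mul_assoc, h'.xy, partialSum_eq, map_zero, zero_add, smul_add, mul_smul_comm,
              smul_comm (q ^ 2), smul_comm (q ^ i.val) (q ^ 2 - 1), Finset.smul_sum]
            congr 2
            refine Finset.sum_congr rfl fun l hl => ?_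
            have hl' : l.val < i.val := Fin.lt_def.1 (Finset.mem_Iio.1 hl)
            rw [mul_smul_comm, smul_smul, ← pow_add, hev, hev]
            congr 2
            omega
          · rw [Fin.rev_rev, Fin.lt_def, hrv, hev] at h; omega)
    refine ⟨φ, fun i => ?_, fun i => ?_⟩
    · rw [map_smul, hφ, hf2, inv_smul_smul₀ (pow_ne_zero _ hq0)]
    · rw [hφ, hf1]

end Symplectic

/-! ### Weyl relations of symmetric type -/

section SymmetricType

open MvPolynomial

variable {K : Type u} [Field K]

/-- The `q`-number `1 + q + ⋯ + q ^ (a - 1)`. -/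
noncomputable def qnum (q : K) (a : ℤ) : K :=
  open Classical in if q = 1 then (a : K) else (q ^ a - 1) / (q - 1)

@[simp] theorem qnum_zero (q : K) : qnum q 0 = 0 := by
  simp [qnum]

theorem qnum_add_one {q : K} (hq : q ≠ 0) (a : ℤ) : qnum q (a + 1) = q * qnum q a + 1 := by
  unfold qnum
  split_ifs with h
  · subst h; push_cast; ring
  · have := sub_ne_zero.2 h
    rw [zpow_add_one₀ hq]
    field_simp
    ring

/-- For `q = 1` this is characteristic zero; otherwise two equal `q`-numbers give equal powers of
`q`. -/
theorem qnum_injective [CharZero K] {q : K} (hq : NonRootOfUnity q ∨ q = 1) :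
    Function.Injective (qnum q) := by
  intro a b hab
  unfold qnum at hab
  split_ifs at hab with h
  · exact_mod_cast hab
  · replace hq := hq.resolve_right h
    have h1 := sub_ne_zero.2 h
    rw [div_left_inj' h1, sub_left_inj] at hab
    by_contra hne
    apply hq.zpow_ne_one (sub_ne_zero.2 hne)
    rw [zpow_sub₀ hq.1, hab, div_self (zpow_ne_zero _ hq.1)]

/-- The relations of the multiparameter Weyl algebra of symmetric type. -/
structure SymmWeylRel {E : Type*} [Ring E] [Algebra K E] {n : ℕ} (q : Fin n → K)
    (γ : Fin n → Fin n → K) (x y : Fin n → E) : Prop where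
  yy : ∀ i j, y i * y j = γ i j • (y j * y i)
  xx : ∀ i j, x i * x j = γ i j • (x j * x i)
  xy_ne : ∀ i j, i ≠ j → x i * y j = γ j i • (y j * x i)
  xy : ∀ i, x i * y i = q i • (y i * x i) + 1

variable {n : ℕ} {q : Fin n → K} {γ : Fin n → Fin n → K}

section Relations

variable {E : Type*} [Ring E] [Algebra K E] {x y : Fin n → E}

theorem SymmWeylRel.yx_mul_y (h : SymmWeylRel q γ x y) (hγ : MultAntisymm γ) {i j : Fin n}
    (hij : i ≠ j) : y i * x i * y j = y j * (y i * x i) := by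
  rw [mul_assoc, h.xy_ne i j hij, mul_smul_comm, ← mul_assoc, h.yy i j, smul_mul_assoc, smul_smul,
    hγ.2, one_smul, mul_assoc]

theorem SymmWeylRel.yx_mul_x (h : SymmWeylRel q γ x y) {i j : Fin n}
    (hij : i ≠ j) : y i * x i * x j = x j * (y i * x i) := by
  rw [mul_assoc, h.xx i j, mul_smul_comm, ← mul_assoc, ← smul_mul_assoc, ← h.xy_ne j i hij.symm,
    mul_assoc]

theorem SymmWeylRel.yx_mul_y_self (h : SymmWeylRel q γ x y) (i : Fin n) :
    y i * x i * y i = y i * (q i • (y i * x i) + 1) := by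
  rw [mul_assoc, h.xy]

theorem SymmWeylRel.yx_mul_x_self (h : SymmWeylRel q γ x y) {i : Fin n} (hq : q i ≠ 0) :
    y i * x i * x i = x i * ((q i)⁻¹ • (y i * x i - 1)) := by
  rw [mul_smul_comm, mul_sub, ← mul_assoc (x i), h.xy, add_mul, smul_mul_assoc]
  simp [smul_smul, hq]

theorem SymmWeylRel.yx_comm (h : SymmWeylRel q γ x y) (hγ : MultAntisymm γ) (i j : Fin n) :
    (y i * x i) * (y j * x j) = (y j * x j) * (y i * x i) := by
  by_cases hij : i = j
  · rw [hij]
  · rw [← mul_assoc, h.yx_mul_y hγ hij, mul_assoc, h.yx_mul_x hij, mul_assoc]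

end Relations

/-- The eigenvalues of `y_i x_i`. -/
noncomputable def symmEigen (q : Fin n → K) (i : Fin n) (a : Fin n → ℤ) : MvPolynomial (Fin n) K :=
  C (q i ^ a i) * X i + C (qnum (q i) (a i))

theorem symmEigen_ne {i j : Fin n} (h : i ≠ j) (a : Fin n → ℤ) (s : ℤ) :
    symmEigen q i (a + Pi.single j s) = C 1 * symmEigen q i a := by
  simp [symmEigen, h]

theorem symmEigen_add_one (hq : ∀ i, q i ≠ 0) (i : Fin n) (a : Fin n → ℤ) :
    symmEigen q i (a + Pi.single i 1) = C (q i) * symmEigen q i a + 1 := by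
  simp only [symmEigen, Pi.add_apply, Pi.single_eq_same, qnum_add_one (hq i),
    zpow_add_one₀ (hq i), map_mul, map_add, map_one]
  ring

theorem symmEigen_ne_zero (hq : ∀ i, q i ≠ 0) (i : Fin n) (a : Fin n → ℤ) :
    symmEigen q i a ≠ 0 := by
  intro h
  have h2 := congrArg (coeff (Finsupp.single i 1)) h
  rw [symmEigen, coeff_add, coeff_C_mul, coeff_X, if_pos rfl, coeff_C, if_neg] at h2
  · exact zpow_ne_zero _ (hq i) (by simpa using h2)
  · intro h
    simpa using DFunLike.congr_fun h i

/-- The weight of `x_i` is the eigenvalue of `y_i x_i`. It depends on the coordinate `a_i` alone and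
follows the recursion `t ↦ q_i t + 1` imposed by the relation. -/
theorem symmWeylRel_representation (hγ : MultAntisymm γ) (hq : ∀ i, q i ≠ 0) :
    SymmWeylRel q γ (fun i => lower γ i (symmEigen q i)) (raise γ) where
  yy := raise_mul_raise hγ
  xx i j := by
    by_cases hij : i = j
    · subst hij; rw [hγ.1, one_smul]
    · have := lower_mul_lower hγ one_ne_zero (symmEigen q i) (symmEigen q j)
        (fun a => symmEigen_ne hij a (-1)) (fun a => symmEigen_ne (Ne.symm hij) a (-1))
      rw [this, inv_one, mul_one, one_mul]
  xy_ne i j hij := by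
    have := lower_mul_raise hγ (i := i) (j := j) (s := 1) (symmEigen q i)
      (fun a => symmEigen_ne hij a 1)
    rw [this, one_mul]
  xy i := by
    simp only [raise_mul_lower hγ]
    rw [lower_mul_raise_self hγ, smul_wshift, ← wshift_one, wshift_add]
    refine wshift_congr rfl fun a => ?_
    rw [symmEigen_add_one hq, smul_eq_C_mul]

/-- A polynomial that is constant along the sequences `u i` in each variable is constant. -/
theorem eq_C_of_orbit {u : Fin n → ℕ → K} (hu : ∀ i, Function.Injective (u i))
    {P : MvPolynomial (Fin n) K} (hP : ∀ (p : Fin n → K) i k, p i = u i k →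
      eval (Function.update p i (u i (k + 1))) P = eval p P) :
    P = C (eval (fun i => u i 0) P) := by
  classical
  have hk : ∀ (k : Fin n → ℕ), eval (fun i => u i (k i)) P = eval (fun i => u i 0) P := by
    intro k
    -- One unit step in one coordinate at a time brings any point of the orbit back to the origin.
    -- The orbits are infinite sets, so agreement on their product determines the polynomial.
    induction hN : ∑ i, k i generalizing k with
    | zero =>
      have : ∀ i, k i = 0 := by simpa using hN
      simp only [this]
    | succ N ih =>
      obtain ⟨i, hi⟩ : ∃ i, k i ≠ 0 := by
        by_contra! h
        simp [h] at hN
      have e2 := Finset.sum_update_of_mem (Finset.mem_univ i) k (k i - 1)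
      have e3 := Finset.add_sum_erase _ k (Finset.mem_univ i)
      rw [Finset.sdiff_singleton_eq_erase] at e2
      rw [← ih (Function.update k i (k i - 1)) (by omega),
        ← hP (fun l => u l (Function.update k i (k i - 1) l)) i (k i - 1) (by simp),
        Nat.sub_add_cancel (Nat.pos_of_ne_zero hi)]
      congr 2
      ext t
      by_cases h : t = i
      · subst h; simp
      · simp [h]
  refine funext_set (fun i => Set.range (u i)) (fun i => Set.infinite_range_of_injective (hu i))
    fun p hp => ?_
  have : ∀ i, ∃ k : ℕ, u i k = p i := fun i => hp i (Set.mem_univ i)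
  choose k hk' using this
  obtain rfl : (fun i => u i (k i)) = p := funext hk'
  rw [hk, eval_C]

theorem eval_aeval_eq_eval_update {ψ : Fin n → MvPolynomial (Fin n) K} {i : Fin n}
    (hψ : ∀ t, t ≠ i → ψ t = X t) (p : Fin n → K) (P : MvPolynomial (Fin n) K) :
    eval p (aeval ψ P) = eval (Function.update p i (eval p (ψ i))) P := by
  rw [← coe_aeval_eq_eval, ← coe_aeval_eq_eval]
  change aeval p (aeval ψ P) = aeval _ P
  rw [← AlgHom.comp_apply, comp_aeval]
  congr 2
  ext t
  by_cases h : t = i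
  · subst h
    simp
  · simp [h, hψ]

/-- Invariance means that `P` does not change under `X_i ↦ q_i X_i + 1`. The orbit of `0` under this
map consists of the `q_i`-numbers, which are pairwise distinct. -/
theorem eq_C_of_qnum_invariant [CharZero K] (hq : ∀ i, NonRootOfUnity (q i) ∨ q i = 1)
    (hq0 : ∀ i, q i ≠ 0) {P : MvPolynomial (Fin n) K}
    (hP : ∀ i, aeval (fun t => symmEigen q t (Pi.single i 1)) P = P) : ∃ c, P = C c := by
  refine ⟨_, eq_C_of_orbit (u := fun i k => qnum (q i) k)
    (fun i => (qnum_injective (hq i)).comp Nat.cast_injective) fun p i k hk => ?_⟩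
  conv_rhs => rw [← hP i]
  rw [eval_aeval_eq_eval_update (i := i)]
  · have h1 := symmEigen_add_one hq0 i 0
    rw [zero_add] at h1
    rw [h1, Nat.cast_succ, qnum_add_one (hq0 i), ← hk]
    simp [symmEigen]
  · intro t ht
    have h2 := symmEigen_ne (q := q) ht 0 1
    rw [zero_add] at h2
    rw [h2]
    simp [symmEigen]

/-- An algebra presented by the relations `SymmWeylRel` has trivial center. -/
theorem isCentral_of_symmWeylRel [CharZero K] (hγ : MultAntisymm γ)
    (hq : ∀ i, NonRootOfUnity (q i) ∨ q i = 1)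
    {A : Type u} [Ring A] [Algebra K A] {x y : Fin n → A} (h : SymmWeylRel q γ x y)
    (hgen : Algebra.adjoin K (Set.range x ∪ Set.range y) = ⊤)
    (hlift : ∀ (E : Type u) [Ring E] [Algebra K E] (x' y' : Fin n → E), SymmWeylRel q γ x' y' →
      ∃ φ : A →ₐ[K] E, (∀ i, φ (x i) = x' i) ∧ ∀ i, φ (y i) = y' i) :
    Algebra.IsCentral K A := by
  have hq0 : ∀ i, q i ≠ 0 := fun i => by
    rcases hq i with h | h
    · exact h.1
    · rw [h]; exact one_ne_zero
  obtain ⟨ι, hι⟩ := exists_mvPolynomial_algHom K (fun i => y i * x i) (h.yx_comm hγ)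
  have hT : IsTwistedGWA ι y x := by
    refine ⟨fun i t => ?_, fun i t => ?_, fun i => ⟨X i, (hι i).symm⟩,
      fun i => ⟨C (q i) * X i + 1, ?_⟩, fun i j _ => ⟨_, h.yy i j⟩,
      fun i j hij => ⟨(γ i j)⁻¹, ?_⟩, fun i j hij => ⟨_, h.xy_ne i j hij⟩,
      fun i j _ => ⟨_, h.xx i j⟩, ?_⟩
    · by_cases hti : t = i
      · subst hti
        refine ⟨C (q t) * X t + 1, ?_⟩
        rw [hι, h.yx_mul_y_self, ← smul_eq_C_mul, map_add, map_smul, hι, map_one]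
      · exact ⟨X t, by rw [hι, h.yx_mul_y hγ hti]⟩
    · by_cases hti : t = i
      · subst hti
        refine ⟨C (q t)⁻¹ * (X t - 1), ?_⟩
        rw [hι, h.yx_mul_x_self (hq0 t), ← smul_eq_C_mul, map_smul, map_sub, hι, map_one]
      · exact ⟨X t, by rw [hι, h.yx_mul_x hti]⟩
    · rw [h.xy, ← smul_eq_C_mul, map_add, map_smul, hι, map_one]
    · exact (smul_eq_iff_inv (hγ.ne_zero i j)).1 (h.xy_ne j i hij.symm)
    · rw [eq_top_iff, ← hgen]
      apply Algebra.adjoin_mono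
      rintro a (ha | ha)
      · exact Or.inl (Or.inr ha)
      · exact Or.inl (Or.inl ha)
  obtain ⟨ρ, hρx, hρy⟩ := hlift _ _ _ (symmWeylRel_representation hγ hq0)
  have hη0 : ∀ t, symmEigen q t 0 = X t := fun t => by simp [symmEigen]
  have hz := (hT.center ρ (symmEigen q) hη0 (fun a ha => ?_) (fun t => ?_)
    (fun i => hρy i ▸ isShift_raise hγ i)
    (fun i => hρx i ▸ isShift_lower hγ i (symmEigen_ne_zero hq0 i))).2
  · constructor
    intro z hzc
    obtain ⟨P, rfl, hP⟩ := hz z hzc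
    obtain ⟨c, rfl⟩ := eq_C_of_qnum_invariant hq hq0 hP
    exact ⟨c, (ι.commutes c).symm⟩
  -- The constant term of the eigenvalue at `t` is the `q`-number of `a t`, which vanishes only for
  -- `a t = 0`.
  · obtain ⟨t, ht⟩ := Function.ne_iff.1 ha
    refine ⟨t, fun h => ht ?_⟩
    have h2 := congrArg (coeff 0) h
    simp only [symmEigen, coeff_add, coeff_C_mul, coeff_zero_X, coeff_zero_C, mul_zero,
      zero_add] at h2
    exact qnum_injective (hq t) (by rw [h2, Pi.zero_apply, qnum_zero])
  · rw [hι, map_mul, hρx, hρy, raise_mul_lower hγ]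

/-- The center of an algebra presented by relations equivalent to `SymmWeylRel`. -/
theorem IsPresentation.isCentral_of_symmWeylRel [CharZero K]
    {r : FreeAlgebra K (XYs n) → FreeAlgebra K (XYs n) → Prop}
    {A : Type u} [Ring A] [Algebra K A] {g : XYs n → A} (h : IsPresentation r g)
    (hγ : MultAntisymm γ) (hq : ∀ i, NonRootOfUnity (q i) ∨ q i = 1)
    (hr : ∀ (E : Type u) [Ring E] [Algebra K E] (f : XYs n → E), Satisfies r f ↔
      SymmWeylRel q γ (fun i => f (XYs.x i)) fun i => f (XYs.y i)) : Algebra.IsCentral K A :=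
  ZariskiPBW.isCentral_of_symmWeylRel hγ hq ((hr A g).1 h.rel) h.adjoin_XYs fun E _ _ x' y' h' => by
    obtain ⟨φ, hφ⟩ := h.lift E (fun | XYs.x i => x' i | XYs.y i => y' i) ((hr E _).2 h')
    exact ⟨φ, fun i => hφ _, fun i => hφ _⟩

/-- The center of an algebra presented by relations equivalent to `SymmWeylRel`, with the roles of
the two families of generators exchanged. -/
theorem IsPresentation.isCentral_of_symmWeylRel_swap [CharZero K]
    {r : FreeAlgebra K (XYs n) → FreeAlgebra K (XYs n) → Prop}
    {A : Type u} [Ring A] [Algebra K A] {g : XYs n → A} (h : IsPresentation r g)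
    (hγ : MultAntisymm γ) (hq : ∀ i, NonRootOfUnity (q i) ∨ q i = 1)
    (hr : ∀ (E : Type u) [Ring E] [Algebra K E] (f : XYs n → E), Satisfies r f ↔
      SymmWeylRel q γ (fun i => f (XYs.y i)) fun i => f (XYs.x i)) : Algebra.IsCentral K A :=
  ZariskiPBW.isCentral_of_symmWeylRel hγ hq ((hr A g).1 h.rel)
    (by rw [Set.union_comm]; exact h.adjoin_XYs) fun E _ _ x' y' h' => by
    obtain ⟨φ, hφ⟩ := h.lift E (fun | XYs.x i => y' i | XYs.y i => x' i) ((hr E _).2 h')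
    exact ⟨φ, fun i => hφ _, fun i => hφ _⟩

theorem isCentral_symmMultiparamWeyl [CharZero K] (hγ : MultAntisymm γ)
    (hq : ∀ i, NonRootOfUnity (q i)) : Algebra.IsCentral K (SymmMultiparamWeyl K q γ) := by
  obtain ⟨g, hg⟩ := exists_isPresentation (SymmMultiparamWeylRel K q γ)
  refine hg.isCentral_of_symmWeylRel hγ (fun i => Or.inl (hq i)) fun E _ _ f => ⟨fun h => ?_,
    fun h => ?_⟩
  · have full : ∀ z : Fin n → E, (∀ i j, i < j → z i * z j = γ i j • (z j * z i)) →
        ∀ i j, z i * z j = γ i j • (z j * z i) := fun z hz i j => by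
      rcases lt_trichotomy i j with hij | rfl | hij
      · exact hz i j hij
      · rw [hγ.1, one_smul]
      · rw [smul_eq_iff_inv (hγ.ne_zero i j), inv_eq_of_mul_eq_one_right (hγ.2 i j)]
        exact hz j i hij
    refine ⟨full _ fun i j hij => ?_, full _ fun i j hij => ?_, fun i j hij => ?_, fun i => ?_⟩
    · simpa using h (.yy i j hij)
    · simpa using h (.xx i j hij)
    · simpa using h (.xy_ne i j hij)
    · simpa using h (.xy i)
  · rintro _ _ (⟨i, j, hij⟩ | ⟨i, j, hij⟩ | ⟨i, j, hij⟩ | ⟨j⟩)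
    · simpa using h.yy i j
    · simpa using h.xx i j
    · simpa using h.xy_ne i j hij
    · simpa using h.xy j

/-- The `∂_i` play the role of the `x_i` and conversely; the matrix is the transpose of `q`, and all
the parameters `q_i` are `1`. -/
theorem isCentral_qSpaceDiff [CharZero K] {q : Fin n → Fin n → K} (hq : MultAntisymm q) :
    Algebra.IsCentral K (QSpaceDiff K q) := by
  obtain ⟨g, hg⟩ := exists_isPresentation (QSpaceDiffRel K q)
  have hγ : MultAntisymm fun i j => q j i := ⟨hq.1, fun i j => hq.2 j i⟩
  refine hg.isCentral_of_symmWeylRel_swap (q := fun _ => 1) hγ (fun i => Or.inr rfl)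
    fun E _ _ f => ⟨fun h => ⟨fun i j => ?_, fun i j => ?_, fun i j hij => ?_, fun i => ?_⟩,
    fun h => ?_⟩
  · simpa using h (.xx j i)
  · simpa using h (.yy j i)
  · simpa [hij] using h (.yx i j)
  · simpa [hq.1] using h (.yx i i)
  · rintro _ _ (⟨i, j⟩ | ⟨i, j⟩ | ⟨i, j⟩)
    · simpa using h.yy j i
    · simpa using h.xx j i
    · by_cases hij : i = j
      · subst hij
        simpa [hq.1] using h.xy i
      · simpa [hij] using h.xy_ne i j hij

theorem isCentral_additiveWeyl [CharZero K] {q : Fin n → K}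
    (hq : ∀ i, NonRootOfUnity (q i) ∨ q i = 1) : Algebra.IsCentral K (AdditiveWeyl K q) := by
  obtain ⟨g, hg⟩ := exists_isPresentation (OperatorRel K q (fun _ => 0) fun _ => 1)
  refine hg.isCentral_of_symmWeylRel_swap (γ := fun _ _ => 1) ⟨fun _ => rfl, fun _ _ => mul_one 1⟩
    hq fun E _ _ f => ⟨fun h => ⟨fun i j => ?_, fun i j => ?_, fun i j hij => ?_, fun i => ?_⟩,
    fun h => ?_⟩
  · simpa using h (.xx j i)
  · simpa using h (.yy j i)
  · simpa using h (.yx_ne j i hij.symm)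
  · simpa using h (.yx i)
  · rintro _ _ (⟨i, j⟩ | ⟨i, j⟩ | ⟨i, j, hij⟩ | ⟨i⟩)
    · simpa using h.yy j i
    · simpa using h.xx j i
    · simpa using h.xy_ne j i hij.symm
    · simpa using h.xy i

/-- Dividing `x` by `h` turns the relation into the symmetric type with one pair of generators. -/
theorem isCentral_qDiffAlgebra [CharZero K] {q h : K} (hq : NonRootOfUnity q ∨ q = 1) (hh : h ≠ 0) :
    Algebra.IsCentral K (QDiffAlgebra K q h) := by
  obtain ⟨g, hg⟩ := exists_isPresentation (QDiffRel K q h)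
  have key : ∀ (E : Type u) [Ring E] [Algebra K E] (f : XY → E), Satisfies (QDiffRel K q h) f ↔
      SymmWeylRel (n := 1) (fun _ => q) (fun _ _ => 1) (fun _ => h⁻¹ • f XY.x)
        (fun _ => f XY.y) := by
    intro E _ _ f
    have e : f XY.x * f XY.y = q • (f XY.y * f XY.x) + algebraMap K E h ↔
        (h⁻¹ • f XY.x) * f XY.y = q • (f XY.y * (h⁻¹ • f XY.x)) + 1 := by
      rw [smul_mul_assoc, mul_smul_comm, smul_comm q, Algebra.algebraMap_eq_smul_one,
        ← (smul_right_injective E (inv_ne_zero hh)).eq_iff, smul_add, inv_smul_smul₀ hh]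
    constructor
    · intro hf
      refine ⟨fun _ _ => by simp, fun _ _ => by simp, fun i j hij =>
        absurd (Subsingleton.elim i j) hij, fun i => e.1 ?_⟩
      simpa using hf .xy
    · rintro hf _ _ ⟨⟩
      simpa using e.2 (hf.xy 0)
  refine isCentral_of_symmWeylRel ⟨fun _ => rfl, fun _ _ => mul_one 1⟩ (fun _ => hq)
    ((key _ g).1 hg.rel) (adjoin_eq_top_of_subset hg.gen ?_) fun E _ _ x' y' h' => ?_
  · rintro _ ⟨_ | _, rfl⟩
    · refine (Submodule.smul_mem_iff (Subalgebra.toSubmodule (Algebra.adjoin K _))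
        (inv_ne_zero hh)).1 (Algebra.subset_adjoin ?_)
      exact Or.inl ⟨0, rfl⟩
    · exact Algebra.subset_adjoin (Or.inr ⟨0, rfl⟩)
  · have e1 : ∀ i : Fin 1, i = 0 := fun i => Subsingleton.elim i 0
    obtain ⟨φ, hφ⟩ := hg.lift E (fun | XY.x => h • x' 0 | XY.y => y' 0) ((key E _).2 (by
      convert h' using 1
      · ext i
        rw [e1 i]
        exact inv_smul_smul₀ hh _
      · ext i
        rw [e1 i]))
    exact ⟨φ, fun i => by rw [e1 i, map_smul, hφ]; exact inv_smul_smul₀ hh _,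
      fun i => by rw [e1 i, hφ]⟩

end SymmetricType

/-! ### Quantum spaces -/

section QuantumSpaces

variable {K : Type u} [Field K]

/-- The ordered monomial `∏ y_i ^ a_i`. -/
def orderedMonomial {A : Type*} [Monoid A] {n : ℕ} (y : Fin n → A) (a : Fin n → ℕ) : A :=
  (List.ofFn fun i => y i ^ a i).prod

theorem orderedMonomial_succ {A : Type*} [Monoid A] {n : ℕ} (y : Fin (n + 1) → A)
    (a : Fin (n + 1) → ℕ) : orderedMonomial y a =
      y 0 ^ a 0 * orderedMonomial (fun i => y i.succ) fun i => a i.succ := by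
  simp [orderedMonomial, List.ofFn_succ]

theorem orderedMonomial_zero {A : Type*} [Monoid A] {n : ℕ} (y : Fin n → A) :
    orderedMonomial y 0 = 1 := by
  refine List.prod_eq_one fun a ha => ?_
  obtain ⟨i, rfl⟩ := (List.mem_ofFn' _ _).1 ha
  simp

theorem mul_orderedMonomial {A : Type*} [Ring A] [Algebra K A] (b : A) :
    ∀ {n : ℕ} {y : Fin n → A} {c : Fin n → K} (_ : ∀ j, b * y j = c j • (y j * b))
      (a : Fin n → ℕ), b * orderedMonomial y a = (∏ j, c j ^ a j) • (orderedMonomial y a * b) := by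
  intro n
  induction n with
  | zero => intro y c _ a; simp [orderedMonomial]
  | succ n ih =>
    intro y c h a
    rw [orderedMonomial_succ, ← mul_assoc, mul_pow_of_qcomm (h 0), Fin.prod_univ_succ,
      smul_mul_assoc, mul_assoc, ih fun j => h j.succ, mul_smul_comm, smul_smul, mul_assoc]

theorem generator_mul_orderedMonomial {A : Type*} [Ring A] [Algebra K A] :
    ∀ {n : ℕ} {y : Fin n → A} (_ : ∀ i j, ∃ c : K, y i * y j = c • (y j * y i)) (a : Fin n → ℕ)
      (i : Fin n), ∃ c : K, y i * orderedMonomial y a =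
        c • orderedMonomial y (a + Pi.single i 1) := by
  intro n
  induction n with
  | zero => intro y _ a i; exact i.elim0
  | succ n ih =>
    intro y h a i
    simp only [orderedMonomial_succ]
    refine Fin.cases ?_ (fun j => ?_) i
    · refine ⟨1, ?_⟩
      rw [← mul_assoc, ← pow_succ']
      simp
    · obtain ⟨c, hc⟩ := h j.succ 0
      obtain ⟨d, hd⟩ := ih (fun i j => h i.succ j.succ) (fun i => a i.succ) j
      refine ⟨c ^ a 0 * d, ?_⟩
      have h1 : (fun i : Fin n => (a + Pi.single j.succ 1 : Fin (n + 1) → ℕ) i.succ)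
          = (fun i => a i.succ) + Pi.single j 1 := by
        ext l
        by_cases h : l = j
        · subst h; simp
        · simp [h]
      rw [h1, ← mul_assoc, mul_pow_of_qcomm hc, smul_mul_assoc, mul_assoc, hd, mul_smul_comm,
        smul_smul]
      simp

/-- A quantum space in which no monomial but `1` commutes with all the generators has trivial
center. -/
theorem isCentral_of_qcomm_fin {n : ℕ} {γ : Fin n → Fin n → K} (hγ : MultAntisymm γ) {A : Type u}
    [Ring A] [Algebra K A] {y : Fin n → A} (hy : ∀ i j, y i * y j = γ i j • (y j * y i))
    (hgen : Algebra.adjoin K (Set.range y) = ⊤)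
    (hlift : ∀ (E : Type u) [Ring E] [Algebra K E] (y' : Fin n → E),
      (∀ i j, y' i * y' j = γ i j • (y' j * y' i)) → ∃ φ : A →ₐ[K] E, ∀ i, φ (y i) = y' i)
    (hsep : ∀ a : Fin n → ℕ, a ≠ 0 → ∃ i, ∏ j, γ i j ^ a j ≠ 1) : Algebra.IsCentral K A := by
  have hspan : Submodule.span K (Set.range (orderedMonomial y)) = ⊤ := by
    refine submodule_eq_top_of_mul_mem hgen _ (Submodule.subset_span ⟨0, orderedMonomial_zero y⟩) ?_
    · rintro _ ⟨i, rfl⟩ t ht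
      induction ht using Submodule.span_induction with
      | mem t ht =>
        obtain ⟨a, rfl⟩ := ht
        obtain ⟨c, hc⟩ := generator_mul_orderedMonomial (fun i j => ⟨_, hy i j⟩) a i
        rw [hc]
        exact Submodule.smul_mem _ _ (Submodule.subset_span ⟨_, rfl⟩)
      | zero => simp
      | add s t _ _ hs ht => rw [mul_add]; exact add_mem hs ht
      | smul c t _ ht => rw [mul_smul_comm]; exact Submodule.smul_mem _ _ ht
  obtain ⟨ρ, hρ⟩ := hlift _ (raise γ) (raise_mul_raise hγ)
  have hmon : ∀ a, IsShift (ρ (orderedMonomial y a)) (fun i => (a i : ℤ)) := by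
    intro a
    have h := IsShift.list_prod (List.finRange n) fun i => (isShift_raise hγ i).pow (a i)
    have e1 : ((List.finRange n).map fun i => a i • (Pi.single i 1 : Fin n → ℤ)).sum =
        fun i => (a i : ℤ) := by
      rw [← List.ofFn_eq_map, List.sum_ofFn]
      ext j
      simp [Finset.sum_apply, Pi.single_apply]
    rw [e1] at h
    rw [orderedMonomial, map_list_prod, List.map_ofFn, List.ofFn_eq_map]
    rwa [show (⇑ρ ∘ fun i => y i ^ a i) = fun i => raise γ i ^ a i from funext fun i => by
      rw [Function.comp_apply, map_pow, hρ]]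
  constructor
  intro z hz
  rw [Subalgebra.mem_center_iff] at hz
  have hz' : z ∈ Submodule.span K (Set.range (orderedMonomial y)) := hspan ▸ Submodule.mem_top
  obtain ⟨f, rfl⟩ := Finsupp.mem_span_range_iff_exists_finsupp.1 hz'
  -- The commutator of `y i` with the monomial of exponent `a` is that monomial times `y i`, up to
  -- the factor `∏ γ_ij ^ a_j - 1`. In the representation by raising operators these products send
  -- `e_0` to nonzero multiples of distinct basis vectors, so the terms of a vanishing sum vanish
  -- separately.
  have key : ∀ a, a ≠ 0 → f a = 0 := by
    intro a ha
    obtain ⟨i, hi⟩ := hsep a ha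
    have e := hz (y i)
    simp only [Finsupp.sum, Finset.mul_sum, Finset.sum_mul, mul_smul_comm, smul_mul_assoc,
      mul_orderedMonomial (y i) (hy i)] at e
    rw [← sub_eq_zero, ← Finset.sum_sub_distrib] at e
    have hsh : ∀ b, ∃ c : MvPolynomial (Fin n) K, c ≠ 0 ∧
        ρ (orderedMonomial y b * y i) (Finsupp.single 0 1) =
          Finsupp.single ((fun i => (b i : ℤ)) + Pi.single i 1) c := fun b => by
      obtain ⟨c, hc, e⟩ := ((hmon b).mul (isShift_raise hγ i)) 0
      refine ⟨c, hc, ?_⟩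
      rw [map_mul, hρ, e, zero_add, mul_one]
    choose c hc0 hc using hsh
    have e2 := congrArg (fun t => ρ t (Finsupp.single 0 1)
      ((fun i => (a i : ℤ)) + Pi.single i 1)) e
    simp only [map_sum, map_sub, map_smul, LinearMap.sum_apply, LinearMap.sub_apply,
      LinearMap.smul_apply, hc, map_zero, LinearMap.zero_apply, Finsupp.coe_zero,
      Pi.zero_apply] at e2
    rw [Finsupp.finsetSum_apply, Finset.sum_eq_single a] at e2
    · rw [smul_smul, ← sub_smul, Finsupp.smul_apply, Finsupp.single_eq_same, smul_eq_zero] at e2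
      have e3 := e2.resolve_right (hc0 a)
      have e4 : f a * (∏ j, γ i j ^ a j - 1) = 0 := by linear_combination e3
      exact (mul_eq_zero.1 e4).resolve_right (sub_ne_zero.2 hi)
    · intro b _ hb
      rw [smul_smul, ← sub_smul, Finsupp.smul_apply, Finsupp.single_eq_of_ne, smul_zero]
      intro h
      apply hb
      have := add_right_cancel h
      funext j
      exact_mod_cast (congrFun this j).symm
    · intro ha
      simp [Finsupp.notMem_support_iff.1 ha]
  have hf : f = Finsupp.single 0 (f 0) := by
    ext a
    by_cases ha : a = 0
    · subst ha; simp
    · rw [key a ha, Finsupp.single_eq_of_ne ha]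
  rw [hf]
  refine ⟨f 0, ?_⟩
  rw [Finsupp.sum_single_index (by simp), orderedMonomial_zero]
  exact Algebra.algebraMap_eq_smul_one _

theorem isCentral_of_qcomm {τ : Type} [Fintype τ] {γ : τ → τ → K} (hγ1 : ∀ i, γ i i = 1)
    (hγ : ∀ i j, γ i j * γ j i = 1) {A : Type u}
    [Ring A] [Algebra K A] {y : τ → A} (hy : ∀ i j, y i * y j = γ i j • (y j * y i))
    (hgen : Algebra.adjoin K (Set.range y) = ⊤)
    (hlift : ∀ (E : Type u) [Ring E] [Algebra K E] (y' : τ → E),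
      (∀ i j, y' i * y' j = γ i j • (y' j * y' i)) → ∃ φ : A →ₐ[K] E, ∀ i, φ (y i) = y' i)
    (hsep : ∀ a : τ → ℕ, a ≠ 0 → ∃ i, ∏ j, γ i j ^ a j ≠ 1) : Algebra.IsCentral K A := by
  let e := Fintype.equivFin τ
  refine isCentral_of_qcomm_fin (γ := fun i j => γ (e.symm i) (e.symm j))
    ⟨fun i => hγ1 _, fun i j => hγ _ _⟩ (y := fun i => y (e.symm i)) (fun i j => hy _ _) ?_
    (fun E _ _ y' h' => ?_) fun a ha => ?_
  · rw [← hgen]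
    congr 1
    exact e.symm.surjective.range_comp y
  · obtain ⟨φ, hφ⟩ := hlift E (fun t => y' (e t)) (fun i j => by simpa using h' (e i) (e j))
    exact ⟨φ, fun i => by simp [hφ]⟩
  · obtain ⟨i, hi⟩ := hsep (fun t => a (e t)) (fun h => ha (by
      ext i
      simpa using congrFun h (e.symm i)))
    refine ⟨e i, fun h => hi ?_⟩
    rw [← h, ← e.prod_comp]
    simp

theorem prod_pow_of_pair {τ : Type} [Fintype τ] [DecidableEq τ] (γ : τ → K) (a : τ → ℕ) {j : τ} {q : K}
    (h : γ j = q) (h' : ∀ i, i ≠ j → γ i = 1) : ∏ i, γ i ^ a i = q ^ a j := by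
  rw [Finset.prod_eq_single j]
  · rw [h]
  · intro i _ hi
    rw [h' i hi, one_pow]
  · simp

/-- Two generators `x`, `y` with `y x = q x y`. -/
theorem isCentral_of_qcomm_pair {q : K} (hq : NonRootOfUnity q) {A : Type u}
    [Ring A] [Algebra K A] {x y : A} (hxy : y * x = q • (x * y))
    (hgen : Algebra.adjoin K {x, y} = ⊤)
    (hlift : ∀ (E : Type u) [Ring E] [Algebra K E] (x' y' : E), y' * x' = q • (x' * y') →
      ∃ φ : A →ₐ[K] E, φ x = x' ∧ φ y = y') : Algebra.IsCentral K A := by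
  have hq0 := hq.1
  refine isCentral_of_qcomm (γ := ![![1, q⁻¹], ![q, 1]]) (y := ![x, y]) ?_ ?_ ?_ ?_
    (fun E _ _ y' h' => ?_) fun a ha => ?_
  · simp [Fin.forall_fin_two]
  · simp [Fin.forall_fin_two, hq0]
  · simp [Fin.forall_fin_two, hxy, smul_smul, hq0]
  · rw [← hgen, Matrix.range_cons, Matrix.range_cons, Matrix.range_empty, Set.union_empty]
    rfl
  · obtain ⟨φ, hx, hy⟩ := hlift E (y' 0) (y' 1) (by simpa using h' 1 0)
    exact ⟨φ, by simp [Fin.forall_fin_two, hx, hy]⟩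
  · have : a 0 ≠ 0 ∨ a 1 ≠ 0 := by
      by_contra! h
      exact ha (by ext i; fin_cases i <;> simp [h])
    rcases this with h | h
    · exact ⟨1, by simpa using hq.pow_ne_one h⟩
    · exact ⟨0, by simpa using hq.pow_ne_one h⟩

theorem isCentral_quantumPlane {q : K} (hq : NonRootOfUnity q) :
    Algebra.IsCentral K (QuantumPlane K q) := by
  obtain ⟨g, hg⟩ := exists_isPresentation (QuantumPlaneRel K q)
  refine isCentral_of_qcomm_pair hq (x := g XY.x) (y := g XY.y) (by simpa using hg.rel .yx)
    (adjoin_eq_top_of_subset hg.gen ?_) fun E _ _ x' y' h' => ?_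
  · rintro _ ⟨_ | _, rfl⟩ <;> exact Algebra.subset_adjoin (by simp)
  · obtain ⟨φ, hφ⟩ := hg.lift E (fun | XY.x => x' | XY.y => y') (by
      rintro _ _ ⟨⟩
      simpa using h')
    exact ⟨φ, hφ _, hφ _⟩

theorem isCentral_qDiffAlgebra_zero {q : K} (hq : NonRootOfUnity q) :
    Algebra.IsCentral K (QDiffAlgebra K q 0) := by
  obtain ⟨g, hg⟩ := exists_isPresentation (QDiffRel K q 0)
  refine isCentral_of_qcomm_pair hq (x := g XY.y) (y := g XY.x) (by simpa using hg.rel .xy)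
    (adjoin_eq_top_of_subset hg.gen ?_) fun E _ _ x' y' h' => ?_
  · rintro _ ⟨_ | _, rfl⟩ <;> exact Algebra.subset_adjoin (by simp)
  · obtain ⟨φ, hφ⟩ := hg.lift E (fun | XY.x => y' | XY.y => x') (by
      rintro _ _ ⟨⟩
      simpa using h')
    exact ⟨φ, hφ _, hφ _⟩

/-- A quantum space in the `2n` generators `t_i`, `H_i`, in which only partners fail to commute:
`H_i` detects the exponent of `t_i`, and `t_i` that of `H_i`. -/
theorem isCentral_partialQDilation {n : ℕ} {q : K} (hq : NonRootOfUnity q) :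
    Algebra.IsCentral K (PartialQDilation K n q) := by
  have hq0 := hq.1
  obtain ⟨g, hg⟩ := exists_isPresentation
    (OperatorRel K (n := n) (fun _ => q) (fun _ => 0) fun _ => 0)
  let γ : Fin n ⊕ Fin n → Fin n ⊕ Fin n → K
    | Sum.inl i, Sum.inr j => if i = j then q⁻¹ else 1
    | Sum.inr i, Sum.inl j => if i = j then q else 1
    | Sum.inl _, Sum.inl _ => 1
    | Sum.inr _, Sum.inr _ => 1
  have key : ∀ (E : Type u) [Ring E] [Algebra K E] (f : XYs n → E),
      Satisfies (OperatorRel K (n := n) (fun _ => q) (fun _ => 0) fun _ => 0) f ↔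
      ∀ i j : Fin n ⊕ Fin n, Sum.elim (fun i => f (XYs.x i)) (fun i => f (XYs.y i)) i *
        Sum.elim (fun i => f (XYs.x i)) (fun i => f (XYs.y i)) j = γ i j •
        (Sum.elim (fun i => f (XYs.x i)) (fun i => f (XYs.y i)) j *
          Sum.elim (fun i => f (XYs.x i)) (fun i => f (XYs.y i)) i) := by
    intro E _ _ f
    constructor
    · intro h
      have hyx : ∀ i j, f (XYs.y i) * f (XYs.x j) = (if i = j then q else 1) •
          (f (XYs.x j) * f (XYs.y i)) := fun i j => by
        split_ifs with hij
        · subst hij; simpa using h (.yx i)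
        · simpa using h (.yx_ne j i (Ne.symm hij))
      rintro (i | i) (j | j)
      · simpa [γ] using h (.xx j i)
      · have hc : (if j = i then q else 1) ≠ 0 := by split_ifs <;> simp [hq0]
        have := (smul_eq_iff_inv hc).1 (hyx j i)
        simp only [γ, Sum.elim_inl, Sum.elim_inr, this]
        congr 1
        by_cases hij : i = j <;> simp [hij, eq_comm]
      · exact hyx i j
      · simpa [γ] using h (.yy j i)
    · rintro h _ _ (⟨i, j⟩ | ⟨i, j⟩ | ⟨i, j, hij⟩ | ⟨i⟩)
      · simpa [γ] using h (Sum.inl j) (Sum.inl i)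
      · simpa [γ] using h (Sum.inr j) (Sum.inr i)
      · simpa [γ, hij.symm] using h (Sum.inr j) (Sum.inl i)
      · simpa [γ] using h (Sum.inr i) (Sum.inl i)
  refine isCentral_of_qcomm (γ := γ) ?_ ?_ ((key _ g).1 hg.rel) ?_ (fun E _ _ y' h' => ?_)
    fun a ha => ?_
  · rintro (i | i) <;> rfl
  · rintro (i | i) (j | j)
    · simp [γ]
    · by_cases hij : i = j <;> simp [γ, hij, hq0, eq_comm]
    · by_cases hij : i = j <;> simp [γ, hij, hq0, eq_comm]
    · simp [γ]
  · rw [Set.Sum.elim_range]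
    exact hg.adjoin_XYs
  · obtain ⟨φ, hφ⟩ := hg.lift E (fun | XYs.x i => y' (Sum.inl i) | XYs.y i => y' (Sum.inr i))
      ((key E _).2 (by rintro (i | i) (j | j) <;> exact h' _ _))
    exact ⟨φ, by rintro (i | i) <;> exact hφ _⟩
  · obtain ⟨i | i, hi⟩ := Function.ne_iff.1 ha
    · refine ⟨Sum.inr i, ?_⟩
      rw [prod_pow_of_pair (γ (Sum.inr i)) a (j := Sum.inl i) (q := q)]
      · exact hq.pow_ne_one hi
      · simp [γ]
      · rintro (j | j) hj
        · have : i ≠ j := fun h => hj (h ▸ rfl)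
          simp [γ, this]
        · rfl
    · refine ⟨Sum.inl i, ?_⟩
      rw [prod_pow_of_pair (γ (Sum.inl i)) a (j := Sum.inr i) (q := q⁻¹)]
      · rw [inv_pow, Ne, inv_eq_one]
        exact hq.pow_ne_one hi
      · simp [γ]
      · rintro (j | j) hj
        · rfl
        · have : i ≠ j := fun h => hj (h ▸ rfl)
          simp [γ, this]

theorem isCentral_quantumSpace {n : ℕ} {q : Fin n → Fin n → K} (hn : 2 ≤ n)
    (hq : MultIndependent q) : Algebra.IsCentral K (QuantumSpace K q) := by
  obtain ⟨g, hg⟩ := exists_isPresentation (QuantumSpaceRel K q)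
  let γ : Fin n → Fin n → K := fun i j =>
    if j < i then q j i else if i < j then (q i j)⁻¹ else 1
  have hlt : ∀ {i j}, i < j → γ i j = (q i j)⁻¹ := fun {i j} h => by simp [γ, h, h.not_gt]
  have hgt : ∀ {i j}, j < i → γ i j = q j i := fun {i j} h => by simp [γ, h]
  have hγ : MultAntisymm γ := by
    refine ⟨fun i => by simp [γ], fun i j => ?_⟩
    rcases lt_trichotomy i j with h | rfl | h
    · rw [hlt h, hgt h, inv_mul_cancel₀ (hq.1 i j h)]
    · simp [γ]
    · rw [hlt h, hgt h, mul_inv_cancel₀ (hq.1 j i h)]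
  refine isCentral_of_qcomm_fin hγ (y := g) (fun i j => ?_) hg.gen (fun E _ _ y' h' => ?_)
    fun a ha => ?_
  · have key : ∀ i j, i < j → g j * g i = q i j • (g i * g j) := fun i j h => by
      simpa using hg.rel (.xx i j h)
    rcases lt_trichotomy i j with h | rfl | h
    · rw [hlt h, key i j h, inv_smul_smul₀ (hq.1 i j h)]
    · rw [hγ.1, one_smul]
    · rw [hgt h, key j i h]
  · refine hg.lift E y' ?_
    rintro _ _ ⟨i, j, h⟩
    have := h' j i
    rw [hgt h] at this
    simpa using this
  · obtain ⟨t, ht⟩ := Function.ne_iff.1 ha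
    -- The exponent of `x_t` is invisible to `x_t` itself, so a second generator is needed; this is
    -- where `2 ≤ n` enters.
    obtain ⟨i, hi⟩ : ∃ i : Fin n, i ≠ t := by
      have : Nontrivial (Fin n) := Fin.nontrivial_iff_two_le.2 hn
      exact exists_ne t
    refine ⟨i, fun h => ht ?_⟩
    -- If the monomial commutes with `x_i`, then the product of the `q_ji ^ a_j` for `j < i` and of
    -- the `q_ij ^ (-a_j)` for `j > i` is `1`. The matrix `e` records these exponents: `a` in column
    -- `i` and `-a` in row `i`.
    let e : Fin n → Fin n → ℤ := fun k l =>
      (if l = i then (a k : ℤ) else 0) + if k = i then -(a l : ℤ) else 0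
    have h1 : ∀ k, ∏ l ∈ Finset.Ioi k, q k l ^ e k l =
        (if k < i then q k i ^ (a k : ℤ) else 1) *
          if k = i then ∏ l ∈ Finset.Ioi i, q i l ^ (-(a l : ℤ)) else 1 := by
      intro k
      have : ∀ l ∈ Finset.Ioi k, q k l ^ e k l = (if l = i then q k l ^ (a k : ℤ) else 1) *
          if k = i then q k l ^ (-(a l : ℤ)) else 1 := fun l hl => by
        rw [zpow_add₀ (hq.1 k l (Finset.mem_Ioi.1 hl))]
        congr 1 <;> split_ifs <;> simp
      rw [Finset.prod_congr rfl this, Finset.prod_mul_distrib, Finset.prod_ite_eq']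
      simp only [Finset.mem_Ioi]
      congr 1
      by_cases hk : k = i
      · simp [hk]
      · simp [hk]
    have h2 : ∏ k, ∏ l ∈ Finset.Ioi k, q k l ^ e k l = 1 := by
      have h4 : ∀ j, γ i j ^ a j = (if j < i then q j i ^ (a j : ℤ) else 1) *
          if i < j then q i j ^ (-(a j : ℤ)) else 1 := fun j => by
        rcases lt_trichotomy i j with hij | rfl | hij
        · simp [hlt hij, hij, hij.not_gt]
        · simp [γ]
        · simp [hgt hij, hij, hij.not_gt]
      simp only [h4, Finset.prod_mul_distrib] at h
      rw [← Finset.prod_filter (fun j => i < j), Finset.filter_lt_eq_Ioi] at h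
      simp only [h1, Finset.prod_mul_distrib, Finset.prod_ite_eq', Finset.mem_univ, if_true]
      exact h
    have h3 := hq.2 e h2
    rcases lt_or_gt_of_ne hi with hit | hit
    · simpa [e, hit.ne'] using h3 i t hit
    · simpa [e, hit.ne] using h3 t i hit

end QuantumSpaces

/-! ### Iterated Ore extensions -/

section Ore

variable {K : Type u} [Field K]

/-- The relations of an iterated Ore extension. -/
structure OreEqs {R : Type u} [CommRing R] [Algebra K R] {V : Type} (σ δ : V → R → R)
    {E : Type*} [Ring E] [Algebra K E] (ι : R →ₐ[K] E) (x : V → E) : Prop where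
  coeff : ∀ i r, x i * ι r = ι (σ i r) * x i + ι (δ i r)
  var : ∀ i j, x j * x i = x i * x j

variable {R : Type u} [CommRing R] [Algebra K R] {V : Type} {σ δ : V → R → R}

/-- `A` is the iterated Ore extension with coefficients `ι : R → A` and variables `x`. -/
structure IsOreExtension (σ δ : V → R → R) {A : Type u} [Ring A] [Algebra K A] (ι : R →ₐ[K] A)
    (x : V → A) : Prop where
  eqs : OreEqs σ δ ι x
  gen : Algebra.adjoin K (Set.range ι ∪ Set.range x) = ⊤
  lift : ∀ (E : Type u) [Ring E] [Algebra K E] (ι' : R →ₐ[K] E) (x' : V → E), OreEqs σ δ ι' x' →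
      ∃ φ : A →ₐ[K] E, (∀ r, φ (ι r) = ι' r) ∧ ∀ i, φ (x i) = x' i

/-- The first three kinds of relations say that the coefficients are mapped in by a homomorphism of
algebras, so the symbols attached to `R` can be replaced by that homomorphism. -/
theorem IsPresentation.exists_isOreExtension {A : Type u} [Ring A] [Algebra K A] {g : R ⊕ V → A}
    (hg : IsPresentation (OreRel K σ δ) g) : ∃ (ι : R →ₐ[K] A) (x : V → A),
      IsOreExtension σ δ ι x := by
  have hscalar : ∀ k, g (Sum.inl (algebraMap K R k)) = algebraMap K _ k := fun k => by
    simpa using hg.rel (.scalar k)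
  have hadd : ∀ r s, g (Sum.inl (r + s)) = g (Sum.inl r) + g (Sum.inl s) := fun r s => by
    simpa using hg.rel (.add r s)
  have hmul : ∀ r s, g (Sum.inl (r * s)) = g (Sum.inl r) * g (Sum.inl s) := fun r s => by
    simpa using hg.rel (.mul r s)
  let ι : R →ₐ[K] A :=
    { toFun := fun r => g (Sum.inl r)
      map_one' := by simpa using hscalar 1
      map_mul' := hmul
      map_zero' := by simpa using hscalar 0
      map_add' := hadd
      commutes' := hscalar }
  refine ⟨ι, fun i => g (Sum.inr i), ⟨fun i r => ?_, fun i j => ?_⟩,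
    adjoin_eq_top_of_subset hg.gen ?_, fun E _ _ ι' x' h' => ?_⟩
  · change g (Sum.inr i) * g (Sum.inl r) = g (Sum.inl _) * g (Sum.inr i) + g (Sum.inl _)
    simpa using hg.rel (.coeff i r)
  · simpa using hg.rel (.var i j)
  · rintro _ ⟨r | i, rfl⟩
    · exact Algebra.subset_adjoin (Or.inl ⟨r, rfl⟩)
    · exact Algebra.subset_adjoin (Or.inr ⟨i, rfl⟩)
  · obtain ⟨φ, hφ⟩ := hg.lift E (Sum.elim ι' x') (by
      rintro _ _ (k | ⟨r, s⟩ | ⟨r, s⟩ | ⟨i, r⟩ | ⟨i, j⟩)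
      · simp
      · simp
      · simp
      · simpa using h'.coeff i r
      · simpa using h'.var i j)
    exact ⟨φ, fun r => hφ _, fun i => hφ _⟩

theorem isCentral_oreAlgebra (σ δ : V → R → R) (h : ∀ (A : Type u) [Ring A] [Algebra K A]
    (ι : R →ₐ[K] A) (x : V → A), IsOreExtension σ δ ι x → Algebra.IsCentral K A) :
    Algebra.IsCentral K (OreAlgebra K σ δ) := by
  obtain ⟨g, hg⟩ := exists_isPresentation (OreRel K σ δ)
  obtain ⟨ι, x, hx⟩ := hg.exists_isOreExtension
  exact h _ ι x hx

end Ore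

/-! ### Algebras of shift and difference operators -/

section ShiftAlgebras

open MvPolynomial

variable {K : Type u} [Field K] {n : ℕ}

/-- Relations of a family of shift operators. -/
structure ShiftEqs {E : Type*} [Ring E] [Algebra K E] (c : Fin n → K) (t s : Fin n → E) :
    Prop where
  tt : ∀ i j, t i * t j = t j * t i
  ss : ∀ i j, s i * s j = s j * s i
  st_ne : ∀ i j, i ≠ j → s i * t j = t j * s i
  st : ∀ i, s i * t i = t i * s i + c i • s i

/-- Each `s_i` is a pure shift, and the eigenvalue of `t_i` decreases by `c_i` at every step in
direction `i`. -/
theorem ShiftEqs.representation (c : Fin n → K) :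
    ShiftEqs c (fun i => wshift 0 fun a => X i - C (c i * a i))
      (fun i => (wshift (Pi.single i 1) fun _ => 1 : Module.End (MvPolynomial (Fin n) K)
        ((Fin n → ℤ) →₀ MvPolynomial (Fin n) K))) where
  tt i j := by
    rw [wshift_mul, wshift_mul]
    exact wshift_congr rfl fun a => by simp; ring
  ss i j := by
    rw [wshift_mul, wshift_mul]
    exact wshift_congr (add_comm _ _) fun a => rfl
  st_ne i j h := by
    rw [wshift_mul, wshift_mul]
    exact wshift_congr (by simp) fun a => by simp [h.symm]
  st i := by
    rw [wshift_mul, wshift_mul, add_zero, zero_add, smul_wshift, wshift_add]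
    refine wshift_congr rfl fun a => ?_
    simp only [Pi.add_apply, Pi.single_eq_same, Int.cast_add, Int.cast_one, mul_add, mul_one,
      map_add, smul_eq_C_mul]
    ring

/-- An algebra presented by the relations `ShiftEqs` has trivial center. -/
theorem isCentral_of_shiftEqs [CharZero K] {c : Fin n → K} (hc : ∀ i, c i ≠ 0)
    {A : Type u} [Ring A] [Algebra K A] {t s : Fin n → A} (h : ShiftEqs c t s)
    (hgen : Algebra.adjoin K (Set.range t ∪ Set.range s) = ⊤)
    (hlift : ∀ (E : Type u) [Ring E] [Algebra K E] (t' s' : Fin n → E), ShiftEqs c t' s' →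
      ∃ φ : A →ₐ[K] E, (∀ i, φ (t i) = t' i) ∧ ∀ i, φ (s i) = s' i) :
    Algebra.IsCentral K A := by
  obtain ⟨ι, hι⟩ := exists_mvPolynomial_algHom K t h.tt
  have hnorm : ∀ i, Normalizes ι.range (s i) := fun i => .of_generators fun j => by
    by_cases hij : i = j
    · subst hij
      refine ⟨X i - C (c i), ?_⟩
      have : ι (C (c i)) = algebraMap K A (c i) := ι.commutes _
      rw [map_sub, hι, this, mul_sub, h.st, ← Algebra.commutes, ← Algebra.smul_def, add_sub_cancel_right]
    · exact ⟨X j, by rw [hι, h.st_ne i j hij]⟩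
  have hnormm : ∀ b, Normalizes ι.range (orderedMonomial s b) := by
    intro b
    rw [orderedMonomial, List.ofFn_eq_map]
    induction List.finRange n with
    | nil => simpa using Normalizes.one _
    | cons i l ih =>
      rw [List.map_cons, List.prod_cons]
      exact ((hnorm i).pow _).mul ih
  -- There are no lowering generators here, so only monomials with nonnegative exponents are needed;
  -- their degrees still embed in the lattice on which the representation lives.
  have hspan : LinearMap.range (polySum ι (orderedMonomial s)) = ⊤ := by
    refine submodule_eq_top_of_mul_mem hgen _ ⟨Finsupp.single 0 1, by simp [orderedMonomial_zero]⟩ ?_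
    have key : ∀ b P, orderedMonomial s b * ι P ∈ LinearMap.range (polySum ι (orderedMonomial s)) :=
      fun b P => ⟨Finsupp.single b P, by simp⟩
    rintro g hg _ ⟨f, rfl⟩
    induction f using Finsupp.induction_linear with
    | zero => simp
    | add f f' hf hf' => rw [map_add, mul_add]; exact add_mem hf hf'
    | single b P =>
      rw [polySum_single, ← mul_assoc]
      rcases hg with ⟨i, rfl⟩ | ⟨i, rfl⟩
      · obtain ⟨_, ⟨Q, rfl⟩, e⟩ := hnormm b (ι (X i)) ⟨_, rfl⟩
        rw [← hι, e, mul_assoc]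
        change _ * (ι Q * ι P) ∈ _
        rw [← map_mul]
        exact key _ _
      · obtain ⟨d, hd⟩ := generator_mul_orderedMonomial (K := K) (y := s)
          (fun i j => ⟨1, by rw [one_smul]; exact h.ss i j⟩) b i
        rw [hd, smul_mul_assoc]
        exact Submodule.smul_mem _ _ (key _ _)
  obtain ⟨ρ, hρt, hρs⟩ := hlift _ _ _ (ShiftEqs.representation c)
  have hs : ∀ i, IsShift (ρ (s i)) (Pi.single i 1) := fun i => by
    rw [hρs]
    exact isShift_wshift _ _ fun _ => one_ne_zero
  have hmon : ∀ a, IsShift (ρ (orderedMonomial s a)) (fun i => (a i : ℤ)) := fun a => by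
    have h := IsShift.list_prod (List.finRange n) fun i => (hs i).pow (a i)
    have e1 : ((List.finRange n).map fun i => a i • (Pi.single i 1 : Fin n → ℤ)).sum =
        fun i => (a i : ℤ) := by
      rw [← List.ofFn_eq_map, List.sum_ofFn]
      ext j
      simp [Finset.sum_apply, Pi.single_apply]
    rw [e1] at h
    rw [orderedMonomial, map_list_prod, List.map_ofFn, List.ofFn_eq_map]
    rwa [show (⇑ρ ∘ fun i => s i ^ a i) = fun i => ρ (s i) ^ a i from funext fun i => by
      rw [Function.comp_apply, map_pow]]
  have hz := (exists_of_mem_center (deg := fun (m : Fin n → ℕ) i => (m i : ℤ))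
    (fun a b h => funext fun i => Int.ofNat.inj (congrFun h i)) (orderedMonomial_zero s) (by ext; simp) hspan ρ
    (fun i a => X i - C (c i * a i)) (by simp) (fun a ha => ?_) (fun i => by rw [hι, hρt]) hmon).2
  · constructor
    intro z hzc
    obtain ⟨P, rfl, hP⟩ := hz z hzc
    -- Invariance is under `X_i ↦ X_i - c_i`, so the orbit of `0` is `0, -c_i, -2 c_i, …`, infinite
    -- in characteristic zero.
    have hPc := eq_C_of_orbit (u := fun i k => -(c i * k)) (fun i k l hkl => ?_) (P := P)
      fun p i k hk => ?_
    · rw [hPc]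
      exact ⟨_, (ι.commutes _).symm⟩
    · have := mul_left_cancel₀ (hc i) (neg_injective hkl)
      exact_mod_cast this
    · conv_rhs => rw [← hP _ _ (hs i)]
      rw [eval_aeval_eq_eval_update (i := i)]
      · simp [hk]
        ring_nf
      · intro j hj
        simp [hj]
  · obtain ⟨i, hi⟩ := Function.ne_iff.1 ha
    refine ⟨i, fun h => ?_⟩
    rw [sub_eq_self, C_eq_zero] at h
    exact hi (by exact_mod_cast (mul_eq_zero.1 h).resolve_left (hc i))

theorem isCentral_partialShift [CharZero K] : Algebra.IsCentral K (PartialShift K n) := by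
  obtain ⟨g, hg⟩ := exists_isPresentation
    (OperatorRel K (n := n) (fun _ => 1) (fun _ => 1) fun _ => 0)
  have key : ∀ (E : Type u) [Ring E] [Algebra K E] (f : XYs n → E),
      Satisfies (OperatorRel K (n := n) (fun _ => 1) (fun _ => 1) fun _ => 0) f ↔
      ShiftEqs (fun _ => (1 : K)) (fun i => f (XYs.x i)) fun i => f (XYs.y i) := by
    refine fun E _ _ f => ⟨fun h => ⟨fun i j => ?_, fun i j => ?_, fun i j hij => ?_, fun i => ?_⟩,
      fun h => ?_⟩
    · simpa using h (.xx j i)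
    · simpa using h (.yy j i)
    · simpa using h (.yx_ne j i hij.symm)
    · simpa using h (.yx i)
    · rintro _ _ (⟨i, j⟩ | ⟨i, j⟩ | ⟨i, j, hij⟩ | ⟨i⟩)
      · simpa using h.tt j i
      · simpa using h.ss j i
      · simpa using h.st_ne j i hij.symm
      · simpa using h.st i
  refine isCentral_of_shiftEqs (fun _ => one_ne_zero) ((key _ g).1 hg.rel) hg.adjoin_XYs
    fun E _ _ t' s' h' => ?_
  obtain ⟨φ, hφ⟩ := hg.lift E (fun | XYs.x i => t' i | XYs.y i => s' i) ((key E _).2 h')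
  exact ⟨φ, fun i => hφ _, fun i => hφ _⟩

/-- The operators `Δ_i + 1` are shifts: the relation is equivalent to `(Δ_i + 1) t_i = t_i (Δ_i + 1)
+ (Δ_i + 1)`. -/
theorem isCentral_partialDifference [CharZero K] : Algebra.IsCentral K (PartialDifference K n) := by
  obtain ⟨g, hg⟩ := exists_isPresentation
    (OperatorRel K (n := n) (fun _ => 1) (fun _ => 1) fun _ => 1)
  have key : ∀ (E : Type u) [Ring E] [Algebra K E] (f : XYs n → E),
      Satisfies (OperatorRel K (n := n) (fun _ => 1) (fun _ => 1) fun _ => 1) f ↔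
      ShiftEqs (fun _ => (1 : K)) (fun i => f (XYs.x i)) fun i => f (XYs.y i) + 1 := by
    refine fun E _ _ f => ⟨fun h => ⟨fun i j => ?_, fun i j => ?_, fun i j hij => ?_, fun i => ?_⟩,
      fun h => ?_⟩
    · simpa using h (.xx j i)
    · have : f (XYs.y i) * f (XYs.y j) = f (XYs.y j) * f (XYs.y i) := by simpa using h (.yy j i)
      simp only [mul_add, add_mul, this, mul_one, one_mul]
      abel
    · have : f (XYs.y i) * f (XYs.x j) = f (XYs.x j) * f (XYs.y i) := by
        simpa using h (.yx_ne j i hij.symm)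
      simp only [mul_add, add_mul, this, mul_one, one_mul]
    · have : f (XYs.y i) * f (XYs.x i) = f (XYs.x i) * f (XYs.y i) + f (XYs.y i) + 1 := by
        simpa using h (.yx i)
      simp only [mul_add, add_mul, this, mul_one, one_mul, one_smul]
      abel
    · rintro _ _ (⟨i, j⟩ | ⟨i, j⟩ | ⟨i, j, hij⟩ | ⟨i⟩)
      · simpa using h.tt j i
      · have := h.ss j i
        simp only [mul_add, add_mul, mul_one, one_mul] at this
        have h2 : f (XYs.y j) * f (XYs.y i) = f (XYs.y i) * f (XYs.y j) := by
          rw [← sub_eq_zero] at this ⊢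
          rw [← this]
          abel
        simpa using h2
      · have := h.st_ne j i hij.symm
        simp only [mul_add, add_mul, mul_one, one_mul, add_left_inj] at this
        simpa using this
      · have := h.st i
        simp only [mul_add, add_mul, mul_one, one_mul, one_smul] at this
        have h2 : f (XYs.y i) * f (XYs.x i) = f (XYs.x i) * f (XYs.y i) + f (XYs.y i) + 1 := by
          rw [← sub_eq_zero] at this ⊢
          rw [← this]
          abel
        simpa using h2
  refine isCentral_of_shiftEqs (fun _ => one_ne_zero) ((key _ g).1 hg.rel)
    (adjoin_eq_top_of_subset hg.adjoin_XYs ?_) fun E _ _ t' s' h' => ?_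
  · rintro _ (⟨i, rfl⟩ | ⟨i, rfl⟩)
    · exact Algebra.subset_adjoin (Or.inl ⟨i, rfl⟩)
    · have : ∀ S : Subalgebra K (RingQuot (OperatorRel K (n := n) (fun _ => 1) (fun _ => 1)
          fun _ => 1)), g (XYs.y i) + 1 ∈ S → g (XYs.y i) ∈ S := fun S hS => by
        simpa using sub_mem hS (one_mem S)
      refine this _ (Algebra.subset_adjoin ?_)
      exact Or.inr ⟨i, rfl⟩
  · obtain ⟨φ, hφ⟩ := hg.lift E (fun | XYs.x i => t' i | XYs.y i => s' i - 1) ((key E _).2 (by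
      simpa using h'))
    exact ⟨φ, fun i => hφ _, fun i => by rw [map_add, hφ]; simp⟩

/-- The elements `r` with this property form a subalgebra. Commutation rules with a coefficient ring
thus need checking on generators only. -/
theorem algHom_intertwine {R : Type*} [CommRing R] [Algebra K R] {A : Type*} [Ring A] [Algebra K A]
    {s : Set R} (hs : Algebra.adjoin K s = ⊤) (ι : R →ₐ[K] A) (σ : R →ₐ[K] R) (a : A)
    (h : ∀ r ∈ s, a * ι r = ι (σ r) * a) (r : R) : a * ι r = ι (σ r) * a := by
  have hr : r ∈ Algebra.adjoin K s := hs ▸ Algebra.mem_top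
  induction hr using Algebra.adjoin_induction with
  | mem r hr => exact h r hr
  | algebraMap k => simp [Algebra.commutes]
  | add r r' _ _ hr hr' => simp only [map_add, mul_add, add_mul, hr, hr']
  | mul r r' _ _ hr hr' => rw [map_mul, map_mul, map_mul, ← mul_assoc, hr, mul_assoc, hr', mul_assoc]

theorem isCentral_discreteLinearSystems [CharZero K] :
    Algebra.IsCentral K (DiscreteLinearSystems K n) := by
  refine isCentral_oreAlgebra _ _ fun A _ _ ι x ⟨h, hgen, hlift⟩ => ?_
  refine isCentral_of_shiftEqs (c := fun _ => 1) (t := fun i => ι (X i)) (s := x)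
    (fun _ => one_ne_zero) ⟨fun i j => ?_, fun i j => h.var j i, fun i j hij => ?_, fun i => ?_⟩
    (adjoin_eq_top_of_subset hgen ?_) fun E _ _ t' s' h' => ?_
  · rw [← map_mul, mul_comm, map_mul]
  · simpa [hij.symm] using h.coeff i (X j)
  · simpa [add_mul] using h.coeff i (X i)
  · rintro _ (⟨P, rfl⟩ | ⟨i, rfl⟩)
    · have h1 : ι P ∈ (Algebra.adjoin K (Set.range (X : Fin n → MvPolynomial (Fin n) K))).map ι :=
        ⟨P, by simp [MvPolynomial.adjoin_range_X], rfl⟩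
      rw [AlgHom.map_adjoin] at h1
      refine Algebra.adjoin_mono ?_ h1
      rintro _ ⟨_, ⟨i, rfl⟩, rfl⟩
      exact Or.inl ⟨i, rfl⟩
    · exact Algebra.subset_adjoin (Or.inr ⟨i, rfl⟩)
  · obtain ⟨ι', hι'⟩ := exists_mvPolynomial_algHom K t' h'.tt
    refine (hlift E ι' s' ⟨fun i r => ?_, fun i j => h'.ss j i⟩).elim fun φ ⟨hφ, hφx⟩ => ?_
    rotate_left
    · exact ⟨φ, fun i => by rw [hφ, hι'], hφx⟩
    · rw [map_zero, add_zero]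
      refine algHom_intertwine MvPolynomial.adjoin_range_X ι' (MvPolynomial.aeval _) (s' i) ?_ r
      rintro _ ⟨j, rfl⟩
      by_cases hij : i = j
      · subst hij
        simp [hι', h'.st, add_mul]
      · simp [hι', h'.st_ne i j hij, Ne.symm hij]

theorem isCentral_shiftAlgebra [CharZero K] {h : K} (hh : h ≠ 0) :
    Algebra.IsCentral K (ShiftAlgebra K h) := by
  refine isCentral_oreAlgebra _ _ fun A _ _ ι x ⟨hx, hgen, hlift⟩ => ?_
  -- From `σ_h(t) = t - h` follows `x_h t = t x_h - h x_h`, whence the sign.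
  refine isCentral_of_shiftEqs (n := 1) (c := fun _ => -h) (t := fun _ => ι Polynomial.X)
    (s := fun _ => x ()) (fun _ => neg_ne_zero.2 hh) ⟨fun i j => rfl, fun i j => rfl,
      fun i j hij => absurd (Subsingleton.elim i j) hij, fun i => ?_⟩
    (adjoin_eq_top_of_subset hgen ?_) fun E _ _ t' s' h' => ?_
  · have := hx.coeff () Polynomial.X
    rw [Polynomial.X_comp, map_zero, add_zero, map_sub, sub_mul] at this
    rw [this, neg_smul, ← sub_eq_add_neg, Algebra.smul_def]
    congr 2
    exact ι.commutes h
  · rintro _ (⟨P, rfl⟩ | ⟨⟨⟩, rfl⟩)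
    · have h1 : ι P ∈ (Algebra.adjoin K ({Polynomial.X} : Set (Polynomial K))).map ι :=
        ⟨P, by simp [Polynomial.adjoin_X], rfl⟩
      rw [AlgHom.map_adjoin] at h1
      refine Algebra.adjoin_mono ?_ h1
      rintro _ ⟨_, rfl, rfl⟩
      exact Or.inl ⟨0, rfl⟩
    · exact Algebra.subset_adjoin (Or.inr ⟨0, rfl⟩)
  · have e1 : ∀ i : Fin 1, i = 0 := fun i => Subsingleton.elim i 0
    refine (hlift E (Polynomial.aeval (t' 0)) (fun _ => s' 0)
      ⟨fun i r => ?_, fun i j => rfl⟩).elim fun φ ⟨hφ, hφx⟩ => ?_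
    rotate_left
    · exact ⟨φ, fun i => by rw [e1 i, hφ, Polynomial.aeval_X], fun i => by rw [e1 i, hφx]⟩
    · rw [map_zero, add_zero]
      refine algHom_intertwine Polynomial.adjoin_X (Polynomial.aeval (t' 0))
        (Polynomial.aeval (Polynomial.X - Polynomial.C h)) (s' 0) ?_ r
      rintro _ rfl
      have := h'.st 0
      simp only [neg_smul, ← sub_eq_add_neg] at this
      simp [this, sub_mul, Algebra.smul_def]

end ShiftAlgebras

/-! ### Ore extensions by a derivation -/

section Derivations

open MvPolynomial

variable {K : Type u} [Field K]

section Commutant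

variable {A : Type*} [Ring A] [Algebra K A]

/-- The Leibniz formula for a map that satisfies `[D, y] = c` with `c` commuting with `D`: as for
`d/dy`, only the first-order term in `c` appears. -/
theorem iterate_commutator_mul {D : A →ₗ[K] A} {y c : A} (h : ∀ b, D (y * b) = y * D b + c * b)
    (hc : ∀ b, D (c * b) = c * D b) (n : ℕ) (b : A) :
    (D ^ (n + 1)) (y * b) = y * (D ^ (n + 1)) b + ((n + 1 : ℕ) : A) * (c * (D ^ n) b) := by
  have hcn : ∀ (n : ℕ) b, D ((n : A) * b) = (n : A) * D b := fun n b => by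
    rw [← nsmul_eq_mul, map_nsmul, nsmul_eq_mul]
  induction n with
  | zero => simp [h]
  | succ n ih =>
    have e1 : ∀ (n : ℕ) b, D ((D ^ n) b) = (D ^ (n + 1)) b := fun n b => by
      rw [pow_succ' D n, Module.End.mul_apply]
    rw [← e1, ih, map_add, h, hcn, hc, e1, e1]
    push_cast
    simp only [add_mul, one_mul]
    abel

/-- The map `D` behaves like `c d/dy`. It serves to isolate the leading coefficient of a polynomial
in `y`. -/
theorem iterate_commutator_pow {D : A →ₗ[K] A} {y c : A} (h : ∀ b, D (y * b) = y * D b + c * b)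
    (hc : ∀ b, D (c * b) = c * D b) (h1 : D 1 = 0) (d : ℕ) :
    (D ^ d) (y ^ d) = (d.factorial : A) * c ^ d ∧ (D ^ (d + 1)) (y ^ d) = 0 := by
  induction d with
  | zero => simp [h1]
  | succ d ih =>
    rw [pow_succ' y, iterate_commutator_mul h hc, iterate_commutator_mul h hc, ih.1, ih.2,
      pow_succ' D (d + 1), Module.End.mul_apply, ih.2]
    simp only [map_zero, mul_zero, zero_add, and_true]
    rw [Nat.factorial_succ, pow_succ' c]
    push_cast
    rw [mul_assoc]
    congr 1
    exact (Nat.cast_commute _ c).symm.left_comm _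

/-- An element of `B[y]` commuting with an element `r` that commutes with `B` but not with `y`
belongs to `B`. -/
theorem mem_of_commute [CharZero K] {B : Subalgebra K A} {y r c : A}
    (hB : ∀ b ∈ B, y * b - b * y ∈ B) (hr : ∀ b ∈ B, b * r = r * b) (hyr : y * r = r * y + c)
    (hc : c ∈ B) (hreg : ∀ b ∈ B, b * c = 0 → b = 0) {z : A}
    (hz : z ∈ Algebra.adjoin K (B ∪ {y} : Set A)) (hzr : z * r = r * z) : z ∈ B := by
  -- The commutator with `r` is linear over `B` on the left and lowers the degree in `y` by one.
  let D : A →ₗ[K] A := LinearMap.mulRight K r - LinearMap.mulLeft K r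
  have hD : ∀ a, D a = a * r - r * a := fun a => rfl
  have hDb : ∀ b ∈ B, ∀ a, D (b * a) = b * D a := fun b hb a => by
    rw [hD, hD, mul_sub, ← mul_assoc r, ← hr b hb]
    simp only [mul_assoc]
  have hDy : ∀ a, D (y * a) = y * D a + c * a := fun a => by
    rw [hD, hD, mul_sub, ← mul_assoc y r, hyr, add_mul]
    simp only [mul_assoc]
    abel
  have hDnb : ∀ n, ∀ b ∈ B, ∀ a, (D ^ n) (b * a) = b * (D ^ n) a := by
    intro n b hb a
    induction n with
    | zero => rfl
    | succ n ih => rw [pow_succ', Module.End.mul_apply, ih, hDb b hb, Module.End.mul_apply]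
  have key := iterate_commutator_pow (K := K) hDy (hDb c hc) (by rw [hD]; simp)
  have hkey2 : ∀ n k, k < n → (D ^ n) (y ^ k) = 0 := by
    intro n k hk
    obtain ⟨m, rfl⟩ := Nat.exists_eq_add_of_le' (Nat.succ_le_of_lt hk)
    rw [pow_add, Module.End.mul_apply, (key k).2, map_zero]
  -- The filtration by degree in `y`. Since `[y, B] ⊆ B`, coefficients can be kept on the left, so
  -- it exhausts `B[y]`.
  let F : ℕ → Submodule K A := fun n => Submodule.span K {a | ∃ k < n, ∃ b ∈ B, a = b * y ^ k}
  have hFmono : Monotone F := fun m n hmn => Submodule.span_mono fun a ⟨k, hk, b, hb, e⟩ =>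
    ⟨k, hk.trans_le hmn, b, hb, e⟩
  have hmemF : ∃ n, z ∈ F n := by
    have hbF : ∀ n, ∀ b ∈ B, ∀ a ∈ F n, b * a ∈ F n := by
      intro n b hb a ha
      induction ha using Submodule.span_induction with
      | mem a ha =>
        obtain ⟨k, hk, b', hb', rfl⟩ := ha
        exact Submodule.subset_span ⟨k, hk, b * b', mul_mem hb hb', by rw [mul_assoc]⟩
      | zero => simp
      | add s t _ _ hs ht => rw [mul_add]; exact add_mem hs ht
      | smul c t _ ht => rw [mul_smul_comm]; exact Submodule.smul_mem _ _ ht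
    have hyF : ∀ n, ∀ a ∈ F n, y * a ∈ F (n + 1) := by
      intro n a ha
      induction ha using Submodule.span_induction with
      | mem a ha =>
        obtain ⟨k, hk, b, hb, rfl⟩ := ha
        have e : y * (b * y ^ k) = b * y ^ (k + 1) + (y * b - b * y) * y ^ k := by
          rw [sub_mul, pow_succ']
          simp only [mul_assoc]
          abel
        rw [e]
        exact add_mem (Submodule.subset_span ⟨k + 1, by omega, b, hb, rfl⟩)
          (Submodule.subset_span ⟨k, by omega, _, hB b hb, rfl⟩)
      | zero => simp
      | add s t _ _ hs ht => rw [mul_add]; exact add_mem hs ht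
      | smul c t _ ht => rw [mul_smul_comm]; exact Submodule.smul_mem _ _ ht
    have h1 : (1 : A) ∈ F 1 := Submodule.subset_span ⟨0, one_pos, 1, one_mem B, by simp⟩
    have : ∀ a ∈ Algebra.adjoin K (B ∪ {y} : Set A), ∀ n, ∀ w ∈ F n, ∃ m, a * w ∈ F m := by
      intro a ha
      induction ha using Algebra.adjoin_induction with
      | mem a ha =>
        rcases ha with ha | rfl
        · exact fun n w hw => ⟨n, hbF n a ha w hw⟩
        · exact fun n w hw => ⟨n + 1, hyF n w hw⟩
      | algebraMap k =>
        exact fun n w hw => ⟨n, by rw [← Algebra.smul_def]; exact Submodule.smul_mem _ _ hw⟩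
      | add a a' _ _ h h' =>
        intro n w hw
        obtain ⟨m, hm⟩ := h n w hw
        obtain ⟨m', hm'⟩ := h' n w hw
        refine ⟨max m m', ?_⟩
        rw [add_mul]
        exact add_mem (hFmono (le_max_left _ _) hm) (hFmono (le_max_right _ _) hm')
      | mul a a' _ _ h h' =>
        intro n w hw
        obtain ⟨m', hm'⟩ := h' n w hw
        obtain ⟨m, hm⟩ := h m' _ hm'
        exact ⟨m, by rwa [mul_assoc]⟩
    obtain ⟨m, hm⟩ := this z hz 1 1 h1
    exact ⟨m, by simpa using hm⟩
  have hFzero : ∀ n, ∀ a ∈ F n, (D ^ n) a = 0 := by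
    intro n a ha
    induction ha using Submodule.span_induction with
    | mem a ha =>
      obtain ⟨k, hk, b, hb, rfl⟩ := ha
      rw [hDnb n b hb, hkey2 n k hk, mul_zero]
    | zero => simp
    | add s t _ _ hs ht => rw [map_add, hs, ht, add_zero]
    | smul c t _ ht => rw [map_smul, ht, smul_zero]
  have hdecomp : ∀ n, ∀ a ∈ F (n + 1), ∃ b ∈ B, ∃ w ∈ F n, a = b * y ^ n + w := by
    intro n a ha
    induction ha using Submodule.span_induction with
    | mem a ha =>
      obtain ⟨k, hk, b, hb, rfl⟩ := ha
      rcases Nat.lt_succ_iff_lt_or_eq.1 hk with hk | rfl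
      · exact ⟨0, zero_mem _, _, Submodule.subset_span ⟨k, hk, b, hb, rfl⟩, by simp⟩
      · exact ⟨b, hb, 0, zero_mem _, by simp⟩
    | zero => exact ⟨0, zero_mem _, 0, zero_mem _, by simp⟩
    | add s t _ _ hs ht =>
      obtain ⟨b, hb, w, hw, rfl⟩ := hs
      obtain ⟨b', hb', w', hw', rfl⟩ := ht
      exact ⟨b + b', add_mem hb hb', w + w', add_mem hw hw', by rw [add_mul]; abel⟩
    | smul c t _ ht =>
      obtain ⟨b, hb, w, hw, rfl⟩ := ht
      exact ⟨c • b, B.smul_mem hb c, c • w, Submodule.smul_mem _ _ hw, by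
        rw [smul_add, smul_mul_assoc]⟩
  have hDz : D z = 0 := by rw [hD, hzr, sub_self]
  obtain ⟨n, hn⟩ := hmemF
  -- The degree is lowered step by step: for `n ≥ 1`, `0 = D ^ n z = n! b c ^ n` with `b` the
  -- coefficient of `y ^ n`. Characteristic zero removes `n!` and regularity of `c` removes `c ^ n`,
  -- so `b = 0`.
  have hF1 : z ∈ F 1 := by
    induction n with
    | zero => exact hFmono zero_le_one hn
    | succ n ih =>
      rcases Nat.eq_zero_or_pos n with rfl | hpos
      · exact hn
      · apply ih
        obtain ⟨b, hb, w, hw, e⟩ := hdecomp n z hn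
        have h2 : (D ^ n) z = 0 := by
          obtain ⟨m, rfl⟩ := Nat.exists_eq_succ_of_ne_zero hpos.ne'
          rw [pow_succ, Module.End.mul_apply, hDz, map_zero]
        rw [e, map_add, hFzero n w hw, hDnb n b hb, (key n).1, add_zero] at h2
        have hfac : ((n.factorial : ℕ) : A) = algebraMap K A n.factorial := (map_natCast _ _).symm
        rw [hfac, Algebra.left_comm, ← Algebra.smul_def, smul_eq_zero] at h2
        have h3 := h2.resolve_left (by exact_mod_cast n.factorial_ne_zero)
        have h4 : ∀ k, ∀ b ∈ B, b * c ^ k = 0 → b = 0 := by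
          intro k
          induction k with
          | zero => intro b _ h; simpa using h
          | succ k ihk =>
            intro b hb h
            rw [pow_succ', ← mul_assoc] at h
            exact hreg b hb (ihk _ (mul_mem hb hc) h)
        rw [h4 n b hb h3, zero_mul, zero_add] at e
        exact e ▸ hw
  obtain ⟨b, hb, w, hw, e⟩ := hdecomp 0 z hF1
  have : w = 0 := by
    have : F 0 = ⊥ := by
      rw [Submodule.span_eq_bot]
      rintro a ⟨k, hk, -⟩
      omega
    rw [this] at hw
    exact (Submodule.mem_bot K).1 hw
  rw [e, this]
  simpa using hb

end Commutant

/-- The center of the algebra of differential operators with polynomial coefficients for a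
derivation `δ ≠ 0` without constants. -/
theorem isCentral_of_derivation [CharZero K] {R : Type*} [CommRing R] [IsDomain R] [Algebra K R]
    {A : Type*} [Ring A] [Algebra K A] (ι : R →ₐ[K] A) (hι : Function.Injective ι) (y : A)
    (δ : R → R) (h : ∀ r, y * ι r = ι r * y + ι (δ r))
    (hgen : Algebra.adjoin K (Set.range ι ∪ {y}) = ⊤) (r₀ : R) (hr₀ : δ r₀ ≠ 0)
    (hδ : ∀ f, δ f = 0 → ∃ k, f = algebraMap K R k) : Algebra.IsCentral K A := by
  constructor
  intro z hz
  rw [Subalgebra.mem_center_iff] at hz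
  -- Commuting with `r₀`, on which the derivation does not vanish, forces `z` to be a coefficient;
  -- commuting with `y` will then make it a constant of `δ`.
  have hmem : z ∈ ι.range := by
    refine mem_of_commute (y := y) (r := ι r₀) (c := ι (δ r₀)) ?_ ?_ (h r₀)
      (ι.mem_range_self _) ?_
      (by rw [AlgHom.coe_range, hgen]; exact Algebra.mem_top) (hz _).symm
    · rintro _ ⟨r, rfl⟩
      exact ⟨δ r, by change _ = y * ι r - ι r * y; rw [h]; simp⟩
    · rintro _ ⟨r, rfl⟩
      change ι r * ι r₀ = ι r₀ * ι r
      rw [← map_mul, mul_comm, map_mul]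
    · rintro _ ⟨r, rfl⟩ h0
      change ι r * ι _ = 0 at h0
      rw [← map_mul] at h0
      have h1 := hι (h0.trans (map_zero ι).symm)
      rw [(mul_eq_zero.1 h1).resolve_right hr₀]
      exact map_zero ι
  obtain ⟨f, rfl⟩ := hmem
  have e := hz y
  change y * ι f = ι f * y at e
  rw [h, add_eq_left] at e
  obtain ⟨k, rfl⟩ := hδ f (hι (e.trans (map_zero ι).symm))
  exact ⟨k, (ι.commutes k).symm⟩

theorem algHom_derivation {R : Type*} [CommRing R] [Algebra K R] {A : Type*} [Ring A] [Algebra K A]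
    {s : Set R} (hs : Algebra.adjoin K s = ⊤) (ι : R →ₐ[K] A) (δ : Derivation K R R) (a : A)
    (h : ∀ r ∈ s, a * ι r = ι r * a + ι (δ r)) (r : R) : a * ι r = ι r * a + ι (δ r) := by
  have hr : r ∈ Algebra.adjoin K s := hs ▸ Algebra.mem_top
  induction hr using Algebra.adjoin_induction with
  | mem r hr => exact h r hr
  | algebraMap k => simp [Algebra.commutes]
  | add r r' _ _ hr hr' => simp only [map_add, mul_add, add_mul, hr, hr']; abel
  | mul r r' _ _ hr hr' =>
    rw [map_mul, ← mul_assoc, hr, add_mul, mul_assoc, hr', Derivation.leibniz, map_add, mul_add,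
      smul_eq_mul, smul_eq_mul, map_mul, map_mul, mul_assoc, ← map_mul ι r' (δ r), mul_comm r',
      map_mul]
    abel

/-- Multiplication operators. -/
theorem lmul_derivation {R : Type*} [CommRing R] [Algebra K R] (δ : Derivation K R R) (r : R) :
    (δ : R →ₗ[K] R) * Algebra.lmul K R r = (Algebra.lmul K R r * (δ : R →ₗ[K] R) +
      Algebra.lmul K R (δ r) : Module.End K R) := by
  ext s
  simp [mul_comm]

/-- An action on `R` in which the coefficients act by multiplication is faithful on them, as the
image of `1` shows. -/
theorem injective_of_lmul {R : Type*} [CommRing R] [Algebra K R] {A : Type*} [Ring A] [Algebra K A]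
    (ι : R →ₐ[K] A) (ρ : A →ₐ[K] Module.End K R) (h : ρ.comp ι = Algebra.lmul K R) :
    Function.Injective ι := by
  intro r s e
  have h1 : Algebra.lmul K R r = Algebra.lmul K R s := by
    rw [← h, AlgHom.comp_apply, AlgHom.comp_apply, e]
  simpa using LinearMap.congr_fun h1 1

/-- The Jordan plane is `K[x][y; x² d/dx]`, and `x² f' = 0` only for constants. -/
theorem isCentral_jordanPlane [CharZero K] : Algebra.IsCentral K (JordanPlane K) := by
  obtain ⟨g, hg⟩ := exists_isPresentation (JordanRel K)
  let δ : Derivation K (Polynomial K) (Polynomial K) := Polynomial.mkDerivation K (Polynomial.X ^ 2)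
  have hδ : ∀ f, δ f = Polynomial.derivative f * Polynomial.X ^ 2 := fun f => by
    simp [δ, Polynomial.mkDerivation_apply]
  have hrel : ∀ (E : Type u) [Ring E] [Algebra K E] (f : XY → E), Satisfies (JordanRel K) f ↔
      f XY.y * f XY.x = f XY.x * f XY.y + f XY.x ^ 2 := by
    intro E _ _ f
    have : f XY.y * f XY.x = f XY.x * f XY.y + f XY.x ^ 2 ↔
        f XY.y * f XY.x - f XY.x * f XY.y - f XY.x ^ 2 = 0 := by
      rw [sub_sub, sub_eq_zero]
    rw [this]
    constructor
    · intro h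
      simpa using h .yx
    · rintro h _ _ ⟨⟩
      simpa using h
  have hgx := (hrel _ g).1 hg.rel
  obtain ⟨ρ, hρ⟩ := hg.lift (Module.End K (Polynomial K))
    (fun | XY.x => Algebra.lmul K _ Polynomial.X | XY.y => (δ : Polynomial K →ₗ[K] Polynomial K))
    ((hrel _ _).2 (by
      change _ = _ + Algebra.lmul K _ Polynomial.X ^ 2
      rw [← map_pow]
      have := lmul_derivation δ Polynomial.X
      rwa [show δ Polynomial.X = Polynomial.X ^ 2 by simp [hδ]] at this))
  refine isCentral_of_derivation (Polynomial.aeval (g XY.x)) (injective_of_lmul _ ρ ?_) (g XY.y) δ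
    (algHom_derivation Polynomial.adjoin_X _ δ _ ?_) (adjoin_eq_top_of_subset hg.gen ?_)
    Polynomial.X ?_ fun f hf => ?_
  · ext1
    simp [hρ]
  · rintro _ rfl
    simpa [hδ] using hgx
  · rintro _ ⟨_ | _, rfl⟩
    · exact Algebra.subset_adjoin (Or.inl ⟨Polynomial.X, by simp⟩)
    · exact Algebra.subset_adjoin (Or.inr rfl)
  · simp [hδ]
  · rw [hδ] at hf
    have h1 := (mul_eq_zero.1 hf).resolve_right (pow_ne_zero _ Polynomial.X_ne_zero)
    exact ⟨_, Polynomial.eq_C_of_natDegree_eq_zero (Polynomial.derivative_eq_zero.1 h1)⟩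

theorem coeff_X_mul_pderiv {τ : Type*} (i : τ) (p : MvPolynomial τ K) (m : τ →₀ ℕ) :
    coeff m (X i * pderiv i p) = m i * coeff m p := by
  classical
  induction p using MvPolynomial.induction_on' with
  | add p q hp hq => simp only [map_add, mul_add, coeff_add, hp, hq]
  | monomial c a =>
    rw [X_mul_pderiv_monomial, coeff_smul, coeff_monomial]
    split_ifs with h
    · rw [h, nsmul_eq_mul]
    · simp

theorem eq_C_of_coeff {τ : Type*} {p : MvPolynomial τ K} (h : ∀ m, m ≠ 0 → coeff m p = 0) :
    ∃ k, p = algebraMap K _ k := by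
  classical
  refine ⟨coeff 0 p, ?_⟩
  ext m
  rw [algebraMap_eq, coeff_C]
  split_ifs with hm
  · rw [hm]
  · exact h m (Ne.symm hm)

/-- The algebra is `K[x, z][y; δ]` with `δ x = a x z + b z²` and `δ z = -c z²`. Divided by `z`, the
equation `δ f = 0` relates the coefficient at `x^i z^j`, with factor `a i - c j`, to the one at
`x^(i+1) z^(j-1)`. -/
theorem isCentral_quadraticA2 [CharZero K] {a b c : K} (ha : a ≠ 0) (hc : c ≠ 0)
    (hac : ∀ r : ℚ, 0 < r → a ≠ (r : K) * c) : Algebra.IsCentral K (QuadraticA2 K a b c) := by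
  obtain ⟨g, hg⟩ := exists_isPresentation (QuadraticRel K a b c)
  let δ : Derivation K (MvPolynomial (Fin 2) K) (MvPolynomial (Fin 2) K) :=
    MvPolynomial.mkDerivation K ![C a * X 0 * X 1 + C b * X 1 ^ 2, -(C c * X 1 ^ 2)]
  have hδ : ∀ f, δ f = X 1 * (C a * (X 0 * pderiv 0 f) + C b * (X 1 * pderiv 0 f) -
      C c * (X 1 * pderiv 1 f)) := by
    intro f
    have : δ = (C a * X 0 * X 1 + C b * X 1 ^ 2 : MvPolynomial (Fin 2) K) • pderiv 0 +
        (-(C c * X 1 ^ 2) : MvPolynomial (Fin 2) K) • pderiv 1 := by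
      apply MvPolynomial.derivation_ext
      rw [Fin.forall_fin_two]
      constructor <;> simp [δ, mkDerivation_X, pderiv_X]
    rw [this]
    simp only [Derivation.add_apply, Derivation.smul_apply, smul_eq_mul]
    ring
  have hrel : ∀ (E : Type u) [Ring E] [Algebra K E] (f : XYZ → E), Satisfies (QuadraticRel K a b c) f ↔
      f XYZ.y * f XYZ.x = f XYZ.x * f XYZ.y + (a • (f XYZ.x * f XYZ.z) + b • f XYZ.z ^ 2) ∧
      f XYZ.z * f XYZ.x = f XYZ.x * f XYZ.z ∧
      f XYZ.y * f XYZ.z = f XYZ.z * f XYZ.y + -(c • f XYZ.z ^ 2) := by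
    intro E _ _ f
    have : f XYZ.y * f XYZ.z = f XYZ.z * f XYZ.y + -(c • f XYZ.z ^ 2) ↔
        f XYZ.z * f XYZ.y = f XYZ.y * f XYZ.z + c • f XYZ.z ^ 2 := by
      rw [← sub_eq_add_neg, eq_sub_iff_add_eq, eq_comm]
    rw [this, ← add_assoc]
    constructor
    · intro h
      exact ⟨by simpa using h .yx, by simpa using h .zx, by simpa using h .zy⟩
    · rintro h _ _ (_ | _ | _)
      · simpa using h.1
      · simpa using h.2.1
      · simpa using h.2.2
  have hδ0 : δ (X 0) = a • (X 0 * X 1) + b • X 1 ^ 2 := by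
    simp [δ, mkDerivation_X, smul_eq_C_mul, mul_assoc]
  have hδ1 : δ (X 1) = -(c • X 1 ^ 2) := by simp [δ, mkDerivation_X, smul_eq_C_mul]
  obtain ⟨h1, h2, h3⟩ := (hrel _ g).1 hg.rel
  obtain ⟨ι, hι⟩ := exists_mvPolynomial_algHom K ![g XYZ.x, g XYZ.z] (by
    simp [Fin.forall_fin_two, h2])
  have hιx : ι (X 0) = g XYZ.x := hι 0
  have hιz : ι (X 1) = g XYZ.z := hι 1
  obtain ⟨ρ, hρ⟩ := hg.lift (Module.End K (MvPolynomial (Fin 2) K))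
    (fun | XYZ.x => Algebra.lmul K _ (X 0) | XYZ.z => Algebra.lmul K _ (X 1)
         | XYZ.y => (δ : MvPolynomial (Fin 2) K →ₗ[K] MvPolynomial (Fin 2) K))
    ((hrel _ _).2 ⟨by
      have := lmul_derivation δ (X 0)
      rw [hδ0, map_add, map_smul, map_smul, map_mul, map_pow] at this
      exact this, by
      rw [← map_mul, mul_comm, map_mul], by
      have := lmul_derivation δ (X 1)
      rw [hδ1, map_neg, map_smul, map_pow] at this
      exact this⟩)
  refine isCentral_of_derivation ι (injective_of_lmul _ ρ ?_) (g XYZ.y) δ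
    (algHom_derivation MvPolynomial.adjoin_range_X _ δ _ ?_) (adjoin_eq_top_of_subset hg.gen ?_)
    (X 1) ?_ fun f hf => ?_
  · apply MvPolynomial.algHom_ext
    simp [Fin.forall_fin_two, hιx, hιz, hρ]
  · rintro _ ⟨i, rfl⟩
    revert i
    rw [Fin.forall_fin_two]
    constructor
    · rw [hδ0, hιx, h1, map_add, map_smul, map_smul, map_mul, map_pow, hιx, hιz]
    · rw [hδ1, hιz, h3, map_neg, map_smul, map_pow, hιz]
  · rintro _ ⟨_ | _ | _, rfl⟩
    · exact Algebra.subset_adjoin (Or.inl ⟨_, hιx⟩)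
    · exact Algebra.subset_adjoin (Or.inr rfl)
    · exact Algebra.subset_adjoin (Or.inl ⟨_, hιz⟩)
  · rw [hδ1]
    simp [hc, X_ne_zero]
  · rw [hδ] at hf
    have hf' := (mul_eq_zero.1 hf).resolve_left (X_ne_zero _)
    apply eq_C_of_coeff
    -- Descending induction on the exponent of `x`, starting above the total degree; the term with
    -- factor `b` has a larger exponent of `x` and is already known to vanish.
    have key : ∀ N : ℕ, ∀ m : Fin 2 →₀ ℕ, m ≠ 0 → f.totalDegree < m 0 + N → coeff m f = 0 := by
      intro N
      induction N with
      | zero =>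
        intro m _ hN
        refine coeff_eq_zero_of_totalDegree_lt (hN.trans_le ?_)
        exact Finset.single_le_sum (f := fun i => m i) (fun _ _ => Nat.zero_le _)
          (Finsupp.mem_support_iff.2 (by omega))
      | succ N ih =>
        intro m hm hN
        have e := congrArg (coeff m) hf'
        rw [coeff_sub, coeff_add, coeff_C_mul, coeff_C_mul, coeff_C_mul, coeff_X_mul_pderiv,
          coeff_X_mul_pderiv, coeff_X_mul', coeff_zero] at e
        have e0 : (if 1 ∈ m.support then coeff (m - Finsupp.single 1 1) (pderiv 0 f) else 0) = 0 := by
          split_ifs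
          · rw [coeff_pderiv, ih, zero_mul]
            · intro h
              simpa using DFunLike.congr_fun h 0
            · simp
              omega
          · rfl
        rw [e0, mul_zero, add_zero] at e
        have e2 : (a * m 0 - c * m 1) * coeff m f = 0 := by linear_combination e
        -- If `a m_0 = c m_1` with `m ≠ 0`, both exponents are positive and `a / c = m_1 / m_0` is a
        -- positive rational number.
        refine (mul_eq_zero.1 e2).resolve_left fun h => ?_
        rw [sub_eq_zero] at h
        by_cases h0 : m 0 = 0
        · have h1 : m 1 = 0 := by
            rw [h0] at h
            simpa [hc] using h.symm
          apply hm
          ext i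
          fin_cases i
          · exact h0
          · exact h1
        · have h1 : m 1 ≠ 0 := by
            intro h1
            rw [h1] at h
            simp [ha, h0] at h
          have h0' : (m 0 : K) ≠ 0 := by exact_mod_cast h0
          refine hac ((m 1 : ℚ) / m 0) (by positivity) ?_
          push_cast
          field_simp
          linear_combination h
    intro m hm
    exact key (f.totalDegree + 1) m hm (by omega)

end Derivations

/-! ### Weyl algebras, the mixed algebra, rational coefficients -/

section WeylAlgebras

open MvPolynomial

variable {K : Type u} [Field K] {n : ℕ}

theorem isCentral_multiplicativeWeyl {lam : Fin n → Fin n → K} (hn : 2 ≤ n)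
    (hlam : MultIndependent fun i j => lam j i) : Algebra.IsCentral K (MultiplicativeWeyl K lam) := by
  have : MultWeylRel K lam = QuantumSpaceRel K fun i j => lam j i := by
    ext a b
    constructor
    · rintro ⟨i, j, h⟩
      exact .xx i j h
    · rintro ⟨i, j, h⟩
      exact .xx i j h
  change Algebra.IsCentral K (RingQuot (MultWeylRel K lam))
  rw [this]
  exact isCentral_quantumSpace hn hlam

theorem isCentral_weylAlgebra [CharZero K] : Algebra.IsCentral K (WeylAlgebra K n) := by
  refine isCentral_oreAlgebra _ _ fun A _ _ ι x ⟨h, hgen, hlift⟩ => ?_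
  refine isCentral_of_symmWeylRel (q := fun _ => 1) (γ := fun _ _ => 1) (x := x)
    (y := fun i => ι (X i)) ⟨fun _ => rfl, fun _ _ => one_mul 1⟩ (fun _ => Or.inr rfl)
    ⟨fun i j => ?_, fun i j => ?_, fun i j hij => ?_, fun i => ?_⟩
    (adjoin_eq_top_of_subset hgen ?_) fun E _ _ x' y' h' => ?_
  · rw [← map_mul, mul_comm, map_mul, one_smul]
  · rw [one_smul, h.var j i]
  · simpa [pderiv_X_of_ne hij.symm] using h.coeff i (X j)
  · simpa using h.coeff i (X i)
  · rintro _ (⟨P, rfl⟩ | ⟨i, rfl⟩)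
    · have h1 : ι P ∈ (Algebra.adjoin K (Set.range (X : Fin n → MvPolynomial (Fin n) K))).map ι :=
        ⟨P, by simp [MvPolynomial.adjoin_range_X], rfl⟩
      rw [AlgHom.map_adjoin] at h1
      refine Algebra.adjoin_mono ?_ h1
      rintro _ ⟨_, ⟨i, rfl⟩, rfl⟩
      exact Or.inr ⟨i, rfl⟩
    · exact Algebra.subset_adjoin (Or.inl ⟨i, rfl⟩)
  · obtain ⟨ι', hι'⟩ := exists_mvPolynomial_algHom K y' fun i j => by simpa using h'.yy i j
    refine (hlift E ι' x' ⟨fun i r => ?_, fun i j => by simpa using h'.xx j i⟩).elim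
      fun φ ⟨hφ, hφx⟩ => ?_
    rotate_left
    · exact ⟨φ, hφx, fun i => by rw [hφ, hι']⟩
    · refine algHom_derivation MvPolynomial.adjoin_range_X ι' (pderiv i) (x' i) ?_ r
      rintro _ ⟨j, rfl⟩
      by_cases hij : i = j
      · subst hij
        simp [hι', h'.xy]
      · simp [hι', h'.xy_ne i j hij, pderiv_X_of_ne (Ne.symm hij)]

/-- The extension is read in the opposite order: `x` and `s = x_h` commute, so the algebra is `K[x,
s][t; δ]` with `δ x = -1` and `δ s = h s`, a derivation whose constants are the scalars. -/
theorem isCentral_mixedAlgebra [CharZero K] {h : K} (hh : h ≠ 0) :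
    Algebra.IsCentral K (MixedAlgebra K h) := by
  refine isCentral_oreAlgebra _ _ fun A _ _ ι x ⟨hx, hgen, hlift⟩ => ?_
  let δ : Derivation K (MvPolynomial (Fin 2) K) (MvPolynomial (Fin 2) K) :=
    MvPolynomial.mkDerivation K ![-1, h • X 1]
  have hδ : ∀ f, δ f = C h * (X 1 * pderiv 1 f) - pderiv 0 f := by
    intro f
    have : δ = (C h * X 1 : MvPolynomial (Fin 2) K) • pderiv 1 +
        (-1 : MvPolynomial (Fin 2) K) • pderiv 0 := by
      apply MvPolynomial.derivation_ext
      rw [Fin.forall_fin_two]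
      constructor <;> simp [δ, mkDerivation_X, pderiv_X, smul_eq_C_mul]
    rw [this]
    simp only [Derivation.add_apply, Derivation.smul_apply, smul_eq_mul]
    ring
  have hδ0 : δ (X 0) = -1 := by simp [δ, mkDerivation_X]
  have hδ1 : δ (X 1) = h • X 1 := by simp [δ, mkDerivation_X]
  have hxt : ι Polynomial.X * x .x = x .x * ι Polynomial.X + -1 := by
    have := hx.coeff .x Polynomial.X
    simp only [Polynomial.derivative_X, map_one] at this
    rw [this]
    abel
  have hst : ι Polynomial.X * x .y = x .y * ι Polynomial.X + h • x .y := by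
    have := hx.coeff .y Polynomial.X
    simp only [Polynomial.X_comp, map_zero, add_zero, map_sub, sub_mul] at this
    have e : ι (Polynomial.C h) = algebraMap K A h := ι.commutes h
    rw [this, e, ← Algebra.smul_def]
    abel
  obtain ⟨κ, hκ⟩ := exists_mvPolynomial_algHom K ![x .x, x .y] (by
    simp [Fin.forall_fin_two, hx.var .y .x])
  have hκx : κ (X 0) = x .x := hκ 0
  have hκs : κ (X 1) = x .y := hκ 1
  let D : Module.End K (MvPolynomial (Fin 2) K) := (δ : MvPolynomial (Fin 2) K →ₗ[K] _)
  have hD0 : D * Algebra.lmul K _ (X 0) = Algebra.lmul K _ (X 0) * D - 1 := by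
    have := lmul_derivation δ (X 0)
    rwa [hδ0, map_neg, map_one, ← sub_eq_add_neg] at this
  have hD1 : D * Algebra.lmul K _ (X 1) = Algebra.lmul K _ (X 1) * D +
      h • Algebra.lmul K _ (X 1) := by
    have := lmul_derivation δ (X 1)
    rwa [hδ1, map_smul] at this
  -- The action on `K[x, s]`, with `t` as the derivation and `x`, `s` as multiplications. Its only
  -- purpose is the injectivity of `κ`.
  refine (hlift (Module.End K (MvPolynomial (Fin 2) K)) (Polynomial.aeval D)
    (fun | .x => Algebra.lmul K _ (X 0) | .y => Algebra.lmul K _ (X 1))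
    ⟨fun i r => ?_, fun i j => ?_⟩).elim fun ρ ⟨_, hρx⟩ => ?_
  · rcases i with _ | _
    · have hd := algHom_derivation Polynomial.adjoin_X (Polynomial.aeval D)
        (Polynomial.mkDerivation K (1 : Polynomial K)) (Algebra.lmul K _ (X 0)) (by
          rintro _ rfl
          rw [Polynomial.aeval_X, Polynomial.mkDerivation_X, map_one, hD0, sub_add_cancel]) r
      rw [Polynomial.mkDerivation_apply, smul_eq_mul, mul_one] at hd
      exact hd
    · rw [map_zero, add_zero]
      refine algHom_intertwine Polynomial.adjoin_X (Polynomial.aeval D)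
        (Polynomial.aeval (Polynomial.X - Polynomial.C h)) (Algebra.lmul K _ (X 1)) ?_ r
      rintro _ rfl
      rw [Polynomial.aeval_X, Polynomial.aeval_X, map_sub, Polynomial.aeval_X, Polynomial.aeval_C,
        sub_mul, hD1, Algebra.smul_def, add_sub_cancel_right]
  · rcases i with _ | _ <;> rcases j with _ | _ <;> simp only [← map_mul, mul_comm]
  refine isCentral_of_derivation κ (injective_of_lmul _ ρ ?_) (ι Polynomial.X) δ
    (algHom_derivation MvPolynomial.adjoin_range_X _ δ _ ?_) (adjoin_eq_top_of_subset hgen ?_)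
    (X 0) ?_ fun f hf => ?_
  · apply MvPolynomial.algHom_ext
    simp [Fin.forall_fin_two, hκx, hκs, hρx]
  · rintro _ ⟨i, rfl⟩
    revert i
    rw [Fin.forall_fin_two]
    constructor
    · rw [hδ0, hκx, hxt, map_neg, map_one]
    · rw [hδ1, hκs, hst, map_smul, hκs]
  · rintro _ (⟨P, rfl⟩ | ⟨_ | _, rfl⟩)
    · have h1 : ι P ∈ (Algebra.adjoin K ({Polynomial.X} : Set (Polynomial K))).map ι :=
        ⟨P, by simp [Polynomial.adjoin_X], rfl⟩
      rw [AlgHom.map_adjoin] at h1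
      refine Algebra.adjoin_mono ?_ h1
      rintro _ ⟨_, rfl, rfl⟩
      exact Or.inr rfl
    · exact Algebra.subset_adjoin (Or.inl ⟨_, hκx⟩)
    · exact Algebra.subset_adjoin (Or.inl ⟨_, hκs⟩)
  · rw [hδ0]
    simp
  · rw [hδ] at hf
    apply eq_C_of_coeff
    have e : ∀ m : Fin 2 →₀ ℕ, h * (m 1 * coeff m f) =
        coeff (m + Finsupp.single 0 1) f * (m 0 + 1) := fun m => by
      have := congrArg (coeff m) hf
      rw [coeff_sub, coeff_C_mul, coeff_X_mul_pderiv, coeff_pderiv, coeff_zero, sub_eq_zero] at this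
      exact this
    -- Descending induction on the exponent of `x`: when `s` occurs, the recursion `e` expresses a
    -- coefficient through one with a larger exponent of `x`. Pure powers of `x` are treated
    -- afterwards by the same recursion, whose left side vanishes.
    have key : ∀ N : ℕ, ∀ m : Fin 2 →₀ ℕ, m 1 ≠ 0 → f.totalDegree < m 0 + N → coeff m f = 0 := by
      intro N
      induction N with
      | zero =>
        intro m _ hN
        refine coeff_eq_zero_of_totalDegree_lt (hN.trans_le ?_)
        exact Finset.single_le_sum (f := fun i => m i) (fun _ _ => Nat.zero_le _)
          (Finsupp.mem_support_iff.2 (by omega))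
      | succ N ih =>
        intro m hm hN
        have e' := e m
        rw [ih (m + Finsupp.single 0 1) (by simpa using hm) (by simp; omega), zero_mul] at e'
        have hm' : (m 1 : K) ≠ 0 := by exact_mod_cast hm
        simpa [hh, hm'] using e'
    intro m hm
    by_cases h1 : m 1 = 0
    · have h0 : m 0 ≠ 0 := fun h0 => hm (by
        ext i
        fin_cases i
        · exact h0
        · exact h1)
      obtain ⟨k, hk⟩ := Nat.exists_eq_succ_of_ne_zero h0
      have e' := e (m - Finsupp.single 0 1)
      rw [tsub_add_cancel_of_le (by
        rw [Finsupp.single_le_iff]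
        omega)] at e'
      have hk' : ((k : K) + 1) ≠ 0 := by exact_mod_cast Nat.succ_ne_zero k
      simpa [h1, hk, hk'] using e'.symm
    · exact key (f.totalDegree + 1) m h1 (by omega)

theorem totalDegree_pderiv_lt {τ : Type*} {i : τ} {s : MvPolynomial τ K} (h0 : pderiv i s ≠ 0) :
    (pderiv i s).totalDegree < s.totalDegree := by
  classical
  obtain ⟨m, hm, hmd⟩ := Finset.exists_mem_eq_sup (pderiv i s).support
    (by simpa [Finset.nonempty_iff_ne_empty] using h0) fun m => m.sum fun _ e => e
  have h2 : coeff (m + Finsupp.single i 1) s ≠ 0 := fun h => by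
    rw [mem_support_iff, coeff_pderiv, h, zero_mul] at hm
    exact hm rfl
  have h3 := le_totalDegree (mem_support_iff.2 h2)
  rw [Finsupp.sum_add_index' (fun _ => rfl) (fun _ _ _ => rfl), Finsupp.sum_single_index rfl] at h3
  have h4 : (pderiv i s).totalDegree = m.sum fun _ e => e := hmd
  omega

/-- A nonzero derivative has smaller total degree than `s`, so it cannot be a multiple of `s`. -/
theorem pderiv_eq_zero_of_dvd {τ : Type*} {i : τ} {s : MvPolynomial τ K} (h : s ∣ pderiv i s) :
    pderiv i s = 0 := by
  obtain ⟨q, hq⟩ := h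
  by_contra h0
  have hs : s ≠ 0 := fun h => h0 (by rw [h, map_zero])
  have hq0 : q ≠ 0 := fun h => h0 (by rw [hq, h, mul_zero])
  have h1 := totalDegree_pderiv_lt h0
  rw [hq, totalDegree_mul_of_isDomain hs hq0] at h1
  omega

theorem eq_C_of_pderiv_eq_zero [CharZero K] {τ : Type*} {p : MvPolynomial τ K}
    (h : ∀ i, pderiv i p = 0) : ∃ k, p = algebraMap K _ k := by
  refine eq_C_of_coeff fun m hm => ?_
  obtain ⟨i, hi⟩ := Finsupp.ne_iff.1 hm
  have := coeff_X_mul_pderiv i p m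
  rw [h i, mul_zero, coeff_zero] at this
  have hi' : (m i : K) ≠ 0 := by exact_mod_cast hi
  simpa [hi'] using this.symm

/-- In a reduced fraction `p / s`, the equation `p' s = p s'` makes `s` divide `s'`. Hence `s' = 0`,
then `p' = 0`, for every partial derivative. -/
theorem exists_of_ratDeriv_eq_zero [CharZero K] {f : RationalFunctions K n}
    (h : ∀ i, ratDeriv K i f = 0) : ∃ k, f = algebraMap K _ k := by
  have hrel := IsFractionRing.num_den_reduced (MvPolynomial (Fin n) K) f
  have hf := IsFractionRing.mk'_num_den (MvPolynomial (Fin n) K) f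
  have hinj := IsFractionRing.injective (MvPolynomial (Fin n) K) (RationalFunctions K n)
  have hs := nonZeroDivisors.ne_zero (IsFractionRing.den (MvPolynomial (Fin n) K) f).2
  have key : ∀ i, pderiv i (IsFractionRing.num (MvPolynomial (Fin n) K) f) *
      (IsFractionRing.den (MvPolynomial (Fin n) K) f).val =
      IsFractionRing.num (MvPolynomial (Fin n) K) f *
        pderiv i (IsFractionRing.den (MvPolynomial (Fin n) K) f).val := by
    intro i
    have := h i
    rw [ratDeriv, div_eq_zero_iff] at this
    rw [← sub_eq_zero]
    refine (map_eq_zero_iff _ hinj).1 (this.resolve_right (pow_ne_zero _ ?_))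
    rwa [Ne, map_eq_zero_iff _ hinj]
  generalize IsFractionRing.num (MvPolynomial (Fin n) K) f = p at *
  generalize IsFractionRing.den (MvPolynomial (Fin n) K) f = s at *
  have hs' : ∀ i, pderiv i s.val = 0 := fun i =>
    pderiv_eq_zero_of_dvd (hrel.symm.dvd_of_dvd_mul_left ⟨pderiv i p, by rw [← key i, mul_comm]⟩)
  obtain ⟨k, hk⟩ := eq_C_of_pderiv_eq_zero fun i => by
    have := key i
    rw [hs', mul_zero] at this
    exact (mul_eq_zero.1 this).resolve_right hs
  obtain ⟨l, hl⟩ := eq_C_of_pderiv_eq_zero hs'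
  refine ⟨k / l, ?_⟩
  have e := IsScalarTower.algebraMap_apply K (MvPolynomial (Fin n) K) (RationalFunctions K n)
  rw [← hf, IsFractionRing.mk'_eq_div, hk, hl, ← e, ← e, map_div₀]

theorem ratDeriv_X (i j : Fin n) :
    ratDeriv K i (algebraMap (MvPolynomial (Fin n) K) (RationalFunctions K n) (X j)) = if i = j then 1 else 0 := by
  have := ratDeriv_div K i (X j) 1 one_ne_zero
  rw [map_one, div_one] at this
  rw [this, pderiv_one, mul_zero, sub_zero, mul_one, one_pow, div_one]
  split_ifs with h
  · rw [h, pderiv_X_self, map_one]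
  · rw [pderiv_X_of_ne (Ne.symm h), map_zero]

/-- The variables `x_m` are eliminated one at a time: commuting with `t_m` removes `x_m`, by
`mem_of_commute` with commutator `c = 1`. What remains is a rational function whose partial
derivatives all vanish. -/
theorem isCentral_extendedWeylAlgebra [CharZero K] :
    Algebra.IsCentral K (ExtendedWeylAlgebra K n) := by
  refine isCentral_oreAlgebra _ _ fun A _ _ ι x ⟨h, hgen, _⟩ => ⟨fun z hz => ?_⟩
  -- No representation is built to show `A ≠ 0`; the zero ring is trivially central, and otherwise
  -- `ι` is injective because its source is a field.
  rcases subsingleton_or_nontrivial A with hA | hA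
  · rw [Subsingleton.elim z 0]
    exact zero_mem _
  rw [Subalgebra.mem_center_iff] at hz
  -- The subalgebra in which only the variables of index at least `m` remain; it is everything for
  -- `m = 0` and the coefficient field for `m = n`.
  let B : ℕ → Subalgebra K A := fun m => Algebra.adjoin K (Set.range ι ∪ {a | ∃ i : Fin n, m ≤ i ∧ x i = a})
  have hB0 : z ∈ B 0 := by
    have : B 0 = ⊤ := by
      rw [← hgen]
      simp only [B, Nat.zero_le, true_and]
      rfl
    rw [this]
    exact Algebra.mem_top
  have hstep : ∀ m (hm : m < n), z ∈ B m → z ∈ B (m + 1) := by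
    intro m hm hzm
    refine mem_of_commute (y := x ⟨m, hm⟩) (r := ι (algebraMap (MvPolynomial (Fin n) K) _ (X ⟨m, hm⟩))) (c := 1)
      (fun b hb => ?_) (fun b hb => ?_) ?_ (one_mem _) (fun b _ hb => by simpa using hb)
      (Algebra.adjoin_le ?_ hzm) (hz _).symm
    · induction hb using Algebra.adjoin_induction with
      | mem b hb =>
        rcases hb with ⟨f, rfl⟩ | ⟨i, _, rfl⟩
        · rw [h.coeff, add_sub_cancel_left]
          exact Algebra.subset_adjoin (Or.inl ⟨_, rfl⟩)
        · rw [h.var, sub_self]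
          exact zero_mem _
      | algebraMap k =>
        rw [Algebra.commutes, sub_self]
        exact zero_mem _
      | add b b' _ _ hb hb' =>
        have := add_mem hb hb'
        rwa [sub_add_sub_comm, ← mul_add, ← add_mul] at this
      | mul b b' hb hb' e e' =>
        have := add_mem (mul_mem e hb') (mul_mem hb e')
        convert this using 1
        noncomm_ring
    · induction hb using Algebra.adjoin_induction with
      | mem b hb =>
        rcases hb with ⟨f, rfl⟩ | ⟨i, hi, rfl⟩
        · rw [← map_mul, mul_comm, map_mul]
        · rw [h.coeff, ratDeriv_X, if_neg, map_zero, add_zero]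
          rintro rfl
          simp at hi
      | algebraMap k => rw [Algebra.commutes]
      | add b b' _ _ hb hb' => rw [add_mul, mul_add, hb, hb']
      | mul b b' _ _ e e' => rw [mul_assoc, e', ← mul_assoc, e, mul_assoc]
    · rw [h.coeff, ratDeriv_X, if_pos rfl, map_one]
    · rintro _ (⟨f, rfl⟩ | ⟨i, hi, rfl⟩)
      · exact Algebra.subset_adjoin (Or.inl (Algebra.subset_adjoin (Or.inl ⟨f, rfl⟩)))
      · rcases hi.lt_or_eq with hi | hi
        · exact Algebra.subset_adjoin (Or.inl (Algebra.subset_adjoin (Or.inr ⟨i, hi, rfl⟩)))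
        · refine Algebra.subset_adjoin (Or.inr ?_)
          subst hi
          rfl
  have hBn : ∀ m ≤ n, z ∈ B m := by
    intro m
    induction m with
    | zero => exact fun _ => hB0
    | succ m ih => exact fun hm => hstep m hm (ih (Nat.le_of_succ_le hm))
  have hrange : B n ≤ ι.range := by
    refine Algebra.adjoin_le ?_
    rintro _ (⟨f, rfl⟩ | ⟨i, hi, rfl⟩)
    · exact ⟨f, rfl⟩
    · exact absurd i.2 (not_lt.2 hi)
  obtain ⟨f, hf⟩ := hrange (hBn n le_rfl)
  obtain ⟨k, hk⟩ := exists_of_ratDeriv_eq_zero (f := f) fun i => by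
    have e := h.coeff i f
    have e' := hz (x i)
    rw [← hf] at e'
    change x i * ι f = ι f * x i at e'
    rw [e', left_eq_add] at e
    exact (map_eq_zero_iff _ ι.toRingHom.injective).1 e
  rw [Algebra.mem_bot]
  refine ⟨k, ?_⟩
  rw [← hf, hk]
  exact (ι.commutes k).symm

end WeylAlgebras

/-! ### Cancellation by a discriminant locus in the center -/

section Discriminant

variable {K : Type u} [Field K]

/-- There is a representation of `A` in an algebra over the field `F`, with central character `χ`,
such that the algebra generated by the image over `F` has the property `Q`. -/
def HasRepresentation {A : Type v} [Ring A] [Algebra K A] {F : Type w₁} [Field F] [Algebra K F]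
    (Q : ∀ (F E : Type w₁) [Field F] [Ring E] [Algebra F E], Subalgebra F E → Prop)
    (χ : Subalgebra.center K A →ₐ[K] F) : Prop :=
  ∃ (E : Type w₁) (_ : Ring E) (_ : Algebra F E) (_ : Algebra K E) (_ : IsScalarTower K F E)
    (ρ : A →ₐ[K] E), (∀ z, ρ z.val = algebraMap F E (χ z)) ∧
      Q F E (Algebra.adjoin F (Set.range ρ))

section Transport

variable {A : Type v} [Ring A] [Algebra K A] {B : Type w₂} [Ring B] [Algebra K B]
  {R : Type w₁} [CommRing R] [Algebra K R] {F : Type w₁} [Field F] [Algebra K F]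
  {Q : ∀ (F E : Type w₁) [Field F] [Ring E] [Algebra F E], Subalgebra F E → Prop}

/-- A representation of `A` extends to `A ⊗ R` by letting `R` act through scalars of `F` as `ξ`
prescribes, and restricts to `B` along `φ`. Because `R` acts by scalars, `A` and `B` generate the
same subalgebra over `F`, so any property of that subalgebra is preserved. -/
theorem HasRepresentation.transport (φ : A ⊗[K] R ≃ₐ[K] B ⊗[K] R)
    (φc : Subalgebra.center K A ⊗[K] R ≃ₐ[K] Subalgebra.center K B ⊗[K] R)
    (hφ : ∀ x, centerTensor B R (φc x) = φ (centerTensor A R x))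
    (ξ : Subalgebra.center K B ⊗[K] R →ₐ[K] F)
    (h : HasRepresentation Q
      ((ξ.comp φc.toAlgHom).comp (Algebra.TensorProduct.includeLeft (R := K) (S := K)))) :
    HasRepresentation Q (ξ.comp (Algebra.TensorProduct.includeLeft (R := K) (S := K))) := by
  obtain ⟨E, _, _, _, _, ρ, hρ, hQ⟩ := h
  let l : R →ₐ[K] E := (IsScalarTower.toAlgHom K F E).comp
    ((ξ.comp φc.toAlgHom).comp Algebra.TensorProduct.includeRight)
  have hl : ∀ r, l r = algebraMap F E (ξ (φc (1 ⊗ₜ r))) := fun r => rfl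
  let ρ' : A ⊗[K] R →ₐ[K] E := Algebra.TensorProduct.lift ρ l fun a r => by
    rw [commute_iff_eq, hl]
    exact (Algebra.commutes _ _).symm
  have hρ' : ∀ a r, ρ' (a ⊗ₜ r) = ρ a * l r := fun a r => Algebra.TensorProduct.lift_tmul _ _ _ _ _
  have hc : ∀ x, ρ' (centerTensor A R x) = algebraMap F E (ξ (φc x)) := by
    intro x
    induction x using TensorProduct.induction_on with
    | zero => simp
    | add x y hx hy => simp only [map_add, hx, hy]
    | tmul z r =>
      have e : z ⊗ₜ[K] r = (z ⊗ₜ[K] (1 : R)) * ((1 : Subalgebra.center K A) ⊗ₜ[K] r) := by simp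
      rw [centerTensor_tmul, hρ', hρ, hl, e, map_mul, map_mul, map_mul]
      rfl
  have hc' : ∀ y, ρ' (φ.symm (centerTensor B R y)) = algebraMap F E (ξ y) := by
    intro y
    obtain ⟨x, rfl⟩ := φc.surjective y
    rw [hφ, φ.symm_apply_apply, hc]
  let ρB : B →ₐ[K] E := (ρ'.comp φ.symm.toAlgHom).comp
    (Algebra.TensorProduct.includeLeft (R := K) (S := K))
  have hρB : ∀ b, ρB b = ρ' (φ.symm (b ⊗ₜ 1)) := fun b => rfl
  refine ⟨E, inferInstance, inferInstance, inferInstance, inferInstance, ρB, fun z => ?_, ?_⟩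
  · rw [hρB, ← centerTensor_tmul, hc']
    rfl
  · convert hQ using 1
    apply le_antisymm
    · refine Algebra.adjoin_le ?_
      rintro _ ⟨b, rfl⟩
      rw [hρB]
      generalize φ.symm (b ⊗ₜ 1) = x
      change ρ' x ∈ Algebra.adjoin F (Set.range ρ)
      induction x using TensorProduct.induction_on with
      | zero =>
        rw [map_zero]
        exact zero_mem _
      | add x y hx hy =>
        rw [map_add]
        exact add_mem hx hy
      | tmul a r =>
        rw [hρ', hl]
        exact mul_mem (Algebra.subset_adjoin ⟨a, rfl⟩) (Subalgebra.algebraMap_mem _ _)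
    · refine Algebra.adjoin_le ?_
      rintro _ ⟨a, rfl⟩
      have e : ρ a = ρ' (φ.symm (φ (a ⊗ₜ 1))) := by rw [φ.symm_apply_apply, hρ', map_one, mul_one]
      rw [e]
      generalize φ (a ⊗ₜ 1) = y
      change ρ' (φ.symm y) ∈ Algebra.adjoin F (Set.range ρB)
      induction y using TensorProduct.induction_on with
      | zero =>
        rw [map_zero, map_zero]
        exact zero_mem _
      | add x y hx hy =>
        rw [map_add, map_add]
        exact add_mem hx hy
      | tmul b r =>
        have e : b ⊗ₜ[K] r = (b ⊗ₜ[K] (1 : R)) *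
            centerTensor B R ((1 : Subalgebra.center K B) ⊗ₜ[K] r) := by simp
        rw [e, map_mul, map_mul, hc', ← hρB]
        exact mul_mem (Algebra.subset_adjoin ⟨b, rfl⟩) (Subalgebra.algebraMap_mem _ _)

theorem hasRepresentation_iff (φ : A ⊗[K] R ≃ₐ[K] B ⊗[K] R)
    (φc : Subalgebra.center K A ⊗[K] R ≃ₐ[K] Subalgebra.center K B ⊗[K] R)
    (hφ : ∀ x, centerTensor B R (φc x) = φ (centerTensor A R x))
    (ξ : Subalgebra.center K B ⊗[K] R →ₐ[K] F) :
    HasRepresentation Q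
      ((ξ.comp φc.toAlgHom).comp (Algebra.TensorProduct.includeLeft (R := K) (S := K))) ↔
    HasRepresentation Q (ξ.comp (Algebra.TensorProduct.includeLeft (R := K) (S := K))) := by
  refine ⟨HasRepresentation.transport φ φc hφ ξ, fun h => ?_⟩
  refine HasRepresentation.transport φ.symm φc.symm (fun y => ?_) (ξ.comp φc.toAlgHom) ?_
  · rw [AlgEquiv.eq_symm_apply, ← hφ, φc.apply_symm_apply]
  · convert h using 2
    refine AlgHom.ext fun x => ?_
    change ξ (φc (φc.symm x)) = ξ x
    rw [φc.apply_symm_apply]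

end Transport

/-- An idempotent matrix of natural numbers without zero rows and columns is the identity. -/
theorem eq_single_of_idempotent {n : ℕ} (m : Fin n → Fin n →₀ ℕ)
    (hm : ∀ i, ∑ j, m i j • m j = m i) (hrow : ∀ i, m i ≠ 0) (hcol : ∀ k, ∃ i, m i k ≠ 0) (i : Fin n) :
    m i = Finsupp.single i 1 := by
  -- Row sums. For the matrix `M` and `d = M 1`, idempotence gives `M d = M 1`; as every `d k ≥ 1`,
  -- equality forces `d k = 1` wherever column `k` has a nonzero entry, that is, for all `k`.
  let d : Fin n → ℕ := fun i => ∑ k, m i k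
  have hd : ∀ i, ∑ j, m i j * d j = ∑ j, m i j * 1 := by
    intro i
    simp only [d, Finset.mul_sum, mul_one]
    rw [Finset.sum_comm]
    refine Finset.sum_congr rfl fun k _ => ?_
    have := DFunLike.congr_fun (hm i) k
    rw [← this, Finsupp.finsetSum_apply]
    rfl
  have hpos : ∀ i, 1 ≤ d i := by
    intro i
    obtain ⟨k, hk⟩ := Finsupp.ne_iff.1 (hrow i)
    refine le_trans (Nat.one_le_iff_ne_zero.2 hk) ?_
    exact Finset.single_le_sum (f := fun k => m i k) (fun _ _ => Nat.zero_le _) (Finset.mem_univ k)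
  have hd1 : ∀ k, d k = 1 := by
    intro k
    obtain ⟨i, hi⟩ := hcol k
    have h1 := (Finset.sum_eq_sum_iff_of_le (f := fun j => m i j * 1) (g := fun j => m i j * d j)
      fun j _ => Nat.mul_le_mul_left _ (hpos j)).1 (hd i).symm k (Finset.mem_univ k)
    exact (Nat.eq_of_mul_eq_mul_left (Nat.pos_of_ne_zero hi) h1).symm
  have hf : ∀ i, ∃ j, m i = Finsupp.single j 1 := by
    intro i
    obtain ⟨k, hk⟩ := Finsupp.ne_iff.1 (hrow i)
    have hk' : m i k ≠ 0 := hk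
    have h1 : m i k + ∑ l ∈ Finset.univ.erase k, m i l = 1 := by
      rw [Finset.add_sum_erase _ (fun l => m i l) (Finset.mem_univ k)]
      exact hd1 i
    refine ⟨k, Finsupp.ext fun l => ?_⟩
    by_cases hl : k = l
    · subst hl
      rw [Finsupp.single_eq_same]
      omega
    · rw [Finsupp.single_eq_of_ne (Ne.symm hl)]
      have h2 : ∑ l ∈ Finset.univ.erase k, m i l = 0 := by omega
      exact Finset.sum_eq_zero_iff.1 h2 l (by simp [Ne.symm hl])
  choose f hf using hf
  -- The rows are unit vectors, so `M` is the matrix of a map `f`, idempotent like `M`. Nonzero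
  -- columns make `f` surjective, and a surjective idempotent map is the identity.
  have hff : ∀ i, f (f i) = f i := by
    intro i
    have := hm i
    rw [Finset.sum_eq_single (f i) (fun j _ hj => by
      rw [hf i, Finsupp.single_eq_of_ne hj, zero_smul]) (by simp)] at this
    rw [hf i, Finsupp.single_eq_same, one_smul, hf (f i)] at this
    exact (Finsupp.single_left_inj one_ne_zero).1 this
  obtain ⟨j, hj⟩ := hcol i
  have hji : f j = i := by
    by_contra h
    rw [hf j, Finsupp.single_eq_of_ne (Ne.symm h)] at hj
    exact hj rfl
  rw [hf i, ← hji, hff]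

open MvPolynomial

/-- An idempotent endomorphism that preserves the augmentation and the vanishing locus of the
product of the variables multiplies the variables by units. -/
theorem exists_unit_mul_X {R : Type*} [CommRing R] [IsDomain R] [Algebra K R] {n : ℕ}
    (T : MvPolynomial (Fin n) R →ₐ[K] MvPolynomial (Fin n) R) (hT : ∀ p, T (T p) = T p)
    (η : MvPolynomial (Fin n) R →ₐ[K] K) (hη : ∀ p, η (T p) = η p) (hηX : ∀ i, η (X i) = 0)
    (hprime : ∀ q : Ideal (MvPolynomial (Fin n) R), q.IsPrime →
      (∏ i, X i ∈ q ↔ T (∏ i, X i) ∈ q)) (i : Fin n) : ∃ u, IsUnit u ∧ T (X i) = C u * X i := by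
  -- Containment of vanishing loci is a statement about radicals, so it gives divisibility of a
  -- power.
  have hrad : ∀ x y : MvPolynomial (Fin n) R,
      (∀ q : Ideal (MvPolynomial (Fin n) R), q.IsPrime → y ∈ q → x ∈ q) → ∃ N, y ∣ x ^ N := by
    intro x y h
    have h1 : x ∈ (Ideal.span {y}).radical := by
      rw [Ideal.radical_eq_sInf, Submodule.mem_sInf]
      rintro q ⟨hq, hqp⟩
      exact h q hqp (hq (Ideal.subset_span rfl))
    obtain ⟨N, hN⟩ := h1
    exact ⟨N, Ideal.mem_span_singleton.1 hN⟩
  obtain ⟨N, hN⟩ := hrad (∏ i, X i) (T (∏ i, X i)) fun q hq h => (hprime q hq).2 h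
  obtain ⟨N', hN'⟩ := hrad (T (∏ i, X i)) (∏ i, X i) fun q hq h => (hprime q hq).1 h
  have hmon : (∏ i : Fin n, X i : MvPolynomial (Fin n) R) ^ N =
      monomial (N • ∑ i, Finsupp.single i 1) 1 := by
    have := monomial_pow (s := ∑ i : Fin n, Finsupp.single i 1) (a := (1 : R)) (e := N)
    rw [one_pow] at this
    rw [← this, monomial_sum_one]
    rfl
  -- The polynomial `T (X i)` divides a power of the product of the variables; over a domain the
  -- divisors of a monomial are monomials up to units.
  have hTX : ∀ i, ∃ m u, IsUnit u ∧ T (X i) = monomial m u := by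
    intro i
    have h1 : T (X i) ∣ monomial (N • ∑ i, Finsupp.single i 1) 1 := by
      rw [← hmon]
      exact (map_dvd T (Finset.dvd_prod_of_mem _ (Finset.mem_univ i))).trans hN
    obtain ⟨m, u, -, hu, e⟩ := dvd_monomial_one_iff_exists.1 h1
    exact ⟨m, u, hu, e⟩
  choose m u hu hm using hTX
  have hid := eq_single_of_idempotent m (fun i => ?_) (fun i h => ?_) (fun k => ?_) i
  · refine ⟨u i, hu i, ?_⟩
    rw [hm, hid, C_mul_X_eq_monomial]
  -- A unit of `R[X]` is constant, so `T` sends unit constants to constants. Comparing the exponents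
  -- in `T (T (X i)) = T (X i)` says that the matrix of exponents is idempotent.
  · have h1 := hT (X i)
    obtain ⟨v, hv, hv'⟩ := isUnit_iff_eq_C_of_isReduced.1 (((hu i).map (C (σ := Fin n))).map T)
    have h2 : T (monomial (m i) (u i)) =
        monomial (∑ j, m i j • m j) (v * ∏ j, u j ^ m i j) := by
      rw [monomial_eq, map_mul, hv', Finsupp.prod_fintype _ _ (by simp), map_prod]
      simp only [map_pow, hm, monomial_pow]
      rw [← monomial_sum_prod, C_mul_monomial]
    rw [hm i, h2, monomial_eq_monomial_iff] at h1
    exact (h1.resolve_right fun h => (hu i).ne_zero h.2).1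
  -- A zero row would make `T (X i)` a unit, although the augmentation kills it.
  · have h1 := hη (X i)
    rw [hηX, hm, h, ← C_apply] at h1
    exact ((hu i).map (C (σ := Fin n))).map η |>.ne_zero h1
  -- The prime `X k` divides some `T (X i)`, so column `k` is nonzero.
  · have h1 : (X k : MvPolynomial (Fin n) R) ∣ T (∏ i, X i) ^ N' :=
      (Finset.dvd_prod_of_mem _ (Finset.mem_univ k)).trans hN'
    have h2 := (MvPolynomial.X_prime (R := R) (i := k)).dvd_of_dvd_pow h1
    rw [map_prod] at h2
    obtain ⟨i, -, hi⟩ := (MvPolynomial.X_prime (R := R) (i := k)).exists_mem_finset_dvd h2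
    refine ⟨i, fun h0 => ?_⟩
    rw [hm, X_dvd_monomial] at hi
    exact hi.elim (hu i).ne_zero fun h => h h0

/-- Whether a central character of `B ⊗ R` lies on the locus depends only on its restriction to
`Z(B)`. So the locus is pulled back from `Z(B)` and is unchanged under the retraction onto `Z(B)`,
which therefore multiplies the variables by units. -/
theorem isUniversallyCancellative_of_discriminant {A : Type v} [Ring A] [Algebra K A] {n : ℕ}
    (e : MvPolynomial (Fin n) K ≃ₐ[K] Subalgebra.center K A)
    (Q : ∀ (F E : Type w₁) [Field F] [Ring E] [Algebra F E], Subalgebra F E → Prop)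
    (hQ : ∀ (F : Type w₁) [Field F] [Algebra K F] (χ : Subalgebra.center K A →ₐ[K] F),
      HasRepresentation Q χ ↔ χ (e (∏ i, X i)) = 0) :
    IsUniversallyCancellative.{u, v, w₁, w₂} K A := by
  intro R _ _ _ _ I ⟨eI⟩ B _ _ ⟨φ⟩
  obtain ⟨φc, hφ⟩ := exists_centerTensor_equiv φ
  have : Algebra.FiniteType K (Subalgebra.center K A) := Algebra.FiniteType.equiv inferInstance e
  let ε := augmentation I eI
  refine nonempty_algEquiv_of_surjective ε φ φc hφ ?_
  let Ψ : MvPolynomial (Fin n) R ≃ₐ[K] Subalgebra.center K A ⊗[K] R :=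
    ((algebraTensorAlgEquiv K R (σ := Fin n)).symm.restrictScalars K).trans
      ((Algebra.TensorProduct.comm K R (MvPolynomial (Fin n) K)).trans
        (Algebra.TensorProduct.congr e AlgEquiv.refl))
  have hΨX : ∀ p, Ψ (MvPolynomial.map (algebraMap K R) p) = e p ⊗ₜ 1 := fun p => by
    have : (algebraTensorAlgEquiv K R (σ := Fin n)).symm (MvPolynomial.map (algebraMap K R) p) =
        1 ⊗ₜ p := by
      rw [AlgEquiv.symm_apply_eq]
      simp
    change Algebra.TensorProduct.congr e AlgEquiv.refl (Algebra.TensorProduct.comm K R _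
      ((algebraTensorAlgEquiv K R (σ := Fin n)).symm _)) = _
    rw [this]
    simp
  have hΨC : ∀ r, Ψ (C r) = 1 ⊗ₜ r := fun r => by
    have : (algebraTensorAlgEquiv K R (σ := Fin n)).symm (C r) = r ⊗ₜ 1 := by
      rw [AlgEquiv.symm_apply_eq]
      simp [MvPolynomial.smul_eq_C_mul]
    change Algebra.TensorProduct.congr e AlgEquiv.refl (Algebra.TensorProduct.comm K R _
      ((algebraTensorAlgEquiv K R (σ := Fin n)).symm _)) = _
    rw [this]
    simp
  let Φ := Ψ.trans φc
  let η : MvPolynomial (Fin n) R →ₐ[K] K :=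
    ε.comp ((MvPolynomial.aeval (0 : Fin n → R)).restrictScalars K)
  have hηX : ∀ i, η (X i) = 0 := fun i => by simp [η]
  -- The augmentation of the factor `R` of `B ⊗ R` at the point `X = 0`, `ε` of `R[X]`. With this
  -- choice the retraction `T` fixes that point, that is, `η ∘ T = η`.
  let ε' : R →ₐ[K] K := (η.comp Φ.symm.toAlgHom).comp Algebra.TensorProduct.includeRight
  let inc : Subalgebra.center K B →ₐ[K] Subalgebra.center K B ⊗[K] R :=
    Algebra.TensorProduct.includeLeft (R := K) (S := K)
  let s : Subalgebra.center K B ⊗[K] R →ₐ[K] Subalgebra.center K B := specialize _ ε'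
  have hs : ∀ z, s (inc z) = z := fun z => by simp [s, inc]
  let T : MvPolynomial (Fin n) R →ₐ[K] MvPolynomial (Fin n) R :=
    Φ.symm.toAlgHom.comp (inc.comp (s.comp Φ.toAlgHom))
  have hTa : ∀ p, T p = Φ.symm (inc (s (Φ p))) := fun p => rfl
  have hT : ∀ p, T (T p) = T p := fun p => by
    rw [hTa (T p), hTa p, Φ.apply_symm_apply, hs]
  have hη : ∀ p, η (T p) = η p := by
    intro p
    obtain ⟨y, rfl⟩ := Φ.symm.surjective p
    rw [hTa, Φ.apply_symm_apply]
    induction y using TensorProduct.induction_on with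
    | zero => simp
    | add x y hx hy => simp only [map_add, hx, hy]
    | tmul z r =>
      have e1 : z ⊗ₜ[K] r = inc z * ((1 : Subalgebra.center K B) ⊗ₜ[K] r) := by simp [inc]
      have e2 : s (z ⊗ₜ[K] r) = ε' r • z := by simp [s]
      rw [e2, e1, map_mul, map_mul, map_smul, map_smul, map_smul, smul_eq_mul, mul_comm]
      rfl
  have hprod : (∏ i, X i : MvPolynomial (Fin n) R) =
      MvPolynomial.map (algebraMap K R) (∏ i, X i) := by simp
  have hprime : ∀ q : Ideal (MvPolynomial (Fin n) R), q.IsPrime →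
      (∏ i, X i ∈ q ↔ T (∏ i, X i) ∈ q) := by
    intro q hq
    -- The prime `q` is tested at its own residue field, where membership in `q` means vanishing.
    let F := FractionRing (MvPolynomial (Fin n) R ⧸ q)
    let χ : MvPolynomial (Fin n) R →ₐ[K] F :=
      (IsScalarTower.toAlgHom K (MvPolynomial (Fin n) R ⧸ q) F).comp (Ideal.Quotient.mkₐ K q)
    have hχ : ∀ p, χ p = 0 ↔ p ∈ q := fun p => by
      change algebraMap _ F (Ideal.Quotient.mk q p) = 0 ↔ _
      rw [map_eq_zero_iff _ (IsFractionRing.injective _ F), Ideal.Quotient.eq_zero_iff_mem]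
    have key : ∀ ξ : Subalgebra.center K B ⊗[K] R →ₐ[K] F,
        HasRepresentation Q (ξ.comp inc) ↔ ξ (Φ (∏ i, X i)) = 0 := by
      intro ξ
      rw [← hasRepresentation_iff φ φc hφ ξ, hQ]
      change ξ (φc (e (∏ i, X i) ⊗ₜ 1)) = 0 ↔ ξ (φc (Ψ (∏ i, X i))) = 0
      rw [hprod, hΨX]
    have h1 := key (χ.comp Φ.symm.toAlgHom)
    -- Composing with the retraction does not change the restriction to `Z(B)`, so both points lie
    -- on the locus or neither does.
    have h2 := key ((χ.comp Φ.symm.toAlgHom).comp (inc.comp s))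
    have h3 : ((χ.comp Φ.symm.toAlgHom).comp (inc.comp s)).comp inc =
        (χ.comp Φ.symm.toAlgHom).comp inc := by
      refine AlgHom.ext fun z => ?_
      change χ (Φ.symm (inc (s (inc z)))) = χ (Φ.symm (inc z))
      rw [hs]
    rw [h3, h1] at h2
    rw [← hχ, ← hχ]
    change χ (Φ.symm (Φ _)) = 0 ↔ _ at h2
    rw [Φ.symm_apply_apply] at h2
    exact h2
  let β : Subalgebra.center K B →ₐ[K] Subalgebra.center K A :=
    (specialize _ ε).comp (φc.symm.toAlgHom.comp inc)
  change Function.Surjective β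
  rw [← AlgHom.range_eq_top, eq_top_iff]
  rintro z -
  obtain ⟨p, rfl⟩ := e.surjective z
  have hX : ∀ i, e (X i) ∈ β.range := by
    intro i
    -- The central element `s (Φ (X i))` of `B` is sent by `β` to `ε u • e (X i)`, and `ε u ≠ 0`
    -- because `u` is a unit.
    obtain ⟨u, hu, hTX⟩ := exists_unit_mul_X T hT η hη hηX hprime i
    have h1 : β (s (Φ (X i))) = ε u • e (X i) := by
      have h2 : φc.symm (inc (s (Φ (X i)))) = Ψ (T (X i)) := by
        rw [hTa]
        exact (Ψ.apply_symm_apply _).symm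
      have h3 : (X i : MvPolynomial (Fin n) R) = MvPolynomial.map (algebraMap K R) (X i) := by simp
      change specialize _ ε (φc.symm (inc (s (Φ (X i))))) = _
      rw [h2, hTX, map_mul, hΨC, h3, hΨX]
      simp
    have h2 : e (X i) = β ((ε u)⁻¹ • s (Φ (X i))) := by
      rw [map_smul, h1, inv_smul_smul₀ (hu.map ε).ne_zero]
    exact ⟨_, h2.symm⟩
  induction p using MvPolynomial.induction_on with
  | C k => exact (e.commutes k) ▸ β.range.algebraMap_mem k
  | add p q hp hq =>
    rw [map_add]
    exact add_mem hp hq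
  | mul_X p i hp =>
    rw [map_mul]
    exact mul_mem hp (hX i)

end Discriminant

/-! ### Generalized Weyl algebras over the polynomials in `u` and `t = xy` -/

section Conformal

open MvPolynomial

variable {K : Type u} [Field K]

/-- `ux = a⁻¹xu`, `uy = ayu`, `yx = cxy + f(u)`. -/
structure ConformalEqs {E : Type*} [Ring E] [Algebra K E] (a c : K) (f : Polynomial K)
    (x y u : E) : Prop where
  ux : u * x = a⁻¹ • (x * u)
  uy : u * y = a • (y * u)
  yx : y * x = c • (x * y) + Polynomial.aeval u f

theorem aeval_mul_of_scale {E : Type*} [Ring E] [Algebra K E] {u v : E} {s : K}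
    (h : u * v = s • (v * u)) (f : Polynomial K) :
    Polynomial.aeval u f * v = v * Polynomial.aeval (s • u) f := by
  induction f using Polynomial.induction_on' with
  | add p q hp hq => rw [map_add, map_add, add_mul, mul_add, hp, hq]
  | monomial k b =>
    have : ∀ k : ℕ, u ^ k * v = v * (s • u) ^ k := fun k => by
      induction k with
      | zero => simp
      | succ k ih => rw [pow_succ, mul_assoc, h, ← mul_smul_comm, ← mul_assoc, ih, mul_assoc, pow_succ]
    rw [Polynomial.aeval_monomial, Polynomial.aeval_monomial, mul_assoc, this, Algebra.left_comm]

variable {a c : K} {f : Polynomial K}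

/-- The automorphism `u ↦ a⁻¹u`, `t ↦ ct + f(u)`. -/
noncomputable def conformalAut (ha : a ≠ 0) (hc : c ≠ 0) (f : Polynomial K) :
    MvPolynomial (Fin 2) K ≃ₐ[K] MvPolynomial (Fin 2) K :=
  AlgEquiv.ofAlgHom (aeval ![a⁻¹ • X 0, c • X 1 + Polynomial.aeval (X 0) f])
    (aeval ![a • X 0, c⁻¹ • (X 1 - Polynomial.aeval (a • X 0) f)])
    (by
      apply MvPolynomial.algHom_ext
      rw [Fin.forall_fin_two]
      constructor
      · simp [smul_smul, ha]
      · simp [← Polynomial.aeval_algHom_apply, smul_smul, ha, hc])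
    (by
      apply MvPolynomial.algHom_ext
      rw [Fin.forall_fin_two]
      constructor
      · simp [smul_smul, ha]
      · simp [← Polynomial.aeval_algHom_apply, smul_smul, hc])

variable {ha : a ≠ 0} {hc : c ≠ 0}

@[simp] theorem conformalAut_X_zero : conformalAut ha hc f (X 0) = a⁻¹ • X 0 := by
  simp [conformalAut]

@[simp] theorem conformalAut_X_one :
    conformalAut ha hc f (X 1) = c • X 1 + Polynomial.aeval (X 0) f := by
  simp [conformalAut]

@[simp] theorem conformalAut_symm_X_zero : (conformalAut ha hc f).symm (X 0) = a • X 0 := by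
  simp [conformalAut]

@[simp] theorem conformalAut_symm_X_one : (conformalAut ha hc f).symm (X 1) =
    c⁻¹ • (X 1 - Polynomial.aeval (a • X 0) f) := by
  simp [conformalAut]

/-- The eigenvalues of `u` and `t = xy`. -/
noncomputable def conformalEigen (ha : a ≠ 0) (hc : c ≠ 0) (f : Polynomial K) (t : Fin 2)
    (m : Fin 1 → ℤ) : MvPolynomial (Fin 2) K := (conformalAut ha hc f ^ m 0) (X t)

theorem conformalEigen_zero_add (m : Fin 1 → ℤ) : conformalEigen ha hc f 0 (m + Pi.single 0 1) =
    a⁻¹ • conformalEigen ha hc f 0 m := by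
  rw [conformalEigen, Pi.add_apply, Pi.single_eq_same, zpow_add_one, AlgEquiv.mul_apply,
    conformalAut_X_zero, map_smul, conformalEigen]

theorem conformalEigen_one_add (m : Fin 1 → ℤ) : conformalEigen ha hc f 1 (m + Pi.single 0 1) =
    c • conformalEigen ha hc f 1 m + Polynomial.aeval (conformalEigen ha hc f 0 m) f := by
  rw [conformalEigen, Pi.add_apply, Pi.single_eq_same, zpow_add_one, AlgEquiv.mul_apply,
    conformalAut_X_one, map_add, map_smul, ← Polynomial.aeval_algHom_apply, conformalEigen,
    conformalEigen]

theorem aeval_wshift {G : Type*} [AddCommMonoid G] {k : Type*} [CommRing k] [Algebra K k] (h : G → k)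
    (f : Polynomial K) : Polynomial.aeval (wshift 0 h : Module.End k (G →₀ k)) f =
      wshift 0 fun m => Polynomial.aeval (h m) f := by
  induction f using Polynomial.induction_on with
  | C b => simp [wshift_algebraMap]
  | add p q hp hq => simp only [map_add, hp, hq, wshift_add]
  | monomial n b ih =>
    rw [pow_succ, ← mul_assoc, map_mul, ih, Polynomial.aeval_X, wshift_mul]
    refine wshift_congr (add_zero 0) fun m => ?_
    simp

/-- The eigenvalues at `m` are the images of `u` and `t` under the `m`-th power of the automorphism.
The operator `x` is a pure shift, so `y` carries the eigenvalue of `t = xy` as its weight. -/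
theorem conformalEqs_representation (ha : a ≠ 0) (hc : c ≠ 0) (f : Polynomial K) :
    ConformalEqs a c f (wshift (Pi.single 0 1) fun _ => 1)
      (wshift (Pi.single 0 (-1)) (conformalEigen ha hc f 1))
      (wshift 0 (conformalEigen ha hc f 0) : Module.End (MvPolynomial (Fin 2) K)
        ((Fin 1 → ℤ) →₀ MvPolynomial (Fin 2) K)) where
  ux := by
    rw [wshift_mul, wshift_mul, smul_wshift]
    refine wshift_congr (by simp) fun m => ?_
    rw [conformalEigen_zero_add]
    simp
  uy := by
    rw [wshift_mul, wshift_mul, smul_wshift]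
    refine wshift_congr (by simp) fun m => ?_
    have := conformalEigen_zero_add (ha := ha) (hc := hc) (f := f) (m + Pi.single 0 (-1))
    rw [add_assoc, ← Pi.single_add, neg_add_cancel, Pi.single_zero, add_zero] at this
    rw [add_zero, this, mul_smul_comm, smul_inv_smul₀ ha, mul_comm]
  yx := by
    have e : (Pi.single 0 (-1) + Pi.single 0 1 : Fin 1 → ℤ) = 0 := by
      rw [← Pi.single_add, neg_add_cancel, Pi.single_zero]
    have e' : (Pi.single 0 1 + Pi.single 0 (-1) : Fin 1 → ℤ) = 0 := by
      rw [add_comm, e]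
    rw [wshift_mul, wshift_mul, smul_wshift, aeval_wshift, e, e', wshift_add]
    refine wshift_congr rfl fun m => ?_
    rw [mul_one, one_mul, conformalEigen_one_add]

variable {A : Type u} [Ring A] [Algebra K A] {x y u : A}

/-- The center of an algebra with generators `x`, `y`, `u` and relations `ConformalEqs`. -/
theorem ConformalEqs.center (h : ConformalEqs a c f x y u) (ha : NonRootOfUnity a) (hc : c ≠ 0)
    (hgen : Algebra.adjoin K {x, y, u} = ⊤)
    (hlift : ∀ (E : Type u) [Ring E] [Algebra K E] (x' y' u' : E), ConformalEqs a c f x' y' u' →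
      ∃ φ : A →ₐ[K] E, φ x = x' ∧ φ y = y' ∧ φ u = u') :
    ∃ ι : MvPolynomial (Fin 2) K →ₐ[K] A, Function.Injective ι ∧ ι (X 0) = u ∧ ι (X 1) = x * y ∧
      ∀ z, z ∈ Subalgebra.center K A ↔ ∃ P, z = ι P ∧ conformalAut ha.1 hc f P = P := by
  have hut : u * (x * y) = x * y * u := by
    rw [← mul_assoc, h.ux, smul_mul_assoc, mul_assoc, h.uy, mul_smul_comm, inv_smul_smul₀ ha.1,
      mul_assoc]
  obtain ⟨ι, hι⟩ := exists_mvPolynomial_algHom K ![u, x * y] (by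
    simp [Fin.forall_fin_two, hut])
  have hι0 : ι (X 0) = u := hι 0
  have hι1 : ι (X 1) = x * y := hι 1
  have hιf : ∀ (b : K), ι (Polynomial.aeval (b • X 0) f) = Polynomial.aeval (b • u) f := fun b => by
    rw [← Polynomial.aeval_algHom_apply, map_smul, hι0]
  have hιf1 : ι (Polynomial.aeval (X 0) f) = Polynomial.aeval u f := by
    rw [← Polynomial.aeval_algHom_apply, hι0]
  -- Conjugation by `y` is the automorphism and conjugation by `x` its inverse. So a polynomial in
  -- `u`, `t` is central exactly when it is invariant.
  have hxy : ∀ P, y * ι P = ι (conformalAut ha.1 hc f P) * y := by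
    refine algHom_intertwine (s := Set.range X) MvPolynomial.adjoin_range_X ι
      (conformalAut ha.1 hc f).toAlgHom y ?_
    rintro _ ⟨t, rfl⟩
    revert t
    rw [Fin.forall_fin_two]
    constructor
    · change _ = ι (conformalAut ha.1 hc f (X 0)) * y
      rw [conformalAut_X_zero, map_smul, hι0, smul_mul_assoc, h.uy, inv_smul_smul₀ ha.1]
    · change _ = ι (conformalAut ha.1 hc f (X 1)) * y
      rw [conformalAut_X_one, map_add, map_smul, hιf1, hι1, ← h.yx, mul_assoc]
  have hyx : ∀ P, x * ι P = ι ((conformalAut ha.1 hc f).symm P) * x := by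
    refine algHom_intertwine (s := Set.range X) MvPolynomial.adjoin_range_X ι
      (conformalAut ha.1 hc f).symm.toAlgHom x ?_
    rintro _ ⟨t, rfl⟩
    revert t
    rw [Fin.forall_fin_two]
    constructor
    · change _ = ι ((conformalAut ha.1 hc f).symm (X 0)) * x
      rw [conformalAut_symm_X_zero, map_smul, hι0, smul_mul_assoc, h.ux, smul_inv_smul₀ ha.1]
    · change _ = ι ((conformalAut ha.1 hc f).symm (X 1)) * x
      have e : u * x = a⁻¹ • (x * u) := h.ux
      have e' : (a • u) * x = x * u := by rw [smul_mul_assoc, e, smul_inv_smul₀ ha.1]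
      have e2 := aeval_mul_of_scale (u := a • u) (v := x) (s := a⁻¹) (by
        rw [e', mul_smul_comm, inv_smul_smul₀ ha.1]) f
      rw [inv_smul_smul₀ ha.1] at e2
      rw [conformalAut_symm_X_one, map_smul, map_sub, hιf, hι1, smul_mul_assoc, sub_mul, e2,
        mul_assoc x y x, h.yx, mul_add, add_sub_cancel_right, mul_smul_comm, inv_smul_smul₀ hc]
  have hT : IsTwistedGWA (n := 1) ι (fun _ => x) (fun _ => y) := by
    have ne : ∀ i j : Fin 1, ¬ i ≠ j := fun i j h => h (Subsingleton.elim i j)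
    refine ⟨fun i t => ⟨conformalAut ha.1 hc f (X t), ?_⟩,
      fun i t => ⟨(conformalAut ha.1 hc f).symm (X t), ?_⟩, fun i => ⟨X 1, hι1.symm⟩,
      fun i => ⟨c • X 1 + Polynomial.aeval (X 0) f, ?_⟩, fun i j hij => absurd hij (ne i j),
      fun i j hij => absurd hij (ne i j), fun i j hij => absurd hij (ne i j),
      fun i j hij => absurd hij (ne i j), ?_⟩
    · rw [hyx, AlgEquiv.symm_apply_apply]
    · rw [hxy, AlgEquiv.apply_symm_apply]
    · rw [map_add, map_smul, hιf1, hι1, h.yx]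
    · refine adjoin_eq_top_of_subset hgen ?_
      rintro _ (rfl | rfl | rfl)
      · exact Algebra.subset_adjoin (Or.inl (Or.inl ⟨0, rfl⟩))
      · exact Algebra.subset_adjoin (Or.inl (Or.inr ⟨0, rfl⟩))
      · exact Algebra.subset_adjoin (Or.inr ⟨_, hι0⟩)
  obtain ⟨ρ, hρx, hρy, hρu⟩ := hlift _ _ _ _ (conformalEqs_representation ha.1 hc f)
  have hη0 : ∀ t, conformalEigen ha.1 hc f t 0 = X t := fun t => by simp [conformalEigen]
  have hηx : ∀ t, ρ (ι (X t)) = wshift 0 (conformalEigen ha.1 hc f t) := by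
    rw [Fin.forall_fin_two]
    constructor
    · rw [hι0, hρu]
    · rw [hι1, map_mul, hρx, hρy, wshift_mul]
      exact wshift_congr (by rw [← Pi.single_add]; simp) fun m => by rw [one_mul]
  have hz := hT.center ρ (conformalEigen ha.1 hc f) hη0 (fun m hm => ⟨0, fun e => hm ?_⟩) hηx
    (fun i => ?_) (fun i => ?_)
  · have hinj : Function.Injective ι := by
      have key : ∀ P g, ρ (ι P) (Finsupp.single 0 g) = Finsupp.single 0 (P * g) := by
        intro P
        induction P using MvPolynomial.induction_on with
        | C k =>
          intro g
          have : ι (C k) = algebraMap K A k := ι.commutes k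
          rw [this, AlgHom.commutes, Module.algebraMap_end_apply, Finsupp.smul_single, C_mul']
        | add P Q hP hQ =>
          intro g
          rw [map_add, map_add, LinearMap.add_apply, hP, hQ, add_mul, Finsupp.single_add]
        | mul_X P t hP =>
          intro g
          rw [map_mul, map_mul, Module.End.mul_apply, hηx, wshift_single, add_zero, hP, hη0, mul_assoc]
      rw [injective_iff_map_eq_zero]
      intro P hP
      have := key P 1
      rw [hP, map_zero, LinearMap.zero_apply, mul_one, eq_comm, Finsupp.single_eq_zero] at this
      exact this
    refine ⟨ι, hinj, hι0, hι1, fun z => ⟨fun hzc => ?_, ?_⟩⟩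
    · obtain ⟨P, rfl, hP⟩ := hz.2 z hzc
      refine ⟨P, rfl, ?_⟩
      have : (aeval fun t => conformalEigen ha.1 hc f t (Pi.single 0 1)) =
          (conformalAut ha.1 hc f).toAlgHom := by
        apply MvPolynomial.algHom_ext
        intro t
        rw [aeval_X, conformalEigen, Pi.single_eq_same, zpow_one]
        rfl
      have e := hP 0
      rw [this] at e
      exact e
    · rintro ⟨P, rfl, hP⟩
      rw [Subalgebra.mem_center_iff]
      intro b
      have hb : b ∈ Algebra.adjoin K {x, y, u} := hgen ▸ Algebra.mem_top
      induction hb using Algebra.adjoin_induction with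
      | mem b hb =>
        rcases hb with rfl | rfl | rfl
        · rw [hyx, (AlgEquiv.symm_apply_eq _).2 hP.symm]
        · rw [hxy, hP]
        · rw [← hι0, ← map_mul, mul_comm, map_mul]
      | algebraMap k => rw [Algebra.commutes]
      | add b b' _ _ hb hb' => rw [add_mul, mul_add, hb, hb']
      | mul b b' _ _ e e' => rw [mul_assoc, e', ← mul_assoc, e, mul_assoc]
  -- The element `u` alone separates the lattice points, since `a` is not a root of unity.
  · have h1 : ∀ k : ℤ, (conformalAut ha.1 hc f ^ k) (X 0) = a⁻¹ ^ k • (X 0 : MvPolynomial (Fin 2) K) := by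
      intro k
      induction k with
      | zero => simp
      | succ k ih => rw [zpow_add_one, AlgEquiv.mul_apply, conformalAut_X_zero, map_smul, ih, smul_smul,
          zpow_add_one₀ (inv_ne_zero ha.1), mul_comm]
      | pred k ih =>
        rw [zpow_sub_one, AlgEquiv.mul_apply]
        change (conformalAut ha.1 hc f ^ (-(k : ℤ))) ((conformalAut ha.1 hc f).symm (X 0)) = _
        rw [conformalAut_symm_X_zero, map_smul, ih, smul_smul, zpow_sub_one₀ (inv_ne_zero ha.1),
          inv_inv, mul_comm]
    rw [conformalEigen, h1] at e
    have e2 := congrArg (coeff (Finsupp.single 0 1)) e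
    rw [coeff_smul, coeff_X, if_pos rfl, smul_eq_mul, mul_one, inv_zpow'] at e2
    by_contra hne
    refine ha.zpow_ne_one (m := -(m 0)) (fun h0 => hne ?_) e2
    ext i
    rw [Subsingleton.elim i 0]
    simpa using h0
  · rw [Subsingleton.elim i 0, hρx]
    exact isShift_wshift _ _ fun _ => one_ne_zero
  · rw [Subsingleton.elim i 0, hρy]
    refine isShift_wshift _ _ fun m e => ?_
    rw [conformalEigen, map_eq_zero_iff _ (AlgEquiv.injective _)] at e
    exact X_ne_zero _ e

end Conformal

/-! ### Invariants with and without resonance -/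

section ConformalCenter

open MvPolynomial

variable {K : Type u} [Field K] {a c : K} {f : Polynomial K}

theorem pderiv_conformalAut (ha : a ≠ 0) (hc : c ≠ 0) (P : MvPolynomial (Fin 2) K) :
    pderiv 1 (conformalAut ha hc f P) = c • conformalAut ha hc f (pderiv 1 P) := by
  induction P using MvPolynomial.induction_on with
  | C k =>
    have : conformalAut ha hc f (C k) = C k := (conformalAut ha hc f).commutes k
    rw [this, pderiv_C, map_zero, smul_zero]
  | add P Q hP hQ => simp only [map_add, smul_add, hP, hQ]
  | mul_X P t hP =>
    have h1 : pderiv 1 (conformalAut ha hc f (X t)) = c • conformalAut ha hc f (pderiv 1 (X t)) := by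
      revert t
      rw [Fin.forall_fin_two]
      constructor
      · simp
      · simp
    simp only [map_mul, Derivation.leibniz, map_add, smul_eq_mul, hP, h1, smul_add, mul_smul_comm]

/-- The factor `c ^ j` makes the induction on the degree work: the derivative in `t` satisfies the
same equation with `j + 1`, so it vanishes. Then `P` is a polynomial in `u` alone, on which the
automorphism is diagonal, and a nonzero coefficient of `u ^ k` requires `c ^ j = a ^ k`. -/
theorem eq_C_of_conformalAut_eq [CharZero K] (ha : a ≠ 0) (hc : c ≠ 0)
    (hres : ∀ j k : ℕ, c ^ j = a ^ k → j = 0 ∧ k = 0) :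
    ∀ (N : ℕ) (P : MvPolynomial (Fin 2) K) (j : ℕ), P.totalDegree < N →
      P = c ^ j • conformalAut ha hc f P → (∃ k, P = C k) ∧ (j ≠ 0 → P = 0) := by
  intro N
  induction N with
  | zero => exact fun P j h => absurd h (Nat.not_lt_zero _)
  | succ N ih =>
    intro P j hdeg hP
    have hd : pderiv 1 P = 0 := by
      by_contra h0
      have h1 : pderiv 1 P = c ^ (j + 1) • conformalAut ha hc f (pderiv 1 P) := by
        conv_lhs => rw [hP]
        rw [Derivation.map_smul, pderiv_conformalAut, smul_smul, pow_succ]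
      exact h0 ((ih _ (j + 1) (by have := totalDegree_pderiv_lt h0; omega) h1).2 (Nat.succ_ne_zero j))
    have hc1 : ∀ m : Fin 2 →₀ ℕ, m 1 ≠ 0 → coeff m P = 0 := fun m hm => by
      have := coeff_X_mul_pderiv 1 P m
      rw [hd, mul_zero, coeff_zero] at this
      have hm' : (m 1 : K) ≠ 0 := by exact_mod_cast hm
      simpa [hm'] using this.symm
    let s : Fin 2 → K := ![a⁻¹, c]
    have hs : conformalAut ha hc f P = aeval (fun t => C (s t) * X t) P := by
      have hv : ∀ (Q : MvPolynomial (Fin 2) K), (∀ m ∈ Q.support, m 1 = 0) →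
          conformalAut ha hc f Q = aeval (fun t => C (s t) * X t) Q := by
        intro Q hQ
        conv_lhs => rw [Q.as_sum]
        conv_rhs => rw [Q.as_sum]
        rw [map_sum, map_sum]
        refine Finset.sum_congr rfl fun m hm => ?_
        have h1 := hQ m hm
        have hm0 : m = Finsupp.single 0 (m 0) := by
          ext i
          fin_cases i
          · simp
          · simp [h1]
        rw [hm0, ← C_mul_X_pow_eq_monomial, map_mul, map_mul, map_pow, map_pow, conformalAut_X_zero, aeval_X]
        have h2 : conformalAut ha hc f (C (coeff (Finsupp.single 0 (m 0)) Q)) =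
          C (coeff (Finsupp.single 0 (m 0)) Q) := (conformalAut ha hc f).commutes _
        rw [h2, aeval_C, smul_eq_C_mul]
        rfl
      refine hv P fun m hm => ?_
      by_contra h
      exact (mem_support_iff.1 hm) (hc1 m h)
    have hcoef : ∀ m : Fin 2 →₀ ℕ, coeff m P ≠ 0 → j = 0 ∧ m = 0 := by
      intro m hm
      have h1 : m 1 = 0 := by
        by_contra h
        exact hm (hc1 m h)
      have e := congrArg (coeff m) hP
      rw [hs, coeff_smul, coeff_aeval_scale, Finsupp.prod_fintype _ _ (by simp), Fin.prod_univ_two,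
        h1, pow_zero, mul_one, smul_eq_mul, ← mul_assoc] at e
      have e2 : c ^ j * (s 0) ^ m 0 = 1 := by
        have := mul_right_cancel₀ hm ((one_mul _).trans e)
        exact this.symm
      have e3 : c ^ j = a ^ m 0 := by
        change c ^ j * a⁻¹ ^ m 0 = 1 at e2
        rwa [inv_pow, mul_inv_eq_one₀ (pow_ne_zero _ ha)] at e2
      refine ⟨(hres _ _ e3).1, ?_⟩
      ext i
      fin_cases i
      · exact (hres _ _ e3).2
      · exact h1
    refine ⟨eq_C_of_coeff fun m hm => ?_, fun hj => ?_⟩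
    · by_contra h
      exact hm (hcoef m h).2
    · ext m
      rw [coeff_zero]
      by_contra h
      exact hj (hcoef m h).1

variable {A : Type u} [Ring A] [Algebra K A] {x y u : A}

theorem ConformalEqs.isCentral [CharZero K] (h : ConformalEqs a c f x y u) (ha : NonRootOfUnity a)
    (hc : c ≠ 0) (hres : ∀ j k : ℕ, c ^ j = a ^ k → j = 0 ∧ k = 0)
    (hgen : Algebra.adjoin K {x, y, u} = ⊤)
    (hlift : ∀ (E : Type u) [Ring E] [Algebra K E] (x' y' u' : E), ConformalEqs a c f x' y' u' →
      ∃ φ : A →ₐ[K] E, φ x = x' ∧ φ y = y' ∧ φ u = u') : Algebra.IsCentral K A := by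
  obtain ⟨ι, -, -, -, hz⟩ := h.center ha hc hgen hlift
  constructor
  intro z hzc
  obtain ⟨P, rfl, hP⟩ := (hz z).1 hzc
  obtain ⟨⟨k, rfl⟩, -⟩ := eq_C_of_conformalAut_eq ha.1 hc hres (P.totalDegree + 1) P 0 (Nat.lt_succ_self _)
    (by rw [pow_zero, one_smul, hP])
  exact ⟨k, (ι.commutes k).symm⟩

/-- Solved coefficient by coefficient, dividing by `c - a ^ (-k)`. The solution makes `w = t + g(u)`
an eigenvector of the automorphism with eigenvalue `c`. -/
theorem exists_conformal_shift (hca : ∀ k : ℕ, c ≠ a⁻¹ ^ k) (f : Polynomial K) :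
    ∃ g : Polynomial K, f + g.comp (Polynomial.C a⁻¹ * Polynomial.X) = Polynomial.C c * g := by
  refine ⟨f.sum fun k b => Polynomial.monomial k (b / (c - a⁻¹ ^ k)), ?_⟩
  have hco : ∀ k, (f.sum fun k b => Polynomial.monomial k (b / (c - a⁻¹ ^ k))).coeff k =
      f.coeff k / (c - a⁻¹ ^ k) := by
    intro k
    rw [Polynomial.sum_def, Polynomial.finsetSum_coeff]
    simp only [Polynomial.coeff_monomial, Finset.sum_ite_eq', Polynomial.mem_support_iff, ne_eq]
    split_ifs with h
    · rfl
    · rw [Polynomial.notMem_support_iff.1 h, zero_div]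
  ext k
  rw [Polynomial.coeff_add, Polynomial.comp_C_mul_X_coeff, Polynomial.coeff_C_mul, hco]
  have : c - a⁻¹ ^ k ≠ 0 := sub_ne_zero.2 (hca k)
  generalize a⁻¹ ^ k = r at *
  field_simp
  ring

/-- The exponents `(l, k)` with `c ^ l = a ^ k` are the multiples of one of them. -/
theorem exists_resonance (ha : NonRootOfUnity a) (hc : NonRootOfUnity c)
    (hres : ¬ ∀ j k : ℕ, c ^ j = a ^ k → j = 0 ∧ k = 0) : ∃ l k : ℕ, l ≠ 0 ∧ k ≠ 0 ∧ c ^ l = a ^ k ∧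
      ∀ l' k' : ℕ, c ^ l' = a ^ k' → ∃ q, l' = q * l ∧ k' = q * k := by
  classical
  have hex : ∃ l : ℕ, l ≠ 0 ∧ ∃ k : ℕ, c ^ l = a ^ k := by
    push Not at hres
    obtain ⟨j, k, e, hjk⟩ := hres
    refine ⟨j, fun h => hjk h ?_, k, e⟩
    by_contra hk
    rw [h, pow_zero] at e
    exact ha.pow_ne_one hk e.symm
  obtain ⟨hl, k, hk⟩ := Nat.find_spec hex
  have hmin := fun m (hm : m < Nat.find hex) => Nat.find_min hex hm
  generalize Nat.find hex = l at *
  have hk0 : k ≠ 0 := by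
    rintro rfl
    exact hc.pow_ne_one hl (by rw [hk, pow_zero])
  refine ⟨l, k, hl, hk0, hk, fun l' k' e => ?_⟩
  have hzinj : ∀ m m' : ℤ, a ^ m = a ^ m' → m = m' := fun m m' h => by
    by_contra hne
    refine ha.zpow_ne_one (sub_ne_zero.2 hne) ?_
    rw [zpow_sub₀ ha.1, h, div_self (zpow_ne_zero _ ha.1)]
  -- Both `(l, k)` and `(l', k')` solve the equation; raising each to the other's first exponent and
  -- using that `a` has infinite order shows them proportional.
  have hcross : l' * k = k' * l := by
    have : a ^ ((k' * l : ℕ) : ℤ) = a ^ ((l' * k : ℕ) : ℤ) := by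
      rw [zpow_natCast, zpow_natCast, pow_mul, ← e, ← pow_mul, mul_comm l' l, pow_mul, hk, ← pow_mul,
        mul_comm k l']
    exact_mod_cast (hzinj _ _ this).symm
  -- Otherwise subtracting a multiple of `(l, k)` would give a solution with a smaller positive
  -- first exponent.
  have hr : l' % l = 0 := by
    by_contra hr0
    refine hmin (l' % l) (Nat.mod_lt _ (Nat.pos_of_ne_zero hl)) ⟨hr0, k' - l' / l * k, ?_⟩
    have hle : l' / l * k ≤ k' := by
      have h1 : l' / l * l ≤ l' := Nat.div_mul_le_self _ _
      have h2 : l' / l * k * l ≤ k' * l := by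
        calc l' / l * k * l = l' / l * l * k := by ring
          _ ≤ l' * k := Nat.mul_le_mul_right _ h1
          _ = k' * l := hcross
      exact Nat.le_of_mul_le_mul_right h2 (Nat.pos_of_ne_zero hl)
    have h3 : c ^ (l' / l * l) * c ^ (l' % l) = a ^ (l' / l * k) * a ^ (k' - l' / l * k) := by
      rw [← pow_add, ← pow_add, Nat.add_sub_cancel' hle, ← e, Nat.div_add_mod']
    have h4 : c ^ (l' / l * l) = a ^ (l' / l * k) := by
      rw [mul_comm, pow_mul, hk, ← pow_mul, mul_comm]
    rw [h4] at h3
    exact mul_left_cancel₀ (pow_ne_zero _ ha.1) h3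
  obtain ⟨q, rfl⟩ := Nat.dvd_of_mod_eq_zero hr
  refine ⟨q, mul_comm _ _, ?_⟩
  have : k' * l = q * k * l := by rw [← hcross]; ring
  exact Nat.eq_of_mul_eq_mul_right (Nat.pos_of_ne_zero hl) this

theorem exists_center_equiv {A : Type*} [Ring A] [Algebra K A] {n : ℕ}
    (κ : MvPolynomial (Fin n) K →ₐ[K] A)
    (hinj : Function.Injective κ) (hmem : ∀ p, κ p ∈ Subalgebra.center K A)
    (hsurj : ∀ z ∈ Subalgebra.center K A, ∃ p, κ p = z) :
    ∃ e : MvPolynomial (Fin n) K ≃ₐ[K] Subalgebra.center K A, ∀ p, (e p).val = κ p :=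
  ⟨AlgEquiv.ofBijective (κ.codRestrict _ hmem) ⟨fun _ _ h => hinj (congrArg Subtype.val h),
    fun z => (hsurj z.1 z.2).imp fun _ h => Subtype.ext h⟩, fun _ => rfl⟩

/-- The polynomials in `u` and `w = xy + g(u)`, in the resonant case. -/
theorem ConformalEqs.exists_center_equiv (h : ConformalEqs a c f x y u) (ha : NonRootOfUnity a)
    (hc : NonRootOfUnity c) (hres : ¬ ∀ j k : ℕ, c ^ j = a ^ k → j = 0 ∧ k = 0)
    (hgen : Algebra.adjoin K {x, y, u} = ⊤)
    (hlift : ∀ (E : Type u) [Ring E] [Algebra K E] (x' y' u' : E), ConformalEqs a c f x' y' u' →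
      ∃ φ : A →ₐ[K] E, φ x = x' ∧ φ y = y' ∧ φ u = u') :
    ∃ (e : MvPolynomial (Fin 1) K ≃ₐ[K] Subalgebra.center K A) (k : ℕ) (w : A), k ≠ 0 ∧
      u * w = w * u ∧ ∃ l, (e (X 0)).val = u ^ k * w ^ l := by
  obtain ⟨ι, hinj, hι0, hι1, hz⟩ := h.center ha hc.1 hgen hlift
  obtain ⟨l, k, hl, hk, hlk, hmul⟩ := exists_resonance ha hc hres
  -- If `c = a ^ (-j)`, the resonance `c ^ l = a ^ k` would give `a ^ (k + j l) = 1`.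
  obtain ⟨g, hg⟩ := exists_conformal_shift (a := a) (c := c) (fun j hj => by
    refine ha.pow_ne_one (m := k + j * l) (by positivity) ?_
    rw [pow_add, ← hlk, hj, pow_mul, ← mul_pow, inv_pow, inv_mul_cancel₀ (pow_ne_zero _ ha.1),
      one_pow]) f
  let G : MvPolynomial (Fin 2) K := Polynomial.aeval (X 0) g
  -- The change of variables `t ↦ t + g(u)` diagonalizes the automorphism, with eigenvalues `a⁻¹`
  -- and `c`.
  let ψ : MvPolynomial (Fin 2) K ≃ₐ[K] MvPolynomial (Fin 2) K :=
    AlgEquiv.ofAlgHom (aeval ![X 0, X 1 + G]) (aeval ![X 0, X 1 - G])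
      (by
        apply MvPolynomial.algHom_ext
        rw [Fin.forall_fin_two]
        constructor <;> simp [G, ← Polynomial.aeval_algHom_apply])
      (by
        apply MvPolynomial.algHom_ext
        rw [Fin.forall_fin_two]
        constructor <;> simp [G, ← Polynomial.aeval_algHom_apply])
  have hψ0 : ψ (X 0) = X 0 := by simp [ψ]
  have hψ1 : ψ (X 1) = X 1 + G := by simp [ψ]
  let s : Fin 2 → K := ![a⁻¹, c]
  let σ₀ : MvPolynomial (Fin 2) K →ₐ[K] MvPolynomial (Fin 2) K := aeval fun t => C (s t) * X t
  have hσ : ∀ Q, conformalAut ha.1 hc.1 f (ψ Q) = ψ (σ₀ Q) := by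
    intro Q
    have : (conformalAut ha.1 hc.1 f).toAlgHom.comp ψ.toAlgHom = ψ.toAlgHom.comp σ₀ := by
      apply MvPolynomial.algHom_ext
      rw [Fin.forall_fin_two]
      constructor
      · change conformalAut ha.1 hc.1 f (ψ (X 0)) = ψ (σ₀ (X 0))
        rw [hψ0, conformalAut_X_zero]
        simp [σ₀, s, smul_eq_C_mul, ψ]
      · change conformalAut ha.1 hc.1 f (ψ (X 1)) = ψ (σ₀ (X 1))
        have e := congrArg (Polynomial.aeval (X 0 : MvPolynomial (Fin 2) K)) hg
        rw [map_add, map_mul, Polynomial.aeval_comp, Polynomial.aeval_C, map_mul, Polynomial.aeval_C,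
          Polynomial.aeval_X, ← Algebra.smul_def, ← Algebra.smul_def] at e
        have e2 : ψ (σ₀ (X 1)) = c • (X 1 + G) := by
          have : σ₀ (X 1) = c • X 1 := by simp [σ₀, s, smul_eq_C_mul]
          rw [this, map_smul, hψ1]
        rw [e2, hψ1, map_add, conformalAut_X_one, smul_add, ← e, ← Polynomial.aeval_algHom_apply,
          conformalAut_X_zero, add_assoc]
    exact DFunLike.congr_fun this Q
  -- The invariant monomials are those whose exponents solve the resonance equation, hence the
  -- powers of this one.
  let M : MvPolynomial (Fin 2) K := X 0 ^ k * X 1 ^ l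
  let μ : MvPolynomial (Fin 1) K →ₐ[K] MvPolynomial (Fin 2) K := aeval fun _ => M
  have hμ : ∀ p, σ₀ (μ p) = μ p := by
    intro p
    have : σ₀.comp μ = μ := by
      apply MvPolynomial.algHom_ext
      intro i
      have hs : a⁻¹ ^ k * c ^ l = 1 := by
        rw [hlk, ← mul_pow, inv_mul_cancel₀ ha.1, one_pow]
      have hs' : (C (a⁻¹) ^ k * C c ^ l : MvPolynomial (Fin 2) K) = 1 := by
        rw [← C_pow, ← C_pow, ← C_mul, hs, C_1]
      have e : σ₀ M = (C a⁻¹ * X 0) ^ k * (C c * X 1) ^ l := by simp [σ₀, M, s]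
      rw [AlgHom.comp_apply, aeval_X, e]
      linear_combination (X 0 ^ k * X 1 ^ l) * hs'
    exact DFunLike.congr_fun this p
  -- Setting the first variable to `1` turns the map into `X ↦ X ^ l`, which is injective since `l ≠
  -- 0`.
  have hμinj : Function.Injective μ := by
    have : (aeval ![1, X 0] : MvPolynomial (Fin 2) K →ₐ[K] MvPolynomial (Fin 1) K).comp μ =
        expand l := by
      apply MvPolynomial.algHom_ext
      intro i
      rw [Subsingleton.elim i 0]
      simp [μ, M]
    refine Function.Injective.of_comp (f := (aeval ![1, X 0] :
      MvPolynomial (Fin 2) K →ₐ[K] MvPolynomial (Fin 1) K)) ?_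
    rw [← AlgHom.coe_comp, this]
    exact expand_injective (Nat.pos_of_ne_zero hl)
  obtain ⟨e, he⟩ := ZariskiPBW.exists_center_equiv (ι.comp (ψ.toAlgHom.comp μ))
    (hinj.comp (ψ.injective.comp hμinj))
    (fun p => (hz _).2 ⟨ψ (μ p), rfl, by rw [hσ, hμ]⟩) (fun z hzc => by
      obtain ⟨P, rfl, hP⟩ := (hz z).1 hzc
      obtain ⟨Q, rfl⟩ := ψ.surjective P
      rw [hσ] at hP
      have hQ := ψ.injective hP
      have hr : Q ∈ μ.range := by
        rw [Q.as_sum]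
        refine sum_mem fun m hm => ?_
        have e1 := congrArg (coeff m) hQ
        rw [coeff_aeval_scale, Finsupp.prod_fintype _ _ (by simp), Fin.prod_univ_two] at e1
        have e2 : a⁻¹ ^ m 0 * c ^ m 1 = 1 :=
          mul_right_cancel₀ (mem_support_iff.1 hm) (e1.trans (one_mul _).symm)
        obtain ⟨q, h1, h0⟩ := hmul (m 1) (m 0) (by
          rwa [inv_pow, inv_mul_eq_one₀ (pow_ne_zero _ ha.1), eq_comm] at e2)
        refine ⟨C (coeff m Q) * X 0 ^ q, ?_⟩
        change μ _ = _
        rw [monomial_eq, Finsupp.prod_fintype _ _ (by simp), Fin.prod_univ_two, h0, h1]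
        simp only [μ, M, map_mul, map_pow, aeval_X, aeval_C, algebraMap_eq, mul_pow, ← pow_mul,
          mul_comm q]
      obtain ⟨p, hp⟩ := hr
      exact ⟨p, congrArg (fun Q => ι (ψ Q)) hp⟩)
  refine ⟨e, k, ι (ψ (X 1)), hk, ?_, l, ?_⟩
  · rw [← hι0, ← map_mul, mul_comm, map_mul]
  · rw [he]
    change ι (ψ (μ (X 0))) = _
    rw [aeval_X, map_mul, map_pow, map_pow, hψ0, map_mul, map_pow, map_pow, hι0]

end ConformalCenter

/-! ### The conformal and Woronowicz algebras -/

section ConformalCancellation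

variable {K : Type u} [Field K]

/-- A presentation lifts to algebras in every universe. -/
theorem IsPresentation.exists_algHom {X : Type v} {r : FreeAlgebra K X → FreeAlgebra K X → Prop}
    {A : Type*} [Ring A] [Algebra K A] {g : X → A} (hg : IsPresentation r g) {E : Type*} [Ring E]
    [Algebra K E] {f : X → E} (hf : Satisfies r f) : ∃ φ : A →ₐ[K] E, ∀ x, φ (g x) = f x := by
  obtain ⟨g₁, hg₁, β, hβ⟩ : ∃ g₁ : X → RingQuot r, Satisfies r g₁ ∧
      ∃ β : RingQuot r →ₐ[K] E, ∀ x, β (g₁ x) = f x := by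
    refine ⟨fun x => RingQuot.mkAlgHom K r (ZariskiPBW.gen K x), fun a b h => ?_,
      RingQuot.liftAlgHom K ⟨FreeAlgebra.lift K f, hf⟩, fun x =>
        (RingQuot.liftAlgHom_mkAlgHom_apply ..).trans (FreeAlgebra.lift_ι_apply _ x)⟩
    have hπ : FreeAlgebra.lift K (fun x => RingQuot.mkAlgHom K r (ZariskiPBW.gen K x)) =
        RingQuot.mkAlgHom K r := by
      ext x
      exact FreeAlgebra.lift_ι_apply _ x
    rw [hπ, RingQuot.mkAlgHom_rel K h]
  obtain ⟨α, hα⟩ := hg.lift _ g₁ hg₁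
  exact ⟨β.comp α, fun x => by rw [AlgHom.comp_apply, hα, hβ]⟩

/-- If `h(u) = 0`, then the elements of `F[u]` are algebraic. -/
theorem isAlgebraic_of_mem_adjoin {F E : Type*} [Field F] [Ring E] [Algebra F E] {u v : E}
    {h : Polynomial F} (h0 : h ≠ 0) (hu : Polynomial.aeval u h = 0) (hv : v ∈ Algebra.adjoin F {u}) :
    IsAlgebraic F v := by
  rw [Algebra.adjoin_singleton_eq_range_aeval] at hv
  obtain ⟨q, rfl⟩ := hv
  have := (AdjoinRoot.powerBasis h0).finite
  obtain ⟨p, hp, hpq⟩ := IsIntegral.of_finite F (AdjoinRoot.mkₐ h q)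
  refine ⟨p, hp.ne_zero, ?_⟩
  rw [← Polynomial.aeval_def, Polynomial.aeval_algHom_apply] at hpq
  obtain ⟨s, hs⟩ := AdjoinRoot.mk_eq_zero.1 hpq
  change Polynomial.aeval (Polynomial.aeval u q) p = 0
  rw [Polynomial.aeval_algHom_apply, hs, map_mul, hu, zero_mul]

variable {a c : K} {f : Polynomial K} {A : Type u} [Ring A] [Algebra K A] {x y u : A}

/-- In the resonant case the center is generated by `u ^ k w ^ l` with `k > 0`. Where it acts as a
nonzero scalar, a commutative image kills `x` and `y`, because `u` rescales them by factors other
than `1`; then `f(u) = 0` and the image is algebraic. Where it acts as zero, sending `u` to `0`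
gives a commutative image in a field of rational functions. -/
theorem ConformalEqs.isUniversallyCancellative [CharZero K] (h : ConformalEqs a c f x y u)
    (ha : NonRootOfUnity a) (hc : NonRootOfUnity c) (hf : f ≠ 0)
    (hgen : Algebra.adjoin K {x, y, u} = ⊤)
    (hlift : ∀ (E : Type u) [Ring E] [Algebra K E] (x' y' u' : E), ConformalEqs a c f x' y' u' →
      ∃ φ : A →ₐ[K] E, φ x = x' ∧ φ y = y' ∧ φ u = u')
    (hlift' : ∀ (E : Type w₁) [Ring E] [Algebra K E] (x' y' u' : E), ConformalEqs a c f x' y' u' →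
      ∃ φ : A →ₐ[K] E, φ x = x' ∧ φ y = y' ∧ φ u = u') :
    IsUniversallyCancellative.{u, u, w₁, w₂} K A := by
  by_cases hres : ∀ j k : ℕ, c ^ j = a ^ k → j = 0 ∧ k = 0
  · have := h.isCentral ha hc.1 hres hgen hlift
    exact isUniversallyCancellative_of_isCentral
  obtain ⟨e, k, w, hk, huw, l, he⟩ := h.exists_center_equiv ha hc hres hgen hlift
  obtain ⟨k, rfl⟩ := Nat.exists_eq_succ_of_ne_zero hk
  refine isUniversallyCancellative_of_discriminant e
    (fun F E _ _ _ V => (∀ s ∈ V, ∀ t ∈ V, s * t = t * s) ∧ ∃ v ∈ V, Transcendental F v)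
    fun F _ _ χ => ?_
  rw [Fin.prod_univ_one]
  constructor
  · rintro ⟨E, _, _, _, _, ρ, hρ, hcomm, v, hv, htr⟩
    by_contra hχ
    apply htr
    have hmem : ∀ b, ρ b ∈ Algebra.adjoin F (Set.range ρ) := fun b =>
      Algebra.subset_adjoin ⟨b, rfl⟩
    -- In a commutative image `u b = s b u` with `s ≠ 1` gives `u b = 0`. As `u` is a factor of the
    -- central generator, which acts as a nonzero scalar, `b` acts as zero.
    have hzero : ∀ (b : A) (s : K), s ≠ 1 → u * b = s • (b * u) → ρ b = 0 := by
      intro b s hs hub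
      have h1 : ρ u * ρ b = 0 := by
        have e1 := congrArg ρ hub
        rw [map_smul, map_mul, map_mul, hcomm _ (hmem b) _ (hmem u)] at e1
        have e2 : (1 - s) • (ρ u * ρ b) = 0 := by
          rw [sub_smul, one_smul, ← e1, sub_self]
        exact (smul_eq_zero.1 e2).resolve_left (sub_ne_zero.2 (Ne.symm hs))
      have h2 := hρ (e (MvPolynomial.X 0))
      have h3 : (algebraMap F E (χ (e (MvPolynomial.X 0)))) * ρ b = 0 := by
        rw [← h2, he, ((show Commute u w from huw).pow_pow (k + 1) l).eq, pow_succ, map_mul, map_mul,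
          mul_assoc, mul_assoc, h1, mul_zero, mul_zero]
      rw [← Algebra.smul_def] at h3
      exact (smul_eq_zero.1 h3).resolve_left hχ
    have hx : ρ x = 0 := hzero x a⁻¹ (fun h => ha.ne_one (inv_eq_one.1 h)) h.ux
    have hy : ρ y = 0 := hzero y a ha.ne_one h.uy
    have hu : Polynomial.aeval (ρ u) (f.map (algebraMap K F)) = 0 := by
      have e1 := congrArg ρ h.yx
      rw [map_mul, map_add, map_smul, map_mul, hx, hy, zero_mul, smul_zero, zero_add,
        ← Polynomial.aeval_algHom_apply] at e1
      rw [Polynomial.aeval_map_algebraMap, ← e1]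
    refine isAlgebraic_of_mem_adjoin (Polynomial.map_ne_zero hf) hu (Algebra.adjoin_le ?_ hv)
    rintro _ ⟨b, rfl⟩
    have hb : b ∈ Algebra.adjoin K {x, y, u} := hgen ▸ Algebra.mem_top
    change ρ b ∈ Algebra.adjoin F {ρ u}
    induction hb using Algebra.adjoin_induction with
    | mem b hb =>
      rcases hb with rfl | rfl | rfl
      · exact hx ▸ zero_mem _
      · exact hy ▸ zero_mem _
      · exact Algebra.subset_adjoin rfl
    | algebraMap k =>
      rw [AlgHom.commutes, IsScalarTower.algebraMap_apply K F E]
      exact Subalgebra.algebraMap_mem _ _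
    | add b b' _ _ hb hb' =>
      rw [map_add]
      exact add_mem hb hb'
    | mul b b' _ _ hb hb' =>
      rw [map_mul]
      exact mul_mem hb hb'
  · intro hχ
    let T : RatFunc F := RatFunc.X
    have hT : T ≠ 0 := RatFunc.X_ne_zero
    -- For `u = 0` and commuting `x`, `y` the last relation reads `xy = c xy + f(0)`, so `xy = f(0)
    -- / (1 - c)`.
    let y' : RatFunc F := algebraMap K (RatFunc F) (f.coeff 0 / (1 - c)) * T⁻¹
    obtain ⟨ρ, hρx, -, hρu⟩ := hlift' (RatFunc F) T y' 0 ⟨by simp, by simp, by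
      have h1 : y' * T = algebraMap K (RatFunc F) (f.coeff 0 / (1 - c)) := by
        rw [mul_assoc, inv_mul_cancel₀ hT, mul_one]
      have h2 : (1 - c) ≠ 0 := sub_ne_zero.2 hc.ne_one.symm
      have h3 : f.coeff 0 / (1 - c) = c * (f.coeff 0 / (1 - c)) + f.coeff 0 := by
        field_simp
        ring
      rw [mul_comm T, h1, Polynomial.aeval_def, Polynomial.eval₂_at_zero, Algebra.smul_def, ← map_mul,
        ← map_add, ← h3]⟩
    refine ⟨RatFunc F, inferInstance, inferInstance, inferInstance, inferInstance, ρ, fun z => ?_,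
      fun s _ t _ => mul_comm s t, T, Algebra.subset_adjoin ⟨x, hρx⟩, RatFunc.transcendental_X⟩
    have : (ρ.comp (Subalgebra.val _)).comp e.toAlgHom =
        ((IsScalarTower.toAlgHom K F (RatFunc F)).comp χ).comp e.toAlgHom := by
      apply MvPolynomial.algHom_ext
      intro i
      rw [Subsingleton.elim i 0]
      change ρ (e (MvPolynomial.X 0)).val = algebraMap F _ (χ (e (MvPolynomial.X 0)))
      rw [hχ, he, map_mul, map_pow, hρu, map_zero, zero_pow (Nat.succ_ne_zero k), zero_mul]
    obtain ⟨p, rfl⟩ := e.surjective z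
    exact DFunLike.congr_fun this p

/-- The change of variables `u = z + (a - 1)⁻¹`. -/
theorem satisfies_conformalRel_iff {E : Type*} [Ring E] [Algebra K E] {a b c : K} (ha : a ≠ 0)
    (ha1 : a ≠ 1) (f : XYZ → E) : Satisfies (ConformalRel K a b c) f ↔
      ConformalEqs a c (Polynomial.C b * (Polynomial.X - Polynomial.C (a - 1)⁻¹) ^ 2 +
        (Polynomial.X - Polynomial.C (a - 1)⁻¹)) (f XYZ.x) (f XYZ.y)
        (f XYZ.z + algebraMap K E (a - 1)⁻¹) := by
  have ha' : a - 1 ≠ 0 := sub_ne_zero.2 ha1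
  have e1 : (f XYZ.z + algebraMap K E (a - 1)⁻¹) * f XYZ.x =
        a⁻¹ • (f XYZ.x * (f XYZ.z + algebraMap K E (a - 1)⁻¹)) ↔
      f XYZ.z * f XYZ.x = a⁻¹ • (f XYZ.x * f XYZ.z) - a⁻¹ • f XYZ.x := by
    have h : a⁻¹ * (a - 1)⁻¹ = (a - 1)⁻¹ - a⁻¹ := by field_simp; ring
    rw [add_mul, mul_add, smul_add, ← Algebra.commutes _ (f XYZ.x), ← Algebra.smul_def, smul_smul, h,
      sub_smul, add_sub, add_sub_right_comm, add_left_inj]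
  have e2 : (f XYZ.z + algebraMap K E (a - 1)⁻¹) * f XYZ.y =
        a • (f XYZ.y * (f XYZ.z + algebraMap K E (a - 1)⁻¹)) ↔
      f XYZ.z * f XYZ.y = a • (f XYZ.y * f XYZ.z) + f XYZ.y := by
    have h : a * (a - 1)⁻¹ = 1 + (a - 1)⁻¹ := by field_simp; ring
    rw [add_mul, mul_add, smul_add, ← Algebra.commutes _ (f XYZ.y), ← Algebra.smul_def, smul_smul, h,
      add_smul, one_smul, ← add_assoc, add_left_inj]
  have e3 : Polynomial.aeval (f XYZ.z + algebraMap K E (a - 1)⁻¹)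
      (Polynomial.C b * (Polynomial.X - Polynomial.C (a - 1)⁻¹) ^ 2 +
        (Polynomial.X - Polynomial.C (a - 1)⁻¹)) = b • f XYZ.z ^ 2 + f XYZ.z := by
    simp [Algebra.smul_def]
  constructor
  · intro h
    refine ⟨e1.2 (by simpa using h .zx), e2.2 (by simpa using h .zy), ?_⟩
    rw [e3, ← add_assoc]
    simpa using h .yx
  · rintro ⟨h1, h2, h3⟩ _ _ (_ | _ | _)
    · rw [e3, ← add_assoc] at h3
      simpa using h3
    · simpa using e1.1 h1
    · simpa using e2.1 h2

/-- The change of variables `u = z + (q² - 1)⁻¹`. -/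
theorem satisfies_woronowiczRel_iff {E : Type*} [Ring E] [Algebra K E] {q : K} (hq : q ≠ 0)
    (hq1 : q ^ 2 - 1 ≠ 0) (f : XYZ → E) : Satisfies (WoronowiczRel K q) f ↔
      ConformalEqs (q ^ 4) (q ^ 2)⁻¹ (Polynomial.C (-q⁻¹) *
        (Polynomial.X - Polynomial.C (q ^ 2 - 1)⁻¹)) (f XYZ.x) (f XYZ.y)
        (f XYZ.z + algebraMap K E (q ^ 2 - 1)⁻¹) := by
  have hq4 : q ^ 4 ≠ 0 := pow_ne_zero _ hq
  have e1 : (f XYZ.z + algebraMap K E (q ^ 2 - 1)⁻¹) * f XYZ.x =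
        (q ^ 4)⁻¹ • (f XYZ.x * (f XYZ.z + algebraMap K E (q ^ 2 - 1)⁻¹)) ↔
      f XYZ.x * f XYZ.z - q ^ 4 • (f XYZ.z * f XYZ.x) = (1 + q ^ 2) • f XYZ.x := by
    have h : q ^ 4 * (q ^ 2 - 1)⁻¹ = (1 + q ^ 2) + (q ^ 2 - 1)⁻¹ := by field_simp; ring
    rw [eq_inv_smul_iff₀ hq4, add_mul, mul_add, smul_add, ← Algebra.commutes _ (f XYZ.x),
      ← Algebra.smul_def, smul_smul, h, add_smul, ← add_assoc, add_left_inj, sub_eq_iff_eq_add',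
      eq_comm]
  have e2 : (f XYZ.z + algebraMap K E (q ^ 2 - 1)⁻¹) * f XYZ.y =
        q ^ 4 • (f XYZ.y * (f XYZ.z + algebraMap K E (q ^ 2 - 1)⁻¹)) ↔
      f XYZ.z * f XYZ.y - q ^ 4 • (f XYZ.y * f XYZ.z) = (1 + q ^ 2) • f XYZ.y := by
    have h : q ^ 4 * (q ^ 2 - 1)⁻¹ = (1 + q ^ 2) + (q ^ 2 - 1)⁻¹ := by field_simp; ring
    rw [add_mul, mul_add, smul_add, ← Algebra.commutes _ (f XYZ.y),
      ← Algebra.smul_def, smul_smul, h, add_smul, ← add_assoc, add_left_inj, sub_eq_iff_eq_add']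
  have e3 : Polynomial.aeval (f XYZ.z + algebraMap K E (q ^ 2 - 1)⁻¹)
      (Polynomial.C (-q⁻¹) * (Polynomial.X - Polynomial.C (q ^ 2 - 1)⁻¹)) = -(q⁻¹ • f XYZ.z) := by
    simp [Algebra.smul_def]
  have e4 : f XYZ.y * f XYZ.x = (q ^ 2)⁻¹ • (f XYZ.x * f XYZ.y) + -(q⁻¹ • f XYZ.z) ↔
      f XYZ.x * f XYZ.y - q ^ 2 • (f XYZ.y * f XYZ.x) = q • f XYZ.z := by
    have h : q⁻¹ • f XYZ.z = (q ^ 2)⁻¹ • q • f XYZ.z := by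
      rw [smul_smul]
      congr 1
      field_simp
    rw [h, ← sub_eq_add_neg, ← smul_sub, eq_inv_smul_iff₀ (pow_ne_zero 2 hq), eq_sub_iff_add_eq,
      sub_eq_iff_eq_add', eq_comm]
  constructor
  · intro h
    refine ⟨e1.2 (by simpa using h .xz), e2.2 (by simpa using h .zy), ?_⟩
    rw [e3, e4]
    simpa using h .xy
  · rintro ⟨h1, h2, h3⟩ _ _ (_ | _ | _)
    · simpa using e1.1 h1
    · rw [e3, e4] at h3
      simpa using h3
    · simpa using e2.1 h2

theorem adjoin_XYZ_add {g : XYZ → A} (hg : Algebra.adjoin K (Set.range g) = ⊤) (s : K) :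
    Algebra.adjoin K {g XYZ.x, g XYZ.y, g XYZ.z + algebraMap K A s} = ⊤ := by
  refine adjoin_eq_top_of_subset hg ?_
  rintro _ ⟨_ | _ | _, rfl⟩
  · exact Algebra.subset_adjoin (by simp)
  · exact Algebra.subset_adjoin (by simp)
  · have h : g XYZ.z + algebraMap K A s ∈
        Algebra.adjoin K {g XYZ.x, g XYZ.y, g XYZ.z + algebraMap K A s} :=
      Algebra.subset_adjoin (by simp)
    simpa using sub_mem h (Subalgebra.algebraMap_mem _ s)

theorem isUniversallyCancellative_conformalAlgebra [CharZero K] {a b c : K} (ha : NonRootOfUnity a)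
    (hb : b ≠ 0) (hc : NonRootOfUnity c) :
    IsUniversallyCancellative.{u, u, w₁, w₂} K (ConformalAlgebra K a b c) := by
  obtain ⟨g, hg⟩ := exists_isPresentation (ConformalRel K a b c)
  have hf : Polynomial.C b * (Polynomial.X - Polynomial.C (a - 1)⁻¹) ^ 2 +
      (Polynomial.X - Polynomial.C (a - 1)⁻¹) ≠ 0 := by
    -- Evaluating at the root plus and minus `1` gives `b + 1 = 0` and `b - 1 = 0`, hence `2b = 0`.
    intro h
    have h1 := congrArg (Polynomial.eval ((a - 1)⁻¹ + 1)) h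
    have h2 := congrArg (Polynomial.eval ((a - 1)⁻¹ - 1)) h
    simp only [Polynomial.eval_add, Polynomial.eval_mul, Polynomial.eval_C, Polynomial.eval_pow,
      Polynomial.eval_sub, Polynomial.eval_X, Polynomial.eval_zero] at h1 h2
    have h3 : 2 * b = 0 := by linear_combination h1 + h2
    exact hb (by simpa using h3)
  refine ((satisfies_conformalRel_iff ha.1 ha.ne_one g).1 hg.rel).isUniversallyCancellative ha hc hf
    (adjoin_XYZ_add hg.gen _) (fun E _ _ x' y' u' h' => ?_) (fun E _ _ x' y' u' h' => ?_)
  all_goals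
    obtain ⟨φ, hφ⟩ := hg.exists_algHom (f := fun
      | XYZ.x => x' | XYZ.y => y' | XYZ.z => u' - algebraMap K E (a - 1)⁻¹)
      ((satisfies_conformalRel_iff ha.1 ha.ne_one _).2 (by simpa using h'))
    exact ⟨φ, hφ _, hφ _, by rw [map_add, hφ, AlgHom.commutes, sub_add_cancel]⟩

theorem isUnivCancellativeAndCancellative_conformalAlgebra [CharZero K] {a b c : K}
    (ha : NonRootOfUnity a) (hb : b ≠ 0) (hc : NonRootOfUnity c) :
    IsUnivCancellativeAndCancellative.{u, u, w₁, w₂} K (ConformalAlgebra K a b c) :=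
  ⟨isUniversallyCancellative_conformalAlgebra ha hb hc,
    isCancellative_of_isUniversallyCancellative (isUniversallyCancellative_conformalAlgebra ha hb hc)⟩

/-- Here `a = q ^ 4` and `c = q ^ (-2)` have exponents of opposite sign, so `c ^ j = a ^ k` would
mean `q ^ (2j + 4k) = 1`: there is no resonance. -/
theorem isCentral_woronowicz [CharZero K] {q : K} (hq : NonRootOfUnity q) :
    Algebra.IsCentral K (Woronowicz K q) := by
  obtain ⟨g, hg⟩ := exists_isPresentation (WoronowiczRel K q)
  have hq2 : q ^ 2 - 1 ≠ 0 := sub_ne_zero.2 (hq.pow_ne_one two_ne_zero)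
  refine ((satisfies_woronowiczRel_iff hq.1 hq2 g).1 hg.rel).isCentral (hq.pow four_ne_zero)
    (inv_ne_zero (pow_ne_zero _ hq.1)) (fun j k e => ?_) (adjoin_XYZ_add hg.gen _)
    fun E _ _ x' y' u' h' => ?_
  · have h1 : q ^ (2 * j + 4 * k) = 1 := by
      rw [pow_add, pow_mul, pow_mul, ← e, inv_pow, mul_inv_cancel₀ (pow_ne_zero _ (pow_ne_zero _ hq.1))]
    by_contra h
    exact hq.pow_ne_one (m := 2 * j + 4 * k) (by omega) h1
  · obtain ⟨φ, hφ⟩ := hg.exists_algHom (f := fun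
      | XYZ.x => x' | XYZ.y => y' | XYZ.z => u' - algebraMap K E (q ^ 2 - 1)⁻¹)
      ((satisfies_woronowiczRel_iff hq.1 hq2 _).2 (by simpa using h'))
    exact ⟨φ, hφ _, hφ _, by rw [map_add, hφ, AlgHom.commutes, sub_add_cancel]⟩

end ConformalCancellation

/-! ### The algebra `U`: normal elements and representations -/

section URelations

open MvPolynomial

variable {K : Type u} [Field K] {n : ℕ}

/-- The relations of the algebra `U`. -/
structure UEqs {K : Type*} [Field K] {E : Type*} [Ring E] [Algebra K E] {n : ℕ} (q : K)
    (x y z : Fin n → E) : Prop where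
  xx : ∀ i j, x j * x i = x i * x j
  yy : ∀ i j, y j * y i = y i * y j
  zz : ∀ i j, z j * z i = z i * z j
  yx : ∀ i j, y j * x i = (if i = j then q else 1) • (x i * y j)
  zx : ∀ i j, z j * x i = (if i = j then q⁻¹ else 1) • (x i * z j)
  zy_ne : ∀ i j, i ≠ j → z j * y i = y i * z j
  zy : ∀ i, z i * y i = q ^ 2 • (y i * z i) - q ^ 2 • x i ^ 2

theorem satisfies_uRel_iff {E : Type*} [Ring E] [Algebra K E] {q : K} (f : XYZs n → E) :
    Satisfies (URel K n q) f ↔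
      UEqs q (fun i => f (XYZs.x i)) (fun i => f (XYZs.y i)) fun i => f (XYZs.z i) := by
  constructor
  · intro h
    exact ⟨fun i j => by simpa using h (.xx i j), fun i j => by simpa using h (.yy i j),
      fun i j => by simpa using h (.zz i j), fun i j => by
        have := h (.yx i j)
        split_ifs at this ⊢ <;> simpa using this,
      fun i j => by
        have := h (.zx i j)
        split_ifs at this ⊢ <;> simpa using this,
      fun i j hij => by simpa using h (.zy_ne i j hij),
      fun i => by simpa using h (.zy i)⟩
  · rintro h _ _ (⟨i, j⟩ | ⟨i, j⟩ | ⟨i, j⟩ | ⟨i, j⟩ | ⟨i, j⟩ | ⟨i, j, hij⟩ | ⟨i⟩)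
    · simpa using h.xx i j
    · simpa using h.yy i j
    · simpa using h.zz i j
    · have := h.yx i j
      split_ifs at this ⊢ <;> simpa using this
    · have := h.zx i j
      split_ifs at this ⊢ <;> simpa using this
    · simpa using h.zy_ne i j hij
    · simpa using h.zy i

/-- The coefficient of `x_i²` in `w_i`. -/
def uCoeff (q : K) : K := q ^ 4 / (1 - q ^ 4)

/-- The linear equation that makes `y_i z_i + α x_i²` normal: it balances the term `q² x_i²` of the
relation between `z_i` and `y_i` against the rescaling of `x_i²`. -/
theorem uCoeff_eq {q : K} (hq : NonRootOfUnity q) :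
    q ^ 2 * uCoeff q = (q ^ 2)⁻¹ * uCoeff q - q ^ 2 := by
  have h1 : (1 - q ^ 4) ≠ 0 := sub_ne_zero.2 (hq.pow_ne_one four_ne_zero).symm
  have h2 := hq.1
  rw [uCoeff]
  field_simp
  ring

theorem uCoeff_ne_zero {q : K} (hq : NonRootOfUnity q) : uCoeff q ≠ 0 :=
  div_ne_zero (pow_ne_zero _ hq.1) (sub_ne_zero.2 (hq.pow_ne_one four_ne_zero).symm)

section

variable {E : Type*} [Ring E] [Algebra K E] {q : K} {x y z : Fin n → E}

/-- The normal elements `w_i = y_i z_i + α x_i²`. -/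
noncomputable def uNormal (q : K) (x y z : Fin n → E) (i : Fin n) : E :=
  y i * z i + uCoeff q • x i ^ 2

/-- The scalars by which conjugation with `y_j` multiplies the `x_i` and the `w_i`. -/
def uScalar (q : K) (j : Fin n) : Fin n ⊕ Fin n → K :=
  Sum.elim (fun i => if i = j then q else 1) fun i => if i = j then (q ^ 2)⁻¹ else 1

theorem uScalar_ne_zero (hq : q ≠ 0) (j : Fin n) (t : Fin n ⊕ Fin n) : uScalar q j t ≠ 0 := by
  rcases t with i | i <;> simp only [uScalar, Sum.elim_inl, Sum.elim_inr] <;> split_ifs <;> simp [hq]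

theorem UEqs.yx_sq (h : UEqs q x y z) (i j : Fin n) :
    y j * x i ^ 2 = (if i = j then q ^ 2 else 1) • (x i ^ 2 * y j) := by
  rw [mul_pow_of_qcomm (h.yx i j)]
  split_ifs <;> simp

theorem UEqs.zx_sq (h : UEqs q x y z) (i j : Fin n) :
    z j * x i ^ 2 = (if i = j then (q ^ 2)⁻¹ else 1) • (x i ^ 2 * z j) := by
  rw [mul_pow_of_qcomm (h.zx i j)]
  split_ifs <;> simp

theorem UEqs.x_mul_normal (h : UEqs q x y z) (hq : q ≠ 0) (i j : Fin n) :
    x j * uNormal q x y z i = uNormal q x y z i * x j := by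
  have h1 : y i * z i * x j = x j * (y i * z i) := by
    rw [mul_assoc, h.zx, mul_smul_comm, ← mul_assoc, h.yx, smul_mul_assoc, smul_smul, mul_assoc]
    split_ifs <;> simp [hq]
  have h2 : x j * x i ^ 2 = x i ^ 2 * x j := (show Commute _ _ from h.xx i j).pow_right 2
  rw [uNormal, mul_add, add_mul, h1, mul_smul_comm, smul_mul_assoc, h2]

theorem UEqs.y_mul_normal (h : UEqs q x y z) (hq : NonRootOfUnity q) (i j : Fin n) :
    y j * uNormal q x y z i = (if i = j then (q ^ 2)⁻¹ else 1) • (uNormal q x y z i * y j) := by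
  have hq2 : q ^ 2 ≠ 0 := pow_ne_zero 2 hq.1
  have hx := h.yx_sq i j
  rw [uNormal, mul_add, add_mul, mul_smul_comm, hx]
  split_ifs with hij
  · subst hij
    rw [if_pos rfl] at hx
    rw [mul_assoc, h.zy, mul_sub, mul_smul_comm, mul_smul_comm, hx, smul_mul_assoc, smul_add, smul_sub,
      inv_smul_smul₀ hq2, smul_smul, smul_smul, smul_smul, sub_add, smul_smul, ← sub_smul,
      sub_eq_add_neg, ← neg_smul]
    congr 2
    rw [mul_comm, uCoeff_eq hq]
    field_simp
    ring
  · rw [mul_assoc (y i), h.zy_ne j i (Ne.symm hij), ← mul_assoc, ← mul_assoc, h.yy i j, one_smul,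
      one_smul, smul_mul_assoc]

theorem UEqs.z_mul_normal (h : UEqs q x y z) (hq : NonRootOfUnity q) (i j : Fin n) :
    z j * uNormal q x y z i = (if i = j then q ^ 2 else 1) • (uNormal q x y z i * z j) := by
  have hx := h.zx_sq i j
  rw [uNormal, mul_add, add_mul, mul_smul_comm, hx]
  split_ifs with hij
  · subst hij
    rw [← mul_assoc, h.zy, sub_mul, smul_mul_assoc, smul_mul_assoc, smul_mul_assoc, smul_add, smul_smul,
      smul_smul, sub_add, ← sub_smul, sub_eq_add_neg, ← neg_smul, uCoeff_eq hq, mul_comm (q ^ 2)⁻¹]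
    congr 2
    ring
  · rw [← mul_assoc, h.zy_ne i j hij, mul_assoc, h.zz i j, one_smul, one_smul, smul_mul_assoc,
      mul_assoc]

theorem UEqs.normal_comm (h : UEqs q x y z) (hq : NonRootOfUnity q) (i j : Fin n) :
    uNormal q x y z j * uNormal q x y z i = uNormal q x y z i * uNormal q x y z j := by
  by_cases hij : i = j
  · rw [hij]
  have hy := h.y_mul_normal hq i j
  have hz := h.z_mul_normal hq i j
  rw [if_neg hij, one_smul] at hy hz
  have hx : Commute (x j ^ 2) (uNormal q x y z i) :=
    (show Commute _ _ from h.x_mul_normal hq.1 i j).pow_left 2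
  have h1 : y j * z j * uNormal q x y z i = uNormal q x y z i * (y j * z j) := by
    rw [mul_assoc, hz, ← mul_assoc, hy, mul_assoc]
  conv_lhs => rw [uNormal, add_mul, h1, smul_mul_assoc, hx.eq]
  conv_rhs => rw [uNormal.eq_def q x y z j, mul_add, mul_smul_comm]

/-- The commutative subalgebra generated by the `x_i` and `w_i`. -/
theorem UEqs.exists_algHom (h : UEqs q x y z) (hq : NonRootOfUnity q) :
    ∃ ι : MvPolynomial (Fin n ⊕ Fin n) K →ₐ[K] E, (∀ i, ι (X (Sum.inl i)) = x i) ∧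
      (∀ i, ι (X (Sum.inr i)) = uNormal q x y z i) ∧
      (∀ j P, y j * ι P = ι (aeval (fun t => C (uScalar q j t) * X t) P) * y j) ∧
      ∀ j P, z j * ι P = ι (aeval (fun t => C (uScalar q j t)⁻¹ * X t) P) * z j := by
  obtain ⟨ι, hι⟩ := exists_mvPolynomial_algHom K (Sum.elim x (uNormal q x y z)) (by
    rintro (i | i) (j | j)
    · exact h.xx j i
    · exact h.x_mul_normal hq.1 j i
    · exact (h.x_mul_normal hq.1 i j).symm
    · exact h.normal_comm hq j i)
  refine ⟨ι, fun i => hι _, fun i => hι _, fun j P => ?_, fun j P => ?_⟩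
  · refine algHom_intertwine MvPolynomial.adjoin_range_X ι _ (y j) ?_ P
    rintro _ ⟨i | i, rfl⟩
    · rw [aeval_X, ← smul_eq_C_mul, map_smul, hι, smul_mul_assoc]
      exact h.yx i j
    · rw [aeval_X, ← smul_eq_C_mul, map_smul, hι, smul_mul_assoc]
      exact h.y_mul_normal hq i j
  · refine algHom_intertwine MvPolynomial.adjoin_range_X ι _ (z j) ?_ P
    rintro _ ⟨i | i, rfl⟩
    · rw [aeval_X, ← smul_eq_C_mul, map_smul, hι, smul_mul_assoc, Sum.elim_inl, h.zx i j]
      simp only [uScalar, Sum.elim_inl]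
      split_ifs <;> simp
    · rw [aeval_X, ← smul_eq_C_mul, map_smul, hι, smul_mul_assoc, Sum.elim_inr, h.z_mul_normal hq i j]
      simp only [uScalar, Sum.elim_inr]
      split_ifs <;> simp

theorem UEqs.isTwistedGWA (h : UEqs q x y z) (hq : NonRootOfUnity q)
    (hgen : Algebra.adjoin K (Set.range x ∪ Set.range y ∪ Set.range z) = ⊤)
    {ι : MvPolynomial (Fin n ⊕ Fin n) K →ₐ[K] E} (hx : ∀ i, ι (X (Sum.inl i)) = x i)
    (hw : ∀ i, ι (X (Sum.inr i)) = uNormal q x y z i)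
    (hy : ∀ j P, y j * ι P = ι (aeval (fun t => C (uScalar q j t) * X t) P) * y j)
    (hz : ∀ j P, z j * ι P = ι (aeval (fun t => C (uScalar q j t)⁻¹ * X t) P) * z j) :
    IsTwistedGWA ι y z := by
  have hyz : ∀ i, y i * z i = ι (X (Sum.inr i) - uCoeff q • X (Sum.inl i) ^ 2) := fun i => by
    rw [map_sub, map_smul, map_pow, hx, hw, uNormal, add_sub_cancel_right]
  refine ⟨fun i t => ⟨C (uScalar q i t)⁻¹ * X t, ?_⟩, fun i t => ⟨C (uScalar q i t) * X t, ?_⟩,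
    fun i => ⟨_, hyz i⟩, fun i => ⟨q ^ 2 • (X (Sum.inr i) - uCoeff q • X (Sum.inl i) ^ 2) -
      q ^ 2 • X (Sum.inl i) ^ 2, ?_⟩, fun i j _ => ⟨1, by rw [one_smul, h.yy]⟩,
    fun i j hij => ⟨1, by rw [one_smul, h.zy_ne i j hij]⟩,
    fun i j hij => ⟨1, by rw [one_smul, h.zy_ne j i hij.symm]⟩,
    fun i j _ => ⟨1, by rw [one_smul, h.zz]⟩, adjoin_eq_top_of_subset hgen ?_⟩
  · rw [hy, map_mul, aeval_X, aeval_C, algebraMap_eq, ← mul_assoc, ← C_mul,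
      inv_mul_cancel₀ (uScalar_ne_zero hq.1 i t), C_1, one_mul]
  · rw [hz, map_mul, aeval_X, aeval_C, algebraMap_eq, ← mul_assoc, ← C_mul,
      mul_inv_cancel₀ (uScalar_ne_zero hq.1 i t), C_1, one_mul]
  · rw [h.zy, map_sub, map_smul, map_smul, ← hyz, map_pow, hx]
  · rintro _ ((⟨i, rfl⟩ | ⟨i, rfl⟩) | ⟨i, rfl⟩)
    · exact Algebra.subset_adjoin (Or.inr ⟨_, hx i⟩)
    · exact Algebra.subset_adjoin (Or.inl (Or.inl ⟨i, rfl⟩))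
    · exact Algebra.subset_adjoin (Or.inl (Or.inr ⟨i, rfl⟩))

end

section Representation

variable {k : Type*} [CommRing k] [Algebra K k]

/-- The representation of `U` on functions on `ℤⁿ` with parameters `ξ`, `ω`. -/
noncomputable def uX (q : K) (ξ : Fin n → k) (i : Fin n) : Module.End k ((Fin n → ℤ) →₀ k) :=
  wshift 0 fun a => algebraMap K k (q ^ (-a i)) * ξ i

/-- See `uX`. -/
noncomputable def uY (i : Fin n) : Module.End k ((Fin n → ℤ) →₀ k) :=
  wshift (Pi.single i 1) fun _ => 1

/-- See `uX`. -/
noncomputable def uZCoeff (q : K) (ξ ω : Fin n → k) (i : Fin n) (a : Fin n → ℤ) : k :=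
  algebraMap K k (q ^ (2 * a i)) * ω i - algebraMap K k (uCoeff q * q ^ (-(2 * a i))) * ξ i ^ 2

/-- See `uX`. -/
noncomputable def uZ (q : K) (ξ ω : Fin n → k) (i : Fin n) : Module.End k ((Fin n → ℤ) →₀ k) :=
  wshift (Pi.single i (-1)) (uZCoeff q ξ ω i)

/-- The elements `x_i` and `w_i` act diagonally, starting from `ξ_i` and `ω_i`; since `y_i` is a
pure shift, the weight of `z_i` must be the eigenvalue of `y_i z_i = w_i - α x_i²`. Generic
parameters serve for the center, and vanishing ones for the degenerate representations. -/
theorem uEqs_representation {q : K} (hq : NonRootOfUnity q) (ξ ω : Fin n → k) :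
    UEqs q (uX q ξ) uY (uZ q ξ ω) where
  xx i j := by
    rw [uX, uX, wshift_mul, wshift_mul]
    exact wshift_congr rfl fun a => by rw [add_zero, mul_comm]
  yy i j := by
    rw [uY, uY, wshift_mul, wshift_mul]
    exact wshift_congr (add_comm _ _) fun a => rfl
  zz i j := by
    by_cases hij : i = j
    · rw [hij]
    rw [uZ, uZ, wshift_mul, wshift_mul]
    refine wshift_congr (add_comm _ _) fun a => ?_
    simp [uZCoeff, hij, Ne.symm hij, mul_comm]
  yx i j := by
    rw [uX, uY, wshift_mul, wshift_mul, smul_wshift]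
    refine wshift_congr (add_comm _ _) fun a => ?_
    split_ifs with hij
    · subst hij
      have : q ^ (-a i) = q * q ^ (-(a i + 1)) := by
        rw [neg_add, zpow_add₀ hq.1, zpow_neg_one]
        field_simp [hq.1]
      simp [this, Algebra.smul_def, mul_assoc]
    · simp [hij]
  zx i j := by
    rw [uX, uZ, wshift_mul, wshift_mul, smul_wshift]
    refine wshift_congr (add_comm _ _) fun a => ?_
    split_ifs with hij
    · subst hij
      have : q ^ (-a i) = q⁻¹ * q ^ (-(a i - 1)) := by
        rw [neg_sub, sub_eq_add_neg, add_comm, zpow_add₀ hq.1, zpow_one]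
        field_simp [hq.1]
      simp only [add_zero, Pi.add_apply, Pi.single_eq_same, ← sub_eq_add_neg, this, Algebra.smul_def,
        map_mul]
      ring
    · simp [hij, mul_comm]
  zy_ne i j hij := by
    rw [uY, uZ, wshift_mul, wshift_mul]
    refine wshift_congr (add_comm _ _) fun a => ?_
    simp [uZCoeff, Ne.symm hij]
  zy i := by
    have e : (Pi.single i (-1) + Pi.single i 1 : Fin n → ℤ) = 0 := by
      rw [← Pi.single_add, neg_add_cancel, Pi.single_zero]
    have e' : (Pi.single i 1 + Pi.single i (-1) : Fin n → ℤ) = 0 := by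
      rw [add_comm, e]
    rw [uY, uZ, pow_two (uX q ξ i), uX, wshift_mul, wshift_mul, wshift_mul, smul_wshift, smul_wshift, e, e',
      add_zero, wshift_sub]
    refine wshift_congr rfl fun a => ?_
    have h1 : q ^ (2 * (a i + 1)) = q ^ 2 * q ^ (2 * a i) := by
      rw [mul_add, zpow_add₀ hq.1, mul_comm]
      norm_cast
    have h2 : uCoeff q * q ^ (-(2 * (a i + 1))) =
        q ^ 2 * (uCoeff q * q ^ (-(2 * a i))) + q ^ 2 * (q ^ (-a i) * q ^ (-a i)) := by
      have h3 : q ^ (-(2 * (a i + 1))) = (q ^ 2)⁻¹ * q ^ (-(2 * a i)) := by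
        rw [mul_add, neg_add, zpow_add₀ hq.1, mul_comm, mul_one, zpow_neg]
        norm_cast
      have h4 : q ^ (-a i) * q ^ (-a i) = q ^ (-(2 * a i)) := by
        rw [← zpow_add₀ hq.1]
        congr 1
        ring
      rw [h3, h4]
      linear_combination (-q ^ (-(2 * a i))) * uCoeff_eq hq
    simp only [uZCoeff, Pi.add_apply, Pi.single_eq_same, Pi.zero_apply, mul_one, add_zero, one_mul, Algebra.smul_def,
      h1, h2, map_mul, map_add]
    ring

theorem uNormal_representation {q : K} (hq : NonRootOfUnity q) (ξ ω : Fin n → k) (i : Fin n) :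
    uNormal q (uX q ξ) uY (uZ q ξ ω) i = wshift 0 fun a => algebraMap K k (q ^ (2 * a i)) * ω i := by
  rw [uNormal, uX, uY, uZ, wshift_mul, pow_two, wshift_mul, smul_wshift, add_zero, ← Pi.single_add,
    neg_add_cancel, Pi.single_zero, wshift_add]
  refine wshift_congr rfl fun a => ?_
  have h4 : q ^ (-(2 * a i)) = q ^ (-a i) * q ^ (-a i) := by
    rw [← zpow_add₀ hq.1]
    congr 1
    ring
  simp only [uZCoeff, h4, add_zero, one_mul, Algebra.smul_def, map_mul]
  ring

end Representation

end URelations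

/-! ### The center of `U` -/

section UCenter

open MvPolynomial

variable {K : Type u} [Field K] {n : ℕ} {q : K}

theorem aeval_scale_inv {τ : Type*} {s : τ → K} (hs : ∀ t, s t ≠ 0) (P : MvPolynomial τ K) :
    aeval (fun t => C (s t)⁻¹ * X t) (aeval (fun t => C (s t) * X t) P) = P := by
  have : (aeval fun t => C (s t)⁻¹ * X t).comp (aeval fun t => C (s t) * X t) =
      AlgHom.id K (MvPolynomial τ K) := by
    apply MvPolynomial.algHom_ext
    intro t
    simp only [AlgHom.comp_apply, aeval_X, map_mul, aeval_C, algebraMap_eq, AlgHom.id_apply]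
    rw [← mul_assoc, ← C_mul, mul_inv_cancel₀ (hs t), C_1, one_mul]
  exact DFunLike.congr_fun this P

theorem prod_uScalar (hq : q ≠ 0) (i : Fin n) (d : Fin n ⊕ Fin n →₀ ℕ) :
    (d.prod fun t k => uScalar q i t ^ k) = q ^ ((d (Sum.inl i) : ℤ) - 2 * d (Sum.inr i)) := by
  rw [Finsupp.prod_fintype _ _ (by simp), Fintype.prod_sum_type,
    Finset.prod_eq_single i (by simp +contextual [uScalar]) (by simp),
    Finset.prod_eq_single i (by simp +contextual [uScalar]) (by simp), zpow_sub₀ hq, zpow_mul]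
  simp only [uScalar, Sum.elim_inl, Sum.elim_inr, if_true, zpow_natCast, inv_pow, div_eq_mul_inv]
  norm_cast

theorem map_uNormal {E E' : Type*} [Ring E] [Algebra K E] [Ring E'] [Algebra K E'] (f : E →ₐ[K] E')
    (x y z : Fin n → E) (i : Fin n) : f (uNormal q x y z i) =
      uNormal q (fun i => f (x i)) (fun i => f (y i)) (fun i => f (z i)) i := by
  simp [uNormal]

/-- The inclusion of the polynomials in the `x_i² w_i`. -/
noncomputable def uCentral (K : Type*) [Field K] (n : ℕ) :
    MvPolynomial (Fin n) K →ₐ[K] MvPolynomial (Fin n ⊕ Fin n) K :=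
  aeval fun i => X (Sum.inl i) ^ 2 * X (Sum.inr i)

theorem uCentral_injective : Function.Injective (uCentral K n) := by
  have : (aeval (Sum.elim 1 X) : MvPolynomial (Fin n ⊕ Fin n) K →ₐ[K] _).comp (uCentral K n) =
      AlgHom.id K (MvPolynomial (Fin n) K) := by
    apply MvPolynomial.algHom_ext
    intro i
    simp [uCentral]
  refine Function.Injective.of_comp (f := (aeval (Sum.elim 1 X) :
    MvPolynomial (Fin n ⊕ Fin n) K →ₐ[K] MvPolynomial (Fin n) K)) ?_
  rw [← AlgHom.coe_comp, this]
  exact Function.injective_id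

theorem monomial_eq_uCentral {d : Fin n ⊕ Fin n →₀ ℕ} (hd : ∀ i, d (Sum.inl i) = 2 * d (Sum.inr i))
    (c : K) : monomial d c = uCentral K n (C c * ∏ i, X i ^ d (Sum.inr i)) := by
  rw [monomial_eq, Finsupp.prod_fintype _ _ (by simp), Fintype.prod_sum_type, ← Finset.prod_mul_distrib,
    map_mul, map_prod]
  congr 1
  · simp [uCentral]
  · refine Finset.prod_congr rfl fun i _ => ?_
    simp [uCentral, hd, mul_pow, pow_mul]

/-- Conjugation by `y_i` multiplies a monomial by a power of `q` whose exponent is the degree in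
`x_i` minus twice the degree in `w_i`; an invariant monomial is a product of the `x_i² w_i`. -/
theorem mem_range_uCentral (hq : NonRootOfUnity q) {P : MvPolynomial (Fin n ⊕ Fin n) K}
    (hP : ∀ i, aeval (fun t => C (uScalar q i t)⁻¹ * X t) P = P) : ∃ p, uCentral K n p = P := by
  suffices P ∈ (uCentral K n).range from this
  rw [P.as_sum]
  refine sum_mem fun d hd => ⟨_, (monomial_eq_uCentral (fun i => ?_) _).symm⟩
  have e := congrArg (coeff d) (hP i)
  rw [coeff_aeval_scale] at e
  have e1 := mul_right_cancel₀ (mem_support_iff.1 hd) (e.trans (one_mul _).symm)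
  have e2 : (d.prod fun t k => uScalar q i t ^ k) = 1 := by
    rw [← inv_inj, inv_one, ← e1, Finsupp.prod, Finsupp.prod, ← Finset.prod_inv_distrib]
    exact Finset.prod_congr rfl fun _ _ => (inv_pow _ _).symm
  rw [prod_uScalar hq.1] at e2
  by_contra h
  exact hq.zpow_ne_one (by omega) e2

theorem aeval_uScalar_uCentral (hq : q ≠ 0) (i : Fin n) (p : MvPolynomial (Fin n) K) :
    aeval (fun t => C (uScalar q i t) * X t) (uCentral K n p) = uCentral K n p := by
  have : (aeval fun t => C (uScalar q i t) * X t).comp (uCentral K n) = uCentral K n := by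
    apply MvPolynomial.algHom_ext
    intro j
    have h : uScalar q i (Sum.inl j) ^ 2 * uScalar q i (Sum.inr j) = 1 := by
      simp only [uScalar, Sum.elim_inl, Sum.elim_inr]
      split_ifs
      · exact mul_inv_cancel₀ (pow_ne_zero 2 hq)
      · simp
    have h' := congrArg (C (σ := Fin n ⊕ Fin n)) h
    rw [C_mul, C_pow, C_1] at h'
    simp only [uCentral, AlgHom.comp_apply, aeval_X, map_mul, map_pow]
    linear_combination (X (Sum.inl j) ^ 2 * X (Sum.inr j)) * h'
  exact DFunLike.congr_fun this p

theorem adjoin_range_XYZs {A : Type*} [Ring A] [Algebra K A] {g : XYZs n → A}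
    (hg : Algebra.adjoin K (Set.range g) = ⊤) :
    Algebra.adjoin K (Set.range (fun i => g (XYZs.x i)) ∪ Set.range (fun i => g (XYZs.y i)) ∪
      Set.range fun i => g (XYZs.z i)) = ⊤ := by
  refine adjoin_eq_top_of_subset hg ?_
  rintro _ ⟨i | i | i, rfl⟩
  · exact Algebra.subset_adjoin (Or.inl (Or.inl ⟨i, rfl⟩))
  · exact Algebra.subset_adjoin (Or.inl (Or.inr ⟨i, rfl⟩))
  · exact Algebra.subset_adjoin (Or.inr ⟨i, rfl⟩)

/-- By the representation with independent parameters, the center consists of the invariant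
polynomials in the `x_i` and `w_i`; the identification makes the variables correspond to the
products whose vanishing is the discriminant. -/
theorem exists_center_equiv_uRel {A : Type u} [Ring A] [Algebra K A] {g : XYZs n → A}
    (hg : IsPresentation (URel K n q) g) (hq : NonRootOfUnity q) :
    ∃ e : MvPolynomial (Fin n) K ≃ₐ[K] Subalgebra.center K A, ∀ i, (e (X i)).val =
      g (XYZs.x i) ^ 2 * uNormal q (fun i => g (XYZs.x i)) (fun i => g (XYZs.y i))
        (fun i => g (XYZs.z i)) i := by
  have h := (satisfies_uRel_iff g).1 hg.rel
  obtain ⟨ι, hx, hw, hy, hz⟩ := h.exists_algHom hq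
  have hA := h.isTwistedGWA hq (adjoin_range_XYZs hg.gen) hx hw hy hz
  let k := MvPolynomial (Fin n ⊕ Fin n) K
  let ξ : Fin n → k := fun i => X (Sum.inl i)
  let ω : Fin n → k := fun i => X (Sum.inr i)
  obtain ⟨ρ, hρ⟩ := hg.exists_algHom (f := fun
    | XYZs.x i => uX q ξ i | XYZs.y i => uY i | XYZs.z i => uZ q ξ ω i)
    ((satisfies_uRel_iff _).2 (uEqs_representation hq ξ ω))
  let η : Fin n ⊕ Fin n → (Fin n → ℤ) → MvPolynomial (Fin n ⊕ Fin n) K := Sum.elim (fun i a => C (q ^ (-a i)) * X (Sum.inl i))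
    fun i a => C (q ^ (2 * a i)) * X (Sum.inr i)
  have hρι : ∀ t, ρ (ι (X t)) = wshift 0 (η t) := by
    rintro (i | i)
    · rw [hx, hρ]
      rfl
    · rw [hw]
      refine (map_uNormal (K := K) (E := A) (E' := Module.End k ((Fin n → ℤ) →₀ k)) ρ _ _ _ i).trans ?_
      simp only [hρ]
      rw [uNormal_representation hq]
      rfl
  have hη0 : ∀ t, η t 0 = X t := by
    rintro (i | i) <;> simp [η]
  obtain ⟨-, hc⟩ := hA.center ρ η hη0 (fun a ha => by
      obtain ⟨i, hi⟩ := Function.ne_iff.1 ha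
      refine ⟨Sum.inl i, fun e => hq.zpow_ne_one (m := -a i) (by simpa using hi) ?_⟩
      have := congrArg (coeff (Finsupp.single (Sum.inl i) 1)) e
      simp only [η, Sum.elim_inl] at this
      rwa [coeff_C_mul, coeff_X, if_pos rfl, mul_one] at this) hρι
    (fun i => by
      rw [hρ]
      exact isShift_wshift _ _ fun _ => one_ne_zero)
    (fun i => by
      rw [hρ]
      -- The weight of `z_i` is nonzero because the parameter `ω_i` occurs in it linearly, with a
      -- power of `q` as coefficient.
      refine isShift_wshift _ _ fun a e => zpow_ne_zero (2 * a i) hq.1 ?_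
      have := congrArg (coeff (Finsupp.single (Sum.inr i) 1)) e
      have h0 : (Finsupp.single (Sum.inr i) 1 : Fin n ⊕ Fin n →₀ ℕ) ≠ Finsupp.single (Sum.inl i) 2 := by
        simp [Finsupp.single_eq_single_iff]
      rw [uZCoeff, coeff_sub, algebraMap_eq, coeff_C_mul, coeff_C_mul, coeff_X, X_pow_eq_monomial,
        coeff_monomial, if_neg h0.symm] at this
      simpa using this)
  have hinj : Function.Injective ι := by
    have key : ∀ P Q : k, ρ (ι P) (Finsupp.single 0 Q) = Finsupp.single 0 (P * Q) := by
      intro P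
      induction P using MvPolynomial.induction_on with
      | C c =>
        intro Q
        rw [← algebraMap_eq, AlgHom.commutes, AlgHom.commutes, wshift_algebraMap, wshift_single, add_zero]
      | add P P' hP hP' =>
        intro Q
        rw [map_add, map_add, LinearMap.add_apply, hP, hP', add_mul, Finsupp.single_add]
      | mul_X P t hP =>
        intro Q
        rw [map_mul, map_mul, Module.End.mul_apply, hρι, wshift_single, add_zero, hη0, hP, mul_assoc]
    intro P P' e
    have := congrArg (fun b => ρ b (Finsupp.single 0 1)) e
    simp only [key, mul_one] at this
    exact Finsupp.single_injective _ this
  have hmem : ∀ p, (ι.comp (uCentral K n)) p ∈ Subalgebra.center K A := by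
    intro p
    rw [Subalgebra.mem_center_iff]
    intro b
    have hb : b ∈ Algebra.adjoin K (Set.range (fun i => g (XYZs.y i)) ∪
      Set.range (fun i => g (XYZs.z i)) ∪ Set.range ι) := hA.gen ▸ Algebra.mem_top
    have h1 : Algebra.adjoin K (Set.range (fun i => g (XYZs.y i)) ∪
      Set.range (fun i => g (XYZs.z i)) ∪ Set.range ι) ≤
        Subalgebra.centralizer K {(ι.comp (uCentral K n)) p} := by
      refine Algebra.adjoin_le ?_
      rintro _ ((⟨i, rfl⟩ | ⟨i, rfl⟩) | ⟨P, rfl⟩) <;>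
        refine Subalgebra.mem_centralizer_iff K |>.2 fun c hc => ?_ <;>
        rw [Set.mem_singleton_iff.1 hc, AlgHom.comp_apply]
      · rw [hy, aeval_uScalar_uCentral hq.1]
      · conv_rhs => rw [← aeval_uScalar_uCentral hq.1 i p, hz]
        rw [aeval_scale_inv (uScalar_ne_zero hq.1 i)]
      · rw [← map_mul, mul_comm, map_mul]
    exact ((Subalgebra.mem_centralizer_iff K).1 (h1 hb) _ rfl).symm
  have hsurj : ∀ b ∈ Subalgebra.center K A, ∃ p, (ι.comp (uCentral K n)) p = b := by
    intro b hb
    obtain ⟨P, rfl, hP⟩ := hc b hb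
    obtain ⟨p, rfl⟩ := mem_range_uCentral hq (P := P) fun i => by
      have e : (fun t => η t (Pi.single i 1)) = fun t => C (uScalar q i t)⁻¹ * X t := by
        ext1 t
        rcases t with j | j
        · by_cases hj : j = i
          · simp [η, uScalar, hj]
          · simp [η, uScalar, hj]
        · by_cases hj : j = i
          · simp [η, uScalar, hj]
          · simp [η, uScalar, hj]
      have := hP i
      rwa [e] at this
    exact ⟨p, rfl⟩
  obtain ⟨e, he⟩ := ZariskiPBW.exists_center_equiv (ι.comp (uCentral K n))
    (hinj.comp uCentral_injective) hmem hsurj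
  refine ⟨e, fun i => ?_⟩
  rw [he, AlgHom.comp_apply, uCentral, aeval_X, map_mul, map_pow, hx, hw]

end UCenter

/-! ### Diagonalizable operators -/

section Eigen

variable {F : Type*} [Field F] {M : Type*} [AddCommGroup M] [Module F M]

/-- A fixed vector in the span of eigenvectors is in the span of the fixed ones. -/
theorem mem_span_fixed (T : Module.End F M) {S : Set M} (hS : ∀ s ∈ S, ∃ c : F, T s = c • s) {e : M}
    (he : e ∈ Submodule.span F S) (hTe : T e = e) : e ∈ Submodule.span F {s ∈ S | T s = s} := by
  have h1 : S ⊆ {s ∈ S | T s = s} ∪ {s ∈ S | T s ≠ s} := fun s hs => by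
    by_cases h : T s = s
    · exact Or.inl ⟨hs, h⟩
    · exact Or.inr ⟨hs, h⟩
  have h2 := Submodule.span_mono (R := F) h1 he
  rw [Submodule.span_union, Submodule.mem_sup] at h2
  obtain ⟨a, ha, b, hb, rfl⟩ := h2
  have ha1 : a ∈ T.eigenspace 1 := by
    refine Submodule.span_le.2 ?_ ha
    rintro s ⟨-, hs⟩
    exact Module.End.mem_eigenspace_iff.2 (by rw [one_smul, hs])
  have hb1 : b ∈ ⨆ μ ≠ (1 : F), T.eigenspace μ := by
    refine Submodule.span_le.2 ?_ hb
    rintro s ⟨hs, hs1⟩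
    obtain ⟨c, hc⟩ := hS s hs
    refine Submodule.mem_iSup_of_mem c (Submodule.mem_iSup_of_mem ?_ (Module.End.mem_eigenspace_iff.2 hc))
    rintro rfl
    exact hs1 (by rw [hc, one_smul])
  -- The part `b` is fixed as a difference of fixed vectors, and it lies in the sum of the other
  -- eigenspaces; by independence it is zero.
  have hb2 : b ∈ T.eigenspace 1 := by
    rw [Module.End.mem_eigenspace_iff, one_smul] at ha1 ⊢
    rwa [map_add, ha1, add_left_cancel_iff] at hTe
  rw [Submodule.disjoint_def.1 (T.eigenspaces_iSupIndep 1) b hb2 hb1, add_zero]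
  exact ha

theorem mem_span_fixed_finset {ι : Type*} (T : ι → Module.End F M) {S : Set M}
    (hS : ∀ i, ∀ s ∈ S, ∃ c : F, T i s = c • s) {e : M} (he : e ∈ Submodule.span F S)
    (hTe : ∀ i, T i e = e) (I : Finset ι) : e ∈ Submodule.span F {s ∈ S | ∀ i ∈ I, T i s = s} := by
  classical
  induction I using Finset.induction_on with
  | empty => simpa using he
  | insert i I _ ih =>
    refine Submodule.span_mono ?_ (mem_span_fixed (T i) (fun s hs => hS i s hs.1) ih (hTe i))
    rintro s ⟨⟨hs, h1⟩, h2⟩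
    exact ⟨hs, Finset.forall_mem_insert _ _ _ |>.2 ⟨h2, h1⟩⟩

/-- An invariant subspace of a diagonalizable endomorphism is spanned by eigenvectors. -/
theorem le_of_eigenvectors_mem {T : Module.End F M} (hT : ⨆ μ, T.eigenspace μ = ⊤)
    {J N : Submodule F M} (hJ : ∀ v ∈ J, T v ∈ J) (h : ∀ v ∈ J, ∀ μ : F, T v = μ • v → v ∈ N) : J ≤ N := by
  intro v hv
  have hv' : v ∈ ⨆ μ, T.eigenspace μ := hT ▸ Submodule.mem_top
  obtain ⟨f, hf, rfl⟩ := (Submodule.mem_iSup_iff_exists_finsupp _ _).1 hv'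
  have hf' : ∀ μ, T (f μ) = μ • f μ := fun μ => Module.End.mem_eigenspace_iff.1 (hf μ)
  refine sum_mem fun μ hμ => h _ ?_ μ (hf' μ)
  -- Modulo `J` the eigencomponents of a vector of `J` sum to zero; being in distinct eigenspaces,
  -- each of them vanishes, so each component already lies in `J`.
  let T' : Module.End F (M ⧸ J) := J.mapQ J T hJ
  have h0 := (iSupIndep_iff_finsetSum_eq_zero_imp_eq_zero _).1 T'.eigenspaces_iSupIndep f.support
    (fun μ => J.mkQ (f μ))
    (fun μ _ => Module.End.mem_eigenspace_iff.2 (by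
      change J.mkQ (T (f μ)) = _
      rw [hf', map_smul]))
    (by rw [← map_sum]; exact (Submodule.Quotient.mk_eq_zero J).2 hv) μ hμ
  exact (Submodule.Quotient.mk_eq_zero J).1 h0

end Eigen

/-! ### Representations of `U` with nonzero central parameters -/

section USimple

open MvPolynomial

theorem mul_signedMonomial_of_qcomm {F E : Type*} [Field F] [Ring E] [Algebra F E] {a : E} :
    ∀ {n : ℕ} {y z : Fin n → E} {c : Fin n → F}, (∀ j, c j ≠ 0) →
      (∀ j, a * y j = c j • (y j * a)) → (∀ j, a * z j = (c j)⁻¹ • (z j * a)) → ∀ m : Fin n → ℤ,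
      a * signedMonomial y z m = zmonomial c m • (signedMonomial y z m * a)
  | 0, y, z, c, _, _, _, m => by simp [signedMonomial, zmonomial]
  | n + 1, y, z, c, hc, hy, hz, m => by
    have h0 : a * signedPow (y 0) (z 0) (m 0) = c 0 ^ m 0 • (signedPow (y 0) (z 0) (m 0) * a) := by
      rw [signedPow]
      split_ifs with h
      · rw [mul_pow_of_qcomm (hy 0), ← zpow_natCast, Int.toNat_of_nonneg h]
      · rw [mul_pow_of_qcomm (hz 0), ← zpow_natCast, Int.toNat_of_nonneg (by omega), inv_zpow,
          zpow_neg, inv_inv]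
    have ih := mul_signedMonomial_of_qcomm (a := a) (fun j => hc j.succ) (fun j => hy j.succ)
      (fun j => hz j.succ) fun j => m j.succ
    rw [signedMonomial_succ, ← mul_assoc, h0, smul_mul_assoc, mul_assoc, ih, mul_smul_comm, smul_smul,
      mul_assoc, zmonomial, zmonomial, Fin.prod_univ_succ]

variable {F : Type*} [Field F] {E : Type*} [Ring E] [Algebra F E] {n : ℕ} {q : F}
  {x y z : Fin n → E}

theorem aeval_scale_monomial {τ : Type*} (s : τ → F) (d : τ →₀ ℕ) (c : F) :
    aeval (fun t => C (s t) * X t) (monomial d c) = (d.prod fun t k => s t ^ k) • monomial d c := by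
  classical
  ext b
  rw [coeff_aeval_scale, coeff_smul, coeff_monomial]
  split_ifs with h
  · rw [h, smul_eq_mul]
  · simp

theorem iSup_eigenspace_scale {τ : Type*} (s : τ → F) :
    ⨆ μ, Module.End.eigenspace
      (aeval (fun t => C (s t) * X t) : MvPolynomial τ F →ₐ[F] MvPolynomial τ F).toLinearMap μ = ⊤ := by
  rw [eq_top_iff]
  rintro P -
  rw [P.as_sum]
  exact sum_mem fun d _ => Submodule.mem_iSup_of_mem _ (Module.End.mem_eigenspace_iff.2
    (aeval_scale_monomial s d _))

/-- The argument is that of highest weights. If `V y^(N+1) = 0`, inserting `y z` after `V y^N` and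
`z y` before `y^N` gives two expressions of `V w y^N` as multiples of `V x² y^N`. Their constants
differ since `q^(4 + 4N) ≠ 1`, so `V x² y^N = 0`, and `x` is invertible. -/
theorem UEqs.mul_pow_eq_zero (h : UEqs q x y z) (hq : NonRootOfUnity q) {i : Fin n} {b : E}
    (hb : b * x i = 1) {V V' : E} (hVx : V * x i = x i * V) (hVz : V * z i = z i * V') {N : ℕ}
    (hV' : ∀ N, V * y i ^ N = 0 → V' * y i ^ N = 0) (hV : V * y i ^ N = 0) : V = 0 := by
  induction N with
  | zero => simpa using hV
  | succ N ih =>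
    apply ih
    have hq2 : q ^ 2 ≠ 0 := pow_ne_zero 2 hq.1
    have hA : (q ^ 2) ^ N ≠ 0 := pow_ne_zero N hq2
    have hw : uNormal q x y z i * y i ^ N = (q ^ 2) ^ N • (y i ^ N * uNormal q x y z i) := by
      refine mul_pow_of_qcomm ?_ N
      rw [h.y_mul_normal hq, if_pos rfl, smul_inv_smul₀ hq2]
    have hx : x i ^ 2 * y i ^ N = ((q ^ 2)⁻¹) ^ N • (y i ^ N * x i ^ 2) := by
      refine mul_pow_of_qcomm ?_ N
      rw [h.yx_sq, if_pos rfl, inv_smul_smul₀ hq2]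
    set w := uNormal q x y z i with hw_def
    have hyz : y i * z i = w - uCoeff q • x i ^ 2 := by rw [hw_def, uNormal, add_sub_cancel_right]
    have e1 : V * w * y i ^ N = ((q ^ 2) ^ N * ((q ^ 2) ^ N * uCoeff q)) • (V * x i ^ 2 * y i ^ N) := by
      have : V * y i ^ N * (w - uCoeff q • x i ^ 2) = 0 := by
        rw [← hyz, ← mul_assoc, mul_assoc V, ← pow_succ, hV, zero_mul]
      rw [mul_sub, mul_smul_comm, sub_eq_zero] at this
      rw [mul_assoc, hw, mul_smul_comm, ← mul_assoc, this, mul_assoc V, mul_assoc V (x i ^ 2), hx,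
        mul_smul_comm, smul_smul, smul_smul, inv_pow]
      congr 1
      field_simp
    have e2 : q ^ 2 • (V * w * y i ^ N) = ((q ^ 2)⁻¹ * uCoeff q) • (V * x i ^ 2 * y i ^ N) := by
      have e3 : V * (z i * y i) * y i ^ N = 0 := by
        rw [← mul_assoc, hVz, mul_assoc, mul_assoc, ← pow_succ', hV' _ hV, mul_zero]
      rw [h.zy, hyz, smul_sub, sub_sub, smul_smul, ← add_smul, mul_sub, sub_mul, mul_smul_comm,
        mul_smul_comm, smul_mul_assoc, smul_mul_assoc, sub_eq_zero] at e3
      rw [e3, uCoeff_eq hq, sub_add_cancel]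
    have e4 : V * x i ^ 2 * y i ^ N = 0 := by
      rw [e1, smul_smul, ← sub_eq_zero, ← sub_smul] at e2
      refine (smul_eq_zero.1 e2).resolve_left fun e => ?_
      have e5 : q ^ (4 + 4 * N) - 1 = 0 := by
        refine (mul_eq_zero.1 ?_).resolve_right (uCoeff_ne_zero hq)
        have : (q ^ 2) * (q ^ 2)⁻¹ = 1 := mul_inv_cancel₀ hq2
        linear_combination q ^ 2 * e + uCoeff q * this
      exact hq.pow_ne_one (m := 4 + 4 * N) (by omega) (sub_eq_zero.1 e5)
    have hVx2 : V * x i ^ 2 = x i ^ 2 * V := (show Commute V (x i) from hVx).pow_right 2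
    calc V * y i ^ N = (b * (b * x i) * x i) * (V * y i ^ N) := by rw [hb, mul_one, hb, one_mul]
      _ = b * b * (x i ^ 2 * V * y i ^ N) := by simp only [pow_two, mul_assoc]
      _ = 0 := by rw [← hVx2, e4, mul_zero]

/-- Conjugation by the invertible `x_i` multiplies the part of degree `m` in the `y`, `z` by `q ^
(-m_i)`. A central element is fixed by all these conjugations, so it comes from the part of degree
`0`. -/
theorem UEqs.mem_range_of_central (h : UEqs q x y z) (hq : NonRootOfUnity q) {b : Fin n → E}
    (hxb : ∀ i, x i * b i = 1) {ι : MvPolynomial (Fin n ⊕ Fin n) F →ₐ[F] E} (hA : IsTwistedGWA ι y z)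
    (hιx : ∀ i P, ι P * x i = x i * ι P) {e : E} (he : ∀ v, e * v = v * e) : ∃ P, ι P = e := by
  let T : Fin n → Module.End F E := fun i => LinearMap.mulLeft F (x i) * LinearMap.mulRight F (b i)
  have hTa : ∀ i v, T i v = x i * (v * b i) := fun i v => rfl
  let S : Set E := {s | ∃ m d, s = signedMonomial y z m * ι (monomial d 1)}
  have hS : ∀ i m P, T i (signedMonomial y z m * ι P) = q ^ (-m i) • (signedMonomial y z m * ι P) := by
    intro i m P
    have hc := mul_signedMonomial_of_qcomm (a := x i) (y := y) (z := z)
      (c := fun j => if i = j then q⁻¹ else 1) (fun j => by split_ifs <;> simp [hq.1])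
      (fun j => by rw [h.yx]; split_ifs <;> simp [hq.1])
      (fun j => by rw [h.zx]; split_ifs <;> simp [hq.1]) m
    have hm : zmonomial (fun j => if i = j then q⁻¹ else 1) m = q ^ (-m i) := by
      rw [zmonomial, Finset.prod_eq_single i (fun j _ hj => by rw [if_neg hj.symm, one_zpow]) (by simp),
        if_pos rfl, inv_zpow, zpow_neg]
    rw [hTa, ← mul_assoc, ← mul_assoc, hc, hm, smul_mul_assoc, smul_mul_assoc, mul_assoc _ (x i),
      ← hιx, mul_assoc, mul_assoc, hxb, mul_one]
  have hspan : e ∈ Submodule.span F S := by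
    have hf : ∀ f, polySum ι (signedMonomial y z) f ∈ Submodule.span F S := by
      intro f
      induction f using Finsupp.induction_linear with
      | zero => rw [map_zero]; exact zero_mem _
      | add f g hf hg => rw [map_add]; exact add_mem hf hg
      | single m P =>
        rw [polySum_single, P.as_sum, map_sum, Finset.mul_sum]
        refine sum_mem fun d _ => ?_
        have : monomial d (coeff d P) = coeff d P • monomial d 1 := by
          rw [smul_monomial, smul_eq_mul, mul_one]
        rw [this, map_smul, mul_smul_comm]
        exact Submodule.smul_mem _ _ (Submodule.subset_span ⟨m, d, rfl⟩)
    obtain ⟨f, rfl⟩ : e ∈ LinearMap.range (polySum ι (signedMonomial y z)) := by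
      rw [hA.range_polySum]
      exact Submodule.mem_top
    exact hf f
  have hfix := mem_span_fixed_finset T (fun i s hs => by
    obtain ⟨m, d, rfl⟩ := hs
    exact ⟨_, hS i m _⟩) hspan (fun i => by rw [hTa, ← mul_assoc, ← he, mul_assoc, hxb, mul_one]) Finset.univ
  suffices Submodule.span F {s ∈ S | ∀ i ∈ Finset.univ, T i s = s} ≤ LinearMap.range ι.toLinearMap from
    this hfix
  rw [Submodule.span_le]
  rintro _ ⟨⟨m, d, rfl⟩, hm⟩
  by_cases hm0 : m = 0
  · exact ⟨monomial d 1, by rw [hm0, signedMonomial_zero, one_mul]; rfl⟩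
  · obtain ⟨i, hi⟩ := Function.ne_iff.1 hm0
    have e1 := hm i (Finset.mem_univ i)
    rw [hS] at e1
    have e2 : (q ^ (-m i) - 1) • (signedMonomial y z m * ι (monomial d 1)) = 0 := by
      rw [sub_smul, one_smul, e1, sub_self]
    rw [(smul_eq_zero.1 e2).resolve_left (sub_ne_zero.2 (hq.zpow_ne_one (neg_ne_zero.2 hi)))]
    exact zero_mem _

/-- The algebra is central when the elements `x_i² w_i` are nonzero scalars. -/
theorem UEqs.mem_bot_of_central (h : UEqs q x y z) (hq : NonRootOfUnity q)
    (hgen : Algebra.adjoin F (Set.range x ∪ Set.range y ∪ Set.range z) = ⊤) {ζ : Fin n → F}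
    (hζ : ∀ i, ζ i ≠ 0) (hxw : ∀ i, x i ^ 2 * uNormal q x y z i = algebraMap F E (ζ i)) {e : E}
    (he : ∀ v, e * v = v * e) : e ∈ (⊥ : Subalgebra F E) := by
  obtain ⟨ι, hx, hw, hy, hz⟩ := h.exists_algHom hq
  have hA := h.isTwistedGWA hq hgen hx hw hy hz
  -- The inverse of `x_i`, available because `x_i² w_i` is a nonzero scalar.
  let b : Fin n → E := fun i => (ζ i)⁻¹ • (x i * uNormal q x y z i)
  have hxb : ∀ i, x i * b i = 1 := fun i => by
    rw [mul_smul_comm, ← mul_assoc, ← pow_two, hxw, Algebra.smul_def, ← map_mul,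
      inv_mul_cancel₀ (hζ i), map_one]
  have hbx : ∀ i, b i * x i = 1 := fun i => by
    rw [smul_mul_assoc, mul_assoc, ← h.x_mul_normal hq.1, ← mul_smul_comm]
    exact hxb i
  have hιx : ∀ i P, ι P * x i = x i * ι P := fun i P => by rw [← hx, ← map_mul, mul_comm, map_mul]
  obtain ⟨P, rfl⟩ := h.mem_range_of_central hq hxb hA hιx he
  let σ : Fin n → MvPolynomial (Fin n ⊕ Fin n) F →ₗ[F] MvPolynomial (Fin n ⊕ Fin n) F := fun i =>
    (aeval fun t => C (uScalar q i t) * X t : MvPolynomial (Fin n ⊕ Fin n) F →ₐ[F] _).toLinearMap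
  have hy' : ∀ i P, y i * ι P = ι (σ i P) * y i := hy
  have hσ : ∀ i d, σ i (monomial d 1) =
      q ^ ((d (Sum.inl i) : ℤ) - 2 * d (Sum.inr i)) • monomial d 1 := fun i d => by
    rw [← prod_uScalar hq.1]
    exact aeval_scale_monomial _ d 1
  -- The map `ι` need not be injective here, so regularity of `y_i` has to be proved in the image.
  -- The polynomials killed by some power of `y_i` form a subspace stable under the diagonalizable
  -- `σ i`, so eigenvectors suffice; for these, `z_i` commutes with `ι P` up to the scalar `μ`, as
  -- `mul_pow_eq_zero` requires.
  have hreg : ∀ i P N, ι P * y i ^ N = 0 → ι P = 0 := by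
    intro i P N hP
    let J : Submodule F (MvPolynomial (Fin n ⊕ Fin n) F) :=
      { carrier := {P | ∃ N, ι P * y i ^ N = 0}
        zero_mem' := ⟨0, by simp⟩
        add_mem' := by
          rintro P Q ⟨N, hP⟩ ⟨N', hQ⟩
          exact ⟨N + N', by rw [map_add, add_mul, pow_add, ← mul_assoc, hP, zero_mul, zero_add,
            ← pow_add, add_comm, pow_add, ← mul_assoc, hQ, zero_mul]⟩
        smul_mem' := by
          rintro c P ⟨N, hP⟩
          exact ⟨N, by rw [map_smul, smul_mul_assoc, hP, smul_zero]⟩ }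
    have hJ : J ≤ LinearMap.ker ι.toLinearMap := by
      refine le_of_eigenvectors_mem (iSup_eigenspace_scale (uScalar q i)) (fun P => ?_) ?_
      · rintro ⟨N, hP⟩
        refine ⟨N + 1, ?_⟩
        change ι (σ i P) * _ = 0
        rw [pow_succ', ← mul_assoc, ← hy', mul_assoc, hP, mul_zero]
      · rintro P ⟨N, hP⟩ μ hμ
        refine show ι P = 0 from h.mul_pow_eq_zero hq (hbx i) (hιx i P) (V' := μ • ι P) ?_ (fun N hN => ?_) hP
        · have e1 := aeval_scale_inv (uScalar_ne_zero hq.1 i) P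
          change aeval (fun t => C (uScalar q i t)⁻¹ * X t) (σ i P) = P at e1
          rw [show σ i P = μ • P from hμ, map_smul] at e1
          rw [mul_smul_comm, hz, ← smul_mul_assoc, ← map_smul, e1]
        · rw [smul_mul_assoc, hN, smul_zero]
    exact hJ ⟨N, hP⟩
  let N := LinearMap.ker ι.toLinearMap
  have hN : ∀ i, N ≤ N.comap (σ i) := fun i P hP => by
    refine hreg i (σ i P) 1 ?_
    have : ι P = 0 := hP
    rw [pow_one, ← hy', this, mul_zero]
  -- By regularity of `y_i`, commuting with `y_i` means being fixed by `σ i` modulo the kernel of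
  -- `ι`; so only the monomials fixed in this quotient contribute.
  let T : Fin n → Module.End F (MvPolynomial (Fin n ⊕ Fin n) F ⧸ N) := fun i => N.mapQ N (σ i) (hN i)
  have hT : ∀ i P, T i (N.mkQ P) = N.mkQ (σ i P) := fun i P => rfl
  have hfix := mem_span_fixed_finset T (S := {s | ∃ d, s = N.mkQ (monomial d 1)}) (e := N.mkQ P)
    (by
      rintro i _ ⟨d, rfl⟩
      exact ⟨_, by rw [hT, hσ, map_smul]⟩)
    (by
      rw [P.as_sum, map_sum]
      refine sum_mem fun d _ => ?_
      have : monomial d (coeff d P) = coeff d P • monomial d 1 := by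
        rw [smul_monomial, smul_eq_mul, mul_one]
      rw [this, map_smul]
      exact Submodule.smul_mem _ _ (Submodule.subset_span ⟨d, rfl⟩))
    (fun i => by
      rw [hT, ← sub_eq_zero, ← map_sub, Submodule.mkQ_apply, Submodule.Quotient.mk_eq_zero]
      refine hreg i _ 1 ?_
      rw [map_sub, sub_mul, pow_one, ← hy', he, sub_self]) Finset.univ
  let L : (MvPolynomial (Fin n ⊕ Fin n) F ⧸ N) →ₗ[F] E := N.liftQ ι.toLinearMap le_rfl
  suffices Submodule.span F {s ∈ {s | ∃ d, s = N.mkQ (monomial d 1)} | ∀ i ∈ Finset.univ, T i s = s} ≤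
      (Subalgebra.toSubmodule (⊥ : Subalgebra F E)).comap L from this hfix
  rw [Submodule.span_le]
  rintro _ ⟨⟨d, rfl⟩, hd⟩
  -- Balanced monomials are products of the scalars `x_i² w_i`. For any other, the eigenvalue is not
  -- `1`, so being fixed makes it zero in the quotient.
  by_cases hd0 : ∀ i, d (Sum.inl i) = 2 * d (Sum.inr i)
  · have hc : ι.comp (uCentral F n) = (Algebra.ofId F E).comp (aeval ζ) := by
      apply MvPolynomial.algHom_ext
      intro i
      simp only [AlgHom.comp_apply, uCentral, aeval_X, map_mul, map_pow, hx, hw, hxw]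
      rfl
    change ι (monomial d 1) ∈ (⊥ : Subalgebra F E)
    rw [monomial_eq_uCentral hd0, ← AlgHom.comp_apply, hc]
    exact Subalgebra.algebraMap_mem _ _
  · obtain ⟨i, hi⟩ := not_forall.1 hd0
    have e1 := hd i (Finset.mem_univ i)
    rw [hT, hσ, map_smul] at e1
    have e2 : (q ^ ((d (Sum.inl i) : ℤ) - 2 * d (Sum.inr i)) - 1) • N.mkQ (monomial d 1) = 0 := by
      rw [sub_smul, one_smul, e1, sub_self]
    rw [(smul_eq_zero.1 e2).resolve_left (sub_ne_zero.2 (hq.zpow_ne_one (by omega)))]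
    exact zero_mem _

end USimple

/-! ### Universal cancellation for `U` -/

section UCancellation

open MvPolynomial

variable {K : Type u} [Field K] {n : ℕ} {q : K}

theorem NonRootOfUnity.map {F : Type*} [Field F] [Algebra K F] (hq : NonRootOfUnity q) :
    NonRootOfUnity (algebraMap K F q) := by
  refine ⟨(map_ne_zero _).2 hq.1, fun h => ?_⟩
  obtain ⟨m, hm, e⟩ := isOfFinOrder_iff_pow_eq_one.1 h
  refine hq.pow_ne_one hm.ne' ((algebraMap K F).injective ?_)
  rw [map_pow, e, map_one]

theorem algebraMap_uCoeff {F : Type*} [Field F] [Algebra K F] :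
    algebraMap K F (uCoeff q) = uCoeff (algebraMap K F q) := by
  simp [uCoeff]

/-- The image of the algebra in a representation over an extension field has trivial center when the
`x_i² w_i` act as nonzero scalars. -/
theorem UEqs.mem_bot_of_representation {A : Type*} [Ring A] [Algebra K A] {x y z : Fin n → A}
    (h : UEqs q x y z) (hq : NonRootOfUnity q)
    (hgen : Algebra.adjoin K (Set.range x ∪ Set.range y ∪ Set.range z) = ⊤)
    {F E : Type*} [Field F] [Algebra K F] [Ring E] [Algebra F E] [Algebra K E] [IsScalarTower K F E]
    (ρ : A →ₐ[K] E) {ζ : Fin n → F} (hζ : ∀ i, ζ i ≠ 0)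
    (hρ : ∀ i, ρ (x i ^ 2 * uNormal q x y z i) = algebraMap F E (ζ i)) {s : E}
    (hs : s ∈ Algebra.adjoin F (Set.range ρ))
    (hc : ∀ v ∈ Algebra.adjoin F (Set.range ρ), s * v = v * s) : s ∈ (⊥ : Subalgebra F E) := by
  set V := Algebra.adjoin F (Set.range ρ) with hV
  -- The subalgebra generated over `F` by the image satisfies the same relations with `q` viewed in
  -- `F`, so the statement over a single field applies to it.
  let f : A → V := fun a => ⟨ρ a, Algebra.subset_adjoin ⟨a, rfl⟩⟩
  have h' : UEqs (algebraMap K F q) (fun i => f (x i)) (fun i => f (y i)) fun i => f (z i) := by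
    refine ⟨fun i j => Subtype.ext ?_, fun i j => Subtype.ext ?_, fun i j => Subtype.ext ?_,
      fun i j => Subtype.ext ?_, fun i j => Subtype.ext ?_, fun i j hij => Subtype.ext ?_,
      fun i => Subtype.ext ?_⟩
    · exact (map_mul ρ _ _).symm.trans ((congrArg ρ (h.xx i j)).trans (map_mul ρ _ _))
    · exact (map_mul ρ _ _).symm.trans ((congrArg ρ (h.yy i j)).trans (map_mul ρ _ _))
    · exact (map_mul ρ _ _).symm.trans ((congrArg ρ (h.zz i j)).trans (map_mul ρ _ _))
    · have := congrArg ρ (h.yx i j)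
      change ρ _ * ρ _ = (if i = j then algebraMap K F q else 1) • (ρ _ * ρ _)
      split_ifs at this ⊢ <;> simpa using this
    · have := congrArg ρ (h.zx i j)
      change ρ _ * ρ _ = (if i = j then (algebraMap K F q)⁻¹ else 1) • (ρ _ * ρ _)
      split_ifs at this ⊢
      · rw [← map_inv₀, algebraMap_smul]
        simpa using this
      · simpa using this
    · exact (map_mul ρ _ _).symm.trans ((congrArg ρ (h.zy_ne i j hij)).trans (map_mul ρ _ _))
    · have := congrArg ρ (h.zy i)
      change ρ _ * ρ _ = algebraMap K F q ^ 2 • (ρ _ * ρ _) - algebraMap K F q ^ 2 • ρ _ ^ 2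
      rw [← map_pow, algebraMap_smul, algebraMap_smul]
      simpa using this
  have hw : ∀ i, f (x i) ^ 2 * uNormal (algebraMap K F q) (fun i => f (x i)) (fun i => f (y i))
      (fun i => f (z i)) i = algebraMap F V (ζ i) := fun i => by
    refine Subtype.ext ?_
    change ρ _ ^ 2 * (ρ _ * ρ _ + uCoeff (algebraMap K F q) • ρ _ ^ 2) = algebraMap F E (ζ i)
    rw [← hρ, uNormal, ← algebraMap_uCoeff, algebraMap_smul]
    simp
  have hgen' : Algebra.adjoin F (Set.range (fun i => f (x i)) ∪ Set.range (fun i => f (y i)) ∪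
      Set.range fun i => f (z i)) = ⊤ := by
    set W := Algebra.adjoin F (Set.range (fun i => f (x i)) ∪ Set.range (fun i => f (y i)) ∪
      Set.range fun i => f (z i))
    have h1 : V ≤ W.map V.val := by
      refine Algebra.adjoin_le ?_
      rintro _ ⟨a, rfl⟩
      have h2 : Algebra.adjoin K (Set.range x ∪ Set.range y ∪ Set.range z) ≤
          ((W.map V.val).restrictScalars K).comap ρ := by
        refine Algebra.adjoin_le ?_
        rintro _ ((⟨i, rfl⟩ | ⟨i, rfl⟩) | ⟨i, rfl⟩)
        · exact ⟨f (x i), Algebra.subset_adjoin (Or.inl (Or.inl ⟨i, rfl⟩)), rfl⟩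
        · exact ⟨f (y i), Algebra.subset_adjoin (Or.inl (Or.inr ⟨i, rfl⟩)), rfl⟩
        · exact ⟨f (z i), Algebra.subset_adjoin (Or.inr ⟨i, rfl⟩), rfl⟩
      exact h2 (hgen ▸ Algebra.mem_top)
    rw [eq_top_iff]
    rintro v -
    obtain ⟨w, hw, e⟩ := h1 v.2
    rwa [← Subtype.ext e]
  obtain ⟨c, hc⟩ := Algebra.mem_bot.1 (h'.mem_bot_of_central hq.map hgen' hζ hw (e := ⟨s, hs⟩)
    fun v => Subtype.ext (hc v v.2))
  exact Algebra.mem_bot.2 ⟨c, congrArg Subtype.val hc⟩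

theorem uX_sq_mul_uNormal {k : Type*} [CommRing k] [Algebra K k] (hq : NonRootOfUnity q)
    (ξ ω : Fin n → k) (i : Fin n) : uX q ξ i ^ 2 * uNormal q (uX q ξ) uY (uZ q ξ ω) i =
      wshift 0 fun _ => ξ i ^ 2 * ω i := by
  rw [uNormal_representation hq, uX, pow_two, wshift_mul, wshift_mul, add_zero, add_zero]
  refine wshift_congr rfl fun a => ?_
  have h : q ^ (-a i) * q ^ (-a i) * q ^ (2 * a i) = 1 := by
    rw [← zpow_add₀ hq.1, ← zpow_add₀ hq.1]
    ring_nf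
    exact zpow_zero q
  have h' := congrArg (algebraMap K k) h
  rw [map_mul, map_mul, map_one] at h'
  simp only [add_zero]
  linear_combination (ξ i ^ 2 * ω i) * h'

theorem uY_notMem_bot {k : Type*} [CommRing k] [Nontrivial k] (i : Fin n) :
    (uY i : Module.End k ((Fin n → ℤ) →₀ k)) ∉ (⊥ : Subalgebra k _) := by
  intro h
  obtain ⟨c, hc⟩ := Algebra.mem_bot.1 h
  have h1 := DFunLike.congr_fun (DFunLike.congr_fun hc (Finsupp.single 0 1)) (Pi.single i 1)
  rw [wshift_algebraMap, uY, wshift_single, wshift_single, add_zero, zero_add, mul_one, mul_one,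
    Finsupp.single_eq_same, Finsupp.single_eq_of_ne] at h1
  · exact zero_ne_one h1
  · simp

/-- If all the `x_i² w_i` act as nonzero scalars, every image has only scalar central elements. If
one of them acts as zero, there is a representation in which the corresponding `x_i` and `z_i`
vanish; then `y_i` commutes with everything and, being a shift, is not a scalar. -/
theorem isUniversallyCancellative_uAlgebra (hq : NonRootOfUnity q) :
    IsUniversallyCancellative.{u, u, w₁, w₂} K (UAlgebra K n q) := by
  obtain ⟨g, hg⟩ := exists_isPresentation (URel K n q)
  obtain ⟨e, he⟩ := exists_center_equiv_uRel hg hq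
  have h := (satisfies_uRel_iff g).1 hg.rel
  refine isUniversallyCancellative_of_discriminant e (fun F E _ _ _ V =>
    ∃ s ∈ V, (∀ v ∈ V, s * v = v * s) ∧ s ∉ (⊥ : Subalgebra F E)) fun F _ _ χ => ⟨?_, ?_⟩
  · rintro ⟨E, _, _, _, _, ρ, hρ, s, hs, hc, hbot⟩
    by_contra hχ
    rw [map_prod, map_prod, Finset.prod_eq_zero_iff] at hχ
    push Not at hχ
    refine hbot (h.mem_bot_of_representation hq (adjoin_range_XYZs hg.gen) ρ
      (ζ := fun i => χ (e (X i))) (fun i => hχ i (Finset.mem_univ i)) (fun i => ?_) hs hc)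
    rw [← he, hρ]
  · intro hχ
    rw [map_prod, map_prod, Finset.prod_eq_zero_iff] at hχ
    obtain ⟨i₀, -, hi₀⟩ := hχ
    -- Any parameters with `ξ_j² ω_j` equal to the prescribed value of the character would do for `j
    -- ≠ i₀`; at `i₀` both are `0`, so that `x_{i₀}` and `z_{i₀}` vanish.
    let ξ : Fin n → F := fun j => if j = i₀ then 0 else 1
    let ω : Fin n → F := fun j => if j = i₀ then 0 else χ (e (X j))
    have hE := uEqs_representation hq ξ ω
    obtain ⟨ρ, hρ⟩ := hg.exists_algHom (f := fun
      | XYZs.x i => uX q ξ i | XYZs.y i => uY i | XYZs.z i => uZ q ξ ω i)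
      ((satisfies_uRel_iff _).2 hE)
    have hx0 : uX q ξ i₀ = 0 := by
      simp only [uX, ξ, if_true, mul_zero]
      exact wshift_zero _
    have hz0 : uZ q ξ ω i₀ = 0 := by
      rw [uZ, ← wshift_zero (Pi.single i₀ (-1))]
      exact wshift_congr rfl fun a => by simp [uZCoeff, ξ, ω]
    refine ⟨Module.End F ((Fin n → ℤ) →₀ F), inferInstance, inferInstance, inferInstance, inferInstance,
      ρ, fun b => ?_, uY i₀, Algebra.subset_adjoin ⟨_, hρ (XYZs.y i₀)⟩, fun v hv => ?_, uY_notMem_bot i₀⟩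
    · have : (ρ.comp (Subalgebra.val _)).comp e.toAlgHom =
          ((IsScalarTower.toAlgHom K F (Module.End F ((Fin n → ℤ) →₀ F))).comp χ).comp e.toAlgHom := by
        apply MvPolynomial.algHom_ext
        intro i
        change ρ (e (X i)).val = algebraMap F _ (χ (e (X i)))
        rw [he, map_mul, map_pow]
        refine (congrArg (ρ (g (XYZs.x i)) ^ 2 * ·) (map_uNormal (K := K) (E := UAlgebra K n q)
          (E' := Module.End F ((Fin n → ℤ) →₀ F)) ρ _ _ _ i)).trans ?_
        simp only [hρ]
        rw [uX_sq_mul_uNormal hq, wshift_algebraMap]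
        refine wshift_congr rfl fun a => ?_
        simp only [ξ, ω]
        split_ifs with hi
        · rw [hi, hi₀]
          simp
        · simp
      obtain ⟨p, rfl⟩ := e.surjective b
      exact DFunLike.congr_fun this p
    · have h1 : Algebra.adjoin F (Set.range ρ) ≤ Subalgebra.centralizer F {uY i₀} := by
        refine Algebra.adjoin_le ?_
        rintro _ ⟨a, rfl⟩
        have h2 : Algebra.adjoin K (Set.range g) ≤ (Subalgebra.centralizer K {uY i₀}).comap ρ := by
          refine Algebra.adjoin_le ?_
          rintro _ ⟨i | i | i, rfl⟩ <;>
            refine Subalgebra.mem_centralizer_iff K |>.2 fun c hc => ?_ <;>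
            rw [Set.mem_singleton_iff.1 hc] <;>
            refine (congrArg (uY i₀ * ·) (hρ _)).trans (Eq.trans ?_ (congrArg (· * uY i₀) (hρ _)).symm)
          · by_cases hi : i = i₀
            · simp only [hi, hx0, mul_zero, zero_mul]
            · simpa [hi] using hE.yx i i₀
          · exact hE.yy i i₀
          · by_cases hi : i = i₀
            · simp only [hi, hz0, mul_zero, zero_mul]
            · exact (hE.zy_ne i₀ i (Ne.symm hi)).symm
        exact fun c hc => Subalgebra.mem_centralizer_iff K |>.1 (h2 (hg.gen ▸ Algebra.mem_top)) c hc
      exact Subalgebra.mem_centralizer_iff F |>.1 (h1 hv) _ rfl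

theorem isUnivCancellativeAndCancellative_uAlgebra (hq : NonRootOfUnity q) :
    IsUnivCancellativeAndCancellative.{u, u, w₁, w₂} K (UAlgebra K n q) :=
  ⟨isUniversallyCancellative_uAlgebra hq,
    isCancellative_of_isUniversallyCancellative (isUniversallyCancellative_uAlgebra hq)⟩

end UCancellation
end ZariskiPBW

theorem mainTheorem4 (K : Type u) [Field K] [CharZero K] :
    -- 1. Weyl algebra
    (∀ n : ℕ, IsUnivCancellativeAndCancellative.{u, u, w₁, w₂} K (WeylAlgebra K n)) ∧
    -- 2. extended Weyl algebra
    (∀ n : ℕ, IsUnivCancellativeAndCancellative.{u, u, w₁, w₂} K (ExtendedWeylAlgebra K n)) ∧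
    -- 3. algebra of q-differential operators
    (∀ q h : K, NonRootOfUnity q ∨ (q = 1 ∧ h ≠ 0) →
      IsUnivCancellativeAndCancellative.{u, u, w₁, w₂} K (QDiffAlgebra K q h)) ∧
    -- 4. algebra of shift operators
    (∀ h : K, h ≠ 0 →
      IsUnivCancellativeAndCancellative.{u, u, w₁, w₂} K (ShiftAlgebra K h)) ∧
    -- 5. mixed algebra
    (∀ h : K, h ≠ 0 →
      IsUnivCancellativeAndCancellative.{u, u, w₁, w₂} K (MixedAlgebra K h)) ∧
    -- 6. discrete linear systems
    (∀ n : ℕ, IsUnivCancellativeAndCancellative.{u, u, w₁, w₂} K (DiscreteLinearSystems K n)) ∧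
    -- 7. linear partial shift operators
    (∀ n : ℕ, IsUnivCancellativeAndCancellative.{u, u, w₁, w₂} K (PartialShift K n)) ∧
    -- 8. linear partial differential operators
    (∀ n : ℕ, IsUnivCancellativeAndCancellative.{u, u, w₁, w₂} K (PartialDifferential K n)) ∧
    -- 9. linear partial difference operators
    (∀ n : ℕ, IsUnivCancellativeAndCancellative.{u, u, w₁, w₂} K (PartialDifference K n)) ∧
    -- 10. linear partial q-dilation operators
    (∀ (n : ℕ) (q : K), NonRootOfUnity q →
      IsUnivCancellativeAndCancellative.{u, u, w₁, w₂} K (PartialQDilation K n q)) ∧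
    -- 11. linear partial q-differential operators
    (∀ (n : ℕ) (q : K), NonRootOfUnity q ∨ q = 1 →
      IsUnivCancellativeAndCancellative.{u, u, w₁, w₂} K (PartialQDifferential K n q)) ∧
    -- 12. additive analogue of the Weyl algebra
    (∀ (n : ℕ) (q : Fin n → K), (∀ i, NonRootOfUnity (q i) ∨ q i = 1) →
      IsUnivCancellativeAndCancellative.{u, u, w₁, w₂} K (AdditiveWeyl K q)) ∧
    -- 13. multiplicative analogue of the Weyl algebra
    (∀ (n : ℕ) (lam : Fin n → Fin n → K), 2 ≤ n → MultIndependent (fun i j => lam j i) →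
      IsUnivCancellativeAndCancellative.{u, u, w₁, w₂} K (MultiplicativeWeyl K lam)) ∧
    -- 14. multiparametric quantum space
    (∀ (n : ℕ) (q : Fin n → Fin n → K), 2 ≤ n → MultIndependent q →
      IsUnivCancellativeAndCancellative.{u, u, w₁, w₂} K (QuantumSpace K q)) ∧
    -- 15. Woronowicz algebra
    (∀ q : K, NonRootOfUnity q →
      IsUnivCancellativeAndCancellative.{u, u, w₁, w₂} K (Woronowicz K q)) ∧
    -- 16. algebra U
    (∀ (n : ℕ) (q : K), NonRootOfUnity q →
      IsUnivCancellativeAndCancellative.{u, u, w₁, w₂} K (UAlgebra K n q)) ∧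
    -- 17. differential operators on a quantum space
    (∀ (n : ℕ) (q : Fin n → Fin n → K), MultAntisymm q →
      IsUnivCancellativeAndCancellative.{u, u, w₁, w₂} K (QSpaceDiff K q)) ∧
    -- 18. particular Witten deformation (conformal algebra)
    (∀ a b c : K, NonRootOfUnity a → b ≠ 0 → NonRootOfUnity c →
      IsUnivCancellativeAndCancellative.{u, u, w₁, w₂} K (ConformalAlgebra K a b c)) ∧
    -- 19. quantum Weyl algebra of Maltsiniotis
    (∀ (n : ℕ) (q : Fin n → Fin n → K) (lam : Fin n → K), MultAntisymm q →
      (∀ i, NonRootOfUnity (lam i)) →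
      IsUnivCancellativeAndCancellative.{u, u, w₁, w₂} K (Maltsiniotis K q lam)) ∧
    -- 20. multiparameter Weyl algebra, general relations and symmetric type
    (∀ (n : ℕ) (q : Fin n → K) (γ : Fin n → Fin n → K), MultAntisymm γ →
      (∀ i, NonRootOfUnity (q i)) →
      IsUnivCancellativeAndCancellative.{u, u, w₁, w₂} K (MultiparamWeyl K q γ) ∧
      IsUnivCancellativeAndCancellative.{u, u, w₁, w₂} K (SymmMultiparamWeyl K q γ)) ∧
    -- 21. quantum symplectic space
    (∀ (n : ℕ) (q : K), NonRootOfUnity q →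
      IsUnivCancellativeAndCancellative.{u, u, w₁, w₂} K (QuantumSymplectic K n q)) ∧
    -- 22. Jordan plane
    IsUnivCancellativeAndCancellative.{u, u, w₁, w₂} K (JordanPlane K) ∧
    -- 23. quantum plane
    (∀ q : K, NonRootOfUnity q →
      IsUnivCancellativeAndCancellative.{u, u, w₁, w₂} K (QuantumPlane K q)) ∧
    -- 24. quadratic algebra A_2 in three variables
    (∀ a b c : K, a ≠ 0 → b ≠ 0 → c ≠ 0 → (∀ r : ℚ, 0 < r → a ≠ (r : K) * c) →
      IsUnivCancellativeAndCancellative.{u, u, w₁, w₂} K (QuadraticA2 K a b c)) := by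
  have central : ∀ {A : Type u} [Ring A] [Algebra K A], Algebra.IsCentral K A →
      IsUnivCancellativeAndCancellative.{u, u, w₁, w₂} K A :=
    fun h => isUnivCancellativeAndCancellative_of_isCentral h
  -- Items 8 and 11 are additive Weyl algebras with equal parameters. Only `U` and the conformal
  -- algebra do not go through triviality of the center.
  refine ⟨fun n => central isCentral_weylAlgebra, fun n => central isCentral_extendedWeylAlgebra,
    fun q h hq => ?_, fun h hh => central (isCentral_shiftAlgebra hh),
    fun h hh => central (isCentral_mixedAlgebra hh),
    fun n => central isCentral_discreteLinearSystems, fun n => central isCentral_partialShift,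
    fun n => central (isCentral_additiveWeyl fun _ => Or.inr rfl),
    fun n => central isCentral_partialDifference,
    fun n q hq => central (isCentral_partialQDilation hq),
    fun n q hq => central (isCentral_additiveWeyl fun _ => hq),
    fun n q hq => central (isCentral_additiveWeyl hq),
    fun n lam hn hlam => central (isCentral_multiplicativeWeyl hn hlam),
    fun n q hn hq => central (isCentral_quantumSpace hn hq),
    fun q hq => central (isCentral_woronowicz hq),
    fun n q hq => isUnivCancellativeAndCancellative_uAlgebra hq,
    fun n q hq => central (isCentral_qSpaceDiff hq),
    fun a b c ha hb hc => isUnivCancellativeAndCancellative_conformalAlgebra ha hb hc,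
    fun n q lam hq hlam => central (isCentral_maltsiniotis hq hlam),
    fun n q γ hγ hq => ⟨central (isCentral_multiparamWeyl hγ hq),
      central (isCentral_symmMultiparamWeyl hγ hq)⟩,
    fun n q hq => central (isCentral_quantumSymplectic hq), central isCentral_jordanPlane,
    fun q hq => central (isCentral_quantumPlane hq),
    fun a b c ha _ hc hac => central (isCentral_quadraticA2 ha hc hac)⟩
  -- For `h = 0` the hypothesis forces `q` generic and the algebra is a quantum plane; otherwise `h`
  -- can be scaled to `1`.
  by_cases hh : h = 0
  · subst hh
    exact central (isCentral_qDiffAlgebra_zero (hq.resolve_right fun h => h.2 rfl))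
  · exact central (isCentral_qDiffAlgebra (hq.imp_right fun h => h.1) hh)
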